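/- Let $n\ge 1$, let $\mathbb{B}_n$ be the open unit ball of $\mathbb{C}^n$ with normalized Lebesgue measure $dV_n$, and let $\mathbb{S}_n$ be the unit sphere with normalized surface measure $d\sigma$. Fix an aperture $\gamma>1$ and, for $\zeta\in\mathbb{S}_n$, put $\Gamma(\zeta)=\{z\in\mathbb{B}_n: |1-\langle z,\zeta\rangle|<\tfrac{\gamma}{2}(1-|z|^2)\}$. For $0<p,q<\infty$ and $\alpha>-n-1$, $\mathcal{HT}^p_{q,\alpha}(\mathbb{B}_n)$ is the space of holomorphic functions $f$ on $\mathbb{B}_n$ with finite quasinorm $$\|f\|_{\mathcal{HT}^p_{q,\alpha}}=\Big(\int_{\mathbb{S}_n}\Big(\int_{\Gamma(\zeta)}|f(z)|^q(1-|z|^2)^\alpha\,dV_n(z)\Big)^{p/q}d\sigma(\zeta)\Big)^{1/p}.$$ For real $s,t$ such that neither $n+s$ nor $n+s+t$ is a negative integer, $R^{s,t}$ is the continuous linear operator on the holomorphic functions on $\mathbb{B}_n$ with $R^{s,t}(1-\langle z,u\rangle)^{-(n+1+s)}=(1-\langle z,u\rangle)^{-(n+1+s+t)}$ for $u\in\mathbb{B}_n$;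 it multiplies the homogeneous part of degree $k$ by $\prod_{j=0}^{k-1}\frac{n+1+s+t+j}{n+1+s+j}$. For such $s,t$ with $t>0$ and $1<p<\infty$, $\mathcal{BT}^{p}(\mathbb{B}_n)$ is the space of holomorphic $g$ on $\mathbb{B}_n$ with finite norm $$\|g\|_{\mathcal{BT}^{p}}=\Big(\int_{\mathbb{S}_n}\Big(\operatorname*{ess\,sup}_{z\in\Gamma(\zeta)}(1-|z|^2)^t|R^{s,t}g(z)|\Big)^{p}d\sigma(\zeta)\Big)^{1/p}.$$ **Theorem.** Let $0<q<1<p<\infty$, $p'=p/(p-1)$, $\alpha>-n-1$ and $\alpha'=\alpha+(1/q-1)(n+1+\alpha)$, and let $s,t$ be as above with $t>0$. Then the dual of $\mathcal{HT}^p_{q,\alpha}(\mathbb{B}_n)$ (its continuous linear functionals) is identified with $\mathcal{BT}^{p'}(\mathbb{B}_n)$ under the pairing $$\lim_{r\to1^-}\langle f_r,g\rangle_{n+\alpha'},\qquad f_r(z)=f(rz),\qquad \langle f,g\rangle_{\beta}=\int_{\mathbb{B}_n}f(z)\overline{g(z)}(1-|z|^2)^{\beta}\,dV_n(z).$$ That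 is: for $f\in\mathcal{HT}^p_{q,\alpha}(\mathbb{B}_n)$, $g\in\mathcal{BT}^{p'}(\mathbb{B}_n)$ and $0<r<1$ the integral $\langle f_r,g\rangle_{n+\alpha'}$ converges absolutely, and there is a conjugate-linear bijection $\tau\mapsto g_\tau$ of $(\mathcal{HT}^p_{q,\alpha}(\mathbb{B}_n))^*$ onto $\mathcal{BT}^{p'}(\mathbb{B}_n)$ such that $$\tau(f)=\lim_{r\to1^-}\langle f_r,g_\tau\rangle_{n+\alpha'}\qquad\text{for all } \tau\in(\mathcal{HT}^p_{q,\alpha}(\mathbb{B}_n))^*,\ f\in\mathcal{HT}^p_{q,\alpha}(\mathbb{B}_n),$$ and $\|\tau\|\le C\|g_\tau\|_{\mathcal{BT}^{p'}}$, $\|g_\tau\|_{\mathcal{BT}^{p'}}\le C\|\tau\|$, where $\|\tau\|=\sup\{|\tau(f)|:\|f\|_{\mathcal{HT}^p_{q,\alpha}}\le1\}$ and $C$ does not depend on $\tau$. -/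

import Mathlib

open MeasureTheory Filter Topology
open scoped ENNReal NNReal

noncomputable section

namespace TentDuality

/-- `ℂⁿ` with the Euclidean norm; `inner ℂ w z` is `∑ zᵢ * conj wᵢ`. -/
abbrev Cn (n : ℕ) : Type := EuclideanSpace ℂ (Fin n)

/-- The open unit ball of `ℂⁿ`. -/
abbrev unitBall (n : ℕ) : Set (Cn n) := Metric.ball (0 : Cn n) 1

/-- The unit sphere of `ℂⁿ`, as a type. -/
abbrev UnitSphere (n : ℕ) : Type := Metric.sphere (0 : Cn n) 1

/-- Lebesgue measure on the unit ball, with total mass `1`. -/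
def ballVolume (n : ℕ) : Measure (Cn n) :=
  ((volume : Measure (Cn n)) (unitBall n))⁻¹ • (volume : Measure (Cn n)).restrict (unitBall n)

/-- Surface measure on the unit sphere, with total mass `1`. -/
def sphereMeasure (n : ℕ) : Measure (UnitSphere n) :=
  ((volume : Measure (Cn n)).toSphere Set.univ)⁻¹ • (volume : Measure (Cn n)).toSphere

/-- The admissible approach region with vertex `ζ` and aperture `γ`. -/
def approachRegion {n : ℕ} (γ : ℝ) (ζ : UnitSphere n) : Set (Cn n) :=
  {z | z ∈ unitBall n ∧ ‖1 - inner ℂ (ζ : Cn n) z‖ < γ / 2 * (1 - ‖z‖ ^ 2)}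

/-- A holomorphic function on the unit ball is represented by its extension by zero to `ℂⁿ`, so
that two such functions are equal exactly when they agree on the ball. -/
def IsHolo (n : ℕ) (f : Cn n → ℂ) : Prop :=
  DifferentiableOn ℂ f (unitBall n) ∧ ∀ z, z ∉ unitBall n → f z = 0

/-- The quasinorm of the tent space `T^p_{q,α}` for finite exponents `p`, `q`. -/
def tentNorm {n : ℕ} (γ p q α : ℝ) (f : Cn n → ℂ) : ℝ≥0∞ :=
  (∫⁻ ζ, (∫⁻ z in approachRegion γ ζ,
      ‖f z‖ₑ ^ q * ENNReal.ofReal ((1 - ‖z‖ ^ 2) ^ α) ∂(ballVolume n)) ^ (p / q)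
    ∂(sphereMeasure n)) ^ (1 / p)

/-- The norm of the tent space `T^p_∞`. -/
def tentSupNorm {n : ℕ} (γ p : ℝ) (f : Cn n → ℂ) : ℝ≥0∞ :=
  (∫⁻ ζ, (essSup (fun z => ‖f z‖ₑ) ((ballVolume n).restrict (approachRegion γ ζ))) ^ p
    ∂(sphereMeasure n)) ^ (1 / p)

/-- The homogeneous part of degree `k` of `f` in its expansion at the origin:
the `k`-th Taylor coefficient at `0` of the slice function `w ↦ f (w z)`, `w ∈ ℂ`. -/
def homogPart {n : ℕ} (f : Cn n → ℂ) (k : ℕ) (z : Cn n) : ℂ :=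
  (k.factorial : ℂ)⁻¹ * iteratedDeriv k (fun w : ℂ => f (w • z)) 0

/-- The fractional differential operator `R^{s,t}`, the coefficient multiplier which multiplies
the homogeneous part of degree `k` by `(n+1+s+t)_k / (n+1+s)_k`, where `(a)_k = a(a+1)⋯(a+k-1)`.
It is the continuous operator on holomorphic functions which sends `(1 - ⟨z,u⟩)^{-(n+1+s)}`
to `(1 - ⟨z,u⟩)^{-(n+1+s+t)}`; see `fracDeriv_kernel`. -/
def fracDeriv {n : ℕ} (s t : ℝ) (f : Cn n → ℂ) (z : Cn n) : ℂ :=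
  ∑' k : ℕ, ((∏ j ∈ Finset.range k,
    (((n : ℝ) + 1 + s + t + j) / ((n : ℝ) + 1 + s + j)) : ℝ) : ℂ) * homogPart f k z

theorem multichoose_eq_prod (c : ℝ) (k : ℕ) :
    Ring.choose ((c : ℂ) + k - 1) k =
      (k.factorial : ℂ)⁻¹ * ((∏ j ∈ Finset.range k, (c + j) : ℝ) : ℂ) := by
  have h1 : Ring.choose ((c : ℂ) + k - 1) k = Ring.multichoose (c : ℂ) k := by
    rw [Ring.choose]; congr 1; ring
  have h2 := Ring.factorial_nsmul_multichoose_eq_ascPochhammer (c : ℂ) k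
  have h3 : (ascPochhammer ℕ k).smeval (c : ℂ) = ((∏ j ∈ Finset.range k, (c + j) : ℝ) : ℂ) := by
    rw [Polynomial.ascPochhammer_smeval_eq_eval]
    clear h1 h2
    induction k with
    | zero => simp
    | succ k ih => rw [ascPochhammer_succ_eval, ih, Finset.prod_range_succ]; push_cast; rfl
  rw [h3, nsmul_eq_mul] at h2
  rw [h1, ← h2, inv_mul_cancel_left₀ (by exact_mod_cast k.factorial_ne_zero)]

theorem homogPart_kernel {n : ℕ} (c : ℝ) (u z : Cn n) (k : ℕ) :
    homogPart (fun v : Cn n => 1 / (1 - inner ℂ u v) ^ (c : ℂ)) k z =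
      Ring.choose ((c : ℂ) + k - 1) k * (inner ℂ u z) ^ k := by
  set x : ℂ := inner ℂ u z with hx
  have h0 := (Complex.one_div_one_sub_cpow_hasFPowerSeriesOnBall_zero (c : ℂ)).hasFPowerSeriesAt
  rw [← map_zero (x • 1 : ℂ →L[ℂ] ℂ)] at h0
  have h1 := h0.compContinuousLinearMap
  have h2 := h1.eq_formalMultilinearSeries h1.analyticAt.hasFPowerSeriesAt
  have h3 := congrArg (fun P : FormalMultilinearSeries ℂ ℂ ℂ => P k fun _ => 1) h2
  simp only [FormalMultilinearSeries.ofScalars_apply_eq,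
    FormalMultilinearSeries.compContinuousLinearMap_apply, Function.comp_def, smul_apply,
    one_apply_eq_self, one_pow, smul_eq_mul, mul_one] at h3
  have h4 : (fun w : ℂ => 1 / (1 - inner ℂ u (w • z)) ^ (c : ℂ)) =
      (fun x : ℂ => 1 / (1 - x) ^ (c : ℂ)) ∘ (x • 1 : ℂ →L[ℂ] ℂ) := by
    funext w
    simp [hx, mul_comm]
  unfold homogPart
  rw [h4, inv_mul_eq_div]
  exact h3.symm

/-- The defining relation of `R^{s,t}` on the kernels. -/
theorem fracDeriv_kernel {n : ℕ} {s t : ℝ} (hs : ∀ m : ℕ, (n : ℝ) + s ≠ -((m : ℝ) + 1))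
    {u z : Cn n} (hu : u ∈ unitBall n) (hz : z ∈ unitBall n) :
    fracDeriv s t (fun v : Cn n => 1 / (1 - inner ℂ u v) ^ (((n : ℝ) + 1 + s : ℝ) : ℂ)) z =
      1 / (1 - inner ℂ u z) ^ (((n : ℝ) + 1 + s + t : ℝ) : ℂ) := by
  set x : ℂ := inner ℂ u z with hx
  have hx1 : ‖x‖ < 1 := by
    rw [mem_ball_zero_iff] at hu hz
    calc ‖x‖ ≤ ‖u‖ * ‖z‖ := norm_inner_le_norm _ _
      _ < 1 := mul_lt_one_of_nonneg_of_lt_one_left (norm_nonneg _) hu hz.le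
  have hsum := (Complex.one_div_one_sub_cpow_hasFPowerSeriesOnBall_zero
    (((n : ℝ) + 1 + s + t : ℝ) : ℂ)).hasSum (y := x) (by
      rw [← ENNReal.ofReal_one, Metric.eball_ofReal, mem_ball_zero_iff]
      exact hx1)
  rw [zero_add] at hsum
  rw [← hsum.tsum_eq]
  unfold fracDeriv
  refine tsum_congr fun k => ?_
  rw [homogPart_kernel, ← hx, multichoose_eq_prod, FormalMultilinearSeries.ofScalars_apply_eq,
    multichoose_eq_prod, Finset.prod_div_distrib, smul_eq_mul]
  have hne : ((∏ j ∈ Finset.range k, ((n : ℝ) + 1 + s + j) : ℝ) : ℂ) ≠ 0 := by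
    rw [Complex.ofReal_ne_zero, Finset.prod_ne_zero_iff]
    intro j _ h
    exact hs j (by linarith)
  rw [Complex.ofReal_div]
  field_simp

/-- The norm of the Hardy-Bloch type space `BT^p`, computed with the parameters `s`, `t`. -/
def btNorm {n : ℕ} (γ p s t : ℝ) (f : Cn n → ℂ) : ℝ≥0∞ :=
  tentSupNorm γ p (fun z => (((1 - ‖z‖ ^ 2) ^ t : ℝ) : ℂ) * fracDeriv s t f z)

/-- The Hardy-Bloch type space `BT^p` on the unit ball of `ℂⁿ`. -/
def BT (n : ℕ) (γ p s t : ℝ) : Set (Cn n → ℂ) :=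
  {f | IsHolo n f ∧ btNorm γ p s t f < ⊤}

/-- The pairing `⟨f, g⟩_β`. -/
def pairing {n : ℕ} (β : ℝ) (f g : Cn n → ℂ) : ℂ :=
  ∫ z, f z * (starRingEnd ℂ) (g z) * (((1 - ‖z‖ ^ 2) ^ β : ℝ) : ℂ) ∂(ballVolume n)

/-- The dilation `f_r (z) = f (r z)`. -/
def dilate {n : ℕ} (r : ℝ) (f : Cn n → ℂ) : Cn n → ℂ := fun z => f ((r : ℂ) • z)

instance instFiniteBallVolume (n : ℕ) : SFinite (ballVolume n) := by
  unfold ballVolume; infer_instance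

theorem IsHolo.measurable {n : ℕ} {f : Cn n → ℂ} (hf : IsHolo n f) : Measurable f := by
  classical
  have h : f = (unitBall n).piecewise f 0 := by
    funext z
    by_cases hz : z ∈ unitBall n
    · rw [Set.piecewise_eq_of_mem _ _ _ hz]
    · rw [Set.piecewise_eq_of_notMem _ _ _ hz, hf.2 z hz, Pi.zero_apply]
  rw [h]
  exact ContinuousOn.measurable_piecewise hf.1.continuousOn continuousOn_const
    Metric.isOpen_ball.measurableSet

theorem measurableSet_approach (n : ℕ) (γ : ℝ) :
    MeasurableSet {x : UnitSphere n × Cn n | x.2 ∈ approachRegion γ x.1} := by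
  apply IsOpen.measurableSet
  have h1 : IsOpen {x : UnitSphere n × Cn n | x.2 ∈ unitBall n} :=
    Metric.isOpen_ball.preimage continuous_snd
  have h2 : IsOpen {x : UnitSphere n × Cn n |
      ‖1 - inner ℂ (x.1 : Cn n) x.2‖ < γ / 2 * (1 - ‖x.2‖ ^ 2)} :=
    isOpen_lt (by fun_prop) (by fun_prop)
  exact h1.inter h2

theorem measurable_area {n : ℕ} (γ q α : ℝ) {f : Cn n → ℂ} (hf : Measurable f) :
    Measurable fun ζ : UnitSphere n => ∫⁻ z in approachRegion γ ζ,
      ‖f z‖ₑ ^ q * ENNReal.ofReal ((1 - ‖z‖ ^ 2) ^ α) ∂(ballVolume n) := by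
  set F : UnitSphere n × Cn n → ℝ≥0∞ :=
    {x : UnitSphere n × Cn n | x.2 ∈ approachRegion γ x.1}.indicator
      (fun x => ‖f x.2‖ₑ ^ q * ENNReal.ofReal ((1 - ‖x.2‖ ^ 2) ^ α)) with hF
  have hm : Measurable F := by
    refine Measurable.indicator ?_ (measurableSet_approach n γ)
    fun_prop
  have h := hm.lintegral_prod_right' (ν := ballVolume n)
  convert h using 2 with ζ
  have hs : MeasurableSet (approachRegion γ ζ) :=
    measurable_prodMk_left (x := ζ) (measurableSet_approach n γ)
  rw [← lintegral_indicator hs]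
  rfl

theorem tentNorm_lt_top_iff {n : ℕ} {γ p q α : ℝ} (hp : 0 < p) (f : Cn n → ℂ) :
    tentNorm γ p q α f < ⊤ ↔ ∫⁻ ζ, (∫⁻ z in approachRegion γ ζ,
      ‖f z‖ₑ ^ q * ENNReal.ofReal ((1 - ‖z‖ ^ 2) ^ α) ∂(ballVolume n)) ^ (p / q)
    ∂(sphereMeasure n) < ⊤ := by
  unfold tentNorm
  exact ENNReal.rpow_lt_top_iff_of_pos (by positivity)

theorem rpow_add_le {r : ℝ} (hr : 0 ≤ r) (a b : ℝ≥0∞) :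
    (a + b) ^ r ≤ 2 ^ r * (a ^ r + b ^ r) := by
  have h : a + b ≤ 2 * max a b := by
    rw [two_mul]; exact add_le_add (le_max_left _ _) (le_max_right _ _)
  calc (a + b) ^ r ≤ (2 * max a b) ^ r := ENNReal.rpow_le_rpow h hr
    _ = 2 ^ r * (max a b) ^ r := ENNReal.mul_rpow_of_nonneg _ _ hr
    _ ≤ 2 ^ r * (a ^ r + b ^ r) := by
      gcongr
      rcases le_total a b with hab | hab
      · rw [max_eq_right hab]; exact le_add_self
      · rw [max_eq_left hab]; exact le_self_add

theorem two_rpow_ne_top {r : ℝ} (hr : 0 ≤ r) : (2 : ℝ≥0∞) ^ r ≠ ⊤ :=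
  ENNReal.rpow_ne_top_of_nonneg hr (by simp)

theorem tentNorm_add_lt_top {n : ℕ} {γ p q α : ℝ} (hp : 0 < p) (hq : 0 < q) {f g : Cn n → ℂ}
    (hf : Measurable f) (hg : Measurable g)
    (hfn : tentNorm γ p q α f < ⊤) (hgn : tentNorm γ p q α g < ⊤) :
    tentNorm γ p q α (f + g) < ⊤ := by
  rw [tentNorm_lt_top_iff hp] at *
  have hpq : 0 ≤ p / q := by positivity
  set A : (Cn n → ℂ) → UnitSphere n → ℝ≥0∞ := fun f ζ => ∫⁻ z in approachRegion γ ζ,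
      ‖f z‖ₑ ^ q * ENNReal.ofReal ((1 - ‖z‖ ^ 2) ^ α) ∂(ballVolume n) with hA
  have key : ∀ ζ, A (f + g) ζ ≤ 2 ^ q * (A f ζ + A g ζ) := by
    intro ζ
    simp only [hA]
    rw [← lintegral_add_left (by fun_prop),
      ← lintegral_const_mul _ (by fun_prop)]
    refine lintegral_mono fun z => ?_
    have h1 : ‖(f + g) z‖ₑ ^ q ≤ 2 ^ q * (‖f z‖ₑ ^ q + ‖g z‖ₑ ^ q) :=
      (ENNReal.rpow_le_rpow (enorm_add_le _ _) hq.le).trans (rpow_add_le hq.le _ _)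
    calc ‖(f + g) z‖ₑ ^ q * ENNReal.ofReal ((1 - ‖z‖ ^ 2) ^ α)
        ≤ 2 ^ q * (‖f z‖ₑ ^ q + ‖g z‖ₑ ^ q) * ENNReal.ofReal ((1 - ‖z‖ ^ 2) ^ α) := by gcongr
      _ = _ := by ring
  have key2 : ∀ ζ, A (f + g) ζ ^ (p / q) ≤
      (2 ^ q) ^ (p / q) * (2 ^ (p / q) * (A f ζ ^ (p / q) + A g ζ ^ (p / q))) := by
    intro ζ
    refine (ENNReal.rpow_le_rpow (key ζ) hpq).trans ?_
    rw [ENNReal.mul_rpow_of_nonneg _ _ hpq]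
    gcongr
    exact rpow_add_le hpq _ _
  have hAf : Measurable (A f) := measurable_area γ q α hf
  have hAg : Measurable (A g) := measurable_area γ q α hg
  refine (lintegral_mono key2).trans_lt ?_
  rw [lintegral_const_mul _ (by fun_prop), lintegral_const_mul _ (by fun_prop),
    lintegral_add_left (by fun_prop)]
  refine ENNReal.mul_lt_top ?_ (ENNReal.mul_lt_top (two_rpow_ne_top hpq).lt_top
    (ENNReal.add_lt_top.2 ⟨hfn, hgn⟩))
  exact (ENNReal.rpow_ne_top_of_nonneg hpq (two_rpow_ne_top hq.le)).lt_top

theorem tentNorm_smul_lt_top {n : ℕ} {γ p q α : ℝ} (hp : 0 < p) (hq : 0 < q) (c : ℂ)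
    {f : Cn n → ℂ} (hf : Measurable f) (hfn : tentNorm γ p q α f < ⊤) :
    tentNorm γ p q α (c • f) < ⊤ := by
  rw [tentNorm_lt_top_iff hp] at *
  have hpq : 0 ≤ p / q := by positivity
  have hc : ‖c‖ₑ ^ q ≠ ⊤ := ENNReal.rpow_ne_top_of_nonneg hq.le enorm_ne_top
  have key : ∀ ζ : UnitSphere n, (∫⁻ z in approachRegion γ ζ,
      ‖(c • f) z‖ₑ ^ q * ENNReal.ofReal ((1 - ‖z‖ ^ 2) ^ α) ∂(ballVolume n)) ^ (p / q) =
      (‖c‖ₑ ^ q) ^ (p / q) * (∫⁻ z in approachRegion γ ζ,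
      ‖f z‖ₑ ^ q * ENNReal.ofReal ((1 - ‖z‖ ^ 2) ^ α) ∂(ballVolume n)) ^ (p / q) := by
    intro ζ
    rw [← ENNReal.mul_rpow_of_nonneg _ _ hpq, ← lintegral_const_mul _ (by fun_prop)]
    congr 1
    refine lintegral_congr fun z => ?_
    rw [Pi.smul_apply, enorm_smul, ENNReal.mul_rpow_of_nonneg _ _ hq.le, mul_assoc]
  simp_rw [key]
  rw [lintegral_const_mul' _ _ (ENNReal.rpow_ne_top_of_nonneg hpq hc)]
  exact ENNReal.mul_lt_top (ENNReal.rpow_ne_top_of_nonneg hpq hc).lt_top hfn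

theorem tentNorm_zero_lt_top {n : ℕ} {γ p q α : ℝ} (hp : 0 < p) (hq : 0 < q) :
    tentNorm γ p q α (0 : Cn n → ℂ) < ⊤ := by
  rw [tentNorm_lt_top_iff hp]
  have hpq : 0 < p / q := by positivity
  simp [hq, hpq]

/-- The holomorphic functions on the unit ball which belong to `T^p_{q,α}`. -/
def htSubmodule (n : ℕ) (γ α : ℝ) {p q : ℝ} (hp : 0 < p) (hq : 0 < q) :
    Submodule ℂ (Cn n → ℂ) where
  carrier := {f | IsHolo n f ∧ tentNorm γ p q α f < ⊤}
  zero_mem' := ⟨⟨differentiableOn_const 0, fun _ _ => rfl⟩, tentNorm_zero_lt_top hp hq⟩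
  add_mem' := fun {f g} hf hg =>
    ⟨⟨hf.1.1.add hg.1.1, fun z hz => by simp [hf.1.2 z hz, hg.1.2 z hz]⟩,
      tentNorm_add_lt_top hp hq hf.1.measurable hg.1.measurable hf.2 hg.2⟩
  smul_mem' := fun c f hf =>
    ⟨⟨hf.1.1.const_smul c, fun z hz => by simp [hf.1.2 z hz]⟩,
      tentNorm_smul_lt_top hp hq c hf.1.measurable hf.2⟩

/-- The Hardy type tent space `HT^p_{q,α}`. It is a type of its own, because it carries
the topology of its quasinorm and not that of pointwise convergence. -/
def HT (n : ℕ) (γ α : ℝ) {p q : ℝ} (hp : 0 < p) (hq : 0 < q) : Type :=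
  ↥(htSubmodule n γ α hp hq)

section HTInstances

variable {n : ℕ} {γ α p q : ℝ} {hp : 0 < p} {hq : 0 < q}

instance instAddCommGroupHT : AddCommGroup (HT n γ α hp hq) :=
  inferInstanceAs (AddCommGroup ↥(htSubmodule n γ α hp hq))

instance instModuleHT : Module ℂ (HT n γ α hp hq) :=
  inferInstanceAs (Module ℂ ↥(htSubmodule n γ α hp hq))

/-- The function on `ℂⁿ` underlying an element of `HT^p_{q,α}`. -/
def HT.toFun (f : HT n γ α hp hq) : Cn n → ℂ :=
  ((show ↥(htSubmodule n γ α hp hq) from f) : Cn n → ℂ)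

/-- The quasinorm of `HT^p_{q,α}`. -/
def HT.qnorm (f : HT n γ α hp hq) : ℝ≥0∞ := tentNorm γ p q α f.toFun

/-- The topology of the quasinorm: a set is open if with each of its points it contains
a quasinorm ball around that point. -/
instance instTopologicalSpaceHT : TopologicalSpace (HT n γ α hp hq) where
  IsOpen U := ∀ f ∈ U, ∃ ε : ℝ≥0∞, 0 < ε ∧ ∀ g : HT n γ α hp hq, (g - f).qnorm < ε → g ∈ U
  isOpen_univ := fun _ _ => ⟨1, one_pos, fun _ _ => Set.mem_univ _⟩
  isOpen_inter := fun U V hU hV f hf => by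
    obtain ⟨a, ha, hU'⟩ := hU f hf.1
    obtain ⟨b, hb, hV'⟩ := hV f hf.2
    exact ⟨min a b, lt_min ha hb, fun g hg =>
      ⟨hU' g (hg.trans_le (min_le_left _ _)), hV' g (hg.trans_le (min_le_right _ _))⟩⟩
  isOpen_sUnion := fun S hS f hf => by
    obtain ⟨U, hUS, hfU⟩ := hf
    obtain ⟨a, ha, hU'⟩ := hS U hUS f hfU
    exact ⟨a, ha, fun g hg => ⟨U, hUS, hU' g hg⟩⟩

/-- The operator quasinorm of a continuous linear functional on `HT^p_{q,α}`. -/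
def dualNorm (τ : HT n γ α hp hq →L[ℂ] ℂ) : ℝ≥0∞ :=
  ⨆ (f : HT n γ α hp hq) (_ : f.qnorm ≤ 1), ‖τ f‖ₑ

end HTInstances

end TentDuality

end

/-!
# The dual of the Hardy type tent spaces for `q < 1 < p`

Write `δ(z) = 1 - |z|²`, `d(z, w) = |1 - ⟨z, w⟩|`, `β = n + α'` and `T = n / q`. The proof
compares both spaces with positive integral operators whose kernels are products of powers of
`δ(w)` and `d(z, w)`, and these operators with the Hardy-Littlewood maximal function on the sphere
for the non-isotropic quasi-distance `d`.

**Holomorphic functions and kernels.** Coefficient sequences whose `N`-th differences decay like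
`k ^ (e - N)` are called symbols of order `e` (`IsSymbol`). Quotients of rising factorials are
symbols, and so are the reciprocals of the moments of radial measures; these moments express the
reproducing formulas. Summation by parts bounds the power series with symbol coefficients
(`IsSymbol.exists_tsum_le`), so that every coefficient multiplier is dominated by a positive
kernel (`exists_enorm_mult_le`). Two consequences carry the proof. A multiplier of order `e` maps
`δ ^ t₁ f` with nontangential maximal function in `L^p` to the same for `δ ^ (t₁ + e)`, for all
apertures (`exists_lintegral_ntMax_mult_le`); in particular, the norm of `BT^{p'}` may be computed
with any admissible fractional derivative and with aperture `4`, for which the shadow of every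
point of the ball is large. And `|f| ^ q` is dominated by a positive operator applied to itself,
over a shell which the approach regions reach (`exists_enorm_rpow_le_kerInt`).

**From `BT` to functionals.** The majorant of `|f| ^ q` is controlled by the tent norm because the
exponent `p / q` exceeds `1`: a positive operator tested against `ψ` is bounded by area integrals
tested against the maximal function of `ψ` (`exists_lintegral_rpow_le_of_duality`). The power `1 /
q` of the majorant then gives the embedding into the tent space with exponents `p, 1`, which is
paired with nontangential maximal functions by Fubini and Hölder
(`exists_lintegral_mul_le_tentNorm`). This makes integration against a fractional derivative of
`g` a bounded functional (`exists_functional`). It agrees with the pairing with `g` on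
polynomials, hence on dilations, and dilations converge in the tent quasinorm by dominated
convergence (`tendsto_tentNorm_dilate_sub`); so functionals are determined by their values on
polynomials.

**From functionals to `BT`.** The homogeneous parts of the function of `τ` are the values of `τ`
at the powers of `⟨·, w⟩`, divided by moments (`dualFun`). Its fractional derivative at `w` is the
value of `τ` at the kernel `(1 - ⟨·, w⟩) ^ (-(n + β + 1 + T))`, up to conjugation and a constant
(`mult_dualFun`). To bound the nontangential maximal function of `h = δ ^ T |τ(kernel)|` in
`L^{p'}`, Vitali's covering theorem chooses, in each set `{h > 2 ^ j}`, finitely many points whose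
shadows are disjoint and carry a fixed proportion of the measure of the level set of the maximal
function (`exists_disjoint_shadows`). The functional is tested on the sum of the kernels at these
points with coefficients `2 ^ (j (p' - 1)) δ ^ (n + T)` and suitable phases. Let `X` be the sum of
`2 ^ (j p') δ ^ n` over all these points, which bounds the `p'`-th power of the norm of the
maximal function. The tent norm of the test function is at most a multiple of `X ^ (1 / p)`
(`exists_tentNorm_sum_kernel_le`), while the value of `τ` at it is at least a multiple of `X`,
because `h > 2 ^ j` at the chosen points. This gives `X ≤ C ‖τ‖ ^ p'` (`exists_sum_le_dualNorm`).
-/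

noncomputable section

namespace TentDuality

/-! ### Polar coordinates and boxes -/

theorem finrank_real_Cn (n : ℕ) : Module.finrank ℝ (Cn n) = 2 * n := by
  rw [← Module.finrank_mul_finrank ℝ ℂ]; simp

theorem lintegral_volume_polar {n : ℕ} [NeZero n] {F : Cn n → ℝ≥0∞} (hF : Measurable F) :
    ∫⁻ x, F x ∂(volume : Measure (Cn n)) =
      ∫⁻ r in Set.Ioi (0 : ℝ), ENNReal.ofReal (r ^ (2 * n - 1)) *
        ∫⁻ η : UnitSphere n, F (r • (η : Cn n)) ∂((volume : Measure (Cn n)).toSphere) := by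
  set μ := (volume : Measure (Cn n)) with hμ
  have h1 : ∫⁻ x, F x ∂μ = ∫⁻ x : ({(0)}ᶜ : Set (Cn n)), F x.1 ∂(μ.comap (↑)) := by
    have := lintegral_subtype_comap (μ := μ) (s := ({(0)}ᶜ : Set (Cn n)))
      (measurableSet_singleton _).compl F
    rw [this, restrict_compl_singleton]
  have h2 : ∀ x : ({(0)}ᶜ : Set (Cn n)), F x.1 =
      (fun y : UnitSphere n × Set.Ioi (0 : ℝ) => F ((y.2 : ℝ) • (y.1 : Cn n)))
        (homeomorphUnitSphereProd (Cn n) x) := by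
    intro x
    have hx : ‖(x : Cn n)‖ ≠ 0 := norm_ne_zero_iff.2 x.2
    simp [smul_smul, hx]
  have hm : Measurable
      (fun y : UnitSphere n × Set.Ioi (0 : ℝ) => F ((y.2 : ℝ) • (y.1 : Cn n))) := by
    fun_prop
  rw [h1, lintegral_congr h2, μ.measurePreserving_homeomorphUnitSphereProd.lintegral_comp hm,
    lintegral_prod_symm' _ hm, Measure.volumeIoiPow, finrank_real_Cn,
    lintegral_withDensity_eq_lintegral_mul _ (by fun_prop) (hm.lintegral_prod_left')]
  exact lintegral_subtype_comap (μ := volume) measurableSet_Ioi (fun r : ℝ =>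
    ENNReal.ofReal (r ^ (2 * n - 1)) * ∫⁻ η : UnitSphere n, F (r • (η : Cn n)) ∂(μ.toSphere))

theorem toSphere_univ (n : ℕ) [NeZero n] :
    (volume : Measure (Cn n)).toSphere Set.univ =
      ENNReal.ofReal (2 * n) * (volume : Measure (Cn n)) (unitBall n) := by
  rw [Measure.toSphere_apply_univ, finrank_real_Cn]
  congr 1
  rw [← ENNReal.ofReal_natCast]; push_cast; rfl

instance sphereMeasure_isProbability (n : ℕ) [NeZero n] :
    IsProbabilityMeasure (sphereMeasure n) := by
  constructor
  rw [sphereMeasure, Measure.smul_apply, smul_eq_mul, ENNReal.inv_mul_cancel]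
  · exact (Measure.measure_univ_ne_zero.2 (Measure.toSphere_ne_zero _))
  · exact measure_ne_top _ _

theorem volume_unitBall_pos (n : ℕ) : (volume : Measure (Cn n)) (unitBall n) ≠ 0 :=
  (Metric.measure_ball_pos _ _ one_pos).ne'

theorem volume_unitBall_ne_top (n : ℕ) : (volume : Measure (Cn n)) (unitBall n) ≠ ⊤ :=
  measure_ball_lt_top.ne

theorem ae_mem_unitBall (n : ℕ) : ∀ᵐ z ∂(ballVolume n), z ∈ unitBall n := by
  refine Measure.ae_smul_measure ?_ _
  exact ae_restrict_mem Metric.isOpen_ball.measurableSet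

theorem toSphere_eq_smul (n : ℕ) [NeZero n] : (volume : Measure (Cn n)).toSphere =
    (ENNReal.ofReal (2 * n) * (volume : Measure (Cn n)) (unitBall n)) • sphereMeasure n := by
  rw [sphereMeasure, smul_smul, ← toSphere_univ, ENNReal.mul_inv_cancel, one_smul]
  · exact (Measure.measure_univ_ne_zero.2 (Measure.toSphere_ne_zero _))
  · exact measure_ne_top _ _

theorem lintegral_ball_polar {n : ℕ} [NeZero n] {F : Cn n → ℝ≥0∞} (hF : Measurable F) :
    ∫⁻ z, F z ∂(ballVolume n) =
      ∫⁻ r in Set.Ioo (0 : ℝ) 1, ENNReal.ofReal (2 * n * r ^ (2 * n - 1)) *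
        ∫⁻ η : UnitSphere n, F (r • (η : Cn n)) ∂(sphereMeasure n) := by
  have hb : MeasurableSet (unitBall n) := Metric.isOpen_ball.measurableSet
  have hind : Measurable ((unitBall n).indicator F) := hF.indicator hb
  set V := (volume : Measure (Cn n)) (unitBall n) with hV
  rw [ballVolume, lintegral_smul_measure, ← lintegral_indicator hb,
    lintegral_volume_polar hind, toSphere_eq_smul, ← hV]
  have h1 : ∀ r ∈ Set.Ioi (0 : ℝ), ENNReal.ofReal (r ^ (2 * n - 1)) *
        ∫⁻ η : UnitSphere n, (unitBall n).indicator F (r • (η : Cn n))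
          ∂((ENNReal.ofReal (2 * n) * V) • sphereMeasure n) =
      (Set.Iio (1 : ℝ)).indicator (fun r => V * (ENNReal.ofReal (2 * n * r ^ (2 * n - 1)) *
        ∫⁻ η : UnitSphere n, F (r • (η : Cn n)) ∂(sphereMeasure n))) r := by
    intro r hr
    have hr0 : 0 < r := hr
    rw [lintegral_smul_measure]
    by_cases h : r < 1
    · have : ∀ η : UnitSphere n,
          (unitBall n).indicator F (r • (η : Cn n)) = F (r • (η : Cn n)) := by
        intro η
        apply Set.indicator_of_mem
        rw [mem_ball_zero_iff, norm_smul, norm_eq_of_mem_sphere, Real.norm_of_nonneg hr0.le]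
        simpa using h
      rw [Set.indicator_of_mem (Set.mem_Iio.2 h), lintegral_congr this,
        ENNReal.ofReal_mul (p := 2 * (n : ℝ)) (by positivity), smul_eq_mul]
      ring
    · have : ∀ η : UnitSphere n, (unitBall n).indicator F (r • (η : Cn n)) = 0 := by
        intro η
        apply Set.indicator_of_notMem
        rw [mem_ball_zero_iff, norm_smul, norm_eq_of_mem_sphere, Real.norm_of_nonneg hr0.le]
        simpa using h
      rw [Set.indicator_of_notMem (by simpa using h), lintegral_congr this]
      simp
  rw [setLIntegral_congr_fun measurableSet_Ioi h1,
    setLIntegral_indicator measurableSet_Iio, Set.inter_comm, Set.Ioi_inter_Iio,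
    lintegral_const_mul' _ _ (volume_unitBall_ne_top n), smul_eq_mul, ← mul_assoc,
    ENNReal.inv_mul_cancel (volume_unitBall_pos n) (volume_unitBall_ne_top n), one_mul]

theorem measurePreserving_repr {n : ℕ} (b : OrthonormalBasis (Fin n) ℂ (Cn n)) :
    MeasurePreserving b.repr (volume : Measure (Cn n)) volume :=
  LinearIsometryEquiv.measurePreserving (E := Cn n) (F := Cn n)
    ⟨b.repr.toLinearEquiv.restrictScalars ℝ, b.repr.norm_map⟩

/-- The volume on `ℂⁿ` agrees with the product volume up to a constant. -/
theorem exists_volume_eq_smul_pi (n : ℕ) : ∃ c : ℝ≥0, c ≠ 0 ∧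
    (volume : Measure (Cn n)) =
      c • Measure.map (WithLp.toLp 2) (volume : Measure (Fin n → ℂ)) := by
  let L : (Fin n → ℂ) ≃L[ℝ] Cn n :=
    (PiLp.continuousLinearEquiv 2 ℝ (fun _ : Fin n => ℂ)).symm
  have hL : Measure.map (WithLp.toLp 2) (volume : Measure (Fin n → ℂ)) =
    Measure.map L volume := rfl
  have : (Measure.map L (volume : Measure (Fin n → ℂ))).IsAddHaarMeasure :=
    L.isAddHaarMeasure_map _
  rw [hL]
  refine ⟨Measure.addHaarScalarFactor volume (Measure.map L volume), ?_, ?_⟩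
  · exact (Measure.addHaarScalarFactor_pos_of_isAddHaarMeasure _ _).ne'
  · exact Measure.isAddLeftInvariant_eq_smul _ _

theorem exists_volume_box (n : ℕ) : ∃ c : ℝ, 0 < c ∧
    ∀ b : OrthonormalBasis (Fin n) ℂ (Cn n), ∀ (a : Fin n → ℂ) (r : Fin n → ℝ), (∀ i, 0 ≤ r i) →
      (volume : Measure (Cn n)) {w | ∀ i, ‖b.repr w i - a i‖ < r i} =
        ENNReal.ofReal (c * ∏ i, r i ^ 2) := by
  obtain ⟨c, hc, hvol⟩ := exists_volume_eq_smul_pi n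
  refine ⟨c * Real.pi ^ n, by positivity, fun b a r hr => ?_⟩
  have h1 : {w : Cn n | ∀ i, ‖b.repr w i - a i‖ < r i} =
      b.repr ⁻¹' {w | ∀ i, ‖w i - a i‖ < r i} := rfl
  have hopen : IsOpen {w : Cn n | ∀ i, ‖w i - a i‖ < r i} := by
    simp only [Set.ofPred_forall]
    exact isOpen_iInter_of_finite fun i => isOpen_lt (by fun_prop) continuous_const
  have h2 : WithLp.toLp 2 ⁻¹' {w : Cn n | ∀ i, ‖w i - a i‖ < r i} =
      Set.univ.pi fun i => Metric.ball (a i) (r i) := by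
    ext w; simp [dist_eq_norm]
  rw [h1, (measurePreserving_repr b).measure_preimage hopen.measurableSet.nullMeasurableSet, hvol,
    Measure.smul_apply, Measure.map_apply (by fun_prop) hopen.measurableSet, h2, volume_pi_pi]
  simp_rw [Complex.volume_ball]
  rw [Finset.prod_mul_distrib, Finset.prod_const, Finset.card_univ, Fintype.card_fin]
  rw [ENNReal.ofReal_mul (by positivity), ENNReal.ofReal_mul (by positivity),
    ENNReal.ofReal_prod_of_nonneg (by intros; positivity), ENNReal.ofReal_pow Real.pi_pos.le]
  simp_rw [fun i => ENNReal.ofReal_pow (hr i) 2]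
  rw [ENNReal.smul_def, smul_eq_mul, ENNReal.ofReal_coe_nnreal, mul_assoc,
    mul_comm (ENNReal.ofReal Real.pi ^ n)]
  congr 3
  rw [← NNReal.coe_real_pi, ENNReal.ofReal_coe_nnreal]

/-! ### The non-isotropic distance -/

/-- The non-isotropic quasi-distance `|1 - ⟨z, w⟩|` on the closed unit ball. -/
def kd {n : ℕ} (z w : Cn n) : ℝ := ‖1 - inner ℂ z w‖

section kd
variable {n : ℕ} {a b c : Cn n}

theorem kd_comm (a b : Cn n) : kd a b = kd b a := by
  unfold kd
  rw [← inner_conj_symm a b, ← Complex.norm_conj, map_sub, map_one, Complex.conj_conj]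

theorem kd_nonneg (a b : Cn n) : 0 ≤ kd a b := norm_nonneg _

theorem norm_inner_le_of_le_one (ha : ‖a‖ ≤ 1) : ‖(inner ℂ a b : ℂ)‖ ≤ ‖b‖ :=
  (norm_inner_le_norm a b).trans (mul_le_of_le_one_left (norm_nonneg _) ha)

theorem one_sub_norm_le_kd (ha : ‖a‖ ≤ 1) : 1 - ‖b‖ ≤ kd a b := by
  have h1 := norm_inner_le_of_le_one (b := b) ha
  have h2 := norm_sub_norm_le (1 : ℂ) (inner ℂ a b)
  rw [norm_one] at h2
  unfold kd; linarith

theorem kd_le_two (ha : ‖a‖ ≤ 1) (hb : ‖b‖ ≤ 1) : kd a b ≤ 2 := by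
  have h1 := norm_inner_le_of_le_one (b := b) ha
  have h2 := norm_sub_le (1 : ℂ) (inner ℂ a b)
  rw [norm_one] at h2
  unfold kd; linarith

theorem one_sub_sq_le_two_kd (ha : ‖a‖ ≤ 1) (hb : ‖b‖ ≤ 1) : 1 - ‖b‖ ^ 2 ≤ 2 * kd a b := by
  have := one_sub_norm_le_kd (b := b) ha
  nlinarith [norm_nonneg b]

theorem kd_pos (ha : ‖a‖ ≤ 1) (hb : ‖b‖ < 1) : 0 < kd a b := by
  have := one_sub_norm_le_kd (b := b) ha
  linarith

theorem norm_sub_sq_le_two_kd (ha : ‖a‖ ≤ 1) (hb : ‖b‖ ≤ 1) : ‖a - b‖ ^ 2 ≤ 2 * kd a b := by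
  have h1 := @norm_sub_sq ℂ _ _ _ _ a b
  have h2 : 1 - RCLike.re (inner ℂ a b) ≤ kd a b := by
    have := Complex.re_le_norm (1 - inner ℂ a b)
    simpa [kd] using this
  rw [h1]
  nlinarith [norm_nonneg a, norm_nonneg b]

theorem kd_triangle (ha : ‖a‖ ≤ 1) (hb : ‖b‖ ≤ 1) (hc : ‖c‖ ≤ 1) :
    kd a b ≤ 3 * (kd a c + kd c b) := by
  have h1 : (1 : ℂ) - inner ℂ a b = (1 - inner ℂ a c) + (1 - inner ℂ c b)
      - (inner ℂ (a - c) (b - c) + (1 - (‖c‖ ^ 2 : ℝ))) := by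
    rw [inner_sub_left, inner_sub_right, inner_sub_right, inner_self_eq_norm_sq_to_K]
    push_cast
    simp only [RCLike.ofReal_eq_complex_ofReal]
    ring
  have h2 : ‖(inner ℂ (a - c) (b - c) : ℂ)‖ ≤ kd a c + kd c b := by
    refine (norm_inner_le_norm _ _).trans ?_
    have e1 := norm_sub_sq_le_two_kd ha hc
    have e2 := norm_sub_sq_le_two_kd hb hc
    rw [kd_comm b c] at e2
    nlinarith [sq_nonneg (‖a - c‖ - ‖b - c‖)]
  have h3 : ‖((1 : ℂ) - (‖c‖ ^ 2 : ℝ))‖ ≤ 2 * kd a c := by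
    have e : ((1 : ℂ) - (‖c‖ ^ 2 : ℝ)) = ((1 - ‖c‖ ^ 2 : ℝ) : ℂ) := by push_cast; ring
    rw [e, Complex.norm_real, Real.norm_of_nonneg (by nlinarith [norm_nonneg c])]
    exact one_sub_sq_le_two_kd ha hc
  have h3' : ‖((1 : ℂ) - (‖c‖ ^ 2 : ℝ))‖ ≤ 2 * kd c b := by
    have e : ((1 : ℂ) - (‖c‖ ^ 2 : ℝ)) = ((1 - ‖c‖ ^ 2 : ℝ) : ℂ) := by push_cast; ring
    rw [e, Complex.norm_real, Real.norm_of_nonneg (by nlinarith [norm_nonneg c]), kd_comm c b]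
    exact one_sub_sq_le_two_kd hb hc
  have h4 : kd a b ≤ kd a c + kd c b + (‖(inner ℂ (a - c) (b - c) : ℂ)‖
      + ‖((1 : ℂ) - (‖c‖ ^ 2 : ℝ))‖) := by
    unfold kd
    rw [h1]
    exact (norm_sub_le _ _).trans (add_le_add (norm_add_le _ _) (norm_add_le _ _))
  linarith

/-- Dilating one of the points does not bring it much closer to the other in the non-isotropic
distance. -/
theorem kd_le_two_kd_smul (ha : ‖a‖ ≤ 1) (hb : ‖b‖ ≤ 1) {r : ℝ} (hr0 : 0 ≤ r) (hr1 : r ≤ 1) :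
    kd a b ≤ 2 * kd a ((r : ℂ) • b) := by
  have h1 : ‖(inner ℂ a b : ℂ)‖ ≤ 1 := (norm_inner_le_of_le_one (b := b) ha).trans hb
  have h2 : (1 : ℂ) - inner ℂ a b =
      (1 - inner ℂ a ((r : ℂ) • b)) - ((1 - r : ℝ) : ℂ) * inner ℂ a b := by
    rw [inner_smul_right]; push_cast; ring
  have h3 : ‖((1 - r : ℝ) : ℂ) * inner ℂ a b‖ ≤ 1 - r := by
    rw [norm_mul, Complex.norm_real, Real.norm_of_nonneg (by linarith)]
    exact mul_le_of_le_one_right (by linarith) h1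
  have h4 : 1 - r ≤ kd a ((r : ℂ) • b) := by
    have := one_sub_norm_le_kd (b := (r : ℂ) • b) ha
    rw [norm_smul, Complex.norm_real, Real.norm_of_nonneg hr0] at this
    nlinarith [norm_nonneg b]
  have h5 : kd a b ≤ kd a ((r : ℂ) • b) + ‖((1 - r : ℝ) : ℂ) * inner ℂ a b‖ := by
    unfold kd
    rw [h2]
    exact norm_sub_le _ _
  linarith

theorem kd_smul_le (ha : ‖a‖ ≤ 1) (hb : ‖b‖ ≤ 1) {r : ℝ} (hr0 : 0 ≤ r) (hr1 : r ≤ 1) :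
    kd a ((r : ℂ) • b) ≤ (1 - r) + kd a b := by
  have h1 : ‖(inner ℂ a b : ℂ)‖ ≤ 1 := (norm_inner_le_of_le_one (b := b) ha).trans hb
  have h2 : (1 : ℂ) - inner ℂ a ((r : ℂ) • b) =
      ((1 - r : ℝ) : ℂ) + (r : ℂ) * (1 - inner ℂ a b) := by
    rw [inner_smul_right]; push_cast; ring
  unfold kd
  rw [h2]
  refine (norm_add_le _ _).trans ?_
  rw [norm_mul, Complex.norm_real, Complex.norm_real, Real.norm_of_nonneg hr0,
    Real.norm_of_nonneg (by linarith)]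
  gcongr
  exact mul_le_of_le_one_left (norm_nonneg _) hr1

@[fun_prop]
theorem continuous_kd_right (a : Cn n) : Continuous (kd a) := by
  unfold kd; fun_prop

theorem measurable_kd {X : Type*} [MeasurableSpace X] {f g : X → Cn n} (hf : Measurable f)
    (hg : Measurable g) : Measurable fun x => kd (f x) (g x) := by
  unfold kd
  exact (measurable_const.sub (hf.inner hg)).norm

theorem norm_sphere (ζ : UnitSphere n) : ‖(ζ : Cn n)‖ = 1 := norm_eq_of_mem_sphere ζ

theorem norm_sphere_le (ζ : UnitSphere n) : ‖(ζ : Cn n)‖ ≤ 1 := (norm_sphere ζ).le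

end kd

/-- The ball of centre `ζ` and radius `δ` in the sphere for the non-isotropic quasi-distance. -/
def korBall {n : ℕ} (ζ : UnitSphere n) (δ : ℝ) : Set (UnitSphere n) :=
  {η | kd (ζ : Cn n) (η : Cn n) < δ}

theorem isOpen_korBall {n : ℕ} (ζ : UnitSphere n) (δ : ℝ) : IsOpen (korBall ζ δ) :=
  isOpen_lt (by fun_prop) continuous_const

theorem measurableSet_korBall {n : ℕ} (ζ : UnitSphere n) (δ : ℝ) : MeasurableSet (korBall ζ δ) :=
  (isOpen_korBall ζ δ).measurableSet

theorem mem_korBall_self {n : ℕ} (ζ : UnitSphere n) {δ : ℝ} (hδ : 0 < δ) : ζ ∈ korBall ζ δ := by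
  simp only [korBall, Set.mem_ofPred_eq, kd]
  rw [inner_self_eq_norm_sq_to_K, norm_sphere]
  simpa using hδ

theorem korBall_eq_univ {n : ℕ} (ζ : UnitSphere n) {δ : ℝ} (hδ : 2 < δ) :
    korBall ζ δ = Set.univ := by
  ext η
  simpa [korBall] using (kd_le_two (norm_sphere_le ζ) (norm_sphere_le η)).trans_lt hδ

theorem korBall_subset_of_inter {n : ℕ} {ζ η : UnitSphere n} {δ ε : ℝ}
    (h : (korBall ζ δ ∩ korBall η ε).Nonempty) : korBall ζ δ ⊆ korBall η (21 * max δ ε) := by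
  obtain ⟨ξ, h1, h2⟩ := h
  intro ω h3
  simp only [korBall, Set.mem_ofPred_eq] at *
  have e1 := kd_triangle (norm_sphere_le η) (norm_sphere_le ω) (norm_sphere_le ξ)
  have e2 := kd_triangle (norm_sphere_le ξ) (norm_sphere_le ω) (norm_sphere_le ζ)
  rw [kd_comm (ξ : Cn n) ζ] at e2
  have := le_max_left δ ε
  have := le_max_right δ ε
  linarith

/-! ### Surface measure of non-isotropic balls -/

theorem exists_orthonormalBasis_zero {n : ℕ} [NeZero n] (ζ : UnitSphere n) :
    ∃ b : OrthonormalBasis (Fin n) ℂ (Cn n), b 0 = ζ := by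
  have hcard : Module.finrank ℂ (Cn n) = Fintype.card (Fin n) := by simp
  have hv : Orthonormal ℂ (({0} : Set (Fin n)).domRestrict (fun _ : Fin n => (ζ : Cn n))) := by
    constructor
    · intro i; simp
    · intro i j hij; exact absurd (Subsingleton.elim i j) hij
  obtain ⟨b, hb⟩ := hv.exists_orthonormalBasis_extension_of_card_eq hcard
  exact ⟨b, hb 0 rfl⟩

theorem norm_sq_eq_sum_repr {n : ℕ} [NeZero n] (b : OrthonormalBasis (Fin n) ℂ (Cn n)) (w : Cn n) :
    ‖w‖ ^ 2 = ‖b.repr w 0‖ ^ 2 + ∑ i ∈ Finset.univ.erase 0, ‖b.repr w i‖ ^ 2 := by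
  rw [← b.repr.norm_map w, EuclideanSpace.norm_sq_eq,
    Finset.add_sum_erase _ (fun i => ‖b.repr w i‖ ^ 2) (Finset.mem_univ 0)]

theorem prod_box {n : ℕ} [NeZero n] (x y : ℝ) :
    ∏ i : Fin n, (if i = 0 then x else y) ^ 2 = x ^ 2 * (y ^ 2) ^ (n - 1) := by
  rw [← Finset.mul_prod_erase _ _ (Finset.mem_univ (0 : Fin n)), if_pos rfl,
    Finset.prod_congr rfl (fun i hi => by rw [if_neg (Finset.ne_of_mem_erase hi)]),
    Finset.prod_const, Finset.card_erase_of_mem (Finset.mem_univ _), Finset.card_univ,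
    Fintype.card_fin]

theorem ballVolume_apply_of_subset {n : ℕ} {s : Set (Cn n)} (hs : s ⊆ unitBall n) :
    ballVolume n s = ((volume : Measure (Cn n)) (unitBall n))⁻¹ * volume s := by
  rw [ballVolume, Measure.smul_apply, smul_eq_mul, Measure.restrict_eq_self _ hs]

/-- The part of the cone over a non-isotropic ball lying in a spherical shell. -/
def korSector {n : ℕ} (ζ : UnitSphere n) (δ a b : ℝ) : Set (Cn n) :=
  {w | ‖w‖ ∈ Set.Ioo a b ∧ kd (ζ : Cn n) (((‖w‖⁻¹ : ℝ) : ℂ) • w) < δ}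

theorem measurableSet_korSector {n : ℕ} (ζ : UnitSphere n) (δ a b : ℝ) :
    MeasurableSet (korSector ζ δ a b) := by
  refine MeasurableSet.inter (measurable_norm measurableSet_Ioo) ?_
  exact measurableSet_lt (measurable_kd measurable_const
    ((Complex.measurable_ofReal.comp measurable_norm.inv).smul measurable_id)) measurable_const

theorem ballVolume_korSector {n : ℕ} [NeZero n] (ζ : UnitSphere n) {δ a b : ℝ} (ha : 0 ≤ a)
    (hb : b ≤ 1) : ballVolume n (korSector ζ δ a b) =
      (∫⁻ r in Set.Ioo a b, ENNReal.ofReal (2 * n * r ^ (2 * n - 1))) *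
        sphereMeasure n (korBall ζ δ) := by
  have hm := measurableSet_korSector ζ δ a b
  rw [← lintegral_indicator_one hm, lintegral_ball_polar (measurable_one.indicator hm)]
  have h1 : ∀ r ∈ Set.Ioo (0 : ℝ) 1, ENNReal.ofReal (2 * n * r ^ (2 * n - 1)) *
        ∫⁻ η : UnitSphere n, (korSector ζ δ a b).indicator 1 (r • (η : Cn n)) ∂(sphereMeasure n)
      = (Set.Ioo a b).indicator (fun r => ENNReal.ofReal (2 * n * r ^ (2 * n - 1)) *
        sphereMeasure n (korBall ζ δ)) r := by
    intro r hr
    have hr0 : 0 < r := hr.1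
    have e : ∀ η : UnitSphere n, r • (η : Cn n) ∈ korSector ζ δ a b ↔
        r ∈ Set.Ioo a b ∧ η ∈ korBall ζ δ := by
      intro η
      have h2 : ‖r • (η : Cn n)‖ = r := by
        rw [norm_smul, norm_sphere, Real.norm_of_nonneg hr0.le, mul_one]
      simp only [korSector, korBall, Set.mem_ofPred_eq, h2]
      rw [← Complex.coe_smul r, smul_smul, ← Complex.ofReal_mul, inv_mul_cancel₀ hr0.ne']
      simp
    by_cases h : r ∈ Set.Ioo a b
    · rw [Set.indicator_of_mem h, ← lintegral_indicator_one (measurableSet_korBall ζ δ)]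
      congr 1
      refine lintegral_congr fun η => ?_
      by_cases h3 : η ∈ korBall ζ δ
      · rw [Set.indicator_of_mem h3, Set.indicator_of_mem ((e η).2 ⟨h, h3⟩)]; rfl
      · rw [Set.indicator_of_notMem h3, Set.indicator_of_notMem (fun h4 => h3 ((e η).1 h4).2)]
    · rw [Set.indicator_of_notMem h]
      have : ∀ η : UnitSphere n, (korSector ζ δ a b).indicator 1 (r • (η : Cn n)) = (0 : ℝ≥0∞) :=
        fun η => Set.indicator_of_notMem (fun h4 => h ((e η).1 h4).1) _
      rw [lintegral_congr this]; simp
  rw [setLIntegral_congr_fun measurableSet_Ioo h1, setLIntegral_indicator measurableSet_Ioo,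
    Set.inter_eq_left.2 (Set.Ioo_subset_Ioo ha hb), lintegral_mul_const' _ _ (measure_ne_top _ _)]

theorem sphereMeasure_korBall_le (n : ℕ) [NeZero n] : ∃ C : ℝ, 0 < C ∧
    ∀ (ζ : UnitSphere n) (δ : ℝ), 0 < δ →
      sphereMeasure n (korBall ζ δ) ≤ ENNReal.ofReal (C * δ ^ n) := by
  obtain ⟨c, hc, hbox⟩ := exists_volume_box n
  have hn : (0 : ℝ) < n := Nat.cast_pos.2 (NeZero.pos n)
  set V := ((volume : Measure (Cn n)) (unitBall n)) with hV
  have hV0 : 0 < V.toReal := ENNReal.toReal_pos (volume_unitBall_pos n) (volume_unitBall_ne_top n)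
  have hVe : V⁻¹ = ENNReal.ofReal (V.toReal⁻¹) := by
    rw [ENNReal.ofReal_inv_of_pos hV0, ENNReal.ofReal_toReal (volume_unitBall_ne_top n)]
  set K : ℝ := 2 * n * (1 / 2) ^ (2 * n - 1) with hK
  have hK0 : 0 < K := by positivity
  set A : ℝ := V.toReal⁻¹ * (c * (4 * 9 ^ (n - 1))) / K with hA
  have hA0 : 0 < A := by positivity
  refine ⟨max A (2 ^ n), lt_max_of_lt_left hA0, fun ζ δ hδ => ?_⟩
  rcases lt_or_ge (1 / 2) δ with h | h
  · refine prob_le_one.trans ?_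
    rw [← ENNReal.ofReal_one]
    apply ENNReal.ofReal_le_ofReal
    calc (1 : ℝ) = (2 * (1 / 2)) ^ n := by norm_num
      _ ≤ (2 * δ) ^ n := by gcongr
      _ = 2 ^ n * δ ^ n := by rw [mul_pow]
      _ ≤ _ := by gcongr; exact le_max_right _ _
  · obtain ⟨b, hb⟩ := exists_orthonormalBasis_zero ζ
    have hsub : korSector ζ δ (1 - δ) 1 ⊆
        {w | ∀ i, ‖b.repr w i - (if i = 0 then 1 else 0)‖ <
          if i = 0 then 2 * δ else 3 * √δ} := by
      rintro w ⟨⟨hw1, hw2⟩, hw3⟩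
      have hw0 : ‖w‖ ≠ 0 := by linarith
      set η : Cn n := ((‖w‖⁻¹ : ℝ) : ℂ) • w with hη
      have hη1 : ‖η‖ = 1 := by
        rw [hη, norm_smul, Complex.norm_real, norm_inv, norm_norm, inv_mul_cancel₀ hw0]
      have hw : w = ((‖w‖ : ℝ) : ℂ) • η := by
        rw [hη, smul_smul, ← Complex.ofReal_mul, mul_inv_cancel₀ hw0]; simp
      have h4 := kd_smul_le (norm_sphere_le ζ) hη1.le (norm_nonneg w) hw2.le
      rw [← hw] at h4
      have h5 : kd (ζ : Cn n) w < 2 * δ := by linarith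
      have h6 : b.repr w 0 = inner ℂ (ζ : Cn n) w := by rw [b.repr_apply_apply, hb]
      have h7 : ‖b.repr w 0 - 1‖ < 2 * δ := by
        rw [norm_sub_rev, h6]; exact h5
      intro i
      by_cases hi : i = 0
      · subst hi; simpa using h7
      · simp only [hi, if_false, sub_zero]
        have h8 : ‖b.repr w i‖ ^ 2 ≤ ∑ i ∈ Finset.univ.erase 0, ‖b.repr w i‖ ^ 2 :=
          Finset.single_le_sum (f := fun i => ‖b.repr w i‖ ^ 2) (fun _ _ => by positivity)
            (Finset.mem_erase.2 ⟨hi, Finset.mem_univ i⟩)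
        have h9 := norm_sq_eq_sum_repr b w
        have h10 : 1 - ‖b.repr w 0‖ < 2 * δ := by
          have := norm_sub_norm_le (1 : ℂ) (b.repr w 0)
          rw [norm_one, norm_sub_rev] at this
          linarith
        have h11 : ‖b.repr w i‖ ^ 2 < (3 * √δ) ^ 2 := by
          rw [mul_pow, Real.sq_sqrt hδ.le]
          nlinarith [norm_nonneg (b.repr w 0), norm_nonneg w, sq_nonneg (1 - ‖b.repr w 0‖)]
        exact lt_of_pow_lt_pow_left₀ 2 (by positivity) h11
    have hle := measure_mono (μ := ballVolume n) (Set.inter_subset_left (s := korSector ζ δ (1-δ) 1)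
      (t := unitBall n))
    have hballsub : korSector ζ δ (1 - δ) 1 ⊆ unitBall n := by
      rintro w ⟨⟨hw1, hw2⟩, hw3⟩
      simpa using hw2
    have h1 : ballVolume n (korSector ζ δ (1 - δ) 1) ≤
        ENNReal.ofReal (V.toReal⁻¹ * (c * (4 * 9 ^ (n - 1))) * δ ^ (n + 1)) := by
      rw [ballVolume_apply_of_subset hballsub, ← hV, hVe]
      refine (mul_le_mul_right (measure_mono hsub) _).trans ?_
      rw [hbox b _ _ (by intro i; split_ifs <;> positivity),
        ← ENNReal.ofReal_mul (by positivity), prod_box]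
      apply ENNReal.ofReal_le_ofReal
      apply le_of_eq
      have : δ ^ (n + 1) = δ ^ 2 * δ ^ (n - 1) := by
        rw [← pow_add]; congr 1; have := NeZero.pos n; omega
      rw [this, mul_pow 3, Real.sq_sqrt hδ.le, mul_pow]
      ring
    have h2 : ENNReal.ofReal (K * δ) ≤
        ∫⁻ r in Set.Ioo (1 - δ) 1, ENNReal.ofReal (2 * n * r ^ (2 * n - 1)) := by
      calc ENNReal.ofReal (K * δ) = ∫⁻ r in Set.Ioo (1 - δ) 1, ENNReal.ofReal K := by
            rw [setLIntegral_const, Real.volume_Ioo, ← ENNReal.ofReal_mul hK0.le]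
            congr 2; ring
        _ ≤ _ := by
            refine setLIntegral_mono' measurableSet_Ioo fun r hr => ?_
            apply ENNReal.ofReal_le_ofReal
            rw [hK]
            have : (1 : ℝ) / 2 ≤ r := by linarith [hr.1]
            gcongr
    rw [ballVolume_korSector ζ (by linarith) le_rfl] at h1
    have h3 : ENNReal.ofReal (K * δ) * sphereMeasure n (korBall ζ δ) ≤
        ENNReal.ofReal (K * δ) * ENNReal.ofReal (A * δ ^ n) := by
      refine (mul_le_mul_left h2 _).trans (h1.trans ?_)
      rw [← ENNReal.ofReal_mul (by positivity)]
      apply ENNReal.ofReal_le_ofReal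
      apply le_of_eq
      rw [hA, pow_succ]; field_simp
    have h4 := (ENNReal.mul_le_mul_iff_right (a := ENNReal.ofReal (K * δ))
      (ENNReal.ofReal_pos.2 (by positivity)).ne' ENNReal.ofReal_ne_top).1 h3
    refine h4.trans (ENNReal.ofReal_le_ofReal ?_)
    gcongr
    exact le_max_left _ _

theorem le_sphereMeasure_korBall (n : ℕ) [NeZero n] : ∃ c : ℝ, 0 < c ∧
    ∀ (ζ : UnitSphere n) (δ : ℝ), 0 < δ → δ ≤ 1 →
      ENNReal.ofReal (c * δ ^ n) ≤ sphereMeasure n (korBall ζ δ) := by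
  obtain ⟨c, hc, hbox⟩ := exists_volume_box n
  have hn : (0 : ℝ) < n := Nat.cast_pos.2 (NeZero.pos n)
  set V := ((volume : Measure (Cn n)) (unitBall n)) with hV
  have hV0 : 0 < V.toReal := ENNReal.toReal_pos (volume_unitBall_pos n) (volume_unitBall_ne_top n)
  have hVe : V⁻¹ = ENNReal.ofReal (V.toReal⁻¹) := by
    rw [ENNReal.ofReal_inv_of_pos hV0, ENNReal.ofReal_toReal (volume_unitBall_ne_top n)]
  set A : ℝ := V.toReal⁻¹ * (c * (1 / 64 * (1 / (8 * n)) ^ (n - 1))) / (2 * n) with hA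
  have hA0 : 0 < A := by positivity
  refine ⟨A, hA0, fun ζ δ hδ hδ1 => ?_⟩
  obtain ⟨b, hb⟩ := exists_orthonormalBasis_zero ζ
  have hsub : {w : Cn n | ∀ i, ‖b.repr w i - (if i = 0 then ((1 - δ / 4 : ℝ) : ℂ) else 0)‖ <
      if i = 0 then δ / 8 else √(δ / (8 * n))} ⊆ korSector ζ δ (1 - δ) 1 := by
    intro w hw
    have h6 : b.repr w 0 = inner ℂ (ζ : Cn n) w := by rw [b.repr_apply_apply, hb]
    have h7 : ‖b.repr w 0 - ((1 - δ / 4 : ℝ) : ℂ)‖ < δ / 8 := by simpa using hw 0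
    have h8 : ∑ i ∈ Finset.univ.erase 0, ‖b.repr w i‖ ^ 2 ≤ δ / 8 := by
      calc ∑ i ∈ Finset.univ.erase 0, ‖b.repr w i‖ ^ 2
          ≤ ∑ i ∈ Finset.univ.erase (0 : Fin n), δ / (8 * n) := by
            refine Finset.sum_le_sum fun i hi => ?_
            have h := hw i
            rw [if_neg (Finset.ne_of_mem_erase hi), if_neg (Finset.ne_of_mem_erase hi),
              sub_zero] at h
            calc ‖b.repr w i‖ ^ 2 ≤ √(δ / (8 * n)) ^ 2 := by gcongr
              _ = _ := Real.sq_sqrt (by positivity)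
        _ ≤ ∑ i : Fin n, δ / (8 * n) :=
            Finset.sum_le_sum_of_subset_of_nonneg (Finset.erase_subset _ _)
              (fun _ _ _ => by positivity)
        _ = δ / 8 := by
            rw [Finset.sum_const, Finset.card_univ, Fintype.card_fin, nsmul_eq_mul]
            field_simp
    have h9 := norm_sq_eq_sum_repr b w
    have h10 : ‖b.repr w 0‖ < 1 - δ / 8 := by
      have := norm_sub_norm_le (b.repr w 0) ((1 - δ / 4 : ℝ) : ℂ)
      rw [Complex.norm_real, Real.norm_of_nonneg (by linarith)] at this
      linarith
    have h11 : 1 - 3 * δ / 8 < ‖b.repr w 0‖ := by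
      have := norm_sub_norm_le ((1 - δ / 4 : ℝ) : ℂ) (b.repr w 0)
      rw [Complex.norm_real, Real.norm_of_nonneg (by linarith), norm_sub_rev] at this
      linarith
    have h12 : ‖b.repr w 0‖ ≤ ‖w‖ := by
      have : 0 ≤ ∑ i ∈ Finset.univ.erase 0, ‖b.repr w i‖ ^ 2 :=
        Finset.sum_nonneg fun _ _ => by positivity
      exact le_of_sq_le_sq (by linarith) (norm_nonneg _)
    have h13 : ‖w‖ < 1 := by
      have : ‖w‖ ^ 2 < 1 := by nlinarith [norm_nonneg (b.repr w 0)]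
      nlinarith [norm_nonneg w]
    have hw0 : 0 < ‖w‖ := by linarith
    refine ⟨⟨by linarith, h13⟩, ?_⟩
    have h14 : ‖(1 : ℂ) - b.repr w 0‖ < 3 * δ / 8 := by
      have e : (1 : ℂ) - b.repr w 0 = ((δ / 4 : ℝ) : ℂ) - (b.repr w 0 - ((1 - δ / 4 : ℝ) : ℂ)) := by
        push_cast; ring
      rw [e]
      refine (norm_sub_le _ _).trans_lt ?_
      rw [Complex.norm_real, Real.norm_of_nonneg (by linarith)]
      linarith
    have h15 : kd (ζ : Cn n) (((‖w‖⁻¹ : ℝ) : ℂ) • w) ≤ ‖(1 : ℂ) - b.repr w 0‖ +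
        ‖((1 - ‖w‖⁻¹ : ℝ) : ℂ) * b.repr w 0‖ := by
      unfold kd
      rw [inner_smul_right, ← h6]
      have e : (1 : ℂ) - ((‖w‖⁻¹ : ℝ) : ℂ) * b.repr w 0 = (1 - b.repr w 0) +
        ((1 - ‖w‖⁻¹ : ℝ) : ℂ) * b.repr w 0 := by push_cast; ring
      rw [e]
      exact norm_add_le _ _
    have h16 : ‖((1 - ‖w‖⁻¹ : ℝ) : ℂ) * b.repr w 0‖ ≤ 1 - ‖w‖ := by
      rw [norm_mul, Complex.norm_real, Real.norm_of_nonpos (by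
        have := (one_le_inv₀ hw0).2 h13.le
        linarith)]
      have h17 : 0 ≤ ‖w‖⁻¹ - 1 := by
        have := (one_le_inv₀ hw0).2 h13.le
        linarith
      calc -(1 - ‖w‖⁻¹) * ‖b.repr w 0‖ = (‖w‖⁻¹ - 1) * ‖b.repr w 0‖ := by ring
        _ ≤ (‖w‖⁻¹ - 1) * ‖w‖ := by gcongr
        _ = 1 - ‖w‖ := by field_simp
    linarith
  have hballsub : korSector ζ δ (1 - δ) 1 ⊆ unitBall n := by
    rintro w ⟨⟨hw1, hw2⟩, hw3⟩
    simpa using hw2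
  have h1 : ENNReal.ofReal (V.toReal⁻¹ * (c * (1 / 64 * (1 / (8 * n)) ^ (n - 1))) * δ ^ (n + 1)) ≤
      ballVolume n (korSector ζ δ (1 - δ) 1) := by
    rw [ballVolume_apply_of_subset hballsub, ← hV, hVe]
    refine le_trans ?_ (mul_le_mul_right (measure_mono hsub) _)
    rw [hbox b _ _ (by intro i; split_ifs <;> positivity),
      ← ENNReal.ofReal_mul (by positivity), prod_box]
    apply ENNReal.ofReal_le_ofReal
    apply le_of_eq
    have : δ ^ (n + 1) = δ ^ 2 * δ ^ (n - 1) := by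
      rw [← pow_add]; congr 1; have := NeZero.pos n; omega
    rw [this, Real.sq_sqrt (by positivity), div_pow δ (8 * (n : ℝ)), one_div_pow]
    ring
  have h2 : ∫⁻ r in Set.Ioo (1 - δ) 1, ENNReal.ofReal (2 * n * r ^ (2 * n - 1)) ≤
      ENNReal.ofReal (2 * n * δ) := by
    calc _ ≤ ∫⁻ r in Set.Ioo (1 - δ) 1, ENNReal.ofReal (2 * n) := by
          refine setLIntegral_mono' measurableSet_Ioo fun r hr => ?_
          apply ENNReal.ofReal_le_ofReal
          exact mul_le_of_le_one_right (by positivity)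
            (pow_le_one₀ (by linarith [hr.1]) hr.2.le)
      _ = ENNReal.ofReal (2 * n * δ) := by
          rw [setLIntegral_const, Real.volume_Ioo, ← ENNReal.ofReal_mul (by positivity)]
          congr 2; ring
  rw [ballVolume_korSector ζ (by linarith) le_rfl] at h1
  have h3 : ENNReal.ofReal (2 * n * δ) * ENNReal.ofReal (A * δ ^ n) ≤
      ENNReal.ofReal (2 * n * δ) * sphereMeasure n (korBall ζ δ) := by
    refine le_trans ?_ (h1.trans (mul_le_mul_left h2 _))
    rw [← ENNReal.ofReal_mul (by positivity)]
    apply ENNReal.ofReal_le_ofReal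
    apply le_of_eq
    rw [hA, pow_succ]; field_simp
  exact (ENNReal.mul_le_mul_iff_right (a := ENNReal.ofReal (2 * n * δ))
    (ENNReal.ofReal_pos.2 (by positivity)).ne' ENNReal.ofReal_ne_top).1 h3

/-! ### Dyadic sums -/

/-- A power is bounded by the sum of the powers of the smaller dyadic numbers. The converse is
`exists_tsum_dyadic_le`. -/
theorem rpow_le_tsum_dyadic {r : ℝ} (hr : 0 < r) (x : ℝ≥0∞) :
    x ^ r ≤ 2 ^ r * ∑' j : ℤ, if (2 : ℝ≥0∞) ^ j < x then ((2 : ℝ≥0∞) ^ j) ^ r else 0 := by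
  rcases eq_or_ne x 0 with rfl | h0
  · simp [hr]
  rcases eq_or_ne x ⊤ with rfl | ht
  · have h1 : (⊤ : ℝ≥0∞) ≤ ∑' j : ℤ, if (2 : ℝ≥0∞) ^ j < ⊤ then ((2 : ℝ≥0∞) ^ j) ^ r else 0 := by
      calc (⊤ : ℝ≥0∞) = ∑' j : ℕ, (1 : ℝ≥0∞) :=
            (ENNReal.tsum_const_eq_top_of_ne_zero one_ne_zero).symm
        _ ≤ ∑' j : ℕ, (fun j : ℤ => if (2 : ℝ≥0∞) ^ j < ⊤ then ((2 : ℝ≥0∞) ^ j) ^ r else 0)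
              (j : ℤ) := by
            refine ENNReal.tsum_le_tsum fun j => ?_
            simp only [zpow_natCast]
            rw [if_pos (ENNReal.pow_lt_top (by simp))]
            exact ENNReal.one_le_rpow (one_le_pow₀ (by norm_num)) hr
        _ ≤ _ := ENNReal.tsum_comp_le_tsum_of_injective Nat.cast_injective _
    rw [top_le_iff.1 h1, ENNReal.mul_top]
    · exact le_top
    · simp
  · obtain ⟨j, hj1, hj2⟩ := ENNReal.exists_mem_Ioc_zpow h0 ht (by norm_num : (1 : ℝ≥0∞) < 2)
      (by simp)
    calc x ^ r ≤ ((2 : ℝ≥0∞) ^ (j + 1)) ^ r := by gcongr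
      _ = 2 ^ r * ((2 : ℝ≥0∞) ^ j) ^ r := by
          rw [ENNReal.zpow_add (by simp) (by simp), zpow_one, mul_comm,
            ENNReal.mul_rpow_of_nonneg _ _ hr.le]
      _ ≤ _ := by
          gcongr
          refine le_trans ?_ (ENNReal.le_tsum j)
          rw [if_pos hj1]

theorem exists_tsum_dyadic_le {r : ℝ} (hr : 0 < r) : ∃ C : ℝ≥0, ∀ x : ℝ≥0∞,
    ∑' j : ℤ, (if (2 : ℝ≥0∞) ^ j < x then ((2 : ℝ≥0∞) ^ j) ^ r else 0) ≤ C * x ^ r := by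
  set g : ℝ≥0∞ := (2 : ℝ≥0∞) ^ (-r) with hg
  have hg1 : g < 1 := ENNReal.rpow_lt_one_of_one_lt_of_neg (by norm_num) (by linarith)
  have hC : (1 - g)⁻¹ ≠ ⊤ := by
    rw [ENNReal.inv_ne_top]; exact (tsub_pos_of_lt hg1).ne'
  refine ⟨((1 - g)⁻¹).toNNReal, fun x => ?_⟩
  rw [ENNReal.coe_toNNReal hC]
  rcases eq_or_ne x 0 with rfl | h0
  · simp
  rcases eq_or_ne x ⊤ with rfl | ht
  · rw [ENNReal.top_rpow_of_pos hr, ENNReal.mul_top]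
    · exact le_top
    · simp
  · obtain ⟨m, hm1, hm2⟩ := ENNReal.exists_mem_Ioc_zpow h0 ht (by norm_num : (1 : ℝ≥0∞) < 2)
      (by simp)
    set F : ℤ → ℝ≥0∞ := fun j => if (2 : ℝ≥0∞) ^ j < x then ((2 : ℝ≥0∞) ^ j) ^ r else 0 with hF
    have hinj : Function.Injective fun i : ℕ => m - (i : ℤ) := fun a b h => by
      simp only at h; omega
    have hsupp : Function.support F ⊆ Set.range fun i : ℕ => m - (i : ℤ) := by
      intro j hj
      have h1 : (2 : ℝ≥0∞) ^ j < x := by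
        by_contra h; simp [hF, h] at hj
      have h2 : j ≤ m := by
        by_contra h
        have h3 : (2 : ℝ≥0∞) ^ (m + 1) ≤ 2 ^ j := ENNReal.zpow_le_of_le (by norm_num) (by omega)
        exact absurd (h1.trans_le (hm2.trans h3)) (lt_irrefl _)
      exact ⟨(m - j).toNat, by simp only; omega⟩
    rw [← hinj.tsum_eq hsupp]
    calc ∑' i : ℕ, F (m - i) ≤ ∑' i : ℕ, ((2 : ℝ≥0∞) ^ m) ^ r * g ^ i := by
          refine ENNReal.tsum_le_tsum fun i => ?_
          have : ((2 : ℝ≥0∞) ^ (m - (i : ℤ))) ^ r = ((2 : ℝ≥0∞) ^ m) ^ r * g ^ i := by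
            rw [ENNReal.zpow_sub (by simp) (by simp), zpow_natCast,
              ENNReal.mul_rpow_of_nonneg _ _ hr.le, ENNReal.inv_rpow, hg, ENNReal.rpow_neg,
              ← ENNReal.inv_pow, ← ENNReal.rpow_natCast, ← ENNReal.rpow_natCast,
              ← ENNReal.rpow_mul, ← ENNReal.rpow_mul, mul_comm (i : ℝ) r]
          simp only [hF]
          split_ifs
          · exact this.le
          · exact zero_le
      _ = (1 - g)⁻¹ * ((2 : ℝ≥0∞) ^ m) ^ r := by
          rw [ENNReal.tsum_mul_left, ENNReal.tsum_geometric, mul_comm]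
      _ ≤ _ := by gcongr

theorem two_zpow_eq_ofReal (j : ℤ) : (2 : ℝ≥0∞) ^ j = ENNReal.ofReal ((2 : ℝ) ^ j) := by
  cases j with
  | ofNat k => simp [ENNReal.ofReal_pow]
  | negSucc k =>
    rw [zpow_negSucc, zpow_negSucc, ENNReal.ofReal_inv_of_pos (by positivity), ENNReal.ofReal_pow
      (by norm_num)]
    simp

/-! ### The maximal function on the sphere -/

/-- The Hardy-Littlewood maximal function for dyadic radii and the non-isotropic quasi-distance.
The averages are normalised by the power `δ ^ n` of the radius, which is comparable to the
surface measure of the ball. -/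
def maxFn {n : ℕ} (ψ : UnitSphere n → ℝ≥0∞) (η : UnitSphere n) : ℝ≥0∞ :=
  ⨆ j : ℤ, (∫⁻ ζ in korBall η ((2 : ℝ) ^ j), ψ ζ ∂(sphereMeasure n)) /
    ENNReal.ofReal (((2 : ℝ) ^ j) ^ n)

theorem measurableSet_korBall_prod {n : ℕ} (ρ : ℝ) :
    MeasurableSet {x : UnitSphere n × UnitSphere n | x.2 ∈ korBall x.1 ρ} :=
  measurableSet_lt (measurable_kd (by fun_prop) (by fun_prop)) measurable_const

theorem measurable_setLIntegral_of_prod {X Y : Type*} [MeasurableSpace X] [MeasurableSpace Y]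
    {ν : Measure Y} [SFinite ν] {s : X → Set Y} (hs : MeasurableSet {x : X × Y | x.2 ∈ s x.1})
    {ψ : X → Y → ℝ≥0∞} (hψ : Measurable (Function.uncurry ψ)) :
    Measurable fun x => ∫⁻ y in s x, ψ x y ∂ν := by
  have h1 : ∀ x, MeasurableSet (s x) := fun x => measurable_prodMk_left (x := x) hs
  have h2 : (fun x => ∫⁻ y in s x, ψ x y ∂ν) =
      fun x => ∫⁻ y, {x : X × Y | x.2 ∈ s x.1}.indicator (Function.uncurry ψ) (x, y) ∂ν := by
    funext x
    rw [← lintegral_indicator (h1 x)]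
    rfl
  rw [h2]
  exact (hψ.indicator hs).lintegral_prod_right'

theorem measurable_maxFn {n : ℕ} [NeZero n] {ψ : UnitSphere n → ℝ≥0∞} (hψ : Measurable ψ) :
    Measurable (maxFn ψ) := by
  refine Measurable.iSup fun j => ?_
  refine Measurable.div_const ?_ _
  exact measurable_setLIntegral_of_prod (ψ := fun _ y => ψ y) (measurableSet_korBall_prod _)
    (hψ.comp measurable_snd)

theorem setLIntegral_korBall_le_maxFn {n : ℕ} (ψ : UnitSphere n → ℝ≥0∞) (η : UnitSphere n)
    (j : ℤ) : ∫⁻ ζ in korBall η ((2 : ℝ) ^ j), ψ ζ ∂(sphereMeasure n) ≤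
      ENNReal.ofReal (((2 : ℝ) ^ j) ^ n) * maxFn ψ η := by
  have h := le_iSup (fun j : ℤ => (∫⁻ ζ in korBall η ((2 : ℝ) ^ j), ψ ζ ∂(sphereMeasure n)) /
    ENNReal.ofReal (((2 : ℝ) ^ j) ^ n)) j
  rw [mul_comm]
  exact (ENNReal.div_le_iff (ENNReal.ofReal_pos.2 (by positivity)).ne' ENNReal.ofReal_ne_top).1 h

/-- The weak type `(1,1)` inequality for the maximal function, by the Vitali covering theorem. -/
theorem maxFn_weak_type (n : ℕ) [NeZero n] : ∃ C : ℝ≥0, ∀ ψ : UnitSphere n → ℝ≥0∞,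
    ∀ l : ℝ≥0∞, l * sphereMeasure n {η | l < maxFn ψ η} ≤ C * ∫⁻ ζ, ψ ζ ∂(sphereMeasure n) := by
  obtain ⟨C, hC, hball⟩ := sphereMeasure_korBall_le n
  refine ⟨(C * 42 ^ n).toNNReal, fun ψ l => ?_⟩
  set t : Set (UnitSphere n × ℤ) := {a | a.2 ≤ 2 ∧ l * ENNReal.ofReal (((2 : ℝ) ^ a.2) ^ n) <
    ∫⁻ ζ in korBall a.1 ((2 : ℝ) ^ a.2), ψ ζ ∂(sphereMeasure n)} with ht
  have hpos : ∀ j : ℤ, (0 : ℝ) < 2 ^ j := fun j => by positivity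
  obtain ⟨u, hut, hdisj, hcov⟩ := Vitali.exists_disjoint_subfamily_covering_enlargement
    (fun a : UnitSphere n × ℤ => korBall a.1 ((2 : ℝ) ^ a.2)) t (fun a => (2 : ℝ) ^ a.2) 2
    one_lt_two (fun a _ => (hpos _).le) (2 ^ (2 : ℤ))
    (fun a ha => zpow_le_zpow_right₀ one_le_two ha.1)
    (fun a _ => ⟨a.1, mem_korBall_self _ (hpos _)⟩)
  have hucount : u.Countable := hdisj.countable_of_isOpen (fun a _ => isOpen_korBall _ _)
    (fun a _ => ⟨a.1, mem_korBall_self _ (hpos _)⟩)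
  have hsub : {η | l < maxFn ψ η} ⊆ ⋃ b ∈ u, korBall b.1 (42 * (2 : ℝ) ^ b.2) := by
    intro η hη
    obtain ⟨j, hj⟩ := lt_iSup_iff.1 (show l < ⨆ j : ℤ, _ from hη)
    have hj' : l * ENNReal.ofReal (((2 : ℝ) ^ j) ^ n) <
        ∫⁻ ζ in korBall η ((2 : ℝ) ^ j), ψ ζ ∂(sphereMeasure n) :=
      (ENNReal.lt_div_iff_mul_lt (Or.inl (ENNReal.ofReal_pos.2 (by positivity)).ne')
        (Or.inl ENNReal.ofReal_ne_top)).1 hj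
    -- a ball of dyadic radius at least `4` is the whole sphere
    have hmin : (η, min j 2) ∈ t := by
      refine ⟨min_le_right _ _, ?_⟩
      rcases le_or_gt j 2 with h | h
      · simpa [min_eq_left h] using hj'
      · simp only [min_eq_right h.le]
        rw [korBall_eq_univ _ (by norm_num)]
        refine lt_of_le_of_lt ?_ (hj'.trans_le (lintegral_mono_set (Set.subset_univ _)))
        gcongr
        norm_num
    obtain ⟨b, hb, hb1, hb2⟩ := hcov _ hmin
    refine Set.mem_biUnion hb ?_
    have h1 := korBall_subset_of_inter hb1 (mem_korBall_self _ (hpos _))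
    simp only [korBall, Set.mem_ofPred_eq] at h1 ⊢
    refine h1.trans_le ?_
    have h3 : max ((2 : ℝ) ^ (min j 2)) (2 ^ b.2) ≤ 2 * 2 ^ b.2 :=
      max_le hb2 (by linarith [hpos b.2])
    linarith
  calc l * sphereMeasure n {η | l < maxFn ψ η}
      ≤ l * ∑' b : u, sphereMeasure n (korBall b.1.1 (42 * (2 : ℝ) ^ b.1.2)) := by
        gcongr
        refine (measure_mono hsub).trans ?_
        exact measure_biUnion_le _ hucount _
    _ ≤ l * ∑' b : u, ENNReal.ofReal (C * 42 ^ n) * ENNReal.ofReal (((2 : ℝ) ^ b.1.2) ^ n) := by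
        gcongr with b
        refine (hball _ _ (by positivity)).trans_eq ?_
        rw [← ENNReal.ofReal_mul (by positivity)]
        congr 1; rw [mul_pow]; ring
    _ = ENNReal.ofReal (C * 42 ^ n) *
          ∑' b : u, l * ENNReal.ofReal (((2 : ℝ) ^ b.1.2) ^ n) := by
        rw [ENNReal.tsum_mul_left, ENNReal.tsum_mul_left]; ring
    _ ≤ ENNReal.ofReal (C * 42 ^ n) *
          ∑' b : u, ∫⁻ ζ in korBall b.1.1 ((2 : ℝ) ^ b.1.2), ψ ζ ∂(sphereMeasure n) := by
        gcongr with b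
        exact (hut b.2).2.le
    _ = ENNReal.ofReal (C * 42 ^ n) *
          ∫⁻ ζ in ⋃ b ∈ u, korBall b.1 ((2 : ℝ) ^ b.2), ψ ζ ∂(sphereMeasure n) := by
        rw [lintegral_biUnion hucount (fun b _ => measurableSet_korBall _ _) hdisj]
    _ ≤ ENNReal.ofReal (C * 42 ^ n) * ∫⁻ ζ, ψ ζ ∂(sphereMeasure n) := by
        exact mul_le_mul_right (setLIntegral_le_lintegral _ _) _

theorem maxFn_le_add (n : ℕ) [NeZero n] : ∃ C : ℝ≥0, 0 < C ∧ ∀ ψ : UnitSphere n → ℝ≥0∞,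
    Measurable ψ → ∀ (s : ℝ≥0∞) (η : UnitSphere n),
      maxFn ψ η ≤ maxFn ({ζ | s < ψ ζ}.indicator ψ) η + C * s := by
  obtain ⟨C, hC, hball⟩ := sphereMeasure_korBall_le n
  refine ⟨C.toNNReal, Real.toNNReal_pos.2 hC, fun ψ hψ s η => iSup_le fun j => ?_⟩
  have hms : MeasurableSet {ζ | s < ψ ζ} := measurableSet_lt measurable_const hψ
  have hp : ENNReal.ofReal (((2 : ℝ) ^ j) ^ n) ≠ 0 :=
    (ENNReal.ofReal_pos.2 (by positivity)).ne'
  rw [ENNReal.div_le_iff hp ENNReal.ofReal_ne_top, add_mul]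
  calc ∫⁻ ζ in korBall η ((2 : ℝ) ^ j), ψ ζ ∂(sphereMeasure n)
      ≤ ∫⁻ ζ in korBall η ((2 : ℝ) ^ j), ({ζ | s < ψ ζ}.indicator ψ ζ + s) ∂(sphereMeasure n) := by
        refine lintegral_mono fun ζ => ?_
        by_cases h : s < ψ ζ
        · rw [Set.indicator_of_mem (by exact h)]; exact le_self_add
        · exact (not_lt.1 h).trans le_add_self
    _ = ∫⁻ ζ in korBall η ((2 : ℝ) ^ j), {ζ | s < ψ ζ}.indicator ψ ζ ∂(sphereMeasure n) +
          s * sphereMeasure n (korBall η ((2 : ℝ) ^ j)) := by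
        rw [lintegral_add_left (hψ.indicator hms), setLIntegral_const]
    _ ≤ _ := by
        refine add_le_add ?_ ?_
        · rw [mul_comm]; exact setLIntegral_korBall_le_maxFn _ _ _
        · calc s * sphereMeasure n (korBall η ((2 : ℝ) ^ j))
              ≤ s * ENNReal.ofReal (C * ((2 : ℝ) ^ j) ^ n) := by
                gcongr; exact hball _ _ (by positivity)
            _ = _ := by
                rw [ENNReal.ofReal_mul hC.le, ENNReal.ofReal]; ring

/-- The Hardy-Littlewood maximal theorem on the sphere. -/
theorem lintegral_maxFn_rpow_le (n : ℕ) [NeZero n] {r : ℝ} (hr : 1 < r) :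
    ∃ C : ℝ≥0, ∀ ψ : UnitSphere n → ℝ≥0∞, Measurable ψ →
      ∫⁻ η, maxFn ψ η ^ r ∂(sphereMeasure n) ≤ C * ∫⁻ η, ψ η ^ r ∂(sphereMeasure n) := by
  obtain ⟨A, hA⟩ := maxFn_weak_type n
  obtain ⟨B, hB0, hB⟩ := maxFn_le_add n
  obtain ⟨D, hD⟩ := exists_tsum_dyadic_le (r := r - 1) (by linarith)
  have hr0 : 0 < r := by linarith
  have hB0' : (B : ℝ≥0∞) ≠ 0 := by exact_mod_cast hB0.ne'
  have h2t : (2 : ℝ≥0∞) ≠ ⊤ := by simp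
  refine ⟨(2 : ℝ≥0) ^ r * (2 * A * (D * (2 * B) ^ (r - 1))), fun ψ hψ => ?_⟩
  -- the weak type inequality at height `2 ^ j`, applied to the large part of `ψ`
  have key : ∀ j : ℤ, ((2 : ℝ≥0∞) ^ j) ^ r * sphereMeasure n {η | (2 : ℝ≥0∞) ^ j < maxFn ψ η} ≤
      ∫⁻ ζ, 2 * A * (ψ ζ * if (2 : ℝ≥0∞) ^ j < 2 * B * ψ ζ then ((2 : ℝ≥0∞) ^ j) ^ (r - 1) else 0)
        ∂(sphereMeasure n) := by
    intro j
    set l : ℝ≥0∞ := (2 : ℝ≥0∞) ^ j with hl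
    have hl0 : l ≠ 0 := (ENNReal.zpow_pos (by simp) (by simp) j).ne'
    have hlt : l ≠ ⊤ := (ENNReal.zpow_lt_top (by simp) (by simp) j).ne
    set s : ℝ≥0∞ := l / (2 * B) with hs
    have h2B : (2 : ℝ≥0∞) * B ≠ 0 := mul_ne_zero (by simp) hB0'
    have h2Bt : (2 : ℝ≥0∞) * B ≠ ⊤ := ENNReal.mul_ne_top (by simp) (by simp)
    have hBs : (B : ℝ≥0∞) * s = l / 2 := by
      rw [hs, ENNReal.div_eq_inv_mul, ENNReal.mul_inv (Or.inl (by simp)) (Or.inl (by simp)),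
        ENNReal.div_eq_inv_mul]
      calc (B : ℝ≥0∞) * (2⁻¹ * (B : ℝ≥0∞)⁻¹ * l) = (B * (B : ℝ≥0∞)⁻¹) * (2⁻¹ * l) := by ring
        _ = _ := by rw [ENNReal.mul_inv_cancel hB0' (by simp), one_mul]
    have hsub : {η | l < maxFn ψ η} ⊆ {η | l / 2 < maxFn ({ζ | s < ψ ζ}.indicator ψ) η} := by
      intro η hη
      by_contra h
      have h1 : maxFn ({ζ | s < ψ ζ}.indicator ψ) η ≤ l / 2 := not_lt.1 h
      have h2 := hB ψ hψ s η
      rw [hBs] at h2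
      have h3 : maxFn ψ η ≤ l := h2.trans ((add_le_add_left h1 _).trans_eq (ENNReal.add_halves l))
      exact absurd (lt_of_lt_of_le hη h3) (lt_irrefl _)
    have hms : MeasurableSet {ζ | s < ψ ζ} := measurableSet_lt measurable_const hψ
    have hmem : ∀ ζ, l < 2 * B * ψ ζ ↔ s < ψ ζ := by
      intro ζ
      rw [hs, ENNReal.div_lt_iff (Or.inl h2B) (Or.inl h2Bt), mul_comm]
    have h4 := hA ({ζ | s < ψ ζ}.indicator ψ) (l / 2)
    rw [lintegral_indicator hms] at h4
    have e1 : l ^ r = l ^ (r - 1) * (2 * (l / 2)) := by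
      rw [ENNReal.mul_div_cancel (by simp) (by simp)]
      nth_rewrite 3 [← ENNReal.rpow_one l]
      rw [← ENNReal.rpow_add _ _ hl0 hlt]; congr 1; ring
    calc l ^ r * sphereMeasure n {η | l < maxFn ψ η}
        ≤ l ^ r * sphereMeasure n {η | l / 2 < maxFn ({ζ | s < ψ ζ}.indicator ψ) η} := by
          gcongr
      _ = l ^ (r - 1) * 2 * (l / 2 *
            sphereMeasure n {η | l / 2 < maxFn ({ζ | s < ψ ζ}.indicator ψ) η}) := by
          rw [e1]; ring
      _ ≤ l ^ (r - 1) * 2 * (A * ∫⁻ ζ in {ζ | s < ψ ζ}, ψ ζ ∂(sphereMeasure n)) := by gcongr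
      _ = ∫⁻ ζ in {ζ | s < ψ ζ}, 2 * A * (ψ ζ * l ^ (r - 1)) ∂(sphereMeasure n) := by
          rw [lintegral_const_mul _ (by fun_prop), lintegral_mul_const _ hψ]; ring
      _ ≤ _ := by
          rw [← lintegral_indicator hms]
          refine lintegral_mono fun ζ => ?_
          by_cases h : s < ψ ζ
          · rw [Set.indicator_of_mem (by exact h), if_pos ((hmem ζ).2 h)]
          · rw [Set.indicator_of_notMem (by exact h)]; exact zero_le
  have hmM := measurable_maxFn hψ
  calc ∫⁻ η, maxFn ψ η ^ r ∂(sphereMeasure n)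
      ≤ ∫⁻ η, 2 ^ r * ∑' j : ℤ, (if (2 : ℝ≥0∞) ^ j < maxFn ψ η then ((2 : ℝ≥0∞) ^ j) ^ r else 0)
          ∂(sphereMeasure n) := lintegral_mono fun η => rpow_le_tsum_dyadic hr0 _
    _ = 2 ^ r * ∑' j : ℤ, ((2 : ℝ≥0∞) ^ j) ^ r *
          sphereMeasure n {η | (2 : ℝ≥0∞) ^ j < maxFn ψ η} := by
        rw [lintegral_const_mul' _ _ (two_rpow_ne_top hr0.le), lintegral_tsum]
        · congr 1
          refine tsum_congr fun j => ?_
          have hms : MeasurableSet {η | (2 : ℝ≥0∞) ^ j < maxFn ψ η} :=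
            measurableSet_lt measurable_const hmM
          rw [← lintegral_indicator_const hms]
          refine lintegral_congr fun η => ?_
          simp only [Set.indicator_apply, Set.mem_ofPred_eq]
        · intro j
          exact (Measurable.ite (measurableSet_lt measurable_const hmM) measurable_const
            measurable_const).aemeasurable
    _ ≤ 2 ^ r * ∑' j : ℤ, ∫⁻ ζ, 2 * A * (ψ ζ *
          if (2 : ℝ≥0∞) ^ j < 2 * B * ψ ζ then ((2 : ℝ≥0∞) ^ j) ^ (r - 1) else 0)
            ∂(sphereMeasure n) := by
        gcongr with j; exact key j
    _ = 2 ^ r * ∫⁻ ζ, 2 * A * (ψ ζ * ∑' j : ℤ,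
          if (2 : ℝ≥0∞) ^ j < 2 * B * ψ ζ then ((2 : ℝ≥0∞) ^ j) ^ (r - 1) else 0)
            ∂(sphereMeasure n) := by
        rw [← lintegral_tsum]
        · congr 1
          refine lintegral_congr fun ζ => ?_
          rw [ENNReal.tsum_mul_left, ENNReal.tsum_mul_left]
        · intro j
          refine Measurable.aemeasurable ?_
          refine Measurable.const_mul (hψ.mul ?_) _
          exact Measurable.ite (measurableSet_lt measurable_const (hψ.const_mul _)) measurable_const
            measurable_const
    _ ≤ 2 ^ r * ∫⁻ ζ, 2 * A * (D * (2 * B) ^ (r - 1)) * ψ ζ ^ r ∂(sphereMeasure n) := by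
        refine mul_le_mul_right (lintegral_mono fun ζ => ?_) _
        calc 2 * (A : ℝ≥0∞) * (ψ ζ * ∑' j : ℤ,
              if (2 : ℝ≥0∞) ^ j < 2 * B * ψ ζ then ((2 : ℝ≥0∞) ^ j) ^ (r - 1) else 0)
            ≤ 2 * A * (ψ ζ * (D * (2 * B * ψ ζ) ^ (r - 1))) := by gcongr; exact hD _
          _ = 2 * A * (D * (2 * B) ^ (r - 1)) * (ψ ζ ^ (1 : ℝ) * ψ ζ ^ (r - 1)) := by
              rw [ENNReal.mul_rpow_of_nonneg _ _ (by linarith), ENNReal.rpow_one]; ring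
          _ = _ := by
              rw [← ENNReal.rpow_add_of_nonneg _ _ zero_le_one (by linarith)]
              congr 2; ring
    _ = _ := by
        rw [lintegral_const_mul _ (by fun_prop), ← mul_assoc]
        congr 1
        rw [ENNReal.coe_mul, ENNReal.coe_mul, ENNReal.coe_mul, ENNReal.coe_mul,
          ENNReal.coe_rpow_of_nonneg _ hr0.le, ENNReal.coe_rpow_of_nonneg _ (by linarith)]
        push_cast; ring

/-! ### Approach regions and their shadows -/

/-- The set of points of the sphere whose approach region contains `w`. -/
def shadow {n : ℕ} (κ : ℝ) (w : Cn n) : Set (UnitSphere n) := {ζ | w ∈ approachRegion κ ζ}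

/-- The part of the unit ball outside the closed ball of radius `ρ`. Approach regions of aperture
less than `2` do not meet a neighbourhood of the origin, so that estimates in terms of them can only
use the values of a function on such a shell. For negative `ρ` this is the whole ball. -/
def outer (n : ℕ) (ρ : ℝ) : Set (Cn n) := {w | w ∈ unitBall n ∧ ρ < ‖w‖}

section regions

variable {n : ℕ} {κ : ℝ} {ζ η : UnitSphere n} {z w : Cn n}

theorem mem_unitBall_iff : z ∈ unitBall n ↔ ‖z‖ < 1 := mem_ball_zero_iff

theorem one_sub_sq_pos (hz : z ∈ unitBall n) : 0 < 1 - ‖z‖ ^ 2 := by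
  rw [mem_unitBall_iff] at hz
  nlinarith [norm_nonneg z]

theorem one_sub_sq_le_one (z : Cn n) : 1 - ‖z‖ ^ 2 ≤ 1 := by
  nlinarith [sq_nonneg ‖z‖]

theorem mem_approachRegion_iff :
    z ∈ approachRegion κ ζ ↔ z ∈ unitBall n ∧ kd (ζ : Cn n) z < κ / 2 * (1 - ‖z‖ ^ 2) := Iff.rfl

theorem isOpen_approachRegion (κ : ℝ) (ζ : UnitSphere n) : IsOpen (approachRegion κ ζ) :=
  Metric.isOpen_ball.inter (isOpen_lt (f := fun z : Cn n => ‖1 - inner ℂ (ζ : Cn n) z‖)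
    (g := fun z : Cn n => κ / 2 * (1 - ‖z‖ ^ 2)) (by fun_prop) (by fun_prop))

theorem isOpen_shadow (κ : ℝ) (w : Cn n) : IsOpen (shadow κ w) := by
  by_cases hw : w ∈ unitBall n
  · have : shadow κ w = {ζ : UnitSphere n | kd (ζ : Cn n) w < κ / 2 * (1 - ‖w‖ ^ 2)} := by
      ext ζ; exact ⟨fun h => h.2, fun h => ⟨hw, h⟩⟩
    rw [this]
    exact isOpen_lt (by unfold kd; fun_prop) continuous_const
  · have : shadow κ w = ∅ := by
      ext ζ; exact ⟨fun h => (hw h.1).elim, fun h => h.elim⟩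
    rw [this]; exact isOpen_empty

theorem isOpen_outer (n : ℕ) (ρ : ℝ) : IsOpen (outer n ρ) :=
  Metric.isOpen_ball.inter (isOpen_lt continuous_const continuous_norm)

/-- Replacing a point of an approach region by its vertex does not increase the distance to a third
point by more than a constant factor. -/
theorem kd_add_le_of_mem_approachRegion (hκ : 0 < κ) (hz : z ∈ approachRegion κ ζ)
    (hw : ‖w‖ ≤ 1) : (1 - ‖z‖ ^ 2) + kd (ζ : Cn n) w ≤ (3 * κ + 5) * kd z w := by
  have hz1 : ‖z‖ ≤ 1 := (mem_unitBall_iff.1 hz.1).le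
  have h1 := kd_triangle (norm_sphere_le ζ) hw hz1
  have h2 := hz.2
  change kd (ζ : Cn n) z < _ at h2
  have h3 := one_sub_sq_le_two_kd hw hz1
  rw [kd_comm] at h3
  nlinarith

theorem shadow_subset_korBall {r : ℝ} (hr0 : 0 ≤ r) (hr1 : r < 1) :
    {η : UnitSphere n | r • (η : Cn n) ∈ approachRegion κ ζ} ⊆ korBall ζ (κ * (1 - r ^ 2)) := by
  intro η hη
  have h1 := hη.2
  have e : r • (η : Cn n) = (r : ℂ) • (η : Cn n) := (Complex.coe_smul r _).symm
  rw [norm_smul, norm_sphere, Real.norm_of_nonneg hr0, mul_one, e] at h1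
  have h2 := kd_le_two_kd_smul (norm_sphere_le ζ) (norm_sphere_le η) hr0 hr1.le
  change kd _ _ < _ at h1
  simp only [korBall, Set.mem_ofPred_eq]
  linarith

theorem exists_eq_smul_sphere [NeZero n] (w : Cn n) :
    ∃ η : UnitSphere n, w = ((‖w‖ : ℝ) : ℂ) • (η : Cn n) := by
  by_cases hw : w = 0
  · obtain ⟨v, hv⟩ := (NormedSpace.sphere_nonempty (x := (0 : Cn n)) (r := 1)).2 zero_le_one
    exact ⟨⟨v, hv⟩, by simp [hw]⟩
  · have h0 : ‖w‖ ≠ 0 := norm_ne_zero_iff.2 hw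
    refine ⟨⟨((‖w‖⁻¹ : ℝ) : ℂ) • w, ?_⟩, ?_⟩
    · rw [mem_sphere_zero_iff_norm, norm_smul, Complex.norm_real, norm_inv, norm_norm,
        inv_mul_cancel₀ h0]
    · rw [smul_smul, ← Complex.ofReal_mul, mul_inv_cancel₀ h0]; simp

theorem korBall_subset_shadow {ε : ℝ} (hw : w ∈ unitBall n)
    (hwη : w = ((‖w‖ : ℝ) : ℂ) • (η : Cn n)) (h : 1 + ε ≤ κ / 2 * (1 + ‖w‖)) :
    korBall η (ε * (1 - ‖w‖)) ⊆ shadow κ w := by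
  intro ζ hζ
  refine ⟨hw, ?_⟩
  have hw1 := mem_unitBall_iff.1 hw
  have h1 := kd_smul_le (norm_sphere_le ζ) (norm_sphere_le η) (norm_nonneg w) hw1.le
  rw [← hwη, kd_comm (ζ : Cn n) η] at h1
  change kd (ζ : Cn n) w < _
  simp only [korBall, Set.mem_ofPred_eq] at hζ
  nlinarith

/-- The shadow of `w` has measure at least a multiple of `(1 - |w|²) ^ n`, provided that `w` is
not close to the part of the ball which the approach regions do not reach. -/
theorem exists_le_sphereMeasure_shadow (n : ℕ) [NeZero n] {ε : ℝ} (hε : 0 < ε) (hε1 : ε ≤ 1) :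
    ∃ c : ℝ, 0 < c ∧ ∀ (κ : ℝ) (w : Cn n), w ∈ unitBall n → 1 + ε ≤ κ / 2 * (1 + ‖w‖) →
      ENNReal.ofReal (c * (1 - ‖w‖ ^ 2) ^ n) ≤ sphereMeasure n (shadow κ w) := by
  obtain ⟨c, hc, h⟩ := le_sphereMeasure_korBall n
  refine ⟨c * (ε / 2) ^ n, by positivity, fun κ w hw hκ => ?_⟩
  obtain ⟨η, hη⟩ := exists_eq_smul_sphere w
  have hw1 := mem_unitBall_iff.1 hw
  refine le_trans ?_ ((h η (ε * (1 - ‖w‖)) (mul_pos hε (by linarith)) ?_).trans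
    (measure_mono (korBall_subset_shadow hw hη hκ)))
  · apply ENNReal.ofReal_le_ofReal
    rw [mul_assoc, ← mul_pow]
    have h1 : 0 ≤ 1 - ‖w‖ ^ 2 := (one_sub_sq_pos hw).le
    refine mul_le_mul_of_nonneg_left (pow_le_pow_left₀ (by positivity) ?_ n) hc.le
    nlinarith [norm_nonneg w, mul_nonneg hε.le (sq_nonneg (1 - ‖w‖))]
  · nlinarith [norm_nonneg w]

theorem measurableSet_shadow_prod (n : ℕ) (κ : ℝ) :
    MeasurableSet {x : Cn n × UnitSphere n | x.2 ∈ shadow κ x.1} :=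
  measurable_swap (measurableSet_approach n κ)

/-- Interchanging integration over a part of the ball and over shadows. -/
theorem lintegral_shadow_swap [NeZero n] {s : Set (Cn n)}
    {F : Cn n → UnitSphere n → ℝ≥0∞} (hF : Measurable (Function.uncurry F)) :
    ∫⁻ w in s, ∫⁻ ζ in shadow κ w, F w ζ ∂(sphereMeasure n) ∂(ballVolume n) =
      ∫⁻ ζ, ∫⁻ w in s ∩ approachRegion κ ζ, F w ζ ∂(ballVolume n) ∂(sphereMeasure n) := by
  have h1 : ∀ w, ∫⁻ ζ in shadow κ w, F w ζ ∂(sphereMeasure n) =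
      ∫⁻ ζ, (shadow κ w).indicator (F w) ζ ∂(sphereMeasure n) := fun w =>
    (lintegral_indicator (isOpen_shadow κ w).measurableSet _).symm
  have hm : Measurable (Function.uncurry fun (w : Cn n) (ζ : UnitSphere n) =>
      (shadow κ w).indicator (F w) ζ) :=
    hF.indicator (measurableSet_shadow_prod n κ)
  simp_rw [h1]
  rw [lintegral_lintegral_swap hm.aemeasurable]
  refine lintegral_congr fun ζ => ?_
  rw [Set.inter_comm, ← Measure.restrict_restrict (isOpen_approachRegion κ ζ).measurableSet,
    ← lintegral_indicator (isOpen_approachRegion κ ζ).measurableSet]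
  rfl

end regions

/-! ### Estimates of the kernels -/

theorem rpow_neg_le_of_le_mul {x y K c : ℝ} (hx : 0 < x) (hK : 0 < K) (hc : 0 ≤ c)
    (h : x ≤ K * y) : y ^ (-c) ≤ K ^ c * x ^ (-c) := by
  have hy : 0 < y := by
    by_contra h'
    nlinarith [not_lt.1 h']
  rw [Real.rpow_neg hy.le, Real.rpow_neg hx.le, ← div_eq_mul_inv, le_div_iff₀ (by positivity),
    inv_mul_le_iff₀ (by positivity), ← Real.mul_rpow hy.le hK.le]
  exact Real.rpow_le_rpow hx.le (by linarith) hc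

/-- A Poisson type integral of `ψ` is bounded by the maximal function, non-tangentially. -/
theorem exists_lintegral_kd_le_maxFn (n : ℕ) [NeZero n] {κ c : ℝ} (hκ : 0 < κ) (hc : n < c) :
    ∃ C : ℝ≥0, ∀ ψ : UnitSphere n → ℝ≥0∞, Measurable ψ → ∀ (η : UnitSphere n),
      ∀ z ∈ approachRegion κ η,
        ∫⁻ ζ, ψ ζ * ENNReal.ofReal (kd z ζ ^ (-c)) ∂(sphereMeasure n) ≤
          C * ENNReal.ofReal ((1 - ‖z‖ ^ 2) ^ (n - c)) * maxFn ψ η := by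
  obtain ⟨D, hD⟩ := exists_tsum_dyadic_le (r := c - n) (by linarith)
  set K : ℝ := 3 * κ + 5 with hK
  have hK0 : 0 < K := by positivity
  have hc0 : 0 < c := lt_of_le_of_lt (Nat.cast_nonneg n) hc
  refine ⟨((2 * K) ^ c).toNNReal * D, fun ψ hψ η z hz => ?_⟩
  have hz1 := mem_unitBall_iff.1 hz.1
  set δ := 1 - ‖z‖ ^ 2 with hδ
  have hδ0 : 0 < δ := one_sub_sq_pos hz.1
  set f : ℤ → UnitSphere n → ℝ≥0∞ := fun j ζ => if δ < 2 ^ j then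
    ENNReal.ofReal (((2 : ℝ) ^ j) ^ (-c)) * (korBall η ((2 : ℝ) ^ j)).indicator ψ ζ else 0 with hf
  have hpt : ∀ ζ, ψ ζ * ENNReal.ofReal (kd z ζ ^ (-c)) ≤
      ENNReal.ofReal ((2 * K) ^ c) * ∑' j : ℤ, f j ζ := by
    intro ζ
    have h1 := kd_add_le_of_mem_approachRegion hκ hz (norm_sphere_le ζ)
    have h2 := kd_nonneg (η : Cn n) ζ
    have hpos : 0 < K * kd z ζ := by linarith
    obtain ⟨j, hj1, hj2⟩ := exists_mem_Ico_zpow hpos one_lt_two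
    have hmem : ζ ∈ korBall η ((2 : ℝ) ^ (j + 1)) := by
      simp only [korBall, Set.mem_ofPred_eq]; linarith
    have hd : δ < (2 : ℝ) ^ (j + 1) := by linarith
    have h3 : f (j + 1) ζ = ENNReal.ofReal (((2 : ℝ) ^ (j + 1)) ^ (-c)) * ψ ζ := by
      simp only [hf]
      rw [if_pos hd, Set.indicator_of_mem hmem]
    have h4 : kd z ζ ^ (-c) ≤ (2 * K) ^ c * ((2 : ℝ) ^ (j + 1)) ^ (-c) := by
      apply rpow_neg_le_of_le_mul (by positivity) (by positivity) hc0.le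
      rw [zpow_add_one₀ (by norm_num)]; linarith
    calc ψ ζ * ENNReal.ofReal (kd z ζ ^ (-c))
        ≤ ψ ζ * ENNReal.ofReal ((2 * K) ^ c * ((2 : ℝ) ^ (j + 1)) ^ (-c)) := by gcongr
      _ = ENNReal.ofReal ((2 * K) ^ c) * f (j + 1) ζ := by
          rw [h3, ENNReal.ofReal_mul (by positivity)]; ring
      _ ≤ _ := by gcongr; exact ENNReal.le_tsum _
  have hfm : ∀ j, Measurable (f j) := by
    intro j
    simp only [hf]
    by_cases h : δ < 2 ^ j
    · simp only [h, if_true]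
      exact (hψ.indicator (measurableSet_korBall _ _)).const_mul _
    · simp only [h, if_false]; exact measurable_const
  have hterm : ∀ j, ∫⁻ ζ, f j ζ ∂(sphereMeasure n) ≤ maxFn ψ η *
      (if (2 : ℝ≥0∞) ^ (-j) < ENNReal.ofReal δ⁻¹ then ((2 : ℝ≥0∞) ^ (-j)) ^ (c - n) else 0) := by
    intro j
    by_cases h : δ < 2 ^ j
    · have h5 : (2 : ℝ≥0∞) ^ (-j) < ENNReal.ofReal δ⁻¹ := by
        rw [two_zpow_eq_ofReal, ENNReal.ofReal_lt_ofReal_iff (by positivity), zpow_neg]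
        exact inv_strictAnti₀ hδ0 h
      have h6 : ((2 : ℝ≥0∞) ^ (-j)) ^ (c - n) = ENNReal.ofReal (((2 : ℝ) ^ j) ^ (-c)) *
          ENNReal.ofReal (((2 : ℝ) ^ j) ^ n) := by
        rw [two_zpow_eq_ofReal, ENNReal.ofReal_rpow_of_pos (by positivity),
          ← ENNReal.ofReal_mul (by positivity), ← Real.rpow_natCast,
          ← Real.rpow_add (by positivity), zpow_neg, ← Real.rpow_neg_one,
          ← Real.rpow_mul (by positivity)]
        congr 2; ring
      simp only [hf, h, if_true]
      rw [if_pos h5, h6, lintegral_const_mul _ (hψ.indicator (measurableSet_korBall _ _)),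
        lintegral_indicator (measurableSet_korBall _ _)]
      calc _ ≤ ENNReal.ofReal (((2 : ℝ) ^ j) ^ (-c)) *
              (ENNReal.ofReal (((2 : ℝ) ^ j) ^ n) * maxFn ψ η) := by
            gcongr; exact setLIntegral_korBall_le_maxFn _ _ _
        _ = _ := by ring
    · simp [hf, h]
  calc ∫⁻ ζ, ψ ζ * ENNReal.ofReal (kd z ζ ^ (-c)) ∂(sphereMeasure n)
      ≤ ∫⁻ ζ, ENNReal.ofReal ((2 * K) ^ c) * ∑' j : ℤ, f j ζ ∂(sphereMeasure n) :=
        lintegral_mono hpt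
    _ = ENNReal.ofReal ((2 * K) ^ c) * ∑' j : ℤ, ∫⁻ ζ, f j ζ ∂(sphereMeasure n) := by
        rw [lintegral_const_mul' _ _ ENNReal.ofReal_ne_top,
          lintegral_tsum fun j => (hfm j).aemeasurable]
    _ ≤ ENNReal.ofReal ((2 * K) ^ c) * ∑' j : ℤ, maxFn ψ η * (if (2 : ℝ≥0∞) ^ (-j) <
          ENNReal.ofReal δ⁻¹ then ((2 : ℝ≥0∞) ^ (-j)) ^ (c - n) else 0) := by
        gcongr with j; exact hterm j
    _ = ENNReal.ofReal ((2 * K) ^ c) * (maxFn ψ η * ∑' j : ℤ, (if (2 : ℝ≥0∞) ^ j <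
          ENNReal.ofReal δ⁻¹ then ((2 : ℝ≥0∞) ^ j) ^ (c - n) else 0)) := by
        rw [ENNReal.tsum_mul_left]
        congr 2
        exact (Equiv.neg ℤ).tsum_eq (fun j : ℤ => (if (2 : ℝ≥0∞) ^ j <
          ENNReal.ofReal δ⁻¹ then ((2 : ℝ≥0∞) ^ j) ^ (c - n) else 0))
    _ ≤ ENNReal.ofReal ((2 * K) ^ c) * (maxFn ψ η * (D * ENNReal.ofReal δ⁻¹ ^ (c - n))) := by
        gcongr; exact hD _
    _ = _ := by
        have h7 : ENNReal.ofReal δ⁻¹ ^ (c - n) = ENNReal.ofReal (δ ^ (n - c)) := by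
          rw [ENNReal.ofReal_rpow_of_pos (by positivity), ← Real.rpow_neg_one,
            ← Real.rpow_mul hδ0.le]
          congr 2; ring
        rw [h7, ENNReal.coe_mul, ENNReal.ofReal]; ring

/-- The one-variable integral behind the estimate over an approach region. -/
theorem exists_lintegral_rpow_add_le {a c : ℝ} (ha : -1 < a) (hc : a + 1 < c) :
    ∃ C : ℝ≥0, ∀ D : ℝ, 0 < D →
      ∫⁻ x in Set.Ioi (0 : ℝ), ENNReal.ofReal (x ^ a * (D + x) ^ (-c)) ≤
        C * ENNReal.ofReal (D ^ (a + 1 - c)) := by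
  have hc0 : 0 < c := by linarith
  refine ⟨(1 / (a + 1) + 1 / (c - a - 1)).toNNReal, fun D hD => ?_⟩
  have h1 : ∫⁻ x in Set.Ioc (0 : ℝ) D, ENNReal.ofReal (x ^ a * (D + x) ^ (-c)) ≤
      ENNReal.ofReal (1 / (a + 1) * D ^ (a + 1 - c)) := by
    calc _ ≤ ∫⁻ x in Set.Ioc (0 : ℝ) D, ENNReal.ofReal (x ^ a * D ^ (-c)) := by
          refine setLIntegral_mono' measurableSet_Ioc fun x hx => ?_
          apply ENNReal.ofReal_le_ofReal
          have := hx.1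
          exact mul_le_mul_of_nonneg_left (Real.rpow_le_rpow_of_nonpos hD (by linarith)
            (by linarith)) (by positivity)
      _ = ENNReal.ofReal (∫ x in Set.Ioc (0 : ℝ) D, x ^ a * D ^ (-c)) := by
          rw [ofReal_integral_eq_lintegral_ofReal]
          · refine Integrable.mul_const ?_ _
            exact (intervalIntegral.intervalIntegrable_rpow' ha (a := 0) (b := D)).1
          · filter_upwards [ae_restrict_mem measurableSet_Ioc] with x hx
            have := hx.1
            positivity
      _ = _ := by
          rw [integral_mul_const, ← intervalIntegral.integral_of_le hD.le,
            integral_rpow (Or.inl ha), Real.zero_rpow (by linarith), sub_zero]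
          congr 1
          rw [sub_eq_add_neg (a + 1) c, Real.rpow_add hD (a + 1)]; ring
  have h2 : ∫⁻ x in Set.Ioi D, ENNReal.ofReal (x ^ a * (D + x) ^ (-c)) ≤
      ENNReal.ofReal (1 / (c - a - 1) * D ^ (a + 1 - c)) := by
    calc _ ≤ ∫⁻ x in Set.Ioi D, ENNReal.ofReal (x ^ (a - c)) := by
          refine setLIntegral_mono' measurableSet_Ioi fun x hx => ?_
          apply ENNReal.ofReal_le_ofReal
          have hx0 : 0 < x := hD.trans hx
          rw [sub_eq_add_neg a c, Real.rpow_add hx0]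
          exact mul_le_mul_of_nonneg_left (Real.rpow_le_rpow_of_nonpos hx0 (by linarith)
            (by linarith)) (by positivity)
      _ = ENNReal.ofReal (∫ x in Set.Ioi D, x ^ (a - c)) := by
          rw [ofReal_integral_eq_lintegral_ofReal]
          · exact integrableOn_Ioi_rpow_of_lt (by linarith) hD
          · filter_upwards [ae_restrict_mem measurableSet_Ioi] with x hx
            have : 0 < x := hD.trans hx
            positivity
      _ = _ := by
          rw [integral_Ioi_rpow_of_lt (by linarith) hD]
          congr 1
          have e1 : a - c + 1 = a + 1 - c := by ring
          have e2 : a + 1 - c = -(c - a - 1) := by ring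
          rw [e1, neg_div, one_div_mul_eq_div]
          nth_rewrite 2 [e2]
          rw [div_neg, neg_neg]
  have ha1 : 0 ≤ 1 / (a + 1) := by
    have : 0 < a + 1 := by linarith
    positivity
  have hc1 : 0 ≤ 1 / (c - a - 1) := by
    have : 0 < c - a - 1 := by linarith
    positivity
  rw [← Set.Ioc_union_Ioi_eq_Ioi hD.le]
  refine (lintegral_union_le _ _ _).trans ((add_le_add h1 h2).trans_eq ?_)
  rw [← ENNReal.ofReal_add (by positivity) (by positivity), ← add_mul,
    ENNReal.ofReal_mul (by positivity)]
  rfl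

/-- The integral of a power of the distance over an approach region. -/
theorem exists_lintegral_approach_le (n : ℕ) [NeZero n] {κ e c : ℝ} (hκ : 0 < κ)
    (he : -(n : ℝ) - 1 < e) (hc : n + 1 + e < c) :
    ∃ C : ℝ≥0, ∀ (ζ : UnitSphere n), ∀ z ∈ unitBall n,
      ∫⁻ w in approachRegion κ ζ, ENNReal.ofReal ((1 - ‖w‖ ^ 2) ^ e * kd z w ^ (-c))
        ∂(ballVolume n) ≤ C * ENNReal.ofReal (kd z ζ ^ (n + 1 + e - c)) := by
  obtain ⟨A, hA0, hA⟩ := sphereMeasure_korBall_le n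
  obtain ⟨B, hB⟩ := exists_lintegral_rpow_add_le (a := e + n) (c := c) (by linarith) (by linarith)
  have hc0 : 0 < c := by linarith
  set K : ℝ := 3 * κ + 5 with hK
  have hK0 : 0 < K := by positivity
  set M : ℝ := 2 * n * (K ^ c * (A * κ ^ n)) * 2 ^ |e + n| with hM
  have hM0 : 0 ≤ M := by positivity
  refine ⟨M.toNNReal * B, fun ζ z hz => ?_⟩
  have hz1 := mem_unitBall_iff.1 hz
  have hD : 0 < kd z ζ := by
    rw [kd_comm]; exact kd_pos (norm_sphere_le ζ) hz1
  set D := kd z ζ with hDdef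
  have hms := (isOpen_approachRegion κ ζ).measurableSet
  set φ : ℝ → ℝ := fun r => K ^ c * ((1 - r ^ 2) ^ e * (D + (1 - r ^ 2)) ^ (-c)) with hφ
  have hφm : Measurable φ := by fun_prop
  -- the integrand is bounded by a radial function
  have h1 : ∫⁻ w in approachRegion κ ζ, ENNReal.ofReal ((1 - ‖w‖ ^ 2) ^ e * kd z w ^ (-c))
      ∂(ballVolume n) ≤ ∫⁻ w, (approachRegion κ ζ).indicator (fun w => ENNReal.ofReal (φ ‖w‖)) w
        ∂(ballVolume n) := by
    rw [lintegral_indicator hms]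
    refine setLIntegral_mono' hms fun w hw => ENNReal.ofReal_le_ofReal ?_
    have h2 := kd_add_le_of_mem_approachRegion hκ hw hz1.le
    have h3 := one_sub_sq_pos hw.1
    rw [kd_comm (ζ : Cn n), kd_comm w z] at h2
    have h4 := rpow_neg_le_of_le_mul (x := D + (1 - ‖w‖ ^ 2)) (by linarith) hK0 hc0.le
      (show _ ≤ K * kd z w by linarith)
    calc (1 - ‖w‖ ^ 2) ^ e * kd z w ^ (-c)
        ≤ (1 - ‖w‖ ^ 2) ^ e * (K ^ c * (D + (1 - ‖w‖ ^ 2)) ^ (-c)) := by gcongr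
      _ = φ ‖w‖ := by simp only [hφ]; ring
  have h2 : ∀ r ∈ Set.Ioo (0 : ℝ) 1, ENNReal.ofReal (2 * n * r ^ (2 * n - 1)) *
      ∫⁻ η : UnitSphere n, (approachRegion κ ζ).indicator (fun w => ENNReal.ofReal (φ ‖w‖))
        (r • (η : Cn n)) ∂(sphereMeasure n) ≤
      ENNReal.ofReal (M * ((1 - r) ^ (e + n) * (D + (1 - r)) ^ (-c))) := by
    intro r hr
    have hr0 := hr.1
    have hr1 := hr.2
    have hx : 0 < 1 - r := by linarith
    have hx2 : 0 < 1 - r ^ 2 := by nlinarith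
    have h3 : ∫⁻ η : UnitSphere n, (approachRegion κ ζ).indicator (fun w => ENNReal.ofReal (φ ‖w‖))
        (r • (η : Cn n)) ∂(sphereMeasure n) ≤
        ENNReal.ofReal (φ r) * ENNReal.ofReal (A * (κ * (1 - r ^ 2)) ^ n) := by
      calc _ ≤ ∫⁻ η : UnitSphere n, (korBall ζ (κ * (1 - r ^ 2))).indicator
              (fun _ => ENNReal.ofReal (φ r)) η ∂(sphereMeasure n) := by
            refine lintegral_mono fun η => ?_
            by_cases h : r • (η : Cn n) ∈ approachRegion κ ζ
            · rw [Set.indicator_of_mem h, Set.indicator_of_mem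
                (shadow_subset_korBall hr0.le hr1 h), norm_smul, norm_sphere,
                Real.norm_of_nonneg hr0.le, mul_one]
            · rw [Set.indicator_of_notMem h]; exact zero_le
        _ = ENNReal.ofReal (φ r) * sphereMeasure n (korBall ζ (κ * (1 - r ^ 2))) :=
            lintegral_indicator_const (measurableSet_korBall _ _) _
        _ ≤ _ := by gcongr; exact hA _ _ (by positivity)
    calc _ ≤ ENNReal.ofReal (2 * n * r ^ (2 * n - 1)) *
          (ENNReal.ofReal (φ r) * ENNReal.ofReal (A * (κ * (1 - r ^ 2)) ^ n)) := by gcongr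
      _ = ENNReal.ofReal (2 * n * r ^ (2 * n - 1) * (φ r * (A * (κ * (1 - r ^ 2)) ^ n))) := by
          rw [ENNReal.ofReal_mul (p := 2 * n * r ^ (2 * n - 1)) (by positivity),
            ENNReal.ofReal_mul (p := φ r) (by simp only [hφ]; positivity)]
      _ ≤ _ := by
          apply ENNReal.ofReal_le_ofReal
          have e1 : φ r * (A * (κ * (1 - r ^ 2)) ^ n) =
              K ^ c * (A * κ ^ n) * ((1 - r ^ 2) ^ (e + n) * (D + (1 - r ^ 2)) ^ (-c)) := by
            simp only [hφ]
            rw [mul_pow, Real.rpow_add hx2, Real.rpow_natCast]; ring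
          have e2 : (1 - r ^ 2) ^ (e + n) ≤ 2 ^ |e + n| * (1 - r) ^ (e + n) := by
            have e3 : 1 - r ^ 2 = (1 + r) * (1 - r) := by ring
            rw [e3, Real.mul_rpow (by linarith) hx.le]
            gcongr
            calc (1 + r) ^ (e + n) ≤ (1 + r) ^ |e + n| :=
                  Real.rpow_le_rpow_of_exponent_le (by linarith) (le_abs_self _)
              _ ≤ 2 ^ |e + n| := Real.rpow_le_rpow (by linarith) (by linarith) (abs_nonneg _)
          have e4 : (D + (1 - r ^ 2)) ^ (-c) ≤ (D + (1 - r)) ^ (-c) :=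
            Real.rpow_le_rpow_of_nonpos (by linarith) (by nlinarith) (by linarith)
          rw [e1]
          calc 2 * n * r ^ (2 * n - 1) * (K ^ c * (A * κ ^ n) *
                ((1 - r ^ 2) ^ (e + n) * (D + (1 - r ^ 2)) ^ (-c)))
              ≤ 2 * n * 1 * (K ^ c * (A * κ ^ n) *
                ((2 ^ |e + n| * (1 - r) ^ (e + n)) * (D + (1 - r)) ^ (-c))) := by
                gcongr
                exact pow_le_one₀ hr0.le hr1.le
            _ = _ := by rw [hM]; ring
  have hind : Measurable ((approachRegion κ ζ).indicator (fun w => ENNReal.ofReal (φ ‖w‖))) :=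
    (by fun_prop : Measurable fun w : Cn n => ENNReal.ofReal (φ ‖w‖)).indicator hms
  set G : ℝ → ℝ≥0∞ := (Set.Ioo (0 : ℝ) 1).indicator
    (fun x => ENNReal.ofReal (M * (x ^ (e + n) * (D + x) ^ (-c)))) with hG
  calc _ ≤ ∫⁻ r in Set.Ioo (0 : ℝ) 1, ENNReal.ofReal (M * ((1 - r) ^ (e + n) *
          (D + (1 - r)) ^ (-c))) := by
        refine h1.trans ?_
        rw [lintegral_ball_polar hind]
        exact setLIntegral_mono' measurableSet_Ioo h2
    _ = ∫⁻ r, G (1 - r) := by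
        rw [← lintegral_indicator measurableSet_Ioo]
        refine lintegral_congr fun r => ?_
        have e5 : (1 - r) ∈ Set.Ioo (0 : ℝ) 1 ↔ r ∈ Set.Ioo (0 : ℝ) 1 := by
          simp only [Set.mem_Ioo]; constructor <;> rintro ⟨_, _⟩ <;> constructor <;> linarith
        simp only [hG]
        by_cases h : r ∈ Set.Ioo (0 : ℝ) 1
        · rw [Set.indicator_of_mem h, Set.indicator_of_mem (e5.2 h)]
        · rw [Set.indicator_of_notMem h, Set.indicator_of_notMem (fun h' => h (e5.1 h'))]
    _ = ∫⁻ x, G x := lintegral_sub_left_eq_self G 1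
    _ ≤ ∫⁻ x in Set.Ioi (0 : ℝ), ENNReal.ofReal (M * (x ^ (e + n) * (D + x) ^ (-c))) := by
        simp only [hG]
        rw [lintegral_indicator measurableSet_Ioo]
        exact lintegral_mono_set Set.Ioo_subset_Ioi_self
    _ = ENNReal.ofReal M * ∫⁻ x in Set.Ioi (0 : ℝ), ENNReal.ofReal (x ^ (e + n) *
          (D + x) ^ (-c)) := by
        rw [← lintegral_const_mul' _ _ ENNReal.ofReal_ne_top]
        refine lintegral_congr fun x => ?_
        rw [ENNReal.ofReal_mul hM0]
    _ ≤ ENNReal.ofReal M * (B * ENNReal.ofReal (D ^ (e + n + 1 - c))) := by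
        gcongr; exact hB D hD
    _ = _ := by
        rw [ENNReal.coe_mul, ← mul_assoc, show e + n + 1 - c = n + 1 + e - c by ring]
        rfl

/-! ### Positive operators -/

/-- The area integral over an approach region with weight `(1 - |w|²) ^ α`. -/
def area {n : ℕ} (κ α : ℝ) (u : Cn n → ℝ≥0∞) (ζ : UnitSphere n) : ℝ≥0∞ :=
  ∫⁻ w in approachRegion κ ζ, u w * ENNReal.ofReal ((1 - ‖w‖ ^ 2) ^ α) ∂(ballVolume n)

/-- The integral over a shell of `u` against the kernel `(1 - |w|²) ^ b |1 - ⟨z, w⟩| ^ (-c)`. -/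
def kerInt {n : ℕ} (ρ b c : ℝ) (u : Cn n → ℝ≥0∞) (z : Cn n) : ℝ≥0∞ :=
  ∫⁻ w in outer n ρ, u w * ENNReal.ofReal ((1 - ‖w‖ ^ 2) ^ b * kd z w ^ (-c)) ∂(ballVolume n)

theorem measurable_weight {n : ℕ} (a : ℝ) :
    Measurable fun w : Cn n => ENNReal.ofReal ((1 - ‖w‖ ^ 2) ^ a) := by fun_prop

theorem measurable_kernel {X : Type*} [MeasurableSpace X] {n : ℕ} {f g : X → Cn n} (b c : ℝ)
    (hf : Measurable f) (hg : Measurable g) :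
    Measurable fun x => ENNReal.ofReal ((1 - ‖g x‖ ^ 2) ^ b * kd (f x) (g x) ^ (-c)) := by
  have := measurable_kd hf hg
  fun_prop

theorem measurable_kernel_right {n : ℕ} (b c : ℝ) (z : Cn n) :
    Measurable fun w : Cn n => ENNReal.ofReal ((1 - ‖w‖ ^ 2) ^ b * kd z w ^ (-c)) :=
  measurable_kernel b c measurable_const measurable_id

theorem measurable_mul_kernel {n : ℕ} (b c : ℝ) (z : Cn n) {u : Cn n → ℝ≥0∞} (hu : Measurable u) :
    Measurable fun w : Cn n => u w * ENNReal.ofReal ((1 - ‖w‖ ^ 2) ^ b * kd z w ^ (-c)) :=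
  hu.mul (measurable_kernel_right b c z)

theorem measurable_mul_weight {n : ℕ} (a : ℝ) {u : Cn n → ℝ≥0∞} (hu : Measurable u) :
    Measurable fun w : Cn n => u w * ENNReal.ofReal ((1 - ‖w‖ ^ 2) ^ a) :=
  hu.mul (measurable_weight a)

theorem measurable_area' {n : ℕ} (κ α : ℝ) {u : Cn n → ℝ≥0∞} (hu : Measurable u) :
    Measurable (area κ α u) :=
  measurable_setLIntegral_of_prod (measurableSet_approach n κ)
    (ψ := fun _ w => u w * ENNReal.ofReal ((1 - ‖w‖ ^ 2) ^ α)) (by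
      exact (hu.comp measurable_snd).mul ((measurable_weight α).comp measurable_snd))

theorem measurable_kerInt {n : ℕ} (ρ b c : ℝ) {u : Cn n → ℝ≥0∞} (hu : Measurable u) :
    Measurable (kerInt ρ b c u) := by
  have : Measurable (Function.uncurry fun z w : Cn n => u w *
      ENNReal.ofReal ((1 - ‖w‖ ^ 2) ^ b * kd z w ^ (-c))) :=
    (hu.comp measurable_snd).mul (measurable_kernel b c measurable_fst measurable_snd)
  exact this.lintegral_prod_right'

/-- An operator which is bounded in the weak sense by the maximal function is bounded on `L^r`. -/
theorem exists_lintegral_rpow_le_of_duality (n : ℕ) [NeZero n] {r : ℝ} (hr : 1 < r) (C₀ : ℝ≥0) :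
    ∃ C : ℝ≥0, ∀ A A' : UnitSphere n → ℝ≥0∞, Measurable A → Measurable A' →
      (∀ ψ : UnitSphere n → ℝ≥0∞, Measurable ψ → ∫⁻ ζ, ψ ζ * A ζ ∂(sphereMeasure n) ≤
        C₀ * ∫⁻ ζ, maxFn ψ ζ * A' ζ ∂(sphereMeasure n)) →
      ∫⁻ ζ, A ζ ^ r ∂(sphereMeasure n) ≤ C * ∫⁻ ζ, A' ζ ^ r ∂(sphereMeasure n) := by
  have hr0 : 0 < r := by linarith
  have hconj : (r / (r - 1)).HolderConjugate r := by
    rw [Real.holderConjugate_iff]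
    constructor
    · rw [lt_div_iff₀ (by linarith)]; linarith
    · field_simp; ring
  set r' := r / (r - 1) with hr'
  have hr'0 : 0 < r' := hconj.pos
  obtain ⟨C₁, hC₁⟩ := lintegral_maxFn_rpow_le n (r := r') hconj.lt
  refine ⟨(C₀ * C₁ ^ (1 / r')) ^ r, fun A A' hA hA' h => ?_⟩
  set Y := ∫⁻ ζ, A' ζ ^ r ∂(sphereMeasure n) with hY
  -- the hypothesis is applied to `ψ = min A N ^ (r - 1)`; truncation makes the integral finite, so
  -- that a power of it can be cancelled
  have key : ∀ N : ℕ, ∫⁻ ζ, (min (A ζ) N) ^ r ∂(sphereMeasure n) ≤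
      ((C₀ * C₁ ^ (1 / r')) ^ r : ℝ≥0) * Y := by
    intro N
    set X := ∫⁻ ζ, (min (A ζ) N) ^ r ∂(sphereMeasure n) with hX
    have hm : Measurable fun ζ => min (A ζ) (N : ℝ≥0∞) := hA.min measurable_const
    have hXtop : X ≠ ⊤ := by
      have : X ≤ ∫⁻ _, (N : ℝ≥0∞) ^ r ∂(sphereMeasure n) :=
        lintegral_mono fun ζ => ENNReal.rpow_le_rpow (min_le_right _ _) hr0.le
      rw [lintegral_const, measure_univ, mul_one] at this
      exact (this.trans_lt (ENNReal.rpow_lt_top_of_nonneg hr0.le (by simp))).ne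
    have h1 : X ≤ ∫⁻ ζ, (min (A ζ) N) ^ (r - 1) * A ζ ∂(sphereMeasure n) := by
      refine lintegral_mono fun ζ => ?_
      calc (min (A ζ) (N : ℝ≥0∞)) ^ r = (min (A ζ) N) ^ (r - 1) * (min (A ζ) N) ^ (1 : ℝ) := by
            rw [← ENNReal.rpow_add_of_nonneg _ _ (by linarith) zero_le_one]; congr 1; ring
        _ ≤ _ := by
            rw [ENNReal.rpow_one]; gcongr; exact min_le_left _ _
    have h2 := h (fun ζ => (min (A ζ) N) ^ (r - 1)) (hm.pow_const _)
    have h3 := ENNReal.lintegral_mul_le_Lp_mul_Lq (sphereMeasure n) hconj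
      (measurable_maxFn (hm.pow_const (r - 1))).aemeasurable hA'.aemeasurable
    have h4 := hC₁ (fun ζ => (min (A ζ) N) ^ (r - 1)) (hm.pow_const _)
    have h5 : ∫⁻ ζ, ((min (A ζ) (N : ℝ≥0∞)) ^ (r - 1)) ^ r' ∂(sphereMeasure n) = X := by
      refine lintegral_congr fun ζ => ?_
      rw [← ENNReal.rpow_mul]
      congr 1
      rw [hr']; have : r - 1 ≠ 0 := by linarith
      field_simp
    rw [h5] at h4
    have h6 : X ≤ C₀ * ((C₁ * X) ^ (1 / r') * Y ^ (1 / r)) := by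
      refine h1.trans (h2.trans ?_)
      refine mul_le_mul_right (h3.trans ?_) _
      exact mul_le_mul_left (ENNReal.rpow_le_rpow h4 (by positivity)) _
    rcases eq_or_ne X 0 with hX0 | hX0
    · rw [hX0]; exact zero_le
    have h7 : X ^ (1 / r) ≤ C₀ * C₁ ^ (1 / r') * Y ^ (1 / r) := by
      have hne0 : X ^ (1 / r') ≠ 0 := by
        rw [Ne, ENNReal.rpow_eq_zero_iff]; push Not
        exact ⟨fun h => absurd h hX0, fun h => absurd h hXtop⟩
      have hnet : X ^ (1 / r') ≠ ⊤ := ENNReal.rpow_ne_top_of_nonneg (by positivity) hXtop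
      rw [← ENNReal.mul_le_mul_iff_right hne0 hnet]
      calc X ^ (1 / r') * X ^ (1 / r) = X := by
            rw [← ENNReal.rpow_add _ _ hX0 hXtop]
            have : 1 / r' + 1 / r = 1 := by
              rw [one_div, one_div]; exact hconj.inv_add_inv_eq_one
            rw [this, ENNReal.rpow_one]
        _ ≤ _ := h6
        _ = _ := by
            rw [ENNReal.mul_rpow_of_nonneg _ _ (by positivity)]; ring
    calc X = (X ^ (1 / r)) ^ r := by
          rw [← ENNReal.rpow_mul, one_div_mul_cancel hr0.ne', ENNReal.rpow_one]
      _ ≤ (C₀ * C₁ ^ (1 / r') * Y ^ (1 / r)) ^ r := ENNReal.rpow_le_rpow h7 hr0.le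
      _ = _ := by
          rw [ENNReal.mul_rpow_of_nonneg _ _ hr0.le, ← ENNReal.rpow_mul,
            one_div_mul_cancel hr0.ne', ENNReal.rpow_one, ENNReal.coe_rpow_of_nonneg _ hr0.le,
            ENNReal.coe_mul, ENNReal.coe_rpow_of_nonneg _ (by positivity)]
  have hsup : ∀ ζ, A ζ ^ r = ⨆ N : ℕ, (min (A ζ) N) ^ r := by
    intro ζ
    refine le_antisymm ?_ (iSup_le fun N => ENNReal.rpow_le_rpow (min_le_left _ _) hr0.le)
    rcases eq_or_ne (A ζ) ⊤ with ht | ht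
    · rw [ht]
      simp only [le_top, inf_of_le_right]
      rw [ENNReal.top_rpow_of_pos hr0, top_le_iff, iSup_eq_top]
      intro b hb
      obtain ⟨N, hN⟩ := ENNReal.exists_nat_gt (r := b ^ (1 / r))
        (ENNReal.rpow_ne_top_of_nonneg (by positivity) hb.ne)
      refine ⟨N, ?_⟩
      calc b = (b ^ (1 / r)) ^ r := by
            rw [← ENNReal.rpow_mul, one_div_mul_cancel hr0.ne', ENNReal.rpow_one]
        _ < _ := ENNReal.rpow_lt_rpow hN hr0
    · obtain ⟨N, hN⟩ := ENNReal.exists_nat_gt ht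
      refine le_trans ?_ (le_iSup _ N)
      rw [min_eq_left hN.le]
  simp_rw [hsup]
  rw [lintegral_iSup]
  · exact iSup_le key
  · exact fun N => (hA.min measurable_const).pow_const _
  · intro N N' hNN' ζ
    exact ENNReal.rpow_le_rpow (min_le_min_left _ (by exact_mod_cast hNN')) hr0.le

theorem exists_le_lintegral_shadow (n : ℕ) [NeZero n] {ε : ℝ} (hε : 0 < ε) (hε1 : ε ≤ 1) :
    ∃ C : ℝ≥0, ∀ (κ : ℝ) (w : Cn n), w ∈ unitBall n → 1 + ε ≤ κ / 2 * (1 + ‖w‖) →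
      ∀ (x : ℝ≥0∞) (G : UnitSphere n → ℝ≥0∞), (∀ ζ ∈ shadow κ w, x ≤ G ζ) →
        x ≤ C * ENNReal.ofReal ((1 - ‖w‖ ^ 2) ^ (-(n : ℝ))) *
          ∫⁻ ζ in shadow κ w, G ζ ∂(sphereMeasure n) := by
  obtain ⟨c, hc, h⟩ := exists_le_sphereMeasure_shadow n hε hε1
  refine ⟨(c⁻¹).toNNReal, fun κ w hw hκ x G hG => ?_⟩
  have hδ := one_sub_sq_pos hw
  have h1 : x * sphereMeasure n (shadow κ w) ≤ ∫⁻ ζ in shadow κ w, G ζ ∂(sphereMeasure n) := by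
    rw [← setLIntegral_const]
    exact setLIntegral_mono' (isOpen_shadow κ w).measurableSet hG
  calc x = ENNReal.ofReal (c⁻¹) * ENNReal.ofReal ((1 - ‖w‖ ^ 2) ^ (-(n : ℝ))) *
        (x * ENNReal.ofReal (c * (1 - ‖w‖ ^ 2) ^ n)) := by
        have e : ENNReal.ofReal (c⁻¹) * ENNReal.ofReal ((1 - ‖w‖ ^ 2) ^ (-(n : ℝ))) *
          ENNReal.ofReal (c * (1 - ‖w‖ ^ 2) ^ n) = 1 := by
          rw [← ENNReal.ofReal_mul (by positivity), ← ENNReal.ofReal_mul (by positivity),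
            Real.rpow_neg hδ.le, Real.rpow_natCast, ← ENNReal.ofReal_one]
          congr 1
          field_simp
        rw [mul_comm x, ← mul_assoc, e, one_mul]
    _ ≤ _ := by
        rw [ENNReal.ofReal]
        gcongr
        exact (mul_le_mul_right (h κ w hw hκ) _).trans h1

/-- The operator with kernel `(1 - |w|²) ^ b |1 - ⟨ζ, w⟩| ^ (α - b)` over a shell on which shadows
are large is controlled by area integrals of any such aperture. -/
theorem exists_lintegral_kerInt_le_area (n : ℕ) [NeZero n] {ε : ℝ} (hε : 0 < ε) (hε1 : ε ≤ 1)
    {κ ρ α b r : ℝ} (hκ : 0 < κ) (hρ : ∀ w ∈ outer n ρ, 1 + ε ≤ κ / 2 * (1 + ‖w‖))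
    (hb : n < b - α) (hr : 1 < r) :
    ∃ C : ℝ≥0, ∀ u : Cn n → ℝ≥0∞, Measurable u →
      ∫⁻ ζ, kerInt ρ b (b - α) u (ζ : UnitSphere n) ^ r ∂(sphereMeasure n) ≤
        C * ∫⁻ ζ, area κ α u ζ ^ r ∂(sphereMeasure n) := by
  obtain ⟨C₁, hC₁⟩ := exists_lintegral_kd_le_maxFn n hκ hb
  obtain ⟨C₂, hC₂⟩ := exists_le_lintegral_shadow n hε hε1
  obtain ⟨C, hC⟩ := exists_lintegral_rpow_le_of_duality n hr (C₂ * C₁)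
  refine ⟨C, fun u hu => hC _ _ ((measurable_kerInt ρ b _ hu).comp measurable_subtype_coe)
    (measurable_area' κ α hu) fun ψ hψ => ?_⟩
  have hMψ := measurable_maxFn hψ
  have ho := (isOpen_outer n ρ).measurableSet
  -- the inner integral is an average of the maximal function over a shadow
  have h1 : ∀ w ∈ outer n ρ, u w * ∫⁻ ζ : UnitSphere n, ψ ζ *
      ENNReal.ofReal ((1 - ‖w‖ ^ 2) ^ b * kd ζ w ^ (-(b - α))) ∂(sphereMeasure n) ≤
      (C₂ * C₁ : ℝ≥0) * ∫⁻ ζ in shadow κ w, maxFn ψ ζ *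
        (u w * ENNReal.ofReal ((1 - ‖w‖ ^ 2) ^ α)) ∂(sphereMeasure n) := by
    intro w hw
    have hδ := one_sub_sq_pos hw.1
    have h2 := hC₂ κ w hw.1 (hρ w hw) (∫⁻ ζ : UnitSphere n, ψ ζ *
      ENNReal.ofReal (kd w ζ ^ (-(b - α))) ∂(sphereMeasure n)) _
      (fun η hη => hC₁ ψ hψ η w hη)
    rw [lintegral_const_mul _ hMψ] at h2
    have h3 : ∫⁻ ζ : UnitSphere n, ψ ζ *
        ENNReal.ofReal ((1 - ‖w‖ ^ 2) ^ b * kd ζ w ^ (-(b - α))) ∂(sphereMeasure n) =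
        ENNReal.ofReal ((1 - ‖w‖ ^ 2) ^ b) * ∫⁻ ζ : UnitSphere n, ψ ζ *
          ENNReal.ofReal (kd w ζ ^ (-(b - α))) ∂(sphereMeasure n) := by
      rw [← lintegral_const_mul' _ _ ENNReal.ofReal_ne_top]
      refine lintegral_congr fun ζ => ?_
      rw [ENNReal.ofReal_mul (by positivity), kd_comm]; ring
    rw [h3, lintegral_mul_const _ hMψ]
    have h4 : ENNReal.ofReal ((1 - ‖w‖ ^ 2) ^ b) * ENNReal.ofReal ((1 - ‖w‖ ^ 2) ^ (-(n : ℝ))) *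
        ENNReal.ofReal ((1 - ‖w‖ ^ 2) ^ (n - (b - α))) = ENNReal.ofReal ((1 - ‖w‖ ^ 2) ^ α) := by
      rw [← ENNReal.ofReal_mul (by positivity), ← ENNReal.ofReal_mul (by positivity),
        ← Real.rpow_add hδ, ← Real.rpow_add hδ]
      congr 2; ring
    calc _ ≤ u w * (ENNReal.ofReal ((1 - ‖w‖ ^ 2) ^ b) * (C₂ * ENNReal.ofReal
          ((1 - ‖w‖ ^ 2) ^ (-(n : ℝ))) * (C₁ * ENNReal.ofReal ((1 - ‖w‖ ^ 2) ^ (n - (b - α))) *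
          ∫⁻ ζ in shadow κ w, maxFn ψ ζ ∂(sphereMeasure n)))) := by gcongr
      _ = C₂ * C₁ * ((∫⁻ ζ in shadow κ w, maxFn ψ ζ ∂(sphereMeasure n)) * (u w *
          (ENNReal.ofReal ((1 - ‖w‖ ^ 2) ^ b) * ENNReal.ofReal ((1 - ‖w‖ ^ 2) ^ (-(n : ℝ))) *
        ENNReal.ofReal ((1 - ‖w‖ ^ 2) ^ (n - (b - α)))))) := by ring
      _ = _ := by rw [h4, ENNReal.coe_mul]
  have hm1 : Measurable (Function.uncurry fun (ζ : UnitSphere n) (w : Cn n) => ψ ζ *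
      (u w * ENNReal.ofReal ((1 - ‖w‖ ^ 2) ^ b * kd ζ w ^ (-(b - α))))) :=
    (hψ.comp measurable_fst).mul ((hu.comp measurable_snd).mul
      (measurable_kernel b _ (measurable_subtype_coe.comp measurable_fst) measurable_snd))
  calc ∫⁻ ζ, ψ ζ * kerInt ρ b (b - α) u (ζ : UnitSphere n) ∂(sphereMeasure n)
      = ∫⁻ ζ : UnitSphere n, ∫⁻ w in outer n ρ, ψ ζ *
          (u w * ENNReal.ofReal ((1 - ‖w‖ ^ 2) ^ b * kd ζ w ^ (-(b - α))))
          ∂(ballVolume n) ∂(sphereMeasure n) := by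
        refine lintegral_congr fun ζ => ?_
        exact (lintegral_const_mul _ (measurable_mul_kernel b _ _ hu)).symm
    _ = ∫⁻ w in outer n ρ, u w * ∫⁻ ζ : UnitSphere n, ψ ζ *
          ENNReal.ofReal ((1 - ‖w‖ ^ 2) ^ b * kd ζ w ^ (-(b - α)))
          ∂(sphereMeasure n) ∂(ballVolume n) := by
        rw [lintegral_lintegral_swap hm1.aemeasurable]
        refine lintegral_congr fun w => ?_
        have hm2 : Measurable fun ζ : UnitSphere n => ψ ζ *
            ENNReal.ofReal ((1 - ‖w‖ ^ 2) ^ b * kd ζ w ^ (-(b - α))) :=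
          hψ.mul (measurable_kernel b _ measurable_subtype_coe measurable_const)
        rw [← lintegral_const_mul _ hm2]
        refine lintegral_congr fun ζ => ?_
        ring
    _ ≤ ∫⁻ w in outer n ρ, (C₂ * C₁ : ℝ≥0) * ∫⁻ ζ in shadow κ w, maxFn ψ ζ *
          (u w * ENNReal.ofReal ((1 - ‖w‖ ^ 2) ^ α)) ∂(sphereMeasure n) ∂(ballVolume n) :=
        setLIntegral_mono' ho h1
    _ = (C₂ * C₁ : ℝ≥0) * ∫⁻ ζ : UnitSphere n, ∫⁻ w in outer n ρ ∩ approachRegion κ ζ,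
          maxFn ψ ζ * (u w * ENNReal.ofReal ((1 - ‖w‖ ^ 2) ^ α))
          ∂(ballVolume n) ∂(sphereMeasure n) := by
        rw [lintegral_const_mul' _ _ ENNReal.coe_ne_top, lintegral_shadow_swap]
        exact (hMψ.comp measurable_snd).mul ((hu.comp measurable_fst).mul
          ((measurable_weight α).comp measurable_fst))
    _ ≤ (C₂ * C₁ : ℝ≥0) * ∫⁻ ζ, maxFn ψ ζ * area κ α u ζ ∂(sphereMeasure n) := by
        refine mul_le_mul_right (lintegral_mono fun ζ => ?_) _
        rw [lintegral_const_mul _ (measurable_mul_weight α hu)]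
        exact mul_le_mul_right (lintegral_mono_set Set.inter_subset_right) _

/-- Area integrals of an integral operator, in terms of the boundary values of its kernel. -/
theorem exists_area_kerInt_le (n : ℕ) [NeZero n] {κ α b : ℝ} (ρ : ℝ) (hκ : 0 < κ)
    (hα : -(n : ℝ) - 1 < α) (hb : α < b) :
    ∃ C : ℝ≥0, ∀ u : Cn n → ℝ≥0∞, Measurable u → ∀ ζ : UnitSphere n,
      area κ α (kerInt ρ b (n + 1 + b) u) ζ ≤ C * kerInt ρ b (b - α) u ζ := by
  obtain ⟨C, hC⟩ := exists_lintegral_approach_le n hκ hα (c := n + 1 + b) (by linarith)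
  refine ⟨C, fun u hu ζ => ?_⟩
  have ho := (isOpen_outer n ρ).measurableSet
  have hm : Measurable (Function.uncurry fun z w : Cn n => u w *
      ENNReal.ofReal ((1 - ‖w‖ ^ 2) ^ b * kd z w ^ (-(n + 1 + b))) *
        ENNReal.ofReal ((1 - ‖z‖ ^ 2) ^ α)) :=
    ((hu.comp measurable_snd).mul (measurable_kernel b _ measurable_fst measurable_snd)).mul
      ((measurable_weight α).comp measurable_fst)
  calc area κ α (kerInt ρ b (n + 1 + b) u) ζ
      = ∫⁻ z in approachRegion κ ζ, ∫⁻ w in outer n ρ, u w *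
          ENNReal.ofReal ((1 - ‖w‖ ^ 2) ^ b * kd z w ^ (-(n + 1 + b))) *
          ENNReal.ofReal ((1 - ‖z‖ ^ 2) ^ α) ∂(ballVolume n) ∂(ballVolume n) := by
        refine lintegral_congr fun z => ?_
        exact (lintegral_mul_const _ (measurable_mul_kernel b _ _ hu)).symm
    _ = ∫⁻ w in outer n ρ, ∫⁻ z in approachRegion κ ζ, u w *
          ENNReal.ofReal ((1 - ‖w‖ ^ 2) ^ b * kd z w ^ (-(n + 1 + b))) *
          ENNReal.ofReal ((1 - ‖z‖ ^ 2) ^ α) ∂(ballVolume n) ∂(ballVolume n) :=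
        lintegral_lintegral_swap hm.aemeasurable
    _ ≤ ∫⁻ w in outer n ρ, C * (u w * ENNReal.ofReal ((1 - ‖w‖ ^ 2) ^ b *
          kd ζ w ^ (-(b - α)))) ∂(ballVolume n) := by
        refine setLIntegral_mono' ho fun w hw => ?_
        have hδ := one_sub_sq_pos hw.1
        calc _ = ∫⁻ z in approachRegion κ ζ, u w * ENNReal.ofReal ((1 - ‖w‖ ^ 2) ^ b) *
                ENNReal.ofReal ((1 - ‖z‖ ^ 2) ^ α * kd w z ^ (-(n + 1 + b)))
                ∂(ballVolume n) := by
              refine setLIntegral_congr_fun (isOpen_approachRegion κ ζ).measurableSet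
                fun z hz => ?_
              have hδ' := one_sub_sq_pos hz.1
              have := kd_nonneg w z
              rw [kd_comm z w, ENNReal.ofReal_mul (by positivity),
                ENNReal.ofReal_mul (by positivity)]; ring
          _ = u w * ENNReal.ofReal ((1 - ‖w‖ ^ 2) ^ b) * ∫⁻ z in approachRegion κ ζ,
                ENNReal.ofReal ((1 - ‖z‖ ^ 2) ^ α * kd w z ^ (-(n + 1 + b))) ∂(ballVolume n) :=
              lintegral_const_mul _ (measurable_kernel_right α _ w)
          _ ≤ u w * ENNReal.ofReal ((1 - ‖w‖ ^ 2) ^ b) *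
                (C * ENNReal.ofReal (kd w ζ ^ (n + 1 + α - (n + 1 + b)))) := by
              gcongr; exact hC ζ w hw.1
          _ = _ := by
              rw [ENNReal.ofReal_mul (by positivity), kd_comm w,
                show n + 1 + α - (n + 1 + b) = -(b - α) by ring]
              ring
    _ = _ := by
        rw [lintegral_const_mul' _ _ (by simp)]; rfl

theorem exists_kerInt_le_of_mem_approachRegion (n : ℕ) [NeZero n] {κ α b : ℝ} (ρ : ℝ) (hκ : 0 < κ)
    (hα : -(n : ℝ) - 1 < α) (hb : α < b) :
    ∃ C : ℝ≥0, ∀ u : Cn n → ℝ≥0∞, ∀ ζ : UnitSphere n, ∀ z ∈ approachRegion κ ζ,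
      kerInt ρ b (n + 1 + b) u z * ENNReal.ofReal ((1 - ‖z‖ ^ 2) ^ (n + 1 + α)) ≤
        C * kerInt ρ b (b - α) u ζ := by
  set K : ℝ := 3 * κ + 5 with hK
  have hK0 : 0 < K := by positivity
  refine ⟨(2 ^ (n + 1 + α) * K ^ (b - α)).toNNReal, fun u ζ z hz => ?_⟩
  have hz1 := mem_unitBall_iff.1 hz.1
  have ho := (isOpen_outer n ρ).measurableSet
  have hδz := one_sub_sq_pos hz.1
  rw [kerInt, kerInt, ← lintegral_mul_const' _ _ ENNReal.ofReal_ne_top,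
    ← lintegral_const_mul' _ _ (by simp)]
  refine setLIntegral_mono' ho fun w hw => ?_
  have hw1 := mem_unitBall_iff.1 hw.1
  have hδ := one_sub_sq_pos hw.1
  have hk : 0 < kd z w := kd_pos hz1.le hw1
  have hkζ : 0 < kd (ζ : Cn n) w := kd_pos (norm_sphere_le ζ) hw1
  rw [mul_assoc, ← ENNReal.ofReal_mul (by positivity)]
  change _ ≤ ENNReal.ofReal _ * _
  rw [mul_left_comm, ← ENNReal.ofReal_mul (by positivity)]
  refine mul_le_mul_right (ENNReal.ofReal_le_ofReal ?_) _
  have h1 := kd_add_le_of_mem_approachRegion hκ hz hw1.le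
  have h2 : kd z w ^ (-(b - α)) ≤ K ^ (b - α) * kd ζ w ^ (-(b - α)) :=
    rpow_neg_le_of_le_mul hkζ hK0 (by linarith) (by linarith)
  have h3 : (1 - ‖z‖ ^ 2) ^ (n + 1 + α) ≤ 2 ^ (n + 1 + α) * kd z w ^ (n + 1 + α) := by
    rw [← Real.mul_rpow (by norm_num) hk.le]
    apply Real.rpow_le_rpow hδz.le _ (by linarith)
    have := one_sub_sq_le_two_kd hw1.le hz1.le
    rwa [kd_comm] at this
  have h4 : kd z w ^ (-(n + 1 + b)) = kd z w ^ (-(b - α)) * kd z w ^ (-(n + 1 + α)) := by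
    rw [← Real.rpow_add hk]; congr 1; ring
  have h5 : kd z w ^ (-(n + 1 + α)) * kd z w ^ (n + 1 + α) = 1 := by
    rw [← Real.rpow_add hk, neg_add_cancel, Real.rpow_zero]
  calc (1 - ‖w‖ ^ 2) ^ b * kd z w ^ (-(n + 1 + b)) * (1 - ‖z‖ ^ 2) ^ (n + 1 + α)
      ≤ (1 - ‖w‖ ^ 2) ^ b * kd z w ^ (-(n + 1 + b)) *
          (2 ^ (n + 1 + α) * kd z w ^ (n + 1 + α)) := by gcongr
    _ = (1 - ‖w‖ ^ 2) ^ b * (2 ^ (n + 1 + α) * kd z w ^ (-(b - α))) *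
          (kd z w ^ (-(n + 1 + α)) * kd z w ^ (n + 1 + α)) := by rw [h4]; ring
    _ ≤ (1 - ‖w‖ ^ 2) ^ b * (2 ^ (n + 1 + α) * (K ^ (b - α) * kd ζ w ^ (-(b - α)))) * 1 := by
        rw [h5]; gcongr
    _ = _ := by ring

/-- The tent space embedding `T^p_{q,α} ⊂ T^p_{1,α'}` for the powers of integral operators: on an
approach region the supremum bound upgrades the exponent `1` to `1/q`. -/
theorem exists_area_kerInt_rpow_le (n : ℕ) [NeZero n] {κ α b q : ℝ} (ρ : ℝ) (hκ : 0 < κ)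
    (hα : -(n : ℝ) - 1 < α) (hb : α < b) (hq0 : 0 < q) (hq1 : q < 1) :
    ∃ C : ℝ≥0, ∀ u : Cn n → ℝ≥0∞, Measurable u → ∀ ζ : UnitSphere n,
      area κ (α + (1 / q - 1) * (n + 1 + α))
        (fun z => kerInt ρ b (n + 1 + b) u z ^ (1 / q)) ζ ≤
          C * kerInt ρ b (b - α) u ζ ^ (1 / q) := by
  obtain ⟨C₁, hC₁⟩ := exists_area_kerInt_le n ρ hκ hα hb
  obtain ⟨C₂, hC₂⟩ := exists_kerInt_le_of_mem_approachRegion n ρ hκ hα hb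
  have hq : 0 < 1 / q - 1 := by
    rw [sub_pos, one_lt_div hq0]; exact hq1
  refine ⟨C₂ ^ (1 / q - 1) * C₁, fun u hu ζ => ?_⟩
  have hms := (isOpen_approachRegion κ ζ).measurableSet
  set L := kerInt ρ b (b - α) u (ζ : Cn n) with hL
  calc _ ≤ ∫⁻ z in approachRegion κ ζ, (C₂ * L) ^ (1 / q - 1) *
        (kerInt ρ b (n + 1 + b) u z * ENNReal.ofReal ((1 - ‖z‖ ^ 2) ^ α)) ∂(ballVolume n) := by
        refine setLIntegral_mono' hms fun z hz => ?_
        have hδz := one_sub_sq_pos hz.1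
        have h1 : _ ≤ (C₂ * L) ^ (1 / q - 1) := ENNReal.rpow_le_rpow (hC₂ u ζ z hz) hq.le
        rw [ENNReal.mul_rpow_of_nonneg _ _ hq.le, ENNReal.ofReal_rpow_of_pos (by positivity),
          ← Real.rpow_mul hδz.le] at h1
        set S := kerInt ρ b (n + 1 + b) u z with hS
        have e1 : S ^ (1 / q) = S ^ (1 / q - 1) * S := by
          nth_rewrite 3 [← ENNReal.rpow_one S]
          rw [← ENNReal.rpow_add_of_nonneg _ _ hq.le zero_le_one]; congr 1; ring
        have e2 : ENNReal.ofReal ((1 - ‖z‖ ^ 2) ^ (α + (1 / q - 1) * (n + 1 + α))) =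
            ENNReal.ofReal ((1 - ‖z‖ ^ 2) ^ α) *
              ENNReal.ofReal ((1 - ‖z‖ ^ 2) ^ ((n + 1 + α) * (1 / q - 1))) := by
          rw [← ENNReal.ofReal_mul (by positivity), ← Real.rpow_add hδz]; congr 2; ring
        change S ^ (1 / q) * _ ≤ (C₂ * L) ^ (1 / q - 1) * (S * _)
        rw [e1, e2]
        calc _ = S ^ (1 / q - 1) * ENNReal.ofReal ((1 - ‖z‖ ^ 2) ^ ((n + 1 + α) * (1 / q - 1))) *
              (S * ENNReal.ofReal ((1 - ‖z‖ ^ 2) ^ α)) := by ring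
          _ ≤ _ := by gcongr
    _ = (C₂ * L) ^ (1 / q - 1) * area κ α (kerInt ρ b (n + 1 + b) u) ζ := by
        exact lintegral_const_mul _ (measurable_mul_weight α (measurable_kerInt ρ b _ hu))
    _ ≤ (C₂ * L) ^ (1 / q - 1) * (C₁ * L) := by gcongr; exact hC₁ u hu ζ
    _ = _ := by
        have e1 : L ^ (1 / q) = L ^ (1 / q - 1) * L := by
          nth_rewrite 3 [← ENNReal.rpow_one L]
          rw [← ENNReal.rpow_add_of_nonneg _ _ hq.le zero_le_one]; congr 1; ring
        rw [e1, ENNReal.mul_rpow_of_nonneg _ _ hq.le, ENNReal.coe_mul,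
          ENNReal.coe_rpow_of_nonneg _ hq.le]; ring

/-- Integral operators with a positive power of `1 - |z|²` in front act on non-tangential maximal
functions, with the Hardy-Littlewood maximal function as a bound. -/
theorem exists_kerInt_le_maxFn (n : ℕ) [NeZero n] {ε : ℝ} (hε : 0 < ε) (hε1 : ε ≤ 1)
    {κ κ' ρ a b : ℝ} (hκ : 0 < κ) (hκ' : 0 < κ')
    (hρ : ∀ w ∈ outer n ρ, 1 + ε ≤ κ / 2 * (1 + ‖w‖)) (ha : 0 < a) (hb : -1 < b) :
    ∃ C : ℝ≥0, ∀ (h : Cn n → ℝ≥0∞) (N : UnitSphere n → ℝ≥0∞), Measurable h → Measurable N →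
      (∀ ζ, ∀ w ∈ approachRegion κ ζ, h w ≤ N ζ) →
      ∀ η, ∀ z ∈ approachRegion κ' η,
        ENNReal.ofReal ((1 - ‖z‖ ^ 2) ^ a) * kerInt ρ b (n + 1 + a + b) h z ≤ C * maxFn N η := by
  obtain ⟨C₁, hC₁⟩ := exists_le_lintegral_shadow n hε hε1
  obtain ⟨C₂, hC₂⟩ := exists_lintegral_approach_le n hκ (e := b - n) (c := n + 1 + a + b)
    (by linarith) (by linarith)
  obtain ⟨C₃, hC₃⟩ := exists_lintegral_kd_le_maxFn n hκ' (c := n + a) (by linarith)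
  refine ⟨C₁ * C₂ * C₃, fun h N hh hN hhN η z hz => ?_⟩
  have ho := (isOpen_outer n ρ).measurableSet
  have hδz := one_sub_sq_pos hz.1
  set c := n + 1 + a + b with hc
  have h1 : kerInt ρ b c h z ≤ C₁ * ∫⁻ ζ : UnitSphere n, ∫⁻ w in outer n ρ ∩ approachRegion κ ζ,
      N ζ * ENNReal.ofReal ((1 - ‖w‖ ^ 2) ^ (b - n) * kd z w ^ (-c))
        ∂(ballVolume n) ∂(sphereMeasure n) := by
    rw [← lintegral_shadow_swap (s := outer n ρ)
      (F := fun w ζ => N ζ * ENNReal.ofReal ((1 - ‖w‖ ^ 2) ^ (b - n) * kd z w ^ (-c)))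
      ((hN.comp measurable_snd).mul (measurable_kernel _ _ measurable_const measurable_fst)),
      ← lintegral_const_mul' _ _ (by simp)]
    refine setLIntegral_mono' ho fun w hw => ?_
    have hδ := one_sub_sq_pos hw.1
    have h2 := hC₁ κ w hw.1 (hρ w hw) (h w) N (fun ζ hζ => hhN ζ w hζ)
    have hk := kd_nonneg z w
    rw [lintegral_mul_const _ hN]
    calc h w * ENNReal.ofReal ((1 - ‖w‖ ^ 2) ^ b * kd z w ^ (-c))
        ≤ (C₁ * ENNReal.ofReal ((1 - ‖w‖ ^ 2) ^ (-(n : ℝ))) *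
          ∫⁻ ζ in shadow κ w, N ζ ∂(sphereMeasure n)) *
          ENNReal.ofReal ((1 - ‖w‖ ^ 2) ^ b * kd z w ^ (-c)) := by gcongr
      _ = C₁ * ((∫⁻ ζ in shadow κ w, N ζ ∂(sphereMeasure n)) *
          (ENNReal.ofReal ((1 - ‖w‖ ^ 2) ^ (-(n : ℝ))) *
            ENNReal.ofReal ((1 - ‖w‖ ^ 2) ^ b * kd z w ^ (-c)))) := by ring
      _ = _ := by
          rw [← ENNReal.ofReal_mul (by positivity), ← mul_assoc ((1 - ‖w‖ ^ 2) ^ (-(n : ℝ))),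
            ← Real.rpow_add hδ]
          congr 5; ring
  calc _ ≤ ENNReal.ofReal ((1 - ‖z‖ ^ 2) ^ a) * (C₁ * ∫⁻ ζ : UnitSphere n, N ζ *
        (C₂ * ENNReal.ofReal (kd z ζ ^ (n + 1 + (b - n) - c))) ∂(sphereMeasure n)) := by
        refine mul_le_mul_right (h1.trans ?_) _
        refine mul_le_mul_right (lintegral_mono fun ζ => ?_) _
        rw [lintegral_const_mul _ (measurable_kernel_right _ _ z)]
        exact mul_le_mul_right ((lintegral_mono_set Set.inter_subset_right).trans
          (hC₂ ζ z hz.1)) _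
    _ = ENNReal.ofReal ((1 - ‖z‖ ^ 2) ^ a) * (C₁ * (C₂ * ∫⁻ ζ : UnitSphere n, N ζ *
        ENNReal.ofReal (kd z ζ ^ (-(n + a))) ∂(sphereMeasure n))) := by
        rw [← lintegral_const_mul' _ _ (by simp : (C₂ : ℝ≥0∞) ≠ ⊤)]
        congr 2
        refine lintegral_congr fun ζ => ?_
        rw [show n + 1 + (b - n) - c = -(n + a) by rw [hc]; ring]; ring
    _ ≤ ENNReal.ofReal ((1 - ‖z‖ ^ 2) ^ a) * (C₁ * (C₂ * (C₃ *
          ENNReal.ofReal ((1 - ‖z‖ ^ 2) ^ (n - (n + a))) * maxFn N η))) := by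
        gcongr; exact hC₃ N hN η z hz
    _ = C₁ * C₂ * C₃ * (ENNReal.ofReal ((1 - ‖z‖ ^ 2) ^ a) *
          ENNReal.ofReal ((1 - ‖z‖ ^ 2) ^ (n - (n + a)))) * maxFn N η := by ring
    _ = _ := by
        rw [← ENNReal.ofReal_mul (by positivity), ← Real.rpow_add hδz]
        simp

/-- The duality between area integrals and non-tangential maximal functions. -/
theorem exists_lintegral_mul_le_area (n : ℕ) [NeZero n] {κ : ℝ} (hκ : 4 ≤ κ) (β : ℝ) :
    ∃ C : ℝ≥0, ∀ (Ψ h : Cn n → ℝ≥0∞) (N : UnitSphere n → ℝ≥0∞), Measurable Ψ → Measurable h →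
      Measurable N → (∀ ζ, ∀ w ∈ approachRegion κ ζ, h w ≤ N ζ) →
      ∫⁻ z, Ψ z * h z * ENNReal.ofReal ((1 - ‖z‖ ^ 2) ^ β) ∂(ballVolume n) ≤
        C * ∫⁻ ζ, N ζ * area κ (β - n) Ψ ζ ∂(sphereMeasure n) := by
  obtain ⟨C₁, hC₁⟩ := exists_le_lintegral_shadow n one_pos le_rfl
  refine ⟨C₁, fun Ψ h N hΨ hh hN hhN => ?_⟩
  have hm : Measurable (Function.uncurry fun (w : Cn n) (ζ : UnitSphere n) =>
      N ζ * (Ψ w * ENNReal.ofReal ((1 - ‖w‖ ^ 2) ^ (β - n)))) :=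
    (hN.comp measurable_snd).mul ((hΨ.comp measurable_fst).mul
      ((measurable_weight _).comp measurable_fst))
  calc _ ≤ ∫⁻ w in Set.univ, C₁ * ∫⁻ ζ in shadow κ w, N ζ * (Ψ w *
        ENNReal.ofReal ((1 - ‖w‖ ^ 2) ^ (β - n))) ∂(sphereMeasure n) ∂(ballVolume n) := by
        rw [Measure.restrict_univ]
        refine lintegral_mono_ae ?_
        filter_upwards [ae_mem_unitBall n] with w hw
        have hδ := one_sub_sq_pos hw
        have h2 := hC₁ κ w hw (by nlinarith [norm_nonneg w]) (h w) N (fun ζ hζ => hhN ζ w hζ)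
        rw [lintegral_mul_const _ hN]
        calc _ ≤ Ψ w * (C₁ * ENNReal.ofReal ((1 - ‖w‖ ^ 2) ^ (-(n : ℝ))) *
              ∫⁻ ζ in shadow κ w, N ζ ∂(sphereMeasure n)) *
              ENNReal.ofReal ((1 - ‖w‖ ^ 2) ^ β) := by gcongr
          _ = C₁ * ((∫⁻ ζ in shadow κ w, N ζ ∂(sphereMeasure n)) * (Ψ w *
              (ENNReal.ofReal ((1 - ‖w‖ ^ 2) ^ β) *
                ENNReal.ofReal ((1 - ‖w‖ ^ 2) ^ (-(n : ℝ)))))) := by ring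
          _ = _ := by
              rw [← ENNReal.ofReal_mul (by positivity), ← Real.rpow_add hδ,
                show β + -(n : ℝ) = β - n by ring]
    _ = C₁ * ∫⁻ ζ : UnitSphere n, ∫⁻ w in approachRegion κ ζ, N ζ * (Ψ w *
          ENNReal.ofReal ((1 - ‖w‖ ^ 2) ^ (β - n))) ∂(ballVolume n) ∂(sphereMeasure n) := by
        rw [lintegral_const_mul' _ _ (by simp), lintegral_shadow_swap hm]
        simp only [Set.univ_inter]
    _ = _ := by
        congr 1
        refine lintegral_congr fun ζ => ?_
        exact lintegral_const_mul _ (measurable_mul_weight _ hΨ)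

/-! ### Coefficient sequences of symbol type -/

/-- Sequences whose `N`-th difference is `O((k + 1) ^ (e - N))` for every `N`. -/
def IsSymbol (e : ℝ) (f : ℕ → ℝ) : Prop :=
  ∀ N : ℕ, ∃ C : ℝ, ∀ k : ℕ, |(fwdDiff 1)^[N] f k| ≤ C * ((k : ℝ) + 1) ^ (e - N)

theorem IsSymbol.fwdDiff {e : ℝ} {f : ℕ → ℝ} (hf : IsSymbol e f) :
    IsSymbol (e - 1) (fwdDiff 1 f) := by
  intro N
  obtain ⟨C, hC⟩ := hf (N + 1)
  refine ⟨C, fun k => ?_⟩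
  have := hC k
  rw [Function.iterate_succ_apply] at this
  rw [show e - 1 - (N : ℝ) = e - ((N + 1 : ℕ) : ℝ) by push_cast; ring]
  exact this

theorem IsSymbol.exists_bound {e : ℝ} {f : ℕ → ℝ} (hf : IsSymbol e f) :
    ∃ C : ℝ, 0 ≤ C ∧ ∀ k : ℕ, |f k| ≤ C * ((k : ℝ) + 1) ^ e := by
  obtain ⟨C, hC⟩ := hf 0
  refine ⟨C, ?_, fun k => by simpa using hC k⟩
  have := (abs_nonneg _).trans (hC 0)
  simpa using this

theorem IsSymbol.mono {e e' : ℝ} {f : ℕ → ℝ} (hf : IsSymbol e f) (h : e ≤ e') :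
    IsSymbol e' f := by
  intro N
  obtain ⟨C, hC⟩ := hf N
  refine ⟨|C|, fun k => (hC k).trans ?_⟩
  have h1 : (1 : ℝ) ≤ (k : ℝ) + 1 := by have := k.cast_nonneg (α := ℝ); linarith
  calc C * ((k : ℝ) + 1) ^ (e - N) ≤ |C| * ((k : ℝ) + 1) ^ (e - N) := by
        gcongr; exact le_abs_self C
    _ ≤ _ := by gcongr

theorem iterate_fwdDiff_add (f g : ℕ → ℝ) (N : ℕ) :
    (_root_.fwdDiff 1)^[N] (f + g) = (_root_.fwdDiff 1)^[N] f + (_root_.fwdDiff 1)^[N] g :=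
  fwdDiff_iter_add 1 f g N

theorem iterate_fwdDiff_const_smul (c : ℝ) (f : ℕ → ℝ) (N : ℕ) :
    (_root_.fwdDiff 1)^[N] (c • f) = c • (_root_.fwdDiff 1)^[N] f :=
  fwdDiff_iter_const_smul 1 c f N

theorem IsSymbol.add {e : ℝ} {f g : ℕ → ℝ} (hf : IsSymbol e f) (hg : IsSymbol e g) :
    IsSymbol e (f + g) := by
  intro N
  obtain ⟨C, hC⟩ := hf N
  obtain ⟨D, hD⟩ := hg N
  refine ⟨C + D, fun k => ?_⟩
  rw [iterate_fwdDiff_add, add_mul]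
  exact (abs_add_le _ _).trans (add_le_add (hC k) (hD k))

theorem IsSymbol.const_smul {e : ℝ} {f : ℕ → ℝ} (hf : IsSymbol e f) (c : ℝ) :
    IsSymbol e (c • f) := by
  intro N
  obtain ⟨C, hC⟩ := hf N
  refine ⟨|c| * C, fun k => ?_⟩
  rw [iterate_fwdDiff_const_smul, Pi.smul_apply, smul_eq_mul, abs_mul, mul_assoc]
  exact mul_le_mul_of_nonneg_left (hC k) (abs_nonneg c)

theorem IsSymbol.shift {e : ℝ} {f : ℕ → ℝ} (hf : IsSymbol e f) :
    IsSymbol e (fun k => f (k + 1)) := by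
  have : (fun k => f (k + 1)) = f + _root_.fwdDiff 1 f := by
    funext k; simp [_root_.fwdDiff]
  rw [this]
  exact hf.add (hf.fwdDiff.mono (by linarith))

theorem IsSymbol.mul {e e' : ℝ} {f g : ℕ → ℝ} (hf : IsSymbol e f) (hg : IsSymbol e' g) :
    IsSymbol (e + e') (f * g) := by
  intro N
  induction N generalizing e e' f g with
  | zero =>
    obtain ⟨C, hC0, hC⟩ := hf.exists_bound
    obtain ⟨D, hD0, hD⟩ := hg.exists_bound
    refine ⟨C * D, fun k => ?_⟩
    have h1 : (0 : ℝ) < (k : ℝ) + 1 := by positivity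
    simp only [Function.iterate_zero, id, Pi.mul_apply, abs_mul, Nat.cast_zero, sub_zero]
    rw [Real.rpow_add h1]
    calc |f k| * |g k| ≤ (C * ((k : ℝ) + 1) ^ e) * (D * ((k : ℝ) + 1) ^ e') := by
          gcongr
          exacts [hC k, hD k]
      _ = _ := by ring
  | succ N ih =>
    obtain ⟨C, hC⟩ := ih hf.fwdDiff hg.shift
    obtain ⟨D, hD⟩ := ih hf hg.fwdDiff
    refine ⟨C + D, fun k => ?_⟩
    have h1 : _root_.fwdDiff 1 (f * g) =
        _root_.fwdDiff 1 f * (fun k => g (k + 1)) + f * _root_.fwdDiff 1 g := by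
      funext k; simp only [_root_.fwdDiff, Pi.mul_apply, Pi.add_apply]; ring
    rw [Function.iterate_succ_apply, h1, iterate_fwdDiff_add, add_mul]
    refine (abs_add_le _ _).trans (add_le_add ?_ ?_)
    · rw [show e + e' - ((N + 1 : ℕ) : ℝ) = e - 1 + e' - N by push_cast; ring]; exact hC k
    · rw [show e + e' - ((N + 1 : ℕ) : ℝ) = e + (e' - 1) - N by push_cast; ring]; exact hD k

/-- The quotient of the rising factorials `(a)_k` and `(b)_k`. -/
def ratio (a b : ℝ) (k : ℕ) : ℝ := ∏ j ∈ Finset.range k, (a + j) / (b + j)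

theorem ratio_zero (a b : ℝ) : ratio a b 0 = 1 := by simp [ratio]

theorem ratio_succ (a b : ℝ) (k : ℕ) : ratio a b (k + 1) = ratio a b k * ((a + k) / (b + k)) :=
  Finset.prod_range_succ _ _

theorem ratio_mul_ratio {a b c : ℝ} (hb : ∀ j : ℕ, b + j ≠ 0) (k : ℕ) :
    ratio a b k * ratio b c k = ratio a c k := by
  unfold ratio
  rw [← Finset.prod_mul_distrib]
  refine Finset.prod_congr rfl fun j _ => ?_
  rw [div_mul_div_cancel₀ (hb j)]

theorem ratio_self {a : ℝ} (ha : ∀ j : ℕ, a + j ≠ 0) (k : ℕ) : ratio a a k = 1 := by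
  unfold ratio
  exact Finset.prod_eq_one fun j _ => div_self (ha j)

theorem ratio_ne_zero {a b : ℝ} (ha : ∀ j : ℕ, a + j ≠ 0) (hb : ∀ j : ℕ, b + j ≠ 0) (k : ℕ) :
    ratio a b k ≠ 0 :=
  Finset.prod_ne_zero_iff.2 fun j _ => div_ne_zero (ha j) (hb j)

theorem ratio_pos {a b : ℝ} (ha : 0 < a) (hb : 0 < b) (k : ℕ) : 0 < ratio a b k :=
  Finset.prod_pos fun j _ => by positivity

theorem fwdDiff_ratio {a b : ℝ} (hb : ∀ j : ℕ, b + j ≠ 0) :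
    _root_.fwdDiff 1 (ratio a b) = ((a - b) / b) • ratio a (b + 1) := by
  have hb0 : b ≠ 0 := by simpa using hb 0
  have key : ∀ k, ratio a b k / (b + k) = ratio a (b + 1) k / b := by
    intro k
    induction k with
    | zero => simp [ratio_zero]
    | succ k ih =>
      have h1 := hb k
      have h2 := hb (k + 1)
      rw [ratio_succ, ratio_succ]
      push_cast at h2 ⊢
      have h3 : b + 1 + (k : ℝ) ≠ 0 := by intro h; apply h2; linarith
      calc ratio a b k * ((a + k) / (b + k)) / (b + (k + 1))
          = (ratio a b k / (b + k)) * ((a + k) / (b + 1 + k)) := by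
            rw [show b + ((k : ℝ) + 1) = b + 1 + k by ring]; field_simp
        _ = _ := by rw [ih]; ring
  funext k
  simp only [_root_.fwdDiff, Pi.smul_apply, smul_eq_mul]
  have h1 := hb k
  calc ratio a b (k + 1) - ratio a b k = (a - b) * (ratio a b k / (b + k)) := by
        rw [ratio_succ]; field_simp; ring
    _ = _ := by rw [key]; ring

theorem exists_ratio_bound {a b : ℝ} (ha : ∀ j : ℕ, a + j ≠ 0) (hb : ∀ j : ℕ, b + j ≠ 0) :
    ∃ C : ℝ, ∀ k : ℕ, |ratio a b k| ≤ C * ((k : ℝ) + 1) ^ (a - b) := by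
  have hΓ : Real.Gamma a ≠ 0 := Real.Gamma_ne_zero fun m h => ha m (by rw [h]; ring)
  have h1 := (Real.GammaSeq_tendsto_Gamma b).div (Real.GammaSeq_tendsto_Gamma a) hΓ
  have h2 : Tendsto (fun k : ℕ => (((k : ℝ) / ((k : ℝ) + 1 + 1)) ^ (a - b)) *
      (Real.GammaSeq b k / Real.GammaSeq a k)) atTop
      (𝓝 (1 ^ (a - b) * (Real.Gamma b / Real.Gamma a))) := by
    refine Tendsto.mul (Tendsto.rpow_const ?_ (Or.inl one_ne_zero)) h1
    have h3 : Tendsto (fun k : ℕ => 1 - 2 / ((k : ℝ) + 2)) atTop (𝓝 (1 - 0)) := by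
      refine tendsto_const_nhds.sub (tendsto_const_nhds.div_atTop ?_)
      exact tendsto_atTop_add_const_right _ _ tendsto_natCast_atTop_atTop
    rw [sub_zero] at h3
    refine h3.congr fun k => ?_
    have : (k : ℝ) + 2 ≠ 0 := by positivity
    have : (k : ℝ) + 1 + 1 ≠ 0 := by positivity
    field_simp; ring
  have h3 : Tendsto (fun k : ℕ => |ratio a b (k + 1)| / ((k : ℝ) + 1 + 1) ^ (a - b)) atTop
      (𝓝 |1 ^ (a - b) * (Real.Gamma b / Real.Gamma a)|) := by
    refine (h2.abs).congr' ?_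
    filter_upwards [eventually_ge_atTop 1] with k hk
    have hk0 : (0 : ℝ) < k := by exact_mod_cast hk
    have e : ratio a b (k + 1) = (k : ℝ) ^ (a - b) * (Real.GammaSeq b k / Real.GammaSeq a k) := by
      unfold Real.GammaSeq ratio
      rw [Finset.prod_div_distrib, Real.rpow_sub hk0]
      have ha' : ∏ j ∈ Finset.range (k + 1), (a + j) ≠ 0 :=
        Finset.prod_ne_zero_iff.2 fun j _ => ha j
      have hb' : ∏ j ∈ Finset.range (k + 1), (b + j) ≠ 0 :=
        Finset.prod_ne_zero_iff.2 fun j _ => hb j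
      have := (Real.rpow_pos_of_pos hk0 a).ne'
      have := (Real.rpow_pos_of_pos hk0 b).ne'
      have : (k.factorial : ℝ) ≠ 0 := by exact_mod_cast k.factorial_ne_zero
      field_simp
    rw [e, Real.div_rpow hk0.le (by positivity), abs_mul, abs_mul,
      abs_of_nonneg (by positivity : 0 ≤ (k : ℝ) ^ (a - b) / ((k : ℝ) + 1 + 1) ^ (a - b)),
      abs_of_nonneg (by positivity : 0 ≤ (k : ℝ) ^ (a - b))]
    ring
  obtain ⟨C, hC⟩ := h3.bddAbove_range
  refine ⟨max C 1, fun k => ?_⟩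
  cases k with
  | zero => simp [ratio_zero]
  | succ k =>
    have := hC ⟨k, rfl⟩
    simp only at this
    rw [div_le_iff₀ (by positivity)] at this
    push_cast
    exact this.trans (mul_le_mul_of_nonneg_right (le_max_left _ _) (by positivity))

/-- The difference of `(a)_k / (b)_k` is a multiple of `(a)_k / (b + 1)_k`. -/
theorem isSymbol_ratio {a b : ℝ} (ha : ∀ j : ℕ, a + j ≠ 0) (hb : ∀ j : ℕ, b + j ≠ 0) :
    IsSymbol (a - b) (ratio a b) := by
  intro N
  induction N generalizing b with
  | zero => simpa using exists_ratio_bound ha hb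
  | succ N ih =>
    have hb1 : ∀ j : ℕ, b + 1 + j ≠ 0 := fun j h => hb (j + 1) (by push_cast; linarith)
    obtain ⟨C, hC⟩ := ih hb1
    refine ⟨|(a - b) / b| * C, fun k => ?_⟩
    rw [Function.iterate_succ_apply, fwdDiff_ratio hb, iterate_fwdDiff_const_smul,
      Pi.smul_apply, smul_eq_mul, abs_mul, mul_assoc]
    refine mul_le_mul_of_nonneg_left ?_ (abs_nonneg _)
    rw [show a - b - ((N + 1 : ℕ) : ℝ) = a - (b + 1) - N by push_cast; ring]; exact hC k

theorem exists_geometric_bound {r : ℝ} (hr0 : 0 ≤ r) (hr1 : r < 1) (e : ℝ) :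
    ∃ C : ℝ, 0 ≤ C ∧ ∀ k : ℕ, r ^ k ≤ C * ((k : ℝ) + 1) ^ e := by
  obtain ⟨m, hm⟩ := exists_nat_gt (-e)
  have h1 := tendsto_pow_const_mul_const_pow_of_abs_lt_one m (r := r) (by rwa [abs_of_nonneg hr0])
  have h2 : Tendsto (fun k : ℕ => ((k : ℝ) + 1) ^ m * r ^ (k + 1)) atTop (𝓝 0) := by
    have := h1.comp (tendsto_add_atTop_nat 1)
    refine this.congr fun k => ?_
    simp
  obtain ⟨D, hD⟩ := h2.bddAbove_range
  rcases hr0.eq_or_lt with rfl | hr0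
  · refine ⟨1, zero_le_one, fun k => ?_⟩
    cases k with
    | zero => simp
    | succ k => simp; positivity
  have hD0 : 0 ≤ D := le_trans (by positivity) (hD ⟨0, rfl⟩)
  refine ⟨D / r, by positivity, fun k => ?_⟩
  have h3 : ((k : ℝ) + 1) ^ m * r ^ (k + 1) ≤ D := hD ⟨k, rfl⟩
  have h4 : (1 : ℝ) ≤ ((k : ℝ) + 1) ^ m * ((k : ℝ) + 1) ^ e := by
    rw [← Real.rpow_natCast, ← Real.rpow_add (by positivity)]
    exact Real.one_le_rpow (by have := k.cast_nonneg (α := ℝ); linarith) (by linarith)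
  calc r ^ k ≤ r ^ k * (((k : ℝ) + 1) ^ m * ((k : ℝ) + 1) ^ e) :=
        le_mul_of_one_le_right (by positivity) h4
    _ = (((k : ℝ) + 1) ^ m * r ^ (k + 1)) / r * ((k : ℝ) + 1) ^ e := by
        rw [pow_succ]; field_simp
    _ ≤ _ := by gcongr

theorem isSymbol_of_geometric {r C : ℝ} (hr0 : 0 ≤ r) (hr1 : r < 1) {f : ℕ → ℝ}
    (hf : ∀ k, |f k| ≤ C * r ^ k) (e : ℝ) : IsSymbol e f := by
  intro N
  induction N generalizing f C e with
  | zero =>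
    obtain ⟨D, hD0, hD⟩ := exists_geometric_bound hr0 hr1 e
    refine ⟨|C| * D, fun k => ?_⟩
    simp only [Function.iterate_zero, id, Nat.cast_zero, sub_zero]
    calc |f k| ≤ C * r ^ k := hf k
      _ ≤ |C| * r ^ k := by gcongr; exact le_abs_self C
      _ ≤ |C| * (D * ((k : ℝ) + 1) ^ e) := by gcongr; exact hD k
      _ = _ := by ring
  | succ N ih =>
    obtain ⟨D, hD⟩ := ih (f := _root_.fwdDiff 1 f) (C := C * (r + 1)) (fun k => by
      simp only [_root_.fwdDiff]
      calc |f (k + 1) - f k| ≤ |f (k + 1)| + |f k| := abs_sub _ _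
        _ ≤ C * r ^ (k + 1) + C * r ^ k := add_le_add (hf _) (hf _)
        _ = _ := by ring) (e - 1)
    refine ⟨D, fun k => ?_⟩
    rw [Function.iterate_succ_apply]
    rw [show e - ((N + 1 : ℕ) : ℝ) = e - 1 - N by push_cast; ring]; exact hD k

/-- The binomial series. -/
theorem hasSum_ratio (c : ℝ) {x : ℂ} (hx : ‖x‖ < 1) :
    HasSum (fun k : ℕ => (ratio c 1 k : ℂ) * x ^ k) (1 / (1 - x) ^ (c : ℂ)) := by
  have h := (Complex.one_div_one_sub_cpow_hasFPowerSeriesOnBall_zero (c : ℂ)).hasSum (y := x) (by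
    rw [← ENNReal.ofReal_one, Metric.eball_ofReal, mem_ball_zero_iff]
    exact hx)
  rw [zero_add] at h
  refine h.congr_fun fun k => ?_
  rw [FormalMultilinearSeries.ofScalars_apply_eq, multichoose_eq_prod, smul_eq_mul]
  congr 1
  have : (k.factorial : ℝ) = ∏ j ∈ Finset.range k, ((1 : ℝ) + j) := by
    rw [← Finset.prod_range_add_one_eq_factorial]; push_cast
    exact Finset.prod_congr rfl fun j _ => add_comm _ _
  rw [ratio, Finset.prod_div_distrib, ← this]
  push_cast
  rw [div_eq_inv_mul]

theorem norm_one_div_one_sub_cpow (c : ℝ) {x : ℂ} (hx : ‖x‖ < 1) :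
    ‖1 / (1 - x) ^ (c : ℂ)‖ = ‖1 - x‖ ^ (-c) := by
  have h0 : 1 - x ≠ 0 := by
    intro h
    rw [sub_eq_zero] at h
    rw [← h] at hx; simp at hx
  rw [norm_div, norm_one, Complex.norm_cpow_of_ne_zero h0]
  simp [Real.rpow_neg]

theorem hasSum_ratio_real {c r : ℝ} (hr0 : 0 ≤ r) (hr1 : r < 1) :
    HasSum (fun k : ℕ => ratio c 1 k * r ^ k) ((1 - r) ^ (-c)) := by
  have h := hasSum_ratio c (x := (r : ℂ)) (by rwa [Complex.norm_real, Real.norm_of_nonneg hr0])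
  rw [← Complex.ofReal_one, ← Complex.ofReal_sub, ← Complex.ofReal_cpow (by linarith),
    ← Complex.ofReal_div] at h
  have h2 : HasSum (fun k : ℕ => (((ratio c 1 k * r ^ k : ℝ)) : ℂ))
      (((1 / (1 - r) ^ c : ℝ)) : ℂ) := by
    refine h.congr_fun fun k => ?_
    push_cast; rfl
  rw [Complex.hasSum_ofReal] at h2
  rwa [one_div, ← Real.rpow_neg (by linarith)] at h2

theorem exists_sum_symbol_le {B : ℝ} (hB : 0 < B) :
    ∃ C : ℝ, 0 ≤ C ∧ ∀ r : ℝ, 0 ≤ r → r < 1 →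
      Summable (fun k : ℕ => ((k : ℝ) + 1) ^ (B - 1) * r ^ k) ∧
      ∑' k : ℕ, ((k : ℝ) + 1) ^ (B - 1) * r ^ k ≤ C * (1 - r) ^ (-B) := by
  have h1 : ∀ j : ℕ, (1 : ℝ) + j ≠ 0 := fun j => by positivity
  have h2 : ∀ j : ℕ, B + j ≠ 0 := fun j => by positivity
  obtain ⟨C, hC0, hC⟩ := (isSymbol_ratio h1 h2).exists_bound
  have key : ∀ k : ℕ, ((k : ℝ) + 1) ^ (B - 1) ≤ C * ratio B 1 k := by
    intro k
    have e := ratio_mul_ratio (a := 1) (b := B) (c := 1) h2 k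
    rw [ratio_self h1] at e
    have h3 := hC k
    rw [abs_of_pos (ratio_pos one_pos hB k)] at h3
    have h4 : (0 : ℝ) < (k : ℝ) + 1 := by positivity
    calc ((k : ℝ) + 1) ^ (B - 1) = (ratio 1 B k * ratio B 1 k) * ((k : ℝ) + 1) ^ (B - 1) := by
          rw [e, one_mul]
      _ ≤ (C * ((k : ℝ) + 1) ^ (1 - B) * ratio B 1 k) * ((k : ℝ) + 1) ^ (B - 1) := by
          have := (ratio_pos hB one_pos k).le
          gcongr
      _ = C * ratio B 1 k * (((k : ℝ) + 1) ^ (1 - B) * ((k : ℝ) + 1) ^ (B - 1)) := by ring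
      _ = _ := by
          rw [← Real.rpow_add h4]; simp
  refine ⟨C, hC0, fun r hr0 hr1 => ?_⟩
  have hs := (hasSum_ratio_real (c := B) hr0 hr1).mul_left C
  have hle : ∀ k : ℕ, ((k : ℝ) + 1) ^ (B - 1) * r ^ k ≤ C * (ratio B 1 k * r ^ k) := fun k => by
    rw [← mul_assoc]; gcongr; exact key k
  have hsum := Summable.of_nonneg_of_le (fun k => by positivity) hle hs.summable
  exact ⟨hsum, (hsum.tsum_le_tsum hle hs.summable).trans_eq hs.tsum_eq⟩

theorem IsSymbol.summable {e : ℝ} {f : ℕ → ℝ} (hf : IsSymbol e f) {x : ℂ} (hx : ‖x‖ < 1) :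
    Summable fun k : ℕ => (f k : ℂ) * x ^ k := by
  obtain ⟨C, hC0, hC⟩ := (hf.mono (le_max_left e 0)).exists_bound
  obtain ⟨D, -, hD⟩ := exists_sum_symbol_le (B := max e 0 + 1)
    (by have := le_max_right e 0; linarith)
  have h1 := ((hD ‖x‖ (norm_nonneg _) hx).1).mul_left C
  refine Summable.of_norm_bounded h1 fun k => ?_
  rw [norm_mul, norm_pow, Complex.norm_real, Real.norm_eq_abs, ← mul_assoc, add_sub_cancel_right]
  gcongr
  exact hC k

/-- Each summation by parts trades a power of `1 - ‖x‖` for one of `‖1 - x‖`. -/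
theorem IsSymbol.exists_tsum_le {B : ℝ} {N : ℕ} (hN : N < B) {c : ℕ → ℝ}
    (hc : IsSymbol (B - 1) c) :
    ∃ C : ℝ, 0 ≤ C ∧ ∀ x : ℂ, ‖x‖ < 1 →
      ‖∑' k : ℕ, (c k : ℂ) * x ^ k‖ ≤ C * (‖1 - x‖ ^ (-(N : ℝ)) * (1 - ‖x‖) ^ (-(B - N))) := by
  induction N generalizing B c with
  | zero =>
    simp only [Nat.cast_zero, neg_zero, Real.rpow_zero, sub_zero, one_mul] at hN ⊢
    obtain ⟨C, hC0, hC⟩ := hc.exists_bound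
    obtain ⟨D, hD0, hD⟩ := exists_sum_symbol_le hN
    refine ⟨C * D, by positivity, fun x hx => ?_⟩
    obtain ⟨h1, h2⟩ := hD ‖x‖ (norm_nonneg _) hx
    have h3 := h1.mul_left C
    have h4 : ∀ k : ℕ, ‖(c k : ℂ) * x ^ k‖ ≤ C * (((k : ℝ) + 1) ^ (B - 1) * ‖x‖ ^ k) := by
      intro k
      rw [norm_mul, norm_pow, Complex.norm_real, Real.norm_eq_abs, ← mul_assoc]
      gcongr
      exact hC k
    calc _ ≤ ∑' k : ℕ, C * (((k : ℝ) + 1) ^ (B - 1) * ‖x‖ ^ k) :=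
          tsum_of_norm_bounded h3.hasSum h4
      _ = C * ∑' k : ℕ, (((k : ℝ) + 1) ^ (B - 1) * ‖x‖ ^ k) := tsum_mul_left
      _ ≤ C * (D * (1 - ‖x‖) ^ (-B)) := by gcongr
      _ = _ := by ring
  | succ N ih =>
    push_cast at hN
    obtain ⟨C, hC0, hC⟩ := ih (B := B - 1) (c := _root_.fwdDiff 1 c) (by linarith) hc.fwdDiff
    refine ⟨|c 0| * 2 ^ (N : ℝ) + C, by positivity, fun x hx => ?_⟩
    have hx1 : 0 < 1 - ‖x‖ := by linarith
    have hx2 : 0 < ‖1 - x‖ := by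
      have := norm_sub_norm_le (1 : ℂ) x
      rw [norm_one] at this; linarith
    have hx3 : ‖1 - x‖ ≤ 2 := by
      have := norm_sub_le (1 : ℂ) x
      rw [norm_one] at this; linarith
    have hs := hc.summable hx
    have hs' := hc.fwdDiff.summable hx
    have e : (1 - x) * ∑' k : ℕ, (c k : ℂ) * x ^ k =
        c 0 + x * ∑' k : ℕ, ((_root_.fwdDiff 1 c k : ℝ) : ℂ) * x ^ k := by
      have h5 := hs.tsum_eq_zero_add
      have hs1 := (summable_nat_add_iff 1).2 hs
      have h6 : x * ∑' k : ℕ, ((_root_.fwdDiff 1 c k : ℝ) : ℂ) * x ^ k =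
          ∑' k : ℕ, (c (k + 1) : ℂ) * x ^ (k + 1) - x * ∑' k : ℕ, (c k : ℂ) * x ^ k := by
        rw [← tsum_mul_left, ← tsum_mul_left, ← hs1.tsum_sub (hs.mul_left x)]
        refine tsum_congr fun k => ?_
        simp only [_root_.fwdDiff]
        push_cast; ring
      rw [h6, sub_mul, one_mul]
      nth_rewrite 1 [h5]
      simp; ring
    set X := ‖1 - x‖ ^ (-(N : ℝ)) * (1 - ‖x‖) ^ (-(B - 1 - N)) with hX
    have h7 : (1 : ℝ) ≤ 2 ^ (N : ℝ) * X := by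
      rw [hX, ← mul_assoc]
      refine one_le_mul_of_one_le_of_one_le ?_ ?_
      · rw [Real.rpow_neg hx2.le, ← div_eq_mul_inv, ← Real.div_rpow (by norm_num) hx2.le]
        exact Real.one_le_rpow ((one_le_div hx2).2 hx3) (by positivity)
      · exact Real.one_le_rpow_of_pos_of_le_one_of_nonpos hx1 (by linarith [norm_nonneg x])
          (by linarith)
    have h8 : ‖1 - x‖ * ‖∑' k : ℕ, (c k : ℂ) * x ^ k‖ ≤ (|c 0| * 2 ^ (N : ℝ) + C) * X := by
      rw [← norm_mul, e]
      calc _ ≤ ‖(c 0 : ℂ)‖ + ‖x‖ * ‖∑' k : ℕ, ((_root_.fwdDiff 1 c k : ℝ) : ℂ) * x ^ k‖ := by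
            rw [← norm_mul]; exact norm_add_le _ _
        _ ≤ |c 0| * (2 ^ (N : ℝ) * X) + 1 * (C * X) := by
            rw [Complex.norm_real, Real.norm_eq_abs]
            gcongr
            · exact le_mul_of_one_le_right (abs_nonneg _) h7
            · exact hC x hx
        _ = _ := by ring
    have h9 : ‖1 - x‖ ^ (-((N + 1 : ℕ) : ℝ)) = ‖1 - x‖⁻¹ * ‖1 - x‖ ^ (-(N : ℝ)) := by
      rw [← Real.rpow_neg_one, ← Real.rpow_add hx2]; push_cast; congr 1; ring
    rw [h9, show -(B - ((N + 1 : ℕ) : ℝ)) = -(B - 1 - N) by push_cast; ring, mul_assoc, ← hX,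
      mul_left_comm, ← div_eq_inv_mul, le_div_iff₀ hx2]
    linarith

/-! ### Homogeneous expansions -/

theorem taylorCoeff_eq_of_hasSum {f : ℂ → ℂ} {a : ℕ → ℂ} {r : ℝ} (hr : 0 < r)
    (h : ∀ w : ℂ, ‖w‖ < r → HasSum (fun k => a k * w ^ k) (f w)) (k : ℕ) :
    (k.factorial : ℂ)⁻¹ * iteratedDeriv k f 0 = a k := by
  have hr2 : 0 < r / 2 := by positivity
  have hp : HasFPowerSeriesOnBall f (FormalMultilinearSeries.ofScalars ℂ a) 0
      (ENNReal.ofReal (r / 2)) := by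
    refine ⟨?_, ENNReal.ofReal_pos.2 hr2, fun {y} hy => ?_⟩
    · have h1 := (h ((r / 2 : ℝ) : ℂ) (by
        rw [Complex.norm_real, Real.norm_of_nonneg hr2.le]; linarith)).summable.norm
      refine FormalMultilinearSeries.le_radius_of_summable _ (r := (r / 2).toNNReal)
        (h1.congr fun k => ?_)
      rw [FormalMultilinearSeries.ofScalars_norm, norm_mul, norm_pow, Complex.norm_real,
        Real.norm_of_nonneg hr2.le, Real.coe_toNNReal _ hr2.le]
    · rw [Metric.eball_ofReal, mem_ball_zero_iff] at hy
      rw [zero_add]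
      refine (h y (by linarith)).congr_fun fun k => ?_
      rw [FormalMultilinearSeries.ofScalars_apply_eq, smul_eq_mul]
  have h2 := hp.factorial_smul (1 : ℂ) k
  rw [FormalMultilinearSeries.ofScalars_apply_eq, one_pow, smul_eq_mul, mul_one,
    nsmul_eq_mul] at h2
  rw [iteratedDeriv_eq_iteratedFDeriv, ← h2, inv_mul_cancel_left₀]
  exact_mod_cast k.factorial_ne_zero

section Homog

variable {n : ℕ} {f : Cn n → ℂ}

theorem differentiableOn_slice (hf : DifferentiableOn ℂ f (unitBall n)) {z : Cn n} {r : ℝ}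
    (hz : r * ‖z‖ ≤ 1) :
    DifferentiableOn ℂ (fun w : ℂ => f (w • z)) (Metric.ball 0 r) := by
  refine hf.comp (by fun_prop) fun w hw => ?_
  rw [mem_ball_zero_iff] at hw
  rw [mem_ball_zero_iff, norm_smul]
  rcases (norm_nonneg z).eq_or_lt with h | h
  · rw [← h, mul_zero]; exact one_pos
  · exact (mul_lt_mul_of_pos_right hw h).trans_le hz

theorem exists_slice_radius (z : Cn n) : ∃ r : ℝ, 0 < r ∧ r * ‖z‖ ≤ 1 ∧ (‖z‖ < 1 → 1 < r) := by
  rcases (norm_nonneg z).eq_or_lt with h | h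
  · exact ⟨2, two_pos, by rw [← h]; simp, fun _ => one_lt_two⟩
  · exact ⟨‖z‖⁻¹, by positivity, (inv_mul_cancel₀ h.ne').le, fun h1 => (one_lt_inv₀ h).2 h1⟩

theorem hasSum_homogPart_smul (hf : DifferentiableOn ℂ f (unitBall n)) {z : Cn n} {r : ℝ}
    (hz : r * ‖z‖ ≤ 1) {w : ℂ} (hw : ‖w‖ < r) :
    HasSum (fun k => homogPart f k z * w ^ k) (f (w • z)) := by
  have h := Complex.hasSum_taylorSeries_on_ball (differentiableOn_slice hf hz)
    (mem_ball_zero_iff.2 hw)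
  refine h.congr_fun fun k => ?_
  rw [sub_zero, smul_eq_mul, smul_eq_mul, homogPart]; ring

/-- A holomorphic function on the ball is the sum of its homogeneous parts. -/
theorem hasSum_homogPart (hf : DifferentiableOn ℂ f (unitBall n)) {z : Cn n} (hz : ‖z‖ < 1) :
    HasSum (fun k => homogPart f k z) (f z) := by
  obtain ⟨r, -, h1, h2⟩ := exists_slice_radius z
  have := hasSum_homogPart_smul hf h1 (w := 1) (by rw [norm_one]; exact h2 hz)
  simpa using this

theorem homogPart_smul (hf : DifferentiableOn ℂ f (unitBall n)) (c : ℂ) (k : ℕ) (z : Cn n) :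
    homogPart f k (c • z) = c ^ k * homogPart f k z := by
  obtain ⟨r, hr, h1, -⟩ := exists_slice_radius z
  have hc : 0 < ‖c‖ + 1 := by positivity
  refine taylorCoeff_eq_of_hasSum (f := fun w : ℂ => f (w • c • z))
    (a := fun k => c ^ k * homogPart f k z) (r := r / (‖c‖ + 1)) (by positivity) (fun w hw => ?_) k
  have h2 : ‖w * c‖ < r := by
    rw [lt_div_iff₀ hc] at hw
    rw [norm_mul]; nlinarith [norm_nonneg w]
  have := hasSum_homogPart_smul hf h1 h2
  rw [smul_smul]
  refine this.congr_fun fun k => ?_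
  rw [mul_pow]; ring

theorem homogPart_dilate (hf : DifferentiableOn ℂ f (unitBall n)) (r : ℝ) (k : ℕ) (z : Cn n) :
    homogPart (dilate r f) k z = (r : ℂ) ^ k * homogPart f k z := by
  rw [← homogPart_smul hf]
  simp only [homogPart, dilate]
  simp_rw [smul_comm (r : ℂ)]

theorem homogPart_eq_of_hasSum {P : ℕ → Cn n → ℂ} {z : Cn n}
    (hP : ∀ k (w : ℂ), P k (w • z) = w ^ k * P k z) {r : ℝ} (hr : 0 < r)
    (h : ∀ w : ℂ, ‖w‖ < r → HasSum (fun k => P k (w • z)) (f (w • z))) (k : ℕ) :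
    homogPart f k z = P k z :=
  taylorCoeff_eq_of_hasSum (a := fun k => P k z) hr
    (fun w hw => (h w hw).congr_fun fun k => by rw [hP]; ring) k

theorem homogPart_eq_circleAverage (hf : DifferentiableOn ℂ f (unitBall n)) {z : Cn n}
    (hz : ‖z‖ < 1) (k : ℕ) :
    homogPart f k z = Real.circleAverage (fun ξ : ℂ => ξ⁻¹ ^ k * f (ξ • z)) 0 1 := by
  obtain ⟨r, -, h1, h2⟩ := exists_slice_radius z
  have hr := h2 hz
  have hd := differentiableOn_slice hf h1
  have hp := (hd.mono (Metric.closedBall_subset_ball (by simpa using hr) :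
    Metric.closedBall (0 : ℂ) (1 : ℝ≥0) ⊆ _)).hasFPowerSeriesOnBall one_pos
  have h3 := hp.factorial_smul (1 : ℂ) k
  rw [cauchyPowerSeries_apply] at h3
  rw [homogPart, iteratedDeriv_eq_iteratedFDeriv, ← h3, Real.circleAverage_eq_circleIntegral
    one_ne_zero, nsmul_eq_mul, inv_mul_cancel_left₀ (by exact_mod_cast k.factorial_ne_zero),
    smul_eq_mul]
  simp only [NNReal.coe_one, smul_eq_mul, sub_zero]
  congr 2
  funext ξ
  simp only [one_div]; ring

theorem norm_homogPart_le (hf : DifferentiableOn ℂ f (unitBall n)) {z : Cn n} (hz : ‖z‖ < 1)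
    {M : ℝ} (hM : ∀ ξ : ℂ, ‖ξ‖ = 1 → ‖f (ξ • z)‖ ≤ M) (k : ℕ) : ‖homogPart f k z‖ ≤ M := by
  rw [homogPart_eq_circleAverage hf hz, Real.circleAverage_def, norm_smul]
  have h := intervalIntegral.norm_integral_le_of_norm_le_const (a := 0) (b := 2 * Real.pi)
    (f := fun θ => (fun ξ : ℂ => ξ⁻¹ ^ k * f (ξ • z)) (circleMap 0 1 θ)) (C := M) (by
      intro θ _
      have h1 : ‖circleMap 0 1 θ‖ = 1 := by simp
      simp only [norm_mul, norm_pow, norm_inv, h1, inv_one, one_pow, one_mul]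
      exact hM _ h1)
  rw [sub_zero, abs_of_pos Real.two_pi_pos] at h
  rw [norm_inv, Real.norm_of_nonneg Real.two_pi_pos.le, inv_mul_le_iff₀ Real.two_pi_pos]
  linarith

/-- A normally convergent series of entire functions is holomorphic. -/
theorem differentiableOn_tsum {P : ℕ → Cn n → ℂ} {R : ℝ} {u : ℕ → ℝ} (hu : Summable u)
    (hP : ∀ k, Differentiable ℂ (P k)) (hb : ∀ k z, ‖z‖ < R → ‖P k z‖ ≤ u k) :
    DifferentiableOn ℂ (fun z => ∑' k, P k z) (Metric.ball 0 R) := by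
  intro z₀ hz₀
  rw [mem_ball_zero_iff] at hz₀
  obtain ⟨R', h1, h2⟩ := exists_between hz₀
  have h1' : z₀ ∈ Metric.ball (0 : Cn n) R' := mem_ball_zero_iff.2 h1
  set d := (R - R') / 2 with hd
  have hd0 : 0 < d := by rw [hd]; linarith
  have hu0 : ∀ k, 0 ≤ u k := fun k => (norm_nonneg _).trans (hb k z₀ hz₀)
  have key : ∀ k (z : Cn n), z ∈ Metric.ball (0 : Cn n) R' → ‖fderiv ℂ (P k) z‖ ≤ u k / d := by
    intro k z hz
    rw [mem_ball_zero_iff] at hz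
    refine ContinuousLinearMap.opNorm_le_bound _ (div_nonneg (hu0 k) hd0.le) fun h => ?_
    rcases eq_or_ne h 0 with rfl | hh
    · simp
    have hh0 : 0 < ‖h‖ := norm_pos_iff.2 hh
    -- Cauchy's estimate on the disc of radius `d / ‖h‖` in the direction `h`
    have h3 : HasDerivAt (fun w : ℂ => P k (z + w • h)) (fderiv ℂ (P k) z h) 0 := by
      have h4 : HasDerivAt (fun w : ℂ => z + w • h) h 0 := by
        simpa using ((hasDerivAt_id (0 : ℂ)).smul_const h).const_add z
      have h5 : HasFDerivAt (P k) (fderiv ℂ (P k) z) (z + (0 : ℂ) • h) := by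
        rw [zero_smul, add_zero]; exact (hP k z).hasFDerivAt
      exact h5.comp_hasDerivAt 0 h4
    have h6 := Complex.norm_deriv_le_of_forall_mem_sphere_norm_le (c := 0) (R := d / ‖h‖)
      (C := u k) (f := fun w : ℂ => P k (z + w • h)) (by positivity)
      ((hP k).comp (by fun_prop)).diffContOnCl (fun w hw => by
        rw [mem_sphere_zero_iff_norm] at hw
        refine hb k _ ?_
        calc ‖z + w • h‖ ≤ ‖z‖ + ‖w‖ * ‖h‖ := by
              rw [← norm_smul]; exact norm_add_le _ _
          _ < R := by
              rw [hw, div_mul_cancel₀ _ hh0.ne', hd]; linarith)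
    rw [h3.deriv] at h6
    calc _ ≤ u k / (d / ‖h‖) := h6
      _ = _ := by field_simp
  exact (hasFDerivAt_tsum_of_isPreconnected (hu.div_const d) Metric.isOpen_ball
    (convex_ball (0 : Cn n) R').isPreconnected (fun k z _ => (hP k z).hasFDerivAt) key h1'
    (Summable.of_norm_bounded hu fun k => hb k z₀ hz₀) h1').differentiableAt.differentiableWithinAt

end Homog

/-! ### Moments of rotation invariant measures -/

theorem integrable_of_integral_pos {X : Type*} [MeasurableSpace X] {μ : Measure X} {f : X → ℝ}
    (h : 0 < ∫ x, f x ∂μ) : Integrable f μ := by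
  by_contra h1
  rw [integral_undef h1] at h
  exact lt_irrefl _ h

theorem lintegral_ofReal_of_integral_pos {X : Type*} [MeasurableSpace X] {μ : Measure X}
    {f : X → ℝ} (h : 0 < ∫ x, f x ∂μ) (hf : 0 ≤ᵐ[μ] f) :
    ∫⁻ x, ENNReal.ofReal (f x) ∂μ = ENNReal.ofReal (∫ x, f x ∂μ) :=
  (ofReal_integral_eq_lintegral_ofReal (integrable_of_integral_pos h) hf).symm

theorem lintegral_gaussian (n : ℕ) [NeZero n] : ∃ c : ℝ≥0∞, c ≠ 0 ∧ c ≠ ⊤ ∧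
    ∀ (e : UnitSphere n) (k : ℕ), ∫⁻ w : Cn n,
      ENNReal.ofReal (‖inner ℂ (e : Cn n) w‖ ^ (2 * k) * Real.exp (-‖w‖ ^ 2)) =
        c * ENNReal.ofReal (k.factorial) := by
  obtain ⟨c, hc, hvol⟩ := exists_volume_eq_smul_pi n
  refine ⟨c * ENNReal.ofReal (Real.pi ^ n), mul_ne_zero (by simpa using hc) (by
    rw [Ne, ENNReal.ofReal_eq_zero, not_le]; positivity), ENNReal.mul_ne_top ENNReal.coe_ne_top
    ENNReal.ofReal_ne_top, fun e k => ?_⟩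
  obtain ⟨b, hb⟩ := exists_orthonormalBasis_zero e
  set g : Fin n → ℂ → ℝ := fun i x => ‖x‖ ^ (if i = 0 then 2 * (k : ℝ) else 0) *
    Real.exp (-‖x‖ ^ (2 : ℝ)) with hg
  have hgi : ∀ i, ∫ x, g i x = Real.pi * (if i = 0 then (k.factorial : ℝ) else 1) := by
    intro i
    rw [hg]
    simp only
    rw [Complex.integral_rpow_mul_exp_neg_rpow one_le_two (by
      have := k.cast_nonneg (α := ℝ)
      split_ifs <;> linarith)]
    split_ifs
    · rw [show (2 * (k : ℝ) + 2) / 2 = k + 1 by ring, Real.Gamma_nat_eq_factorial]; ring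
    · norm_num
  have hprod : ∫ x : Fin n → ℂ, ∏ i, g i (x i) = Real.pi ^ n * k.factorial := by
    rw [integral_fintype_prod_volume_eq_prod, Finset.prod_congr rfl fun i _ => hgi i,
      Finset.prod_mul_distrib, Finset.prod_const, Finset.prod_ite_eq' Finset.univ (0 : Fin n)]
    simp
  have hpos : 0 < ∫ x : Fin n → ℂ, ∏ i, g i (x i) := by
    rw [hprod]; positivity
  have h0 : ∀ x : Fin n → ℂ, 0 ≤ ∏ i, g i (x i) := fun x =>
    Finset.prod_nonneg fun i _ => by rw [hg]; positivity
  have h1 : ∀ w : Cn n, ENNReal.ofReal (‖inner ℂ (e : Cn n) w‖ ^ (2 * k) *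
      Real.exp (-‖w‖ ^ 2)) = ENNReal.ofReal (∏ i, g i (b.repr w i)) := by
    intro w
    congr 1
    have : ∀ i, g i (b.repr w i) = (if i = 0 then ‖b.repr w 0‖ ^ (2 * k) else 1) *
        Real.exp (-‖b.repr w i‖ ^ 2) := by
      intro i
      rw [hg]
      simp only
      split_ifs with h
      · subst h
        rw [← Real.rpow_natCast _ (2 * k)]
        push_cast
        rw [Real.rpow_two]
      · rw [Real.rpow_zero, Real.rpow_two]
    rw [Finset.prod_congr rfl fun i _ => this i, Finset.prod_mul_distrib,
      Finset.prod_ite_eq' Finset.univ (0 : Fin n), if_pos (Finset.mem_univ _),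
      ← Real.exp_sum, b.repr_apply_apply, hb, Finset.sum_neg_distrib]
    congr 3
    rw [← b.repr.norm_map w, EuclideanSpace.norm_sq_eq]
  have hm : Measurable fun w : Cn n => ENNReal.ofReal (∏ i, g i (w i)) := by
    rw [hg]; fun_prop
  simp_rw [h1]
  rw [(measurePreserving_repr b).lintegral_comp hm, hvol, lintegral_smul_measure,
    lintegral_map hm (by fun_prop), ENNReal.smul_def, smul_eq_mul, mul_assoc,
    ← ENNReal.ofReal_mul (by positivity), ← hprod]
  congr 1
  exact lintegral_ofReal_of_integral_pos hpos (ae_of_all _ h0)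

theorem factorial_div_eq_ratio (n : ℕ) [NeZero n] (k : ℕ) :
    (k.factorial : ℝ) * (n - 1).factorial / (n - 1 + k).factorial = ratio 1 n k := by
  induction k with
  | zero => simp [ratio_zero, Nat.factorial_ne_zero]
  | succ k ih =>
    have hn : ((n - 1 : ℕ) : ℝ) = n - 1 := by
      rw [Nat.cast_sub NeZero.one_le]; simp
    rw [ratio_succ, ← ih, ← add_assoc, Nat.factorial_succ, Nat.factorial_succ]
    push_cast
    rw [hn]
    have h1 : ((n - 1 + k).factorial : ℝ) ≠ 0 := by exact_mod_cast Nat.factorial_ne_zero _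
    have h2 : (n : ℝ) + k ≠ 0 := by
      have : (0 : ℝ) < n := by exact_mod_cast NeZero.pos n
      positivity
    rw [show (n : ℝ) - 1 + k + 1 = n + k by ring]
    field_simp
    ring

theorem lintegral_sphere_moment (n : ℕ) [NeZero n] (e : UnitSphere n) (k : ℕ) :
    ∫⁻ η : UnitSphere n, ENNReal.ofReal (‖inner ℂ (e : Cn n) (η : Cn n)‖ ^ (2 * k))
      ∂(sphereMeasure n) = ENNReal.ofReal (ratio 1 n k) := by
  obtain ⟨c, hc0, hct, hc⟩ := lintegral_gaussian n
  set V := ENNReal.ofReal (2 * n) * (volume : Measure (Cn n)) (unitBall n) with hV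
  set S : ℕ → ℝ≥0∞ := fun k => ∫⁻ η : UnitSphere n,
    ENNReal.ofReal (‖inner ℂ (e : Cn n) (η : Cn n)‖ ^ (2 * k)) ∂(sphereMeasure n) with hS
  have hn : (2 * n - 1 : ℕ) = 2 * (n - 1) + 1 := by have := NeZero.one_le (n := n); omega
  have hrad : ∀ k : ℕ, ∫⁻ r in Set.Ioi (0 : ℝ),
      ENNReal.ofReal (r ^ (2 * n - 1 + 2 * k) * Real.exp (-r ^ 2)) =
        ENNReal.ofReal ((n - 1 + k).factorial / 2) := by
    intro k
    have h1 : ∫ r in Set.Ioi (0 : ℝ), r ^ (2 * n - 1 + 2 * k) * Real.exp (-r ^ 2) =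
        (n - 1 + k).factorial / 2 := by
      have h2 := integral_rpow_mul_exp_neg_rpow (p := 2) (q := ((2 * n - 1 + 2 * k : ℕ) : ℝ))
        two_pos (by have := (2 * n - 1 + 2 * k).cast_nonneg (α := ℝ); linarith)
      simp only [Real.rpow_natCast, Real.rpow_two] at h2
      rw [h2, show (((2 * n - 1 + 2 * k : ℕ) : ℝ) + 1) / 2 = ((n - 1 + k : ℕ) : ℝ) + 1 by
        rw [hn]; push_cast; ring, Real.Gamma_nat_eq_factorial]
      ring
    rw [lintegral_ofReal_of_integral_pos, h1]
    · rw [h1]; positivity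
    · exact (ae_restrict_iff' measurableSet_Ioi).2 (ae_of_all _ fun r (hr : 0 < r) => by positivity)
  have key : ∀ k, c * ENNReal.ofReal (k.factorial) =
      ENNReal.ofReal ((n - 1 + k).factorial / 2) * (V * S k) := by
    intro k
    rw [← hc e k, lintegral_volume_polar (by fun_prop), ← hrad k, toSphere_eq_smul, ← hV,
      ← lintegral_mul_const' _ _ (ENNReal.mul_ne_top (ENNReal.mul_ne_top ENNReal.ofReal_ne_top
        (volume_unitBall_ne_top n)) ?_)]
    · refine setLIntegral_congr_fun measurableSet_Ioi fun r (hr : 0 < r) => ?_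
      rw [lintegral_smul_measure, smul_eq_mul, hS]
      simp only
      rw [mul_left_comm, mul_left_comm (ENNReal.ofReal _) V]
      congr 1
      rw [← lintegral_const_mul' _ _ ENNReal.ofReal_ne_top,
        ← lintegral_const_mul' _ _ ENNReal.ofReal_ne_top]
      refine lintegral_congr fun η => ?_
      rw [← ENNReal.ofReal_mul (by positivity), ← ENNReal.ofReal_mul (by positivity)]
      congr 1
      have e1 : inner ℂ (e : Cn n) (r • (η : Cn n)) = (r : ℂ) * inner ℂ (e : Cn n) (η : Cn n) := by
        rw [← Complex.coe_smul, inner_smul_right]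
      rw [e1, norm_mul, Complex.norm_real, norm_smul, norm_sphere, Real.norm_of_nonneg hr.le,
        mul_one, mul_pow, pow_add]
      ring
    · have : S k ≤ ∫⁻ _, 1 ∂(sphereMeasure n) := by
        refine lintegral_mono fun η => ?_
        rw [← ENNReal.ofReal_one]
        refine ENNReal.ofReal_le_ofReal (pow_le_one₀ (norm_nonneg _) ?_)
        have := norm_inner_le_norm (𝕜 := ℂ) (e : Cn n) (η : Cn n)
        rwa [norm_sphere, norm_sphere, mul_one] at this
      rw [lintegral_one, measure_univ] at this
      exact (this.trans_lt ENNReal.one_lt_top).ne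
  have h0 : S 0 = 1 := by simp [hS]
  have hk := key k
  have hk0 := key 0
  rw [h0, mul_one, add_zero, Nat.factorial_zero, Nat.cast_one, ENNReal.ofReal_one, mul_one] at hk0
  rw [hk0] at hk
  have hV0 : V ≠ 0 := by
    intro h; rw [h, mul_zero] at hk0; exact hc0 hk0
  have hVt : V ≠ ⊤ := ENNReal.mul_ne_top ENNReal.ofReal_ne_top (volume_unitBall_ne_top n)
  rw [← factorial_div_eq_ratio]
  change S k = _
  have h5 : ENNReal.ofReal (((n - 1 + k).factorial : ℝ) / 2) ≠ 0 := by
    rw [Ne, ENNReal.ofReal_eq_zero, not_le]; positivity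
  have h6 : ENNReal.ofReal (((n - 1 + k).factorial : ℝ) / 2) * V ≠ ⊤ :=
    ENNReal.mul_ne_top ENNReal.ofReal_ne_top hVt
  rw [← ENNReal.mul_right_inj (mul_ne_zero h5 hV0) h6, mul_assoc, ← hk, mul_right_comm,
    ← ENNReal.ofReal_mul (by positivity), mul_right_comm, ← ENNReal.ofReal_mul (by positivity)]
  congr 2
  field_simp

/-- The weighted volume `(1 - |w|²) ^ b dV` on the part of the unit ball outside radius `ρ`. -/
def shellMeasure (n : ℕ) (ρ b : ℝ) : Measure (Cn n) :=
  ((ballVolume n).restrict (outer n ρ)).withDensity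
    (fun w => ENNReal.ofReal ((1 - ‖w‖ ^ 2) ^ b))

/-- The radial factor of the moments of `shellMeasure`. -/
def radial (n : ℕ) (ρ b : ℝ) (k : ℕ) : ℝ :=
  ∫ r in (max ρ 0)..1, r ^ (2 * n - 1 + 2 * k) * (1 - r ^ 2) ^ b

/-- The integral of `|⟨w, e⟩| ^ (2 * k)` over `shellMeasure n ρ b` for a unit vector `e`, written in
polar coordinates. -/
def moment (n : ℕ) (ρ b : ℝ) (k : ℕ) : ℝ := 2 * n * radial n ρ b k * ratio 1 n k

theorem intervalIntegrable_radial (m : ℕ) {b : ℝ} (hb : -1 < b) {x y : ℝ} (hx : 0 ≤ x)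
    (hx1 : x ≤ 1) (hy : 0 ≤ y) (hy1 : y ≤ 1) :
    IntervalIntegrable (fun r : ℝ => r ^ m * (1 - r ^ 2) ^ b) volume x y := by
  have h1 : IntervalIntegrable (fun r : ℝ => (1 - r) ^ b) volume x y := by
    have := (intervalIntegral.intervalIntegrable_rpow' (a := 1 - x) (b := 1 - y) hb).comp_sub_left 1
    simpa using this
  have h2 : IntervalIntegrable (fun r : ℝ => r ^ m * (1 + r) ^ b * (1 - r) ^ b) volume x y := by
    refine h1.continuousOn_mul ?_
    refine ContinuousOn.mul (by fun_prop) (ContinuousOn.rpow_const (by fun_prop) ?_)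
    intro r hr
    have : 0 ≤ r := (le_min hx hy).trans hr.1
    left; positivity
  refine h2.congr ?_
  intro r hr
  have hr' := Set.uIoc_subset_uIcc hr
  have h3 : 0 ≤ r := (le_min hx hy).trans hr'.1
  have h4 : r ≤ 1 := hr'.2.trans (max_le hx1 hy1)
  simp only
  rw [show 1 - r ^ 2 = (1 + r) * (1 - r) by ring, Real.mul_rpow (by positivity) (by linarith),
    mul_assoc]

theorem radial_pos (n : ℕ) {ρ b : ℝ} (hρ : ρ < 1) (hb : -1 < b) (k : ℕ) : 0 < radial n ρ b k := by
  refine intervalIntegral.intervalIntegral_pos_of_pos_on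
    (intervalIntegrable_radial _ hb (le_max_right _ _) (max_le hρ.le zero_le_one) zero_le_one
      le_rfl)
    (fun r hr => ?_) (max_lt hρ one_pos)
  have h1 : 0 < r := (le_max_right _ _).trans_lt hr.1
  have h2 : 0 < 1 - r ^ 2 := by nlinarith [hr.2]
  positivity

theorem moment_pos (n : ℕ) [NeZero n] {ρ b : ℝ} (hρ : ρ < 1) (hb : -1 < b) (k : ℕ) :
    0 < moment n ρ b k := by
  have := radial_pos n hρ hb k
  have h1 : (0 : ℝ) < n := by exact_mod_cast NeZero.pos n
  have := ratio_pos one_pos h1 k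
  unfold moment; positivity

theorem lintegral_shellMeasure {n : ℕ} (ρ b : ℝ) {F : Cn n → ℝ≥0∞} (hF : Measurable F) :
    ∫⁻ w, F w ∂(shellMeasure n ρ b) =
      ∫⁻ w in outer n ρ, F w * ENNReal.ofReal ((1 - ‖w‖ ^ 2) ^ b) ∂(ballVolume n) := by
  rw [shellMeasure, lintegral_withDensity_eq_lintegral_mul _ (measurable_weight b) hF]
  refine lintegral_congr fun w => ?_
  simp [mul_comm]

theorem lintegral_moment (n : ℕ) [NeZero n] {ρ b : ℝ} (hρ : ρ < 1) (hb : -1 < b)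
    (e : UnitSphere n) (k : ℕ) :
    ∫⁻ w, ENNReal.ofReal (‖inner ℂ (e : Cn n) w‖ ^ (2 * k)) ∂(shellMeasure n ρ b) =
      ENNReal.ofReal (moment n ρ b k) := by
  have ho := (isOpen_outer n ρ).measurableSet
  have hm : Measurable fun w : Cn n => ENNReal.ofReal (‖inner ℂ (e : Cn n) w‖ ^ (2 * k)) *
      ENNReal.ofReal ((1 - ‖w‖ ^ 2) ^ b) := by fun_prop
  rw [lintegral_shellMeasure ρ b (by fun_prop), ← lintegral_indicator ho,
    lintegral_ball_polar (hm.indicator ho)]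
  have hM : max ρ 0 < 1 := max_lt hρ one_pos
  have hr0 : ∀ r ∈ Set.Ioo (max ρ 0) 1, 0 < r ∧ 0 < 1 - r ^ 2 := fun r hr => by
    have h1 : 0 < r := (le_max_right _ _).trans_lt hr.1
    exact ⟨h1, by nlinarith [hr.2]⟩
  have h1 : ∀ r ∈ Set.Ioo (0 : ℝ) 1, ENNReal.ofReal (2 * n * r ^ (2 * n - 1)) *
      ∫⁻ η : UnitSphere n, (outer n ρ).indicator (fun w => ENNReal.ofReal
        (‖inner ℂ (e : Cn n) w‖ ^ (2 * k)) * ENNReal.ofReal ((1 - ‖w‖ ^ 2) ^ b))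
          (r • (η : Cn n)) ∂(sphereMeasure n) =
      (Set.Ioi ρ).indicator (fun r => ENNReal.ofReal (r ^ (2 * n - 1 + 2 * k) * (1 - r ^ 2) ^ b) *
        ENNReal.ofReal (2 * n * ratio 1 n k)) r := by
    intro r hr
    have hr1 : 0 < r := hr.1
    have hr2 : 0 < 1 - r ^ 2 := by nlinarith [hr.2]
    have hnorm : ∀ η : UnitSphere n, ‖r • (η : Cn n)‖ = r := fun η => by
      rw [norm_smul, norm_sphere, mul_one, Real.norm_of_nonneg hr1.le]
    by_cases h : ρ < r
    · rw [Set.indicator_of_mem (Set.mem_Ioi.2 h)]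
      have h2 : ∀ η : UnitSphere n, (outer n ρ).indicator (fun w => ENNReal.ofReal
        (‖inner ℂ (e : Cn n) w‖ ^ (2 * k)) * ENNReal.ofReal ((1 - ‖w‖ ^ 2) ^ b)) (r • (η : Cn n)) =
          ENNReal.ofReal (r ^ (2 * k) * (1 - r ^ 2) ^ b) *
            ENNReal.ofReal (‖inner ℂ (e : Cn n) (η : Cn n)‖ ^ (2 * k)) := by
        intro η
        have e1 : inner ℂ (e : Cn n) (r • (η : Cn n)) =
            (r : ℂ) * inner ℂ (e : Cn n) (η : Cn n) := by
          rw [← Complex.coe_smul, inner_smul_right]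
        rw [Set.indicator_of_mem (show r • (η : Cn n) ∈ outer n ρ from
          ⟨by rw [mem_ball_zero_iff, hnorm]; exact hr.2, by rw [hnorm]; exact h⟩), hnorm, e1,
          norm_mul, Complex.norm_real,
          Real.norm_of_nonneg hr1.le, ← ENNReal.ofReal_mul (by positivity),
          ← ENNReal.ofReal_mul (by positivity)]
        congr 1; ring
      rw [lintegral_congr h2, lintegral_const_mul' _ _ ENNReal.ofReal_ne_top,
        lintegral_sphere_moment, ← ENNReal.ofReal_mul (by positivity),
        ← ENNReal.ofReal_mul (by positivity), ← ENNReal.ofReal_mul (by positivity)]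
      congr 1; rw [pow_add]; ring
    · rw [Set.indicator_of_notMem (by simpa using h)]
      have h2 : ∀ η : UnitSphere n, (outer n ρ).indicator (fun w => ENNReal.ofReal
        (‖inner ℂ (e : Cn n) w‖ ^ (2 * k)) * ENNReal.ofReal ((1 - ‖w‖ ^ 2) ^ b))
          (r • (η : Cn n)) = 0 := by
        intro η
        refine Set.indicator_of_notMem (fun hη => h ?_) _
        have := hη.2; rwa [hnorm] at this
      rw [lintegral_congr h2]; simp
  have hset : Set.Ioi ρ ∩ Set.Ioo (0 : ℝ) 1 = Set.Ioo (max ρ 0) 1 := by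
    ext r; simp only [Set.mem_inter_iff, Set.mem_Ioi, Set.mem_Ioo, max_lt_iff]; tauto
  rw [setLIntegral_congr_fun measurableSet_Ioo h1, setLIntegral_indicator measurableSet_Ioi, hset,
    lintegral_mul_const' _ _ ENNReal.ofReal_ne_top]
  have hpos := radial_pos n hρ hb k
  rw [radial, intervalIntegral.integral_of_le hM.le, integral_Ioc_eq_integral_Ioo] at hpos
  rw [lintegral_ofReal_of_integral_pos hpos ((ae_restrict_iff' measurableSet_Ioo).2
    (ae_of_all _ fun r hr => by
      obtain ⟨h2, h3⟩ := hr0 r hr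
      simp only [Pi.zero_apply]; positivity)), ← ENNReal.ofReal_mul hpos.le, moment, radial,
      intervalIntegral.integral_of_le hM.le, integral_Ioc_eq_integral_Ioo]
  congr 1; ring

theorem isFiniteMeasure_shellMeasure (n : ℕ) [NeZero n] {ρ b : ℝ} (hρ : ρ < 1) (hb : -1 < b) :
    IsFiniteMeasure (shellMeasure n ρ b) := by
  have hne : (Metric.sphere (0 : Cn n) 1).Nonempty := NormedSpace.sphere_nonempty.2 zero_le_one
  obtain ⟨e, he⟩ := hne
  have h := lintegral_moment n hρ hb ⟨e, he⟩ 0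
  simp only [mul_zero, pow_zero, ENNReal.ofReal_one, lintegral_one] at h
  exact ⟨by rw [h]; exact ENNReal.ofReal_lt_top⟩

theorem radial_succ (n : ℕ) [NeZero n] {ρ b : ℝ} (hρ : ρ ≤ 0) (hb : -1 < b) (k : ℕ) :
    radial n ρ b (k + 1) = radial n ρ b k * ((n + k) / (n + b + 1 + k)) := by
  have hn := NeZero.one_le (n := n)
  have hn0 : (0 : ℝ) < n := by exact_mod_cast NeZero.pos n
  have hb1 : 0 < b + 1 := by linarith
  set m := n + k with hm
  have hm0 : (0 : ℝ) < m := by rw [hm]; push_cast; positivity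
  have e1 : 2 * n - 1 + 2 * k = 2 * m - 1 := by omega
  have e2 : 2 * n - 1 + 2 * (k + 1) = 2 * m + 1 := by omega
  have hi1 := intervalIntegrable_radial (2 * m - 1) hb (x := 0) (y := 1) le_rfl zero_le_one
    zero_le_one le_rfl
  have hi2 := intervalIntegrable_radial (2 * m + 1) hb (x := 0) (y := 1) le_rfl zero_le_one
    zero_le_one le_rfl
  have h := intervalIntegral.integral_eq_sub_of_hasDerivAt_of_le (a := 0) (b := 1)
    (f := fun r : ℝ => r ^ (2 * m) * (1 - r ^ 2) ^ (b + 1))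
    (f' := fun r : ℝ => 2 * m * (r ^ (2 * m - 1) * (1 - r ^ 2) ^ b) -
      2 * (m + b + 1) * (r ^ (2 * m + 1) * (1 - r ^ 2) ^ b)) zero_le_one
    (ContinuousOn.mul (by fun_prop) (ContinuousOn.rpow_const (by fun_prop)
      fun r _ => Or.inr hb1.le)) (fun r hr => by
      have h1 : 0 < 1 - r ^ 2 := by nlinarith [hr.1, hr.2]
      have h2 : HasDerivAt (fun r : ℝ => 1 - r ^ 2) (-(2 * r)) r := by
        simpa using (hasDerivAt_pow 2 r).const_sub 1
      have h3 := (hasDerivAt_pow (2 * m) r).mul (h2.rpow_const (p := b + 1) (Or.inl h1.ne'))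
      refine h3.congr_deriv ?_
      rw [add_sub_cancel_right, Real.rpow_add_one h1.ne']
      have e3 : r ^ (2 * m + 1) = r ^ (2 * m - 1) * r ^ 2 := by
        rw [← pow_add]; congr 1; omega
      have e4 : r ^ (2 * m) = r ^ (2 * m - 1) * r := by
        rw [← pow_succ]; congr 1; omega
      rw [e3, e4]
      push_cast
      ring) ((hi1.const_mul _).sub (hi2.const_mul _))
  rw [intervalIntegral.integral_sub (hi1.const_mul _) (hi2.const_mul _),
    intervalIntegral.integral_const_mul, intervalIntegral.integral_const_mul] at h
  have hz : (0 : ℝ) ^ (2 * m) = 0 := zero_pow (by omega)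
  rw [hz] at h
  simp only [one_pow, sub_self, zero_mul, Real.zero_rpow hb1.ne', mul_zero] at h
  rw [radial, radial, max_eq_right hρ, e1, e2]
  have h5 : (n : ℝ) + k = m := by rw [hm]; push_cast; ring
  have h6 : (n : ℝ) + b + 1 + k = m + b + 1 := by rw [← h5]; ring
  rw [h5, h6]
  have h7 : (m : ℝ) + b + 1 ≠ 0 := by rw [add_assoc]; positivity
  field_simp
  linarith

theorem radial_eq (n : ℕ) [NeZero n] {ρ b : ℝ} (hρ : ρ ≤ 0) (hb : -1 < b) (k : ℕ) :
    radial n ρ b k = radial n ρ b 0 * ratio n (n + b + 1) k := by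
  induction k with
  | zero => simp [ratio_zero]
  | succ k ih => rw [radial_succ n hρ hb, ih, ratio_succ]; ring

theorem moment_eq (n : ℕ) [NeZero n] {ρ b : ℝ} (hρ : ρ ≤ 0) (hb : -1 < b) (k : ℕ) :
    moment n ρ b k = moment n ρ b 0 * ratio 1 (n + b + 1) k := by
  have hn0 : (0 : ℝ) < n := by exact_mod_cast NeZero.pos n
  rw [moment, moment, radial_eq n hρ hb, ratio_zero,
    ← ratio_mul_ratio (a := 1) (b := n) (c := n + b + 1) (fun j => by positivity)]
  ring

theorem isSymbol_inv_moment (n : ℕ) [NeZero n] {ρ b : ℝ} (hρ : ρ < 1) (hb : -1 < b) :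
    IsSymbol (n + b) (fun k => (moment n ρ b k)⁻¹) := by
  have hn0 : (0 : ℝ) < n := by exact_mod_cast NeZero.pos n
  have hb1 : 0 < b + 1 := by linarith
  have p1 : ∀ j : ℕ, (1 : ℝ) + j ≠ 0 := fun j => by positivity
  have p2 : ∀ j : ℕ, (n : ℝ) + b + 1 + j ≠ 0 := fun j => by
    rw [add_assoc (n : ℝ)]; positivity
  have p3 : 0 < (n : ℝ) + b + 1 := by linarith
  -- on the full ball the moments are quotients of rising factorials
  have hfull : ∀ ρ' : ℝ, ρ' ≤ 0 → IsSymbol (n + b) (fun k => (moment n ρ' b k)⁻¹) := by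
    intro ρ' hρ'
    have e : (fun k => (moment n ρ' b k)⁻¹) = (moment n ρ' b 0)⁻¹ • ratio (n + b + 1) 1 := by
      funext k
      have e1 := ratio_mul_ratio (a := n + b + 1) (b := 1) (c := n + b + 1) p1 k
      rw [ratio_self p2] at e1
      rw [moment_eq n hρ' hb, mul_inv, Pi.smul_apply, smul_eq_mul, eq_inv_of_mul_eq_one_left e1]
    rw [e]
    have := (isSymbol_ratio p2 p1).const_smul (moment n ρ' b 0)⁻¹
    rwa [add_sub_cancel_right] at this
  rcases le_or_gt ρ 0 with h0 | h0
  · exact hfull ρ h0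
  -- otherwise the difference to the case of the full ball is exponentially small
  set A := radial n 0 b with hA
  set A' := radial n ρ b with hA'
  have hApos : ∀ k, 0 < A k := radial_pos n one_pos hb
  have hApos' : ∀ k, 0 < A' k := radial_pos n hρ hb
  set D : ℕ → ℝ := fun k => ∫ r in (0 : ℝ)..ρ, r ^ (2 * n - 1 + 2 * k) * (1 - r ^ 2) ^ b with hD
  have hi : ∀ {x y : ℝ} (m : ℕ), 0 ≤ x → x ≤ 1 → 0 ≤ y → y ≤ 1 →
      IntervalIntegrable (fun r : ℝ => r ^ m * (1 - r ^ 2) ^ b) volume x y :=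
    fun m => intervalIntegrable_radial m hb
  have hsum : ∀ k, A k = D k + A' k := by
    intro k
    rw [hA, hA', hD, radial, radial, max_self, max_eq_left h0.le,
      intervalIntegral.integral_add_adjacent_intervals (hi _ le_rfl zero_le_one h0.le hρ.le)
        (hi _ h0.le hρ.le zero_le_one le_rfl)]
  have hD1 : ∀ k, D k ≤ ρ ^ (2 * k) * D 0 := by
    intro k
    rw [hD]
    simp only
    rw [← intervalIntegral.integral_const_mul]
    refine intervalIntegral.integral_mono_on h0.le (hi _ le_rfl zero_le_one h0.le hρ.le)
      ((hi _ le_rfl zero_le_one h0.le hρ.le).const_mul _) fun r hr => ?_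
    have h1 : 0 ≤ 1 - r ^ 2 := by nlinarith [hr.1, hr.2]
    have h2 : r ^ (2 * k) ≤ ρ ^ (2 * k) := pow_le_pow_left₀ hr.1 hr.2 _
    have h3 : 0 ≤ r ^ (2 * n - 1) * (1 - r ^ 2) ^ b := by have := hr.1; positivity
    rw [pow_add, mul_zero, add_zero]
    nlinarith [mul_le_mul_of_nonneg_right h2 h3]
  have hA1 : ∀ k, ρ ^ (2 * k) * A' 0 ≤ A' k := by
    intro k
    rw [hA', radial, radial, max_eq_left h0.le, ← intervalIntegral.integral_const_mul]
    refine intervalIntegral.integral_mono_on hρ.le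
      ((hi _ h0.le hρ.le zero_le_one le_rfl).const_mul _) (hi _ h0.le hρ.le zero_le_one le_rfl)
      fun r hr => ?_
    have hr0 : 0 ≤ r := h0.le.trans hr.1
    have h1 : 0 ≤ 1 - r ^ 2 := by nlinarith [hr.2]
    have h2 : ρ ^ (2 * k) ≤ r ^ (2 * k) := pow_le_pow_left₀ h0.le hr.1 _
    have h3 : 0 ≤ r ^ (2 * n - 1) * (1 - r ^ 2) ^ b := by positivity
    rw [pow_add r _ (2 * k), mul_zero, add_zero]
    nlinarith [mul_le_mul_of_nonneg_right h2 h3]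
  have hD0 : 0 ≤ D 0 := by
    refine intervalIntegral.integral_nonneg h0.le fun r hr => ?_
    have h1 : 0 ≤ 1 - r ^ 2 := by nlinarith [hr.1, hr.2]
    have := hr.1; positivity
  have hDk : ∀ k, 0 ≤ D k := by
    intro k
    refine intervalIntegral.integral_nonneg h0.le fun r hr => ?_
    have h1 : 0 ≤ 1 - r ^ 2 := by nlinarith [hr.1, hr.2]
    have := hr.1; positivity
  set K := A 0 / A' 0 with hK
  have hK0 : 0 < K := div_pos (hApos 0) (hApos' 0)
  have hAK : ∀ k, A k ≤ K * A' k := by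
    intro k
    have h1 : D k * A' 0 ≤ D 0 * A' k := by
      calc D k * A' 0 ≤ ρ ^ (2 * k) * D 0 * A' 0 :=
            mul_le_mul_of_nonneg_right (hD1 k) (hApos' 0).le
        _ = D 0 * (ρ ^ (2 * k) * A' 0) := by ring
        _ ≤ _ := mul_le_mul_of_nonneg_left (hA1 k) hD0
    rw [hK, div_mul_eq_mul_div, le_div_iff₀ (hApos' 0), hsum k, hsum 0]
    linarith
  obtain ⟨C₁, hC10, hC₁⟩ := (isSymbol_ratio (a := n + b + 1) (b := 1) p2 p1).exists_bound
  obtain ⟨C₂, hC20, hC₂⟩ := (isSymbol_ratio (a := n + b + 1) (b := n) p2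
    (fun j => by positivity)).exists_bound
  obtain ⟨C₃, hC30, hC₃⟩ := exists_geometric_bound h0.le hρ
    (-((n + b + 1 - 1) + (n + b + 1 - n)))
  have hgeo : IsSymbol (n + b) (fun k => (moment n ρ b k)⁻¹ - (moment n 0 b k)⁻¹) := by
    refine isSymbol_of_geometric h0.le hρ
      (C := D 0 * K * ((moment n 0 b 0)⁻¹ * C₁ * ((A 0)⁻¹ * C₂) * C₃)) (fun k => ?_) _
    have hk1 : (0 : ℝ) < (k : ℝ) + 1 := by positivity
    have hr1 := ratio_pos one_pos hn0 k
    -- the reciprocals of `A k` and of the full moment grow polynomially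
    have b1 : (A k)⁻¹ ≤ (A 0)⁻¹ * (C₂ * ((k : ℝ) + 1) ^ (n + b + 1 - n)) := by
      have e1 := ratio_mul_ratio (a := n + b + 1) (b := n) (c := n + b + 1)
        (fun j => by positivity) k
      rw [ratio_self p2] at e1
      rw [hA, radial_eq n le_rfl hb, mul_inv, ← eq_inv_of_mul_eq_one_left e1]
      have := (le_abs_self _).trans (hC₂ k)
      have := (hApos 0).le
      gcongr
    have b2 : (moment n 0 b k)⁻¹ ≤
        (moment n 0 b 0)⁻¹ * (C₁ * ((k : ℝ) + 1) ^ (n + b + 1 - 1)) := by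
      have e1 := ratio_mul_ratio (a := n + b + 1) (b := 1) (c := n + b + 1) p1 k
      rw [ratio_self p2] at e1
      rw [moment_eq n le_rfl hb, mul_inv, ← eq_inv_of_mul_eq_one_left e1]
      have := (le_abs_self _).trans (hC₁ k)
      have := (moment_pos n one_pos hb 0).le
      gcongr
    have hm0 := moment_pos n one_pos hb k
    have e2 : (moment n ρ b k)⁻¹ - (moment n 0 b k)⁻¹ =
        D k * (A' k)⁻¹ * (moment n 0 b k)⁻¹ := by
      have h1 := hsum k
      have h2 := (hApos' k).ne'
      have h3 := (hApos k).ne'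
      rw [moment, moment, ← hA, ← hA']
      field_simp
      linarith
    have b3 : (A' k)⁻¹ ≤ K * (A k)⁻¹ := by
      have := hAK k
      have h2 := hApos' k
      have h3 := hApos k
      rw [inv_eq_one_div, div_le_iff₀ h2, mul_assoc, mul_comm (A k)⁻¹, ← mul_assoc,
        ← div_eq_mul_inv, le_div_iff₀ h3, one_mul]
      exact this
    rw [e2, abs_of_nonneg (by have := hDk k; have := (hApos' k).le; positivity)]
    have hAi : 0 ≤ (A 0)⁻¹ := (inv_pos.2 (hApos 0)).le
    have hAi' : 0 ≤ (A' k)⁻¹ := (inv_pos.2 (hApos' k)).le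
    have hAik : 0 ≤ (A k)⁻¹ := (inv_pos.2 (hApos k)).le
    have hmi : 0 ≤ (moment n 0 b 0)⁻¹ := (inv_pos.2 (moment_pos n one_pos hb 0)).le
    calc D k * (A' k)⁻¹ * (moment n 0 b k)⁻¹
        ≤ (ρ ^ (2 * k) * D 0) * (K * ((A 0)⁻¹ * (C₂ * ((k : ℝ) + 1) ^ (n + b + 1 - n)))) *
          ((moment n 0 b 0)⁻¹ * (C₁ * ((k : ℝ) + 1) ^ (n + b + 1 - 1))) := by
          gcongr
          · exact hD1 k
          · exact b3.trans (by gcongr)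
      _ = D 0 * K * ((moment n 0 b 0)⁻¹ * C₁ * ((A 0)⁻¹ * C₂)) * ρ ^ k * (ρ ^ k *
          ((k : ℝ) + 1) ^ ((n + b + 1 - 1) + (n + b + 1 - n))) := by
          rw [Real.rpow_add hk1, two_mul k, pow_add]; ring
      _ ≤ D 0 * K * ((moment n 0 b 0)⁻¹ * C₁ * ((A 0)⁻¹ * C₂)) * ρ ^ k *
          (C₃ * ((k : ℝ) + 1) ^ (-((n + b + 1 - 1) + (n + b + 1 - n))) *
          ((k : ℝ) + 1) ^ ((n + b + 1 - 1) + (n + b + 1 - n))) := by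
          gcongr
          exact hC₃ k
      _ = _ := by
          rw [mul_assoc C₃, ← Real.rpow_add hk1, neg_add_cancel, Real.rpow_zero]; ring
  have := (hfull 0 le_rfl).add hgeo
  convert this using 1
  funext k
  simp

/-! ### Reproducing formulas -/

theorem lintegral_shellMeasure_volume {n : ℕ} (ρ b : ℝ) {F : Cn n → ℝ≥0∞} (hF : Measurable F) :
    ∫⁻ w, F w ∂(shellMeasure n ρ b) = ((volume : Measure (Cn n)) (unitBall n))⁻¹ *
      ∫⁻ w, F w * (outer n ρ).indicator (fun w => ENNReal.ofReal ((1 - ‖w‖ ^ 2) ^ b)) w := by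
  have ho := (isOpen_outer n ρ).measurableSet
  have hsub : outer n ρ ⊆ unitBall n := fun w hw => hw.1
  rw [lintegral_shellMeasure ρ b hF, ballVolume, Measure.restrict_smul, lintegral_smul_measure,
    Measure.restrict_restrict ho, Set.inter_eq_left.2 hsub, ← lintegral_indicator ho, smul_eq_mul]
  congr 1
  refine lintegral_congr fun w => ?_
  by_cases hw : w ∈ outer n ρ
  · rw [Set.indicator_of_mem hw, Set.indicator_of_mem hw]
  · rw [Set.indicator_of_notMem hw, Set.indicator_of_notMem hw, mul_zero]

theorem measurePreserving_shellMeasure {n : ℕ} (ρ b : ℝ) (U : Cn n →ₗ[ℂ] Cn n)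
    (hU : ∀ w, ‖U w‖ = ‖w‖) :
    MeasurePreserving U (shellMeasure n ρ b) (shellMeasure n ρ b) := by
  set V : Cn n ≃ₗᵢ[ℂ] Cn n := LinearIsometry.toLinearIsometryEquiv ⟨U, hU⟩ rfl with hV
  have hVU : ∀ w, V w = U w := fun w => rfl
  have hvol : MeasurePreserving V (volume : Measure (Cn n)) volume :=
    LinearIsometryEquiv.measurePreserving (E := Cn n) (F := Cn n)
      ⟨V.toLinearEquiv.restrictScalars ℝ, V.norm_map⟩
  have hmU : Measurable U := hvol.measurable
  refine ⟨hmU, Measure.ext fun s hs => ?_⟩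
  have ho := (isOpen_outer n ρ).measurableSet
  have h1 : ∀ s, MeasurableSet s → shellMeasure n ρ b s =
      ∫⁻ w, s.indicator 1 w ∂(shellMeasure n ρ b) := fun s hs => (lintegral_indicator_one hs).symm
  rw [Measure.map_apply hmU hs, h1 s hs, h1 _ (hmU hs),
    lintegral_shellMeasure_volume ρ b (measurable_one.indicator hs),
    lintegral_shellMeasure_volume ρ b (measurable_one.indicator (hmU hs))]
  congr 1
  have hm : Measurable fun w : Cn n => s.indicator (1 : Cn n → ℝ≥0∞) w *
      (outer n ρ).indicator (fun w => ENNReal.ofReal ((1 - ‖w‖ ^ 2) ^ b)) w :=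
    (measurable_one.indicator hs).mul ((measurable_weight b).indicator ho)
  rw [← hvol.lintegral_comp hm]
  refine lintegral_congr fun w => ?_
  have h2 : (outer n ρ).indicator (fun w => ENNReal.ofReal ((1 - ‖w‖ ^ 2) ^ b)) (V w) =
      (outer n ρ).indicator (fun w => ENNReal.ofReal ((1 - ‖w‖ ^ 2) ^ b)) w := by
    classical
    simp only [Set.indicator_apply, outer, Set.mem_ofPred_eq, mem_unitBall_iff, V.norm_map]
  rw [h2]
  rfl

theorem ae_shellMeasure_mem (n : ℕ) (ρ b : ℝ) : ∀ᵐ w ∂(shellMeasure n ρ b), w ∈ outer n ρ :=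
  (withDensity_absolutelyContinuous _ _).ae_le (ae_restrict_mem (isOpen_outer n ρ).measurableSet)

theorem integral_comp_measurePreserving {X : Type*} [MeasurableSpace X] {μ : Measure X}
    {T : X → X} (hT : MeasurePreserving T μ μ) {E : Type*} [NormedAddCommGroup E]
    [NormedSpace ℝ E] [MeasurableSpace E] [BorelSpace E] [SecondCountableTopology E] {g : X → E}
    (hg : Measurable g) : ∫ w, g (T w) ∂μ = ∫ w, g w ∂μ := by
  rw [← integral_map hT.measurable.aemeasurable hg.aestronglyMeasurable, hT.map_eq]

/-- Averaging over a circle of measure preserving maps does not change an integral. -/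
theorem integral_circleAverage {n : ℕ} {μ : Measure (Cn n)} [IsFiniteMeasure μ]
    {V : ℂ → Cn n → Cn n} (hV : Measurable (Function.uncurry V))
    (hp : ∀ ξ, ‖ξ‖ = 1 → MeasurePreserving (V ξ) μ μ) {H : Cn n → ℂ} (hH : Measurable H)
    (hHi : Integrable H μ) :
    Integrable (fun w => Real.circleAverage (fun ξ => H (V ξ w)) 0 1) μ ∧
      ∫ w, Real.circleAverage (fun ξ => H (V ξ w)) 0 1 ∂μ = ∫ w, H w ∂μ := by
  set ν := (volume : Measure ℝ).restrict (Set.Ioc 0 (2 * Real.pi)) with hν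
  set K : ℝ × Cn n → ℂ := fun x => H (V (circleMap 0 1 x.1) x.2) with hK
  have hcm : Measurable (circleMap 0 1) := (continuous_circleMap 0 1).measurable
  have hKm : Measurable K := hH.comp (hV.comp ((hcm.comp measurable_fst).prodMk measurable_snd))
  have hone : ∀ θ : ℝ, ‖circleMap 0 1 θ‖ = 1 := fun θ => by simp
  have hKi : Integrable K (ν.prod μ) := by
    rw [integrable_prod_iff hKm.aestronglyMeasurable]
    refine ⟨ae_of_all _ fun θ => (hp _ (hone θ)).integrable_comp_of_integrable hHi, ?_⟩
    have : ∀ θ : ℝ, ∫ w, ‖K (θ, w)‖ ∂μ = ∫ w, ‖H w‖ ∂μ := fun θ =>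
      integral_comp_measurePreserving (hp _ (hone θ)) hH.norm
    simp_rw [this]
    exact integrable_const _
  have havg : ∀ w, Real.circleAverage (fun ξ => H (V ξ w)) 0 1 =
      (2 * Real.pi)⁻¹ • ∫ θ, K (θ, w) ∂ν := by
    intro w
    rw [Real.circleAverage_def, intervalIntegral.integral_of_le Real.two_pi_pos.le]
  simp_rw [havg]
  refine ⟨hKi.integral_prod_right.fun_smul _, ?_⟩
  rw [integral_smul, ← integral_integral_swap hKi]
  have : ∀ θ : ℝ, ∫ w, K (θ, w) ∂μ = ∫ w, H w ∂μ := fun θ =>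
    integral_comp_measurePreserving (hp _ (hone θ)) hH
  simp_rw [this]
  rw [integral_const, smul_smul, hν, measureReal_restrict_apply_univ, Real.volume_real_Ioc_of_le
    Real.two_pi_pos.le, sub_zero, inv_mul_cancel₀ Real.two_pi_pos.ne', one_smul]

theorem inner_eq_sum {n : ℕ} (u v : Cn n) :
    inner ℂ u v = ∑ i, v i * (starRingEnd ℂ) (u i) := PiLp.inner_apply u v

theorem homogPart_congr {n : ℕ} {f g : Cn n → ℂ} (hg : DifferentiableOn ℂ g (unitBall n))
    (h : ∀ z ∈ unitBall n, f z = g z) (k : ℕ) (z : Cn n) : homogPart f k z = homogPart g k z := by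
  obtain ⟨r, hr, h1, -⟩ := exists_slice_radius z
  refine homogPart_eq_of_hasSum (P := homogPart g) (fun k w => homogPart_smul hg w k z) hr
    (fun w hw => ?_) k
  have h2 : ‖w • z‖ < 1 := by
    rw [norm_smul]
    rcases (norm_nonneg z).eq_or_lt with h0 | h0
    · rw [← h0, mul_zero]; exact one_pos
    · exact (mul_lt_mul_of_pos_right hw h0).trans_le h1
  rw [h _ (mem_unitBall_iff.2 h2)]
  exact hasSum_homogPart hg h2

/-- The unitary map which rotates the orthogonal complement of the unit vector `e` by `ξ`. -/
def twist {n : ℕ} (e : UnitSphere n) (ξ : ℂ) : Cn n →ₗ[ℂ] Cn n :=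
  ξ • LinearMap.id + (1 - ξ) • ((innerSL ℂ (e : Cn n)).smulRight (e : Cn n)).toLinearMap

theorem twist_apply {n : ℕ} (e : UnitSphere n) (ξ : ℂ) (w : Cn n) :
    twist e ξ w = inner ℂ (e : Cn n) w • (e : Cn n) +
      ξ • (w - inner ℂ (e : Cn n) w • (e : Cn n)) := by
  simp only [twist, LinearMap.add_apply, LinearMap.smul_apply, LinearMap.id_apply,
    ContinuousLinearMap.coe_coe, ContinuousLinearMap.smulRight_apply, innerSL_apply_apply]
  module

theorem inner_self_sphere {n : ℕ} (e : UnitSphere n) : inner ℂ (e : Cn n) (e : Cn n) = 1 := by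
  rw [inner_self_eq_norm_sq_to_K, norm_sphere]; simp

theorem inner_sub_proj {n : ℕ} (e : UnitSphere n) (w : Cn n) :
    inner ℂ (e : Cn n) (w - inner ℂ (e : Cn n) w • (e : Cn n)) = 0 := by
  rw [inner_sub_right, inner_smul_right, inner_self_sphere, mul_one, sub_self]

theorem inner_twist {n : ℕ} (e : UnitSphere n) (ξ : ℂ) (w : Cn n) :
    inner ℂ (e : Cn n) (twist e ξ w) = inner ℂ (e : Cn n) w := by
  rw [twist_apply, inner_add_right, inner_smul_right, inner_smul_right, inner_self_sphere,
    inner_sub_proj, mul_one, mul_zero, add_zero]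

theorem norm_twist_sq {n : ℕ} (e : UnitSphere n) (ξ : ℂ) (w : Cn n) :
    ‖twist e ξ w‖ ^ 2 = ‖inner ℂ (e : Cn n) w‖ ^ 2 +
      ‖ξ‖ ^ 2 * ‖w - inner ℂ (e : Cn n) w • (e : Cn n)‖ ^ 2 := by
  have h := norm_add_sq_eq_norm_sq_add_norm_sq_of_inner_eq_zero (𝕜 := ℂ)
    (inner ℂ (e : Cn n) w • (e : Cn n)) (ξ • (w - inner ℂ (e : Cn n) w • (e : Cn n))) (by
      rw [inner_smul_left, inner_smul_right, inner_sub_proj, mul_zero, mul_zero])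
  rw [twist_apply, sq, h, norm_smul, norm_smul, norm_sphere]
  ring

theorem twist_one {n : ℕ} (e : UnitSphere n) (w : Cn n) : twist e 1 w = w := by
  rw [twist_apply]; module

theorem norm_twist_le {n : ℕ} (e : UnitSphere n) {ξ : ℂ} (hξ : ‖ξ‖ ≤ 1) (w : Cn n) :
    ‖twist e ξ w‖ ≤ ‖w‖ := by
  have h1 := norm_twist_sq e 1 w
  rw [twist_one, norm_one, one_pow, one_mul] at h1
  refine (pow_le_pow_iff_left₀ (norm_nonneg _) (norm_nonneg _) two_ne_zero).1 ?_
  rw [norm_twist_sq, h1]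
  have : ‖ξ‖ ^ 2 ≤ 1 := pow_le_one₀ (norm_nonneg _) hξ
  nlinarith [sq_nonneg ‖w - inner ℂ (e : Cn n) w • (e : Cn n)‖]

theorem norm_twist {n : ℕ} (e : UnitSphere n) {ξ : ℂ} (hξ : ‖ξ‖ = 1) (w : Cn n) :
    ‖twist e ξ w‖ = ‖w‖ := by
  have h1 := norm_twist_sq e 1 w
  have h2 := norm_twist_sq e ξ w
  rw [twist_one, norm_one] at h1
  rw [hξ, ← h1] at h2
  exact (pow_left_inj₀ (norm_nonneg _) (norm_nonneg _) two_ne_zero).1 h2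

section Reproducing

variable {n : ℕ} {ρ b : ℝ} {f : Cn n → ℂ}

theorem integrable_mul_inner_pow (hfi : Integrable f (shellMeasure n ρ b)) (z : Cn n) (k : ℕ) :
    Integrable (fun w => f w * (inner ℂ w z) ^ k) (shellMeasure n ρ b) := by
  refine hfi.mul_bdd (c := ‖z‖ ^ k) (by fun_prop) ?_
  filter_upwards [ae_shellMeasure_mem n ρ b] with w hw
  have hw1 := (mem_unitBall_iff.1 hw.1).le
  rw [norm_pow]
  refine pow_le_pow_left₀ (norm_nonneg _) ((norm_inner_le_norm w z).trans ?_) k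
  exact mul_le_of_le_one_left (norm_nonneg _) hw1

theorem continuousOn_dilate (hf : DifferentiableOn ℂ f (unitBall n)) {r : ℝ} (hr0 : 0 ≤ r)
    (hr1 : r < 1) : ContinuousOn (dilate r f) (Metric.closedBall 0 1) := by
  refine hf.continuousOn.comp (by fun_prop) fun w hw => ?_
  rw [mem_closedBall_zero_iff] at hw
  rw [mem_unitBall_iff, norm_smul, Complex.norm_real, Real.norm_of_nonneg hr0]
  nlinarith [norm_nonneg w]

theorem differentiableOn_dilate (hf : DifferentiableOn ℂ f (unitBall n)) {r : ℝ} (hr0 : 0 ≤ r)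
    (hr1 : r ≤ 1) : DifferentiableOn ℂ (dilate r f) (unitBall n) := by
  refine hf.comp (by fun_prop) fun w hw => ?_
  rw [mem_unitBall_iff] at hw
  rw [mem_unitBall_iff, norm_smul, Complex.norm_real, Real.norm_of_nonneg hr0]
  nlinarith [norm_nonneg w]

theorem exists_norm_dilate_le (hf : DifferentiableOn ℂ f (unitBall n)) {r : ℝ} (hr0 : 0 ≤ r)
    (hr1 : r < 1) : ∃ M : ℝ, 0 ≤ M ∧ ∀ z, ‖z‖ ≤ 1 → ‖dilate r f z‖ ≤ M := by
  obtain ⟨M, hM⟩ := (isCompact_closedBall (0 : Cn n) 1).exists_bound_of_continuousOn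
    (continuousOn_dilate hf hr0 hr1)
  exact ⟨M, (norm_nonneg _).trans (hM 0 (by simp)),
    fun z hz => hM z (mem_closedBall_zero_iff.2 hz)⟩

variable [NeZero n]

theorem integral_mul_inner_pow_sphere (hρ : ρ < 1) (hb : -1 < b)
    (hf : DifferentiableOn ℂ f (unitBall n)) (hfm : Measurable f)
    (hfi : Integrable f (shellMeasure n ρ b)) (k : ℕ) (e : UnitSphere n) :
    ∫ w, f w * (inner ℂ w (e : Cn n)) ^ k ∂(shellMeasure n ρ b) =
      moment n ρ b k * homogPart f k e := by
  have := isFiniteMeasure_shellMeasure n hρ hb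
  set P : Cn n → Cn n := fun w => inner ℂ (e : Cn n) w • (e : Cn n) with hP
  have hPle : ∀ w, ‖P w‖ ≤ ‖w‖ := fun w => by
    rw [hP]; simp only
    rw [norm_smul, norm_sphere, mul_one]
    simpa [norm_sphere] using norm_inner_le_norm (𝕜 := ℂ) (e : Cn n) w
  -- averaging over rotations of the orthogonal complement of `e` replaces `f w` by `f (P w)`
  have hV1 : Measurable (Function.uncurry fun (ξ : ℂ) (w : Cn n) => twist e ξ w) := by
    simp only [Function.uncurry_def, twist_apply]
    fun_prop
  have hi1 := integrable_mul_inner_pow hfi (e : Cn n) k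
  have h1 := integral_circleAverage hV1
    (fun ξ hξ => measurePreserving_shellMeasure ρ b (twist e ξ) (norm_twist e hξ))
    (H := fun w => f w * (inner ℂ w (e : Cn n)) ^ k) (by fun_prop) hi1
  have e1 : (fun w => Real.circleAverage (fun ξ => f (twist e ξ w) *
      (inner ℂ (twist e ξ w) (e : Cn n)) ^ k) 0 1) =ᵐ[shellMeasure n ρ b]
      fun w => f (P w) * (inner ℂ w (e : Cn n)) ^ k := by
    filter_upwards [ae_shellMeasure_mem n ρ b] with w hw
    have hw1 := mem_unitBall_iff.1 hw.1
    have h2 : ∀ ξ, inner ℂ (twist e ξ w) (e : Cn n) = inner ℂ w (e : Cn n) := fun ξ => by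
      rw [← inner_conj_symm, inner_twist, inner_conj_symm]
    simp_rw [h2]
    have h3 : DiffContOnCl ℂ (fun ξ : ℂ => f (twist e ξ w) * (inner ℂ w (e : Cn n)) ^ k)
        (Metric.ball 0 |1|) := by
      apply DifferentiableOn.diffContOnCl
      refine DifferentiableOn.mul_const (hf.comp ?_ fun ξ hξ => ?_) _
      · simp only [twist_apply]; fun_prop
      · rw [abs_one, closure_ball _ one_ne_zero, mem_closedBall_zero_iff] at hξ
        exact mem_unitBall_iff.2 ((norm_twist_le e hξ w).trans_lt hw1)
    rw [h3.circleAverage, twist_apply, zero_smul, add_zero]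
  have hi2 : Integrable (fun w => f (P w) * (inner ℂ w (e : Cn n)) ^ k) (shellMeasure n ρ b) :=
    h1.1.congr e1
  -- averaging over rotations of the ball extracts the homogeneous part
  have hV2 : Measurable (Function.uncurry fun (ξ : ℂ) (w : Cn n) => ξ • w) := by
    simp only [Function.uncurry_def]; fun_prop
  have h2 := integral_circleAverage hV2 (fun ξ hξ => measurePreserving_shellMeasure ρ b
    (ξ • LinearMap.id) (fun w => by simp [norm_smul, hξ]))
    (H := fun w => f (P w) * (inner ℂ w (e : Cn n)) ^ k) (by fun_prop) hi2
  have e2 : (fun w => Real.circleAverage (fun ξ => f (P (ξ • w)) *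
      (inner ℂ (ξ • w) (e : Cn n)) ^ k) 0 1) =ᵐ[shellMeasure n ρ b]
      fun w => ((‖inner ℂ (e : Cn n) w‖ ^ (2 * k) : ℝ) : ℂ) * homogPart f k e := by
    filter_upwards [ae_shellMeasure_mem n ρ b] with w hw
    have hw1 := mem_unitBall_iff.1 hw.1
    have h3 : Set.EqOn (fun ξ : ℂ => f (P (ξ • w)) * (inner ℂ (ξ • w) (e : Cn n)) ^ k)
        (fun ξ => (inner ℂ w (e : Cn n)) ^ k • (ξ⁻¹ ^ k * f (ξ • P w)))
        (Metric.sphere 0 |1|) := by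
      intro ξ hξ
      rw [abs_one, mem_sphere_zero_iff_norm] at hξ
      have e3 : P (ξ • w) = ξ • P w := by
        rw [hP]; simp only
        rw [inner_smul_right, smul_smul]
      simp only
      rw [e3, inner_smul_left, Complex.inv_eq_conj hξ, smul_eq_mul, mul_pow]
      ring
    rw [Real.circleAverage_congr_sphere h3, Real.circleAverage_fun_smul,
      ← homogPart_eq_circleAverage hf ((hPle w).trans_lt hw1), hP, smul_eq_mul]
    simp only
    rw [homogPart_smul hf, ← mul_assoc, ← mul_pow, ← inner_conj_symm w, Complex.conj_mul']
    push_cast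
    rw [pow_mul]
  rw [← h1.2, integral_congr_ae e1, ← h2.2, integral_congr_ae e2, integral_mul_const,
    integral_complex_ofReal]
  congr 2
  rw [integral_eq_lintegral_of_nonneg_ae (ae_of_all _ fun w => by positivity) (by fun_prop),
    lintegral_moment n hρ hb, ENNReal.toReal_ofReal (moment_pos n hρ hb k).le]

/-- Integration against `⟨z, w⟩ ^ k` and a rotation invariant weight extracts the homogeneous part
of degree `k`. -/
theorem integral_mul_inner_pow (hρ : ρ < 1) (hb : -1 < b)
    (hf : DifferentiableOn ℂ f (unitBall n)) (hfi : Integrable f (shellMeasure n ρ b)) (k : ℕ)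
    (z : Cn n) :
    ∫ w, f w * (inner ℂ w z) ^ k ∂(shellMeasure n ρ b) = moment n ρ b k * homogPart f k z := by
  classical
  set g := (unitBall n).indicator f with hg
  have hgf : ∀ w ∈ unitBall n, g w = f w := fun w hw => Set.indicator_of_mem hw f
  have hae : g =ᵐ[shellMeasure n ρ b] f := by
    filter_upwards [ae_shellMeasure_mem n ρ b] with w hw using hgf w hw.1
  have hgd : DifferentiableOn ℂ g (unitBall n) := hf.congr hgf
  have hgm : Measurable g := IsHolo.measurable ⟨hgd, fun z hz => Set.indicator_of_notMem hz f⟩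
  obtain ⟨η, hη⟩ := exists_eq_smul_sphere z
  have h := integral_mul_inner_pow_sphere hρ hb hgd hgm (hfi.congr hae.symm) k η
  have e1 : ∀ w : Cn n, inner ℂ w z = (‖z‖ : ℂ) * inner ℂ w (η : Cn n) := fun w => by
    nth_rewrite 1 [hη]; rw [inner_smul_right]
  have e2 : homogPart f k z = (‖z‖ : ℂ) ^ k * homogPart g k η := by
    nth_rewrite 1 [hη]
    rw [homogPart_smul hf, homogPart_congr hf hgf]
  rw [e2, mul_left_comm, ← h, ← integral_const_mul]
  refine integral_congr_ae ?_
  filter_upwards [hae] with w hw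
  rw [hw, e1, mul_pow]; ring

theorem integrable_shellMeasure_of_bounded (hρ : ρ < 1) (hb : -1 < b)
    (hf : DifferentiableOn ℂ f (unitBall n)) {M : ℝ} (hM : ∀ z, ‖z‖ ≤ 1 → ‖f z‖ ≤ M) :
    Integrable f (shellMeasure n ρ b) := by
  classical
  have := isFiniteMeasure_shellMeasure n hρ hb
  set g := (unitBall n).indicator f with hg
  have hgf : ∀ w ∈ unitBall n, g w = f w := fun w hw => Set.indicator_of_mem hw f
  have hae : g =ᵐ[shellMeasure n ρ b] f := by
    filter_upwards [ae_shellMeasure_mem n ρ b] with w hw using hgf w hw.1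
  have hgm : Measurable g :=
    IsHolo.measurable ⟨hf.congr hgf, fun z hz => Set.indicator_of_notMem hz f⟩
  refine Integrable.of_bound (hgm.aestronglyMeasurable.congr hae) M ?_
  filter_upwards [ae_shellMeasure_mem n ρ b] with w hw
  exact hM w (mem_unitBall_iff.1 hw.1).le

/-- Homogeneous parts are linear combinations of powers of linear functionals: a functional which
vanishes on these powers also vanishes on the homogeneous part, by its integral representation. -/
theorem homogPart_mem_span (hf : DifferentiableOn ℂ f (unitBall n)) (k : ℕ) :
    homogPart f k ∈ Submodule.span ℂ (Set.range fun (u z : Cn n) => (inner ℂ u z : ℂ) ^ k) := by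
  by_contra hnot
  obtain ⟨L, hL, hker⟩ := Submodule.exists_le_ker_of_notMem hnot
  have hLe : ∀ u : Cn n, L (fun z => (inner ℂ u z : ℂ) ^ k) = 0 := fun u =>
    hker (Submodule.subset_span ⟨u, rfl⟩)
  have hhalf : (0 : ℝ) ≤ 1 / 2 := by norm_num
  have hhalf1 : (1 / 2 : ℝ) < 1 := by norm_num
  obtain ⟨M, -, hM⟩ := exists_norm_dilate_le hf hhalf hhalf1
  set F := dilate (1 / 2) f with hF
  have hFd := differentiableOn_dilate hf hhalf hhalf1.le
  have hFi : Integrable F (shellMeasure n 0 0) :=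
    integrable_shellMeasure_of_bounded one_pos (by norm_num) hFd hM
  set mono : (Fin k → Fin n) → Cn n → ℂ := fun i z => ∏ j, z (i j) with hmono
  have hexp : ∀ w z : Cn n, (inner ℂ w z : ℂ) ^ k =
      ∑ i : Fin k → Fin n, mono i z * (starRingEnd ℂ) (mono i w) := by
    intro w z
    rw [inner_eq_sum, Fintype.sum_pow]
    refine Finset.sum_congr rfl fun i _ => ?_
    rw [Finset.prod_mul_distrib, hmono, map_prod]
  have hint : ∀ i, Integrable (fun w => F w * (starRingEnd ℂ) (mono i w))
      (shellMeasure n 0 0) := by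
    intro i
    refine hFi.mul_bdd (c := 1) (Measurable.aestronglyMeasurable (by rw [hmono]; fun_prop)) ?_
    filter_upwards [ae_shellMeasure_mem n 0 0] with w hw
    rw [RCLike.norm_conj, hmono]
    simp only [norm_prod]
    exact Finset.prod_le_one (fun _ _ => norm_nonneg _) fun j _ =>
      (PiLp.norm_apply_le w (i j)).trans (mem_unitBall_iff.1 hw.1).le
  have h1 : (moment n 0 0 k : ℂ) • homogPart F k =
      ∑ i : Fin k → Fin n, (∫ w, F w * (starRingEnd ℂ) (mono i w) ∂(shellMeasure n 0 0)) •
        mono i := by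
    funext z
    rw [Pi.smul_apply, smul_eq_mul, ← integral_mul_inner_pow one_pos (by norm_num) hFd hFi,
      Finset.sum_apply]
    simp only [Pi.smul_apply, smul_eq_mul]
    simp_rw [← integral_mul_const]
    rw [← integral_finsetSum _ fun i _ => (hint i).mul_const _]
    refine integral_congr_ae (ae_of_all _ fun w => ?_)
    simp only
    rw [hexp, Finset.mul_sum]
    exact Finset.sum_congr rfl fun i _ => by ring
  have h2 : L ((moment n 0 0 k : ℂ) • homogPart F k) = 0 := by
    rw [h1, map_sum]
    simp only [map_smul, smul_eq_mul]
    simp_rw [← integral_mul_const]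
    rw [← integral_finsetSum _ fun i _ => (hint i).mul_const _]
    refine integral_eq_zero_of_ae (ae_of_all _ fun w => ?_)
    simp only [Pi.zero_apply]
    have h3 : L (fun z => (inner ℂ w z : ℂ) ^ k) =
        ∑ i : Fin k → Fin n, (starRingEnd ℂ) (mono i w) * L (mono i) := by
      have h4 : (fun z => (inner ℂ w z : ℂ) ^ k) =
          ∑ i : Fin k → Fin n, (starRingEnd ℂ) (mono i w) • mono i := by
        funext z
        rw [hexp, Finset.sum_apply]
        exact Finset.sum_congr rfl fun i _ => by
          rw [Pi.smul_apply, smul_eq_mul, mul_comm]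
      rw [h4, map_sum]
      simp only [map_smul, smul_eq_mul]
    rw [hLe] at h3
    calc _ = F w * ∑ i : Fin k → Fin n, (starRingEnd ℂ) (mono i w) * L (mono i) := by
          rw [Finset.mul_sum]; exact Finset.sum_congr rfl fun i _ => by ring
      _ = 0 := by rw [← h3, mul_zero]
  have h3 : homogPart F k = (((1 / 2 : ℝ) : ℂ) ^ k) • homogPart f k := by
    funext z; rw [hF, homogPart_dilate hf]; rfl
  rw [h3, map_smul, map_smul, smul_eq_mul, smul_eq_mul, mul_eq_zero, mul_eq_zero] at h2
  have hm := (moment_pos n (ρ := 0) one_pos (b := 0) (by norm_num) k).ne'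
  rcases h2 with h2 | h2 | h2
  · exact hm (by exact_mod_cast h2)
  · exact absurd h2 (pow_ne_zero _ (by norm_num))
  · exact hL h2

theorem differentiable_homogPart (hf : DifferentiableOn ℂ f (unitBall n)) (k : ℕ) :
    Differentiable ℂ (homogPart f k) := by
  refine Submodule.span_induction (p := fun g _ => Differentiable ℂ g) ?_ ?_ ?_ ?_
    (homogPart_mem_span hf k)
  · rintro _ ⟨u, rfl⟩
    exact ((innerSL ℂ u).differentiable).pow k
  · exact differentiable_const _
  · exact fun _ _ _ _ h1 h2 => h1.add h2
  · exact fun c _ _ h => h.const_smul c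

end Reproducing

/-! ### Coefficient multipliers -/

/-- A sequence of homogeneous polynomials of degrees `0, 1, 2, …` whose sum converges normally
inside the unit ball. -/
structure IsHomogSeries {n : ℕ} (P : ℕ → Cn n → ℂ) : Prop where
  differentiable : ∀ k, Differentiable ℂ (P k)
  smul : ∀ k (c : ℂ) z, P k (c • z) = c ^ k * P k z
  bound : ∀ R : ℝ, 0 < R → R < 1 → ∃ u : ℕ → ℝ, Summable u ∧ ∀ k z, ‖z‖ < R → ‖P k z‖ ≤ u k

namespace IsHomogSeries

variable {n : ℕ} {P : ℕ → Cn n → ℂ}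

theorem summable (hP : IsHomogSeries P) {z : Cn n} (hz : ‖z‖ < 1) : Summable fun k => P k z := by
  obtain ⟨R, h1, h2⟩ := exists_between hz
  obtain ⟨u, hu, hb⟩ := hP.bound R ((norm_nonneg z).trans_lt h1) h2
  exact Summable.of_norm_bounded hu fun k => hb k z h1

theorem differentiableOn_tsum (hP : IsHomogSeries P) :
    DifferentiableOn ℂ (fun z => ∑' k, P k z) (unitBall n) := by
  intro z hz
  obtain ⟨R, h1, h2⟩ := exists_between (mem_unitBall_iff.1 hz)
  obtain ⟨u, hu, hb⟩ := hP.bound R ((norm_nonneg z).trans_lt h1) h2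
  have h3 := TentDuality.differentiableOn_tsum hu hP.differentiable hb
  exact (h3.differentiableAt (Metric.isOpen_ball.mem_nhds
    (mem_ball_zero_iff.2 h1))).differentiableWithinAt

theorem homogPart_eq (hP : IsHomogSeries P) {f : Cn n → ℂ}
    (hf : ∀ z ∈ unitBall n, f z = ∑' k, P k z) (k : ℕ) (z : Cn n) : homogPart f k z = P k z := by
  obtain ⟨r, hr, h1, -⟩ := exists_slice_radius z
  refine homogPart_eq_of_hasSum (fun k w => hP.smul k w z) hr (fun w hw => ?_) k
  have h2 : ‖w • z‖ < 1 := by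
    rw [norm_smul]
    rcases (norm_nonneg z).eq_or_lt with h0 | h0
    · rw [← h0, mul_zero]; exact one_pos
    · exact (mul_lt_mul_of_pos_right hw h0).trans_le h1
  rw [hf _ (mem_unitBall_iff.2 h2)]
  exact (hP.summable h2).hasSum

theorem symbol_mul (hP : IsHomogSeries P) {e : ℝ} {m : ℕ → ℝ} (hm : IsSymbol e m) :
    IsHomogSeries fun k z => (m k : ℂ) * P k z := by
  refine ⟨fun k => (hP.differentiable k).const_mul _, fun k c z => ?_, fun R hR0 hR1 => ?_⟩
  · rw [hP.smul]; ring
  · obtain ⟨R', h1, h2⟩ := exists_between hR1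
    have hR' : 0 < R' := hR0.trans h1
    obtain ⟨u, hu, hb⟩ := hP.bound R' hR' h2
    obtain ⟨C, hC0, hC⟩ := hm.exists_bound
    obtain ⟨D, hD0, hD⟩ := exists_geometric_bound (div_nonneg hR0.le hR'.le)
      ((div_lt_one hR').2 h1) (-e)
    refine ⟨fun k => C * D * u k, hu.mul_left _, fun k z hz => ?_⟩
    -- shrinking the ball wins a geometric factor, which absorbs the growth of the symbol
    have e1 : P k z = ((R / R' : ℝ) : ℂ) ^ k * P k (((R' / R : ℝ) : ℂ) • z) := by
      rw [← hP.smul, smul_smul, ← Complex.ofReal_mul,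
        show R / R' * (R' / R) = 1 by field_simp, Complex.ofReal_one, one_smul]
    have h3 : ‖P k (((R' / R : ℝ) : ℂ) • z)‖ ≤ u k := by
      refine hb k _ ?_
      rw [norm_smul, Complex.norm_real, Real.norm_of_nonneg (by positivity),
        div_mul_eq_mul_div, div_lt_iff₀ hR0]
      nlinarith
    have hk : (0 : ℝ) < (k : ℝ) + 1 := by positivity
    rw [e1, norm_mul, norm_mul, norm_pow, Complex.norm_real, Complex.norm_real,
      Real.norm_of_nonneg (by positivity : 0 ≤ R / R'), Real.norm_eq_abs]
    calc |m k| * ((R / R') ^ k * ‖P k (((R' / R : ℝ) : ℂ) • z)‖)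
        ≤ (C * ((k : ℝ) + 1) ^ e) * ((D * ((k : ℝ) + 1) ^ (-e)) * u k) := by
          gcongr
          · exact hC k
          · exact hD k
      _ = C * D * u k * (((k : ℝ) + 1) ^ e * ((k : ℝ) + 1) ^ (-e)) := by ring
      _ = _ := by rw [← Real.rpow_add hk, add_neg_cancel, Real.rpow_zero, mul_one]

end IsHomogSeries

section Multiplier

variable {n : ℕ} {f : Cn n → ℂ}

/-- The coefficient multiplier with coefficients `m`. -/
def mult (m : ℕ → ℝ) (f : Cn n → ℂ) (z : Cn n) : ℂ := ∑' k : ℕ, (m k : ℂ) * homogPart f k z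

theorem fracDeriv_eq_mult (s t : ℝ) (f : Cn n → ℂ) :
    fracDeriv s t f = mult (ratio (n + 1 + s + t) (n + 1 + s)) f := rfl

theorem mult_one (hf : DifferentiableOn ℂ f (unitBall n)) {z : Cn n} (hz : z ∈ unitBall n) :
    mult 1 f z = f z := by
  unfold mult
  simpa using (hasSum_homogPart hf (mem_unitBall_iff.1 hz)).tsum_eq

variable [NeZero n]

theorem isHomogSeries_homogPart (hf : DifferentiableOn ℂ f (unitBall n)) :
    IsHomogSeries (homogPart f) := by
  refine ⟨differentiable_homogPart hf, fun k c z => homogPart_smul hf c k z, fun R hR0 hR1 => ?_⟩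
  obtain ⟨R', h1, h2⟩ := exists_between hR1
  have hR' : 0 < R' := hR0.trans h1
  obtain ⟨M, hM0, hM⟩ := exists_norm_dilate_le hf hR'.le h2
  refine ⟨fun k => M * (R / R') ^ k, (summable_geometric_of_lt_one (by positivity)
    ((div_lt_one hR').2 h1)).mul_left M, fun k z hz => ?_⟩
  have hfd := differentiableOn_dilate hf hR'.le h2.le
  have e1 : homogPart f k z =
      ((R / R' : ℝ) : ℂ) ^ k * homogPart (dilate R' f) k (((R⁻¹ : ℝ) : ℂ) • z) := by
    rw [homogPart_dilate hf, ← homogPart_smul hf, ← homogPart_smul hf, smul_smul, smul_smul,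
      ← Complex.ofReal_mul, ← Complex.ofReal_mul,
      show R / R' * R' * R⁻¹ = 1 by field_simp, Complex.ofReal_one, one_smul]
  have hz1 : ‖((R⁻¹ : ℝ) : ℂ) • z‖ < 1 := by
    rw [norm_smul, Complex.norm_real, Real.norm_of_nonneg (by positivity), inv_mul_lt_iff₀ hR0,
      mul_one]
    exact hz
  rw [e1, norm_mul, norm_pow, Complex.norm_real, Real.norm_of_nonneg (by positivity), mul_comm]
  refine mul_le_mul_of_nonneg_right (norm_homogPart_le hfd hz1 (fun ξ hξ => hM _ ?_) k)
    (by positivity)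
  rw [norm_smul, hξ, one_mul]; exact hz1.le

variable {e : ℝ} {m : ℕ → ℝ}

theorem differentiableOn_mult (hm : IsSymbol e m) (hf : DifferentiableOn ℂ f (unitBall n)) :
    DifferentiableOn ℂ (mult m f) (unitBall n) :=
  ((isHomogSeries_homogPart hf).symbol_mul hm).differentiableOn_tsum

theorem homogPart_mult (hm : IsSymbol e m) (hf : DifferentiableOn ℂ f (unitBall n)) (k : ℕ)
    (z : Cn n) : homogPart (mult m f) k z = m k * homogPart f k z :=
  ((isHomogSeries_homogPart hf).symbol_mul hm).homogPart_eq (fun _ _ => rfl) k z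

theorem mult_mult (m' : ℕ → ℝ) (hm : IsSymbol e m) (hf : DifferentiableOn ℂ f (unitBall n)) :
    mult m' (mult m f) = mult (m' * m) f := by
  funext z
  unfold mult
  refine tsum_congr fun k => ?_
  have := homogPart_mult hm hf k z
  unfold mult at this
  rw [this, Pi.mul_apply]; push_cast; ring

/-- The integral representation of a coefficient multiplier. -/
theorem mult_eq_integral {ρ b : ℝ} (hρ : ρ < 1) (hb : -1 < b) (hm : IsSymbol e m)
    (hf : DifferentiableOn ℂ f (unitBall n)) (hfi : Integrable f (shellMeasure n ρ b)) {z : Cn n}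
    (hz : z ∈ unitBall n) :
    mult m f z = ∫ w, f w * ∑' k : ℕ, ((m k * (moment n ρ b k)⁻¹ : ℝ) : ℂ) * (inner ℂ w z) ^ k
      ∂(shellMeasure n ρ b) := by
  have hz1 := mem_unitBall_iff.1 hz
  set c : ℕ → ℝ := fun k => m k * (moment n ρ b k)⁻¹ with hc
  have hcs : IsSymbol (e + (n + b)) c := hm.mul (isSymbol_inv_moment n hρ hb)
  set F : ℕ → Cn n → ℂ := fun k w => (c k : ℂ) * (f w * (inner ℂ w z) ^ k) with hF
  have hFi : ∀ k, Integrable (F k) (shellMeasure n ρ b) := fun k =>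
    (integrable_mul_inner_pow hfi z k).const_mul _
  have hsum : Summable fun k => ∫ w, ‖F k w‖ ∂(shellMeasure n ρ b) := by
    have h1 : Summable fun k : ℕ => ‖(c k : ℂ) * ((‖z‖ : ℝ) : ℂ) ^ k‖ *
        ∫ w, ‖f w‖ ∂(shellMeasure n ρ b) :=
      (hcs.summable (x := ((‖z‖ : ℝ) : ℂ)) (by simpa using hz1)).norm.mul_right _
    refine Summable.of_nonneg_of_le (fun k => integral_nonneg fun w => norm_nonneg _)
      (fun k => ?_) h1
    rw [← integral_const_mul]
    refine integral_mono_ae (hFi k).norm (hfi.norm.const_mul _) ?_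
    filter_upwards [ae_shellMeasure_mem n ρ b] with w hw
    have hw1 := (mem_unitBall_iff.1 hw.1).le
    have h2 : ‖(inner ℂ w z : ℂ)‖ ≤ ‖z‖ :=
      (norm_inner_le_norm w z).trans (mul_le_of_le_one_left (norm_nonneg _) hw1)
    simp only [hF, norm_mul, norm_pow, Complex.norm_real, norm_norm]
    calc _ ≤ ‖c k‖ * (‖f w‖ * ‖z‖ ^ k) := by gcongr
      _ = _ := by ring
  have h := hasSum_integral_of_summable_integral_norm hFi hsum
  have h3 : ∀ k, ∫ w, F k w ∂(shellMeasure n ρ b) = m k * homogPart f k z := by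
    intro k
    rw [hF]
    simp only
    rw [integral_const_mul, integral_mul_inner_pow hρ hb hf hfi, hc, ← mul_assoc]
    congr 1
    have := (moment_pos n hρ hb k).ne'
    rw [← Complex.ofReal_mul]
    congr 1
    field_simp
  simp_rw [h3] at h
  unfold mult
  rw [h.tsum_eq]
  refine integral_congr_ae (ae_of_all _ fun w => ?_)
  simp only [hF]
  rw [← tsum_mul_left]
  exact tsum_congr fun k => by ring

/-- The size of a coefficient multiplier, in terms of a positive integral operator. -/
theorem exists_enorm_mult_le (hm : IsSymbol e m) {ρ b : ℝ} {N : ℕ} (hρ : ρ < 1) (hb : -1 < b)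
    (hN : N < n + 1 + b + e) :
    ∃ C : ℝ≥0, ∀ f : Cn n → ℂ, DifferentiableOn ℂ f (unitBall n) →
      Integrable f (shellMeasure n ρ b) → ∀ z ∈ unitBall n,
        ‖mult m f z‖ₑ ≤ C * kerInt ρ (N - (n + 1 + e)) N (fun w => ‖f w‖ₑ) z := by
  have hcs : IsSymbol (n + 1 + b + e - 1) fun k => m k * (moment n ρ b k)⁻¹ := by
    rw [show (n : ℝ) + 1 + b + e - 1 = e + (n + b) by ring]
    exact hm.mul (isSymbol_inv_moment n hρ hb)
  obtain ⟨C, hC0, hC⟩ := hcs.exists_tsum_le hN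
  set θ := (n : ℝ) + 1 + b + e - N with hθ
  have hθ0 : 0 < θ := by rw [hθ]; linarith
  refine ⟨(C * 2 ^ θ).toNNReal, fun f hf hfi z hz => ?_⟩
  classical
  set g := (unitBall n).indicator f with hg
  have hgf : ∀ w ∈ unitBall n, g w = f w := fun w hw => Set.indicator_of_mem hw f
  have hgm : Measurable g :=
    IsHolo.measurable ⟨hf.congr hgf, fun z hz => Set.indicator_of_notMem hz f⟩
  have hz1 := mem_unitBall_iff.1 hz
  rw [mult_eq_integral hρ hb hm hf hfi hz]
  refine (enorm_integral_le_lintegral_enorm _).trans ?_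
  have h1 : ∀ᵐ w ∂(shellMeasure n ρ b),
      ‖f w * ∑' k : ℕ, ((m k * (moment n ρ b k)⁻¹ : ℝ) : ℂ) * (inner ℂ w z) ^ k‖ₑ ≤
        (C * 2 ^ θ).toNNReal *
          (‖g w‖ₑ * ENNReal.ofReal ((1 - ‖w‖ ^ 2) ^ (-θ) * kd z w ^ (-(N : ℝ)))) := by
    filter_upwards [ae_shellMeasure_mem n ρ b] with w hw
    have hw1 := mem_unitBall_iff.1 hw.1
    have hδ := one_sub_sq_pos hw.1
    have h2 : ‖(inner ℂ w z : ℂ)‖ ≤ ‖w‖ :=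
      (norm_inner_le_norm w z).trans (mul_le_of_le_one_right (norm_nonneg _) hz1.le)
    have h3 := hC (inner ℂ w z) (h2.trans_lt hw1)
    have hk := kd_nonneg z w
    have e1 : ‖1 - (inner ℂ w z : ℂ)‖ = kd z w := by rw [kd_comm, kd]
    have h4 : (1 - ‖(inner ℂ w z : ℂ)‖) ^ (-θ) ≤ 2 ^ θ * (1 - ‖w‖ ^ 2) ^ (-θ) := by
      refine rpow_neg_le_of_le_mul hδ two_pos hθ0.le ?_
      nlinarith [norm_nonneg w]
    have h5 : ‖∑' k : ℕ, ((m k * (moment n ρ b k)⁻¹ : ℝ) : ℂ) * (inner ℂ w z) ^ k‖ₑ ≤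
        ENNReal.ofReal (C * 2 ^ θ * ((1 - ‖w‖ ^ 2) ^ (-θ) * kd z w ^ (-(N : ℝ)))) := by
      rw [← ofReal_norm]
      refine ENNReal.ofReal_le_ofReal (h3.trans ?_)
      rw [e1]
      calc _ ≤ C * (kd z w ^ (-(N : ℝ)) * (2 ^ θ * (1 - ‖w‖ ^ 2) ^ (-θ))) := by gcongr
        _ = _ := by ring
    rw [enorm_mul, hgf w hw.1]
    calc _ ≤ ‖f w‖ₑ *
          ENNReal.ofReal (C * 2 ^ θ * ((1 - ‖w‖ ^ 2) ^ (-θ) * kd z w ^ (-(N : ℝ)))) := by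
          gcongr
      _ = _ := by
          rw [ENNReal.ofReal_mul (by positivity)]
          simp only [ENNReal.ofReal]; ring
  refine (lintegral_mono_ae h1).trans ?_
  have hmeas := measurable_mul_kernel (-θ) N z hgm.enorm
  rw [lintegral_const_mul _ hmeas, lintegral_shellMeasure ρ b hmeas]
  refine mul_le_mul_right (setLIntegral_mono' (isOpen_outer n ρ).measurableSet
    fun w hw => ?_) _
  have hδ := one_sub_sq_pos hw.1
  have := kd_nonneg z w
  rw [hgf w hw.1, mul_assoc, ← ENNReal.ofReal_mul (by positivity), mul_right_comm,
    ← Real.rpow_add hδ, show -θ + b = N - (n + 1 + e) by rw [hθ]; ring]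

end Multiplier

/-! ### Pointwise bounds for holomorphic functions -/

theorem exists_measurable_eqOn {n : ℕ} {f : Cn n → ℂ} (hf : DifferentiableOn ℂ f (unitBall n)) :
    ∃ g : Cn n → ℂ, Measurable g ∧ Set.EqOn g f (unitBall n) := by
  classical
  have hgf : ∀ w ∈ unitBall n, (unitBall n).indicator f w = f w :=
    fun w hw => Set.indicator_of_mem hw f
  exact ⟨(unitBall n).indicator f, IsHolo.measurable
    ⟨hf.congr hgf, fun z hz => Set.indicator_of_notMem hz f⟩, hgf⟩

theorem kerInt_congr {n : ℕ} {ρ b c : ℝ} {u v : Cn n → ℝ≥0∞}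
    (h : ∀ w ∈ unitBall n, u w = v w) : kerInt ρ b c u = kerInt ρ b c v := by
  funext z
  refine setLIntegral_congr_fun (isOpen_outer n ρ).measurableSet fun w hw => ?_
  rw [h w hw.1]

theorem area_congr {n : ℕ} {κ α : ℝ} {u v : Cn n → ℝ≥0∞}
    (h : ∀ w ∈ unitBall n, u w = v w) : area κ α u = area κ α v := by
  funext ζ
  refine setLIntegral_congr_fun (isOpen_approachRegion κ ζ).measurableSet fun w hw => ?_
  rw [h w hw.1]

theorem one_lt_of_aperture {n : ℕ} {γ : ℝ} (hγ : 1 < γ) {w : Cn n} (hw : w ∈ outer n γ⁻¹) :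
    1 + min ((γ - 1) / 2) 1 ≤ γ / 2 * (1 + ‖w‖) := by
  have h1 : γ⁻¹ < ‖w‖ := hw.2
  have h2 : γ * γ⁻¹ = 1 := mul_inv_cancel₀ (by positivity)
  have h3 := min_le_left ((γ - 1) / 2) 1
  nlinarith

/-- Coefficient multipliers act on weighted non-tangential maximal functions, up to the
Hardy-Littlewood maximal function. -/
theorem exists_mult_le_maxFn (n : ℕ) [NeZero n] {γ κ : ℝ} (hγ : 1 < γ) (hκ : 0 < κ) {e : ℝ}
    {m : ℕ → ℝ} (hm : IsSymbol e m) {t₁ t₂ : ℝ} (ht : t₂ = t₁ + e) (ht0 : 0 < t₂) :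
    ∃ C : ℝ≥0, ∀ f : Cn n → ℂ, DifferentiableOn ℂ f (unitBall n) → ∀ G : UnitSphere n → ℝ≥0∞,
      Measurable G → ∫⁻ ζ, G ζ ∂(sphereMeasure n) ≠ ⊤ →
      (∀ ζ, ∀ w ∈ approachRegion γ ζ, ENNReal.ofReal ((1 - ‖w‖ ^ 2) ^ t₁) * ‖f w‖ₑ ≤ G ζ) →
      ∀ η, ∀ z ∈ approachRegion κ η,
        ENNReal.ofReal ((1 - ‖z‖ ^ 2) ^ t₂) * ‖mult m f z‖ₑ ≤ C * maxFn G η := by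
  have hγ0 : 0 < γ := by linarith
  have hρ1 : γ⁻¹ < 1 := inv_lt_one_of_one_lt₀ hγ
  set ε := min ((γ - 1) / 2) 1 with hε
  have hε0 : 0 < ε := lt_min (by linarith) one_pos
  have hε1 : ε ≤ 1 := min_le_right _ _
  have hout : ∀ w ∈ outer n γ⁻¹, 1 + ε ≤ γ / 2 * (1 + ‖w‖) := fun w => one_lt_of_aperture hγ
  -- the order `N` of the reproducing kernel is large enough for integrability of `f` and for the
  -- bound by the maximal function
  obtain ⟨N, hN⟩ := exists_nat_gt (max (2 * n + t₂) (max (n + e) (n + t₂)))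
  have hN1 : 2 * n + t₂ < N := (le_max_left _ _).trans_lt hN
  have hN2 : n + e < N := ((le_max_left _ _).trans (le_max_right _ _)).trans_lt hN
  have hN3 : n + t₂ < N := ((le_max_right _ _).trans (le_max_right _ _)).trans_lt hN
  set b : ℝ := N - (n + 1 + e) + 1 with hb
  obtain ⟨C₁, hC₁⟩ := exists_enorm_mult_le hm (ρ := γ⁻¹) (b := b) (N := N) hρ1
    (by rw [hb]; linarith) (by rw [hb]; linarith)
  obtain ⟨C₂, hC₂⟩ := exists_kerInt_le_maxFn n hε0 hε1 hγ0 hκ hout ht0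
    (b := N - (n + 1 + t₂)) (by linarith)
  obtain ⟨C₃, hC₃⟩ := exists_le_lintegral_shadow n hε0 hε1
  refine ⟨C₁ * C₂, fun f hf G hG hGi hfG η z hz => ?_⟩
  obtain ⟨g, hgm, hgf⟩ := exists_measurable_eqOn hf
  have ho := (isOpen_outer n γ⁻¹).measurableSet
  have hfi : Integrable f (shellMeasure n γ⁻¹ b) := by
    have := isFiniteMeasure_shellMeasure n hρ1 (b := b) (by rw [hb]; linarith)
    -- averaging the bound by `G` over shadows gives `|f w| ≤ D (1 - |w|²) ^ (-t₁ - n)`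
    have hfin := isFiniteMeasure_shellMeasure n hρ1 (b := b - t₁ - n) (by rw [hb]; linarith)
    have hae : g =ᵐ[shellMeasure n γ⁻¹ b] f := by
      filter_upwards [ae_shellMeasure_mem n γ⁻¹ b] with w hw using hgf hw.1
    refine ⟨hgm.aestronglyMeasurable.congr hae, ?_⟩
    have e0 : ∫⁻ w, ‖f w‖ₑ ∂(shellMeasure n γ⁻¹ b) = ∫⁻ w, ‖g w‖ₑ ∂(shellMeasure n γ⁻¹ b) :=
      lintegral_congr_ae (by filter_upwards [hae] with w hw; rw [hw])
    rw [hasFiniteIntegral_iff_enorm, e0, lintegral_shellMeasure _ _ hgm.enorm]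
    set D := C₃ * ∫⁻ ζ, G ζ ∂(sphereMeasure n) with hD
    calc _ ≤ ∫⁻ w in outer n γ⁻¹, D * (1 * ENNReal.ofReal ((1 - ‖w‖ ^ 2) ^ (b - t₁ - n)))
          ∂(ballVolume n) := by
          refine setLIntegral_mono' ho fun w hw => ?_
          have hδ := one_sub_sq_pos hw.1
          have h1 := hC₃ γ w hw.1 (hout w hw) _ G (fun ζ hζ => hfG ζ w hζ)
          rw [hgf hw.1]
          have e1 : ENNReal.ofReal ((1 - ‖w‖ ^ 2) ^ b) =
              ENNReal.ofReal ((1 - ‖w‖ ^ 2) ^ t₁) * ENNReal.ofReal ((1 - ‖w‖ ^ 2) ^ (b - t₁)) := by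
            rw [← ENNReal.ofReal_mul (by positivity), ← Real.rpow_add hδ]; congr 2; ring
          have e2 : ENNReal.ofReal ((1 - ‖w‖ ^ 2) ^ (b - t₁ - n)) =
              ENNReal.ofReal ((1 - ‖w‖ ^ 2) ^ (-(n : ℝ))) *
                ENNReal.ofReal ((1 - ‖w‖ ^ 2) ^ (b - t₁)) := by
            rw [← ENNReal.ofReal_mul (by positivity), ← Real.rpow_add hδ]; congr 2; ring
          calc _ = ENNReal.ofReal ((1 - ‖w‖ ^ 2) ^ t₁) * ‖f w‖ₑ *
                ENNReal.ofReal ((1 - ‖w‖ ^ 2) ^ (b - t₁)) := by rw [e1]; ring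
            _ ≤ (C₃ * ENNReal.ofReal ((1 - ‖w‖ ^ 2) ^ (-(n : ℝ))) *
                ∫⁻ ζ, G ζ ∂(sphereMeasure n)) *
                ENNReal.ofReal ((1 - ‖w‖ ^ 2) ^ (b - t₁)) := by
                exact mul_le_mul_left
                  (h1.trans (mul_le_mul_right (setLIntegral_le_lintegral _ _) _)) _
            _ = _ := by rw [e2, hD]; ring
      _ = D * shellMeasure n γ⁻¹ (b - t₁ - n) Set.univ := by
          rw [lintegral_const_mul _ (by fun_prop),
            ← lintegral_shellMeasure _ _ measurable_const, lintegral_one]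
      _ < ⊤ := ENNReal.mul_lt_top (ENNReal.mul_lt_top ENNReal.coe_lt_top hGi.lt_top)
          (measure_lt_top _ _)
  have hhm : Measurable fun w => ENNReal.ofReal ((1 - ‖w‖ ^ 2) ^ t₁) * ‖g w‖ₑ :=
    (measurable_weight t₁).mul hgm.enorm
  have h2 := hC₂ _ G hhm hG (fun ζ w hw => by rw [hgf hw.1]; exact hfG ζ w hw) η z hz
  rw [show n + 1 + t₂ + (N - (n + 1 + t₂)) = (N : ℝ) by ring] at h2
  have h3 : kerInt γ⁻¹ (N - (n + 1 + e)) N (fun w => ‖f w‖ₑ) z =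
      kerInt γ⁻¹ (N - (n + 1 + t₂)) N
        (fun w => ENNReal.ofReal ((1 - ‖w‖ ^ 2) ^ t₁) * ‖g w‖ₑ) z := by
    refine setLIntegral_congr_fun ho fun w hw => ?_
    have hδ := one_sub_sq_pos hw.1
    have hk := kd_nonneg z w
    simp only
    rw [hgf hw.1, mul_comm (ENNReal.ofReal _) ‖f w‖ₑ, mul_assoc,
      ← ENNReal.ofReal_mul (by positivity), ← mul_assoc, ← Real.rpow_add hδ, ht,
      show t₁ + (N - (n + 1 + (t₁ + e))) = N - (n + 1 + e) by ring]
  calc _ ≤ ENNReal.ofReal ((1 - ‖z‖ ^ 2) ^ t₂) *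
        (C₁ * kerInt γ⁻¹ (N - (n + 1 + e)) N (fun w => ‖f w‖ₑ) z) :=
        mul_le_mul_right (hC₁ f hf hfi z hz.1) _
    _ = C₁ * (ENNReal.ofReal ((1 - ‖z‖ ^ 2) ^ t₂) * kerInt γ⁻¹ (N - (n + 1 + t₂)) N
        (fun w => ENNReal.ofReal ((1 - ‖w‖ ^ 2) ^ t₁) * ‖g w‖ₑ) z) := by rw [h3]; ring
    _ ≤ C₁ * (C₂ * maxFn G η) := mul_le_mul_right h2 _
    _ = _ := by push_cast; ring

theorem rpow_kernel_le {A D a b d q : ℝ} {N : ℕ} {n : ℝ} (hA : 0 < A) (hD : 0 < D) (ha : 0 < a)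
    (hb : 0 < b) (hd : 0 < d) (hAab : A ≤ 3 * (a + b)) (hda : d ≤ 2 * a) (hdb : d ≤ 2 * b) :
    (A ^ (N : ℝ) * D ^ (-(N : ℝ))) ^ (1 - q) *
      (D ^ (N - (n + 1)) * b ^ (-(N : ℝ)) * (d ^ (N : ℝ) * a ^ (-(N : ℝ)))) ≤
      12 ^ N * (D ^ (N * q - n - 1) * A ^ (-(N * q))) := by
  have e1 : (A ^ (N : ℝ) * D ^ (-(N : ℝ))) ^ (1 - q) =
      A ^ (N : ℝ) * A ^ (-(N * q)) * D ^ (-(N : ℝ) * (1 - q)) := by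
    rw [Real.mul_rpow (by positivity) (by positivity), ← Real.rpow_mul hA.le,
      ← Real.rpow_mul hD.le, ← Real.rpow_add hA]
    congr 2; ring
  have e2 : D ^ (-(N : ℝ) * (1 - q)) * D ^ (N - (n + 1)) = D ^ (N * q - n - 1) := by
    rw [← Real.rpow_add hD]; congr 1; ring
  have e3 : A ^ (N : ℝ) * (b ^ (-(N : ℝ)) * (d ^ (N : ℝ) * a ^ (-(N : ℝ)))) =
      (A * d / (a * b)) ^ N := by
    simp only [Real.rpow_neg ha.le, Real.rpow_neg hb.le, Real.rpow_natCast]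
    rw [div_pow, mul_pow, mul_pow]; field_simp
  have h1 : A * d / (a * b) ≤ 12 := by
    rw [div_le_iff₀ (by positivity)]
    nlinarith [mul_le_mul_of_nonneg_right hAab hd.le]
  calc _ = (A ^ (N : ℝ) * (b ^ (-(N : ℝ)) * (d ^ (N : ℝ) * a ^ (-(N : ℝ))))) *
        ((D ^ (-(N : ℝ) * (1 - q)) * D ^ (N - (n + 1))) * A ^ (-(N * q))) := by rw [e1]; ring
    _ = (A * d / (a * b)) ^ N * (D ^ (N * q - n - 1) * A ^ (-(N * q))) := by rw [e2, e3]
    _ ≤ _ := by gcongr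

/-- Subharmonicity of `|f| ^ q` for bounded `f`: the power `1 - q` of `f` in the reproducing
formula is absorbed into a weighted supremum. -/
theorem exists_enorm_rpow_le_of_bounded (n : ℕ) [NeZero n] {ρ q : ℝ} (hρ : ρ < 1) (hq0 : 0 < q)
    (hq1 : q ≤ 1) {N : ℕ} (hN : n < N) :
    ∃ C : ℝ≥0, ∀ f : Cn n → ℂ, DifferentiableOn ℂ f (unitBall n) →
      (∃ M : ℝ, ∀ z, ‖z‖ ≤ 1 → ‖f z‖ ≤ M) → ∀ z ∈ unitBall n,
        ‖f z‖ₑ ^ q ≤ C * kerInt ρ (N * q - n - 1) (N * q) (fun w => ‖f w‖ₑ ^ q) z := by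
  have hN' : (n : ℝ) < N := by exact_mod_cast hN
  have hone : IsSymbol 0 (1 : ℕ → ℝ) := by
    have := isSymbol_ratio (a := 1) (b := 1) (fun j => by positivity) (fun j => by positivity)
    rw [sub_self] at this
    convert this using 1
    funext k
    exact (ratio_self (fun j => by positivity) k).symm
  set b : ℝ := N - (n + 1) + 1 with hb
  obtain ⟨C, hC⟩ := exists_enorm_mult_le (n := n) hone (ρ := ρ) (b := b) (N := N) hρ
    (by rw [hb]; linarith) (by rw [hb]; linarith)
  refine ⟨C * 12 ^ N, fun f hf ⟨M₀, hM₀⟩ z hz => ?_⟩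
  have hz1 := mem_unitBall_iff.1 hz
  have hfi := integrable_shellMeasure_of_bounded hρ (b := b) (by rw [hb]; linarith) hf hM₀
  have ho := (isOpen_outer n ρ).measurableSet
  have hrep : ∀ ξ ∈ unitBall n, ‖f ξ‖ₑ ≤ C * kerInt ρ (N - (n + 1)) N (fun w => ‖f w‖ₑ) ξ := by
    intro ξ hξ
    have := hC f hf hfi ξ hξ
    rwa [mult_one hf hξ, add_zero] at this
  -- the weight `φ` equals `1` at `z`, and it transforms the kernel at `ξ` into the kernel at `z`
  set φ : Cn n → ℝ≥0∞ := fun ξ =>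
    ENNReal.ofReal ((1 - ‖ξ‖ ^ 2) ^ (N : ℝ) * kd z ξ ^ (-(N : ℝ))) with hφ
  set M : ℝ≥0∞ := ⨆ ξ ∈ unitBall n, ‖f ξ‖ₑ * φ ξ with hM
  have hM₀0 : 0 ≤ M₀ := (norm_nonneg _).trans (hM₀ 0 (by simp))
  have hMtop : M ≠ ⊤ := by
    refine ne_of_lt (lt_of_le_of_lt (b := ENNReal.ofReal (M₀ * 2 ^ N)) ?_ ENNReal.ofReal_lt_top)
    refine iSup₂_le fun ξ hξ => ?_
    have hξ1 := mem_unitBall_iff.1 hξ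
    have hδ := one_sub_sq_pos hξ
    have hk : 0 < kd z ξ := kd_pos hz1.le hξ1
    rw [hφ, ← ofReal_norm, ← ENNReal.ofReal_mul (norm_nonneg _)]
    refine ENNReal.ofReal_le_ofReal (mul_le_mul (hM₀ ξ hξ1.le) ?_ (by positivity) hM₀0)
    rw [Real.rpow_neg hk.le, Real.rpow_natCast, Real.rpow_natCast, ← div_eq_mul_inv, ← div_pow]
    refine pow_le_pow_left₀ (by positivity) ?_ N
    rw [div_le_iff₀ hk]
    exact one_sub_sq_le_two_kd hz1.le hξ1.le
  set I := kerInt ρ (N * q - n - 1) (N * q) (fun w => ‖f w‖ₑ ^ q) z with hI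
  have hkey : M ≤ M ^ (1 - q) * ((C * 12 ^ N : ℝ≥0) * I) := by
    refine iSup₂_le fun ξ hξ => ?_
    have hξ1 := mem_unitBall_iff.1 hξ
    have hδξ := one_sub_sq_pos hξ
    have hkξ : 0 < kd z ξ := kd_pos hz1.le hξ1
    have hq1' : 0 ≤ 1 - q := by linarith
    have hMt : M ^ (1 - q) ≠ ⊤ := ENNReal.rpow_ne_top_of_nonneg hq1' hMtop
    calc ‖f ξ‖ₑ * φ ξ ≤ C * kerInt ρ (N - (n + 1)) N (fun w => ‖f w‖ₑ) ξ * φ ξ :=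
          mul_le_mul_left (hrep ξ hξ) _
      _ = C * ∫⁻ w in outer n ρ, ‖f w‖ₑ * ENNReal.ofReal ((1 - ‖w‖ ^ 2) ^ (N - (n + 1) : ℝ) *
            kd ξ w ^ (-(N : ℝ))) * φ ξ ∂(ballVolume n) := by
          rw [mul_assoc, kerInt, lintegral_mul_const' _ _ ENNReal.ofReal_ne_top]
      _ ≤ C * ∫⁻ w in outer n ρ, M ^ (1 - q) * ((12 ^ N : ℝ≥0) * (‖f w‖ₑ ^ q * ENNReal.ofReal
            ((1 - ‖w‖ ^ 2) ^ (N * q - n - 1) * kd z w ^ (-(N * q))))) ∂(ballVolume n) := by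
          refine mul_le_mul_right (setLIntegral_mono' ho fun w hw => ?_) _
          have hw1 := mem_unitBall_iff.1 hw.1
          have hδ := one_sub_sq_pos hw.1
          have hk : 0 < kd z w := kd_pos hz1.le hw1
          have hk' : 0 < kd ξ w := kd_pos hξ1.le hw1
          have h1 : ‖f w‖ₑ ≤
              M * ENNReal.ofReal (kd z w ^ (N : ℝ) * (1 - ‖w‖ ^ 2) ^ (-(N : ℝ))) := by
            have h2 : ‖f w‖ₑ * φ w ≤ M := le_iSup₂_of_le w hw.1 le_rfl
            calc ‖f w‖ₑ = ‖f w‖ₑ * φ w *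
                  ENNReal.ofReal (kd z w ^ (N : ℝ) * (1 - ‖w‖ ^ 2) ^ (-(N : ℝ))) := by
                  rw [hφ, mul_assoc, ← ENNReal.ofReal_mul (by positivity)]
                  have : (1 - ‖w‖ ^ 2) ^ (N : ℝ) * kd z w ^ (-(N : ℝ)) *
                      (kd z w ^ (N : ℝ) * (1 - ‖w‖ ^ 2) ^ (-(N : ℝ))) = 1 := by
                    rw [Real.rpow_neg hk.le, Real.rpow_neg hδ.le]
                    have := (Real.rpow_pos_of_pos hk N).ne'
                    have := (Real.rpow_pos_of_pos hδ N).ne'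
                    field_simp
                  rw [this, ENNReal.ofReal_one, mul_one]
              _ ≤ _ := mul_le_mul_left h2 _
          have h3 : ‖f w‖ₑ ≤ ‖f w‖ₑ ^ q * (M ^ (1 - q) * ENNReal.ofReal
              ((kd z w ^ (N : ℝ) * (1 - ‖w‖ ^ 2) ^ (-(N : ℝ))) ^ (1 - q))) := by
            calc ‖f w‖ₑ = ‖f w‖ₑ ^ q * ‖f w‖ₑ ^ (1 - q) := by
                  rw [← ENNReal.rpow_add_of_nonneg _ _ hq0.le hq1', add_sub_cancel,
                    ENNReal.rpow_one]
              _ ≤ _ := by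
                  refine mul_le_mul_right ?_ _
                  rw [← ENNReal.ofReal_rpow_of_nonneg (by positivity) hq1',
                    ← ENNReal.mul_rpow_of_nonneg _ _ hq1']
                  exact ENNReal.rpow_le_rpow h1 hq1'
          have h4 : 1 - ‖ξ‖ ^ 2 ≤ 2 * kd ξ w := by
            rw [kd_comm]; exact one_sub_sq_le_two_kd hw1.le hξ1.le
          have h5 := rpow_kernel_le (q := q) (N := N) (n := n) hk hδ hkξ hk' hδξ
            (kd_triangle hz1.le hw1.le hξ1.le) (one_sub_sq_le_two_kd hz1.le hξ1.le) h4
          calc _ ≤ ‖f w‖ₑ ^ q * (M ^ (1 - q) * ENNReal.ofReal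
                ((kd z w ^ (N : ℝ) * (1 - ‖w‖ ^ 2) ^ (-(N : ℝ))) ^ (1 - q))) *
                ENNReal.ofReal ((1 - ‖w‖ ^ 2) ^ (N - (n + 1) : ℝ) * kd ξ w ^ (-(N : ℝ))) * φ ξ := by
                gcongr
            _ = M ^ (1 - q) * (‖f w‖ₑ ^ q * ENNReal.ofReal
                ((kd z w ^ (N : ℝ) * (1 - ‖w‖ ^ 2) ^ (-(N : ℝ))) ^ (1 - q) *
                ((1 - ‖w‖ ^ 2) ^ (N - (n + 1) : ℝ) * kd ξ w ^ (-(N : ℝ)) *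
                ((1 - ‖ξ‖ ^ 2) ^ (N : ℝ) * kd z ξ ^ (-(N : ℝ)))))) := by
                have e : ∀ X Y Z : ℝ, 0 ≤ X → 0 ≤ Y → ENNReal.ofReal (X * (Y * Z)) =
                    ENNReal.ofReal X * (ENNReal.ofReal Y * ENNReal.ofReal Z) := by
                  intro X Y Z hX hY
                  rw [ENNReal.ofReal_mul hX, ENNReal.ofReal_mul hY]
                rw [e _ _ _ (by positivity) (by positivity)]
                ring
            _ ≤ M ^ (1 - q) * (‖f w‖ₑ ^ q * ENNReal.ofReal (12 ^ N *
                ((1 - ‖w‖ ^ 2) ^ (N * q - n - 1) * kd z w ^ (-(N * q))))) := by gcongr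
            _ = _ := by
                rw [ENNReal.ofReal_mul (by positivity), ENNReal.ofReal_pow (by norm_num),
                  ENNReal.ofReal_ofNat]
                push_cast; ring
      _ = _ := by
          rw [lintegral_const_mul' _ _ hMt, lintegral_const_mul' _ _ ENNReal.coe_ne_top, hI,
            kerInt]
          push_cast; ring
  -- the supremum is finite, so its power can be cancelled
  have hMq : M ^ q ≤ (C * 12 ^ N : ℝ≥0) * I := by
    rcases eq_or_ne M 0 with h0 | h0
    · rw [h0, ENNReal.zero_rpow_of_pos hq0]; exact zero_le
    · have h1 : M ^ (1 - q) ≠ 0 := by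
        rw [Ne, ENNReal.rpow_eq_zero_iff]; push Not
        exact ⟨fun h => absurd h h0, fun h => absurd h hMtop⟩
      rw [← ENNReal.mul_le_mul_iff_right h1
        (ENNReal.rpow_ne_top_of_nonneg (by linarith) hMtop), ← ENNReal.rpow_add _ _ h0 hMtop,
        sub_add_cancel, ENNReal.rpow_one]
      exact hkey
  refine le_trans (ENNReal.rpow_le_rpow ?_ hq0.le) hMq
  have hzz : φ z = 1 := by
    have hδ := one_sub_sq_pos hz
    have e1 : kd z z = 1 - ‖z‖ ^ 2 := by
      have e2 : (1 : ℂ) - ((‖z‖ : ℝ) : ℂ) ^ 2 = ((1 - ‖z‖ ^ 2 : ℝ) : ℂ) := by push_cast; ring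
      rw [kd, inner_self_eq_norm_sq_to_K]
      refine (congrArg norm e2).trans ?_
      rw [Complex.norm_real, Real.norm_of_nonneg hδ.le]
    simp only [hφ]
    rw [e1, ← Real.rpow_add hδ, add_neg_cancel, Real.rpow_zero, ENNReal.ofReal_one]
  calc ‖f z‖ₑ = ‖f z‖ₑ * φ z := by rw [hzz, mul_one]
    _ ≤ M := le_iSup₂_of_le z hz le_rfl

theorem setLIntegral_outer_eq {n : ℕ} (ρ : ℝ) (F : Cn n → ℝ≥0∞) :
    ∫⁻ w in outer n ρ, F w ∂(ballVolume n) =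
      ((volume : Measure (Cn n)) (unitBall n))⁻¹ * ∫⁻ w, (outer n ρ).indicator F w := by
  have ho := (isOpen_outer n ρ).measurableSet
  have hsub : outer n ρ ⊆ unitBall n := fun w hw => hw.1
  rw [ballVolume, Measure.restrict_smul, lintegral_smul_measure,
    Measure.restrict_restrict ho, Set.inter_eq_left.2 hsub, ← lintegral_indicator ho, smul_eq_mul]

theorem setLIntegral_outer_smul_le {n : ℕ} {ρ₀ ρ₁ r : ℝ} (hr0 : 0 < r) (hr1 : r ≤ 1)
    (hρ : ρ₀ ≤ r * ρ₁) {F : Cn n → ℝ≥0∞} (hF : Measurable F) :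
    ∫⁻ w in outer n ρ₁, F (r • w) ∂(ballVolume n) ≤
      ENNReal.ofReal ((r ^ (2 * n))⁻¹) * ∫⁻ w in outer n ρ₀, F w ∂(ballVolume n) := by
  have ho := (isOpen_outer n ρ₀).measurableSet
  have hsc : ∫⁻ w : Cn n, (outer n ρ₀).indicator F (r • w) =
      ENNReal.ofReal ((r ^ (2 * n))⁻¹) * ∫⁻ w, (outer n ρ₀).indicator F w := by
    rw [← lintegral_map (hF.indicator ho) (measurable_const_smul r),
      Measure.map_addHaar_smul _ hr0.ne', lintegral_smul_measure, finrank_real_Cn,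
      abs_of_pos (by positivity), smul_eq_mul]
  rw [setLIntegral_outer_eq, setLIntegral_outer_eq, mul_left_comm, ← hsc]
  refine mul_le_mul_right (lintegral_mono fun w => ?_) _
  by_cases hw : w ∈ outer n ρ₁
  · have h1 := mem_unitBall_iff.1 hw.1
    have h2 : ρ₁ < ‖w‖ := hw.2
    have h3 : ‖r • w‖ = r * ‖w‖ := by rw [norm_smul, Real.norm_of_nonneg hr0.le]
    rw [Set.indicator_of_mem hw, Set.indicator_of_mem (show r • w ∈ outer n ρ₀ from ?_)]
    refine ⟨?_, ?_⟩
    · rw [mem_ball_zero_iff, h3]; nlinarith [norm_nonneg w]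
    · rw [h3]; exact hρ.trans_lt (mul_lt_mul_of_pos_left h2 hr0)
  · rw [Set.indicator_of_notMem hw]; exact zero_le

/-- Subharmonicity of `|f| ^ q`: on the ball it is dominated by an integral operator applied to
itself, over any shell. -/
theorem exists_enorm_rpow_le_kerInt (n : ℕ) [NeZero n] {ρ q : ℝ} (hρ0 : 0 ≤ ρ) (hρ : ρ < 1)
    (hq0 : 0 < q) (hq1 : q ≤ 1) {N : ℕ} (hN : n + 1 ≤ N * q) :
    ∃ C : ℝ≥0, ∀ f : Cn n → ℂ, DifferentiableOn ℂ f (unitBall n) → ∀ z ∈ unitBall n,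
      ‖f z‖ₑ ^ q ≤ C * kerInt ρ (N * q - n - 1) (N * q) (fun w => ‖f w‖ₑ ^ q) z := by
  have hNn : n < N := by
    have h1 : (N : ℝ) * q ≤ N := mul_le_of_le_one_right (by positivity) hq1
    have h2 : (n : ℝ) < N := by linarith
    exact_mod_cast h2
  set ρ₁ := (1 + ρ) / 2 with hρ₁
  have hρ₁1 : ρ₁ < 1 := by rw [hρ₁]; linarith
  obtain ⟨C, hC⟩ := exists_enorm_rpow_le_of_bounded n hρ₁1 hq0 hq1 hNn
  set c := (N : ℝ) * q with hc
  have hc0 : 0 ≤ c := by positivity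
  refine ⟨C * ((2 ^ (2 * n) * 3 ^ c : ℝ)).toNNReal, fun f hf z hz => ?_⟩
  have hz1 := mem_unitBall_iff.1 hz
  obtain ⟨g, hgm, hgf⟩ := exists_measurable_eqOn hf
  -- `f` is replaced by its dilation, which is bounded, and `z` by `r⁻¹ z`; the change of variable
  -- `w ↦ r w` costs only constants if `r` is close to `1`, depending on `z`
  obtain ⟨r, hr1, hrhalf, hrz, hrρ, hrq⟩ : ∃ r : ℝ, r < 1 ∧ 1 / 2 ≤ r ∧ ‖z‖ < r ∧ ρ ≤ r * ρ₁ ∧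
      1 - r ^ 2 ≤ 2 * r * (r - ‖z‖) := by
    have h1 : ∀ᶠ r : ℝ in 𝓝[<] 1, r < 1 := self_mem_nhdsWithin
    have h2 : ∀ {φ ψ : ℝ → ℝ}, Continuous φ → Continuous ψ → φ 1 < ψ 1 →
        ∀ᶠ r : ℝ in 𝓝[<] 1, φ r < ψ r := fun hφ hψ h =>
      nhdsWithin_le_nhds (hφ.continuousAt.eventually_lt hψ.continuousAt h)
    obtain ⟨r, hr⟩ := (h1.and ((h2 (φ := fun _ => 1 / 2) (ψ := fun r => r) (by fun_prop)
      (by fun_prop) (by norm_num)).and ((h2 (φ := fun _ => ‖z‖) (ψ := fun r => r) (by fun_prop)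
      (by fun_prop) hz1).and ((h2 (φ := fun _ => ρ) (ψ := fun r => r * ρ₁) (by fun_prop)
      (by fun_prop) (by rw [hρ₁]; linarith)).and (h2 (φ := fun r => 1 - r ^ 2)
      (ψ := fun r => 2 * r * (r - ‖z‖)) (by fun_prop) (by fun_prop) (by
        simp only [one_pow, sub_self]; linarith)))))).exists
    exact ⟨r, hr.1, hr.2.1.le, hr.2.2.1, hr.2.2.2.1.le, hr.2.2.2.2.le⟩
  have hr0 : 0 < r := by linarith
  obtain ⟨M, -, hM⟩ := exists_norm_dilate_le hf hr0.le hr1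
  have hzr : ‖((r⁻¹ : ℝ) : ℂ) • z‖ < 1 := by
    rw [norm_smul, Complex.norm_real, Real.norm_of_nonneg (by positivity), inv_mul_lt_iff₀ hr0,
      mul_one]
    exact hrz
  have h1 := hC (dilate r f) (differentiableOn_dilate hf hr0.le hr1.le) ⟨M, hM⟩ _
    (mem_unitBall_iff.2 hzr)
  have e1 : dilate r f (((r⁻¹ : ℝ) : ℂ) • z) = f z := by
    rw [dilate, smul_smul, ← Complex.ofReal_mul, mul_inv_cancel₀ hr0.ne', Complex.ofReal_one,
      one_smul]
  rw [e1] at h1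
  refine h1.trans ?_
  rw [ENNReal.coe_mul, mul_assoc]
  refine mul_le_mul_right ?_ _
  set F : Cn n → ℝ≥0∞ := fun w => ‖g w‖ₑ ^ q *
    ENNReal.ofReal ((1 - ‖w‖ ^ 2) ^ (c - n - 1) * kd z w ^ (-c)) with hF
  have hFm : Measurable F := measurable_mul_kernel _ _ z (hgm.enorm.pow_const q)
  have ho := (isOpen_outer n ρ₁).measurableSet
  calc _ ≤ ∫⁻ w in outer n ρ₁, ENNReal.ofReal (3 ^ c) * F (r • w) ∂(ballVolume n) := by
        refine setLIntegral_mono' ho fun w hw => ?_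
        have hw1 := mem_unitBall_iff.1 hw.1
        have hδ := one_sub_sq_pos hw.1
        have hrw : ‖r • w‖ = r * ‖w‖ := by rw [norm_smul, Real.norm_of_nonneg hr0.le]
        have hrw1 : ‖r • w‖ < 1 := by rw [hrw]; nlinarith [norm_nonneg w]
        have hδr : 1 - ‖w‖ ^ 2 ≤ 1 - ‖r • w‖ ^ 2 := by
          rw [hrw]
          have : r * ‖w‖ ≤ ‖w‖ := mul_le_of_le_one_left (norm_nonneg _) hr1.le
          have := pow_le_pow_left₀ (by positivity) this 2
          linarith
        have hk : 0 < kd z (r • w) := kd_pos hz1.le hrw1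
        have hkd : kd z (r • w) ≤ 3 * kd (((r⁻¹ : ℝ) : ℂ) • z) w := by
          set x : ℂ := inner ℂ (((r⁻¹ : ℝ) : ℂ) • z) w with hx
          have hx1 : ‖x‖ ≤ ‖z‖ / r := by
            refine (norm_inner_le_norm _ _).trans ?_
            rw [norm_smul, Complex.norm_real, Real.norm_of_nonneg (by positivity),
              div_eq_inv_mul]
            exact mul_le_of_le_one_right (by positivity) hw1.le
          have e2 : inner ℂ z (r • w) = ((r ^ 2 : ℝ) : ℂ) * x := by
            rw [hx, ← Complex.coe_smul, inner_smul_right, inner_smul_left, Complex.conj_ofReal,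
              ← mul_assoc, ← Complex.ofReal_mul]
            congr 2; field_simp
          have e3 : (1 : ℂ) - inner ℂ z (r • w) =
              ((r ^ 2 : ℝ) : ℂ) * (1 - x) + ((1 - r ^ 2 : ℝ) : ℂ) := by
            rw [e2]; push_cast; ring
          have h5 : 1 - ‖x‖ ≤ ‖1 - x‖ := by
            have := norm_sub_norm_le (1 : ℂ) x; rwa [norm_one] at this
          have h6 : 2 * r * (r - ‖z‖) = 2 * r ^ 2 * (1 - ‖z‖ / r) := by field_simp
          have hr2 : r ^ 2 ≤ 1 := pow_le_one₀ hr0.le hr1.le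
          rw [kd, e3]
          calc _ ≤ r ^ 2 * ‖1 - x‖ + (1 - r ^ 2) := by
                refine (norm_add_le _ _).trans_eq ?_
                rw [norm_mul, Complex.norm_real, Complex.norm_real,
                  Real.norm_of_nonneg (by positivity), Real.norm_of_nonneg (by linarith)]
            _ ≤ r ^ 2 * ‖1 - x‖ + 2 * r ^ 2 * (1 - ‖x‖) := by
                have : 2 * r ^ 2 * (1 - ‖z‖ / r) ≤ 2 * r ^ 2 * (1 - ‖x‖) := by gcongr
                linarith
            _ ≤ r ^ 2 * ‖1 - x‖ + 2 * r ^ 2 * ‖1 - x‖ := by gcongr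
            _ = r ^ 2 * (3 * ‖1 - x‖) := by ring
            _ ≤ 1 * (3 * ‖1 - x‖) := by gcongr
            _ = _ := one_mul _
        have h4 := rpow_neg_le_of_le_mul hk three_pos hc0 hkd
        rw [hF]
        simp only
        rw [hgf (mem_unitBall_iff.2 hrw1), dilate, Complex.coe_smul, mul_left_comm,
          ← ENNReal.ofReal_mul (by positivity)]
        refine mul_le_mul_right (ENNReal.ofReal_le_ofReal ?_) _
        have h7 : (1 - ‖w‖ ^ 2) ^ (c - n - 1) ≤ (1 - ‖r • w‖ ^ 2) ^ (c - n - 1) :=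
          Real.rpow_le_rpow hδ.le hδr (by linarith)
        have hδ' : 0 ≤ 1 - ‖r • w‖ ^ 2 := hδ.le.trans hδr
        calc _ ≤ (1 - ‖r • w‖ ^ 2) ^ (c - n - 1) * (3 ^ c * kd z (r • w) ^ (-c)) :=
              mul_le_mul h7 h4 (Real.rpow_nonneg (kd_nonneg _ _) _) (Real.rpow_nonneg hδ' _)
          _ = _ := by ring
    _ = ENNReal.ofReal (3 ^ c) * ∫⁻ w in outer n ρ₁, F (r • w) ∂(ballVolume n) :=
        lintegral_const_mul' _ _ ENNReal.ofReal_ne_top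
    _ ≤ ENNReal.ofReal (3 ^ c) * (ENNReal.ofReal ((r ^ (2 * n))⁻¹) *
          ∫⁻ w in outer n ρ, F w ∂(ballVolume n)) :=
        mul_le_mul_right (setLIntegral_outer_smul_le hr0 hr1.le hrρ hFm) _
    _ ≤ ENNReal.ofReal (3 ^ c) * (ENNReal.ofReal (2 ^ (2 * n)) *
          ∫⁻ w in outer n ρ, F w ∂(ballVolume n)) := by
        gcongr
        rw [← inv_pow]
        refine pow_le_pow_left₀ (by positivity) ?_ _
        rw [inv_le_comm₀ hr0 two_pos]; linarith
    _ = (2 ^ (2 * n) * 3 ^ c : ℝ).toNNReal * ∫⁻ w in outer n ρ, F w ∂(ballVolume n) := by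
        rw [← mul_assoc, ← ENNReal.ofReal_mul (by positivity), mul_comm (3 ^ c)]; rfl
    _ = _ := by
        congr 1
        refine congrFun (kerInt_congr (u := fun w => ‖g w‖ₑ ^ q) fun w hw => ?_) z
        rw [hgf hw]

/-! ### Nontangential maximal functions -/

/-- The nontangential maximal function: the supremum of `h` over the approach region. -/
def ntMax {n : ℕ} (κ : ℝ) (h : Cn n → ℝ≥0∞) (ζ : UnitSphere n) : ℝ≥0∞ :=
  ⨆ z ∈ approachRegion κ ζ, h z

/-- The size of `f`, weighted by the power `t` of the distance to the sphere. -/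
def weighted {n : ℕ} (t : ℝ) (f : Cn n → ℂ) (z : Cn n) : ℝ≥0∞ :=
  ENNReal.ofReal ((1 - ‖z‖ ^ 2) ^ t) * ‖f z‖ₑ

section ntMax

variable {n : ℕ} {κ t : ℝ} {h : Cn n → ℝ≥0∞} {f : Cn n → ℂ}

theorem le_ntMax {ζ : UnitSphere n} {z : Cn n} (hz : z ∈ approachRegion κ ζ) :
    h z ≤ ntMax κ h ζ :=
  le_iSup₂ (f := fun z _ => h z) z hz

/-- The superlevel sets are unions of shadows, so that no regularity of `h` is needed. -/
theorem setOf_lt_ntMax (a : ℝ≥0∞) :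
    {ζ | a < ntMax κ h ζ} = ⋃ z ∈ {z | a < h z}, shadow κ z := by
  ext ζ
  simp only [ntMax, lt_iSup_iff, Set.mem_iUnion, shadow, Set.mem_ofPred_eq]
  exact ⟨fun ⟨z, hz, ha⟩ => ⟨z, ha, hz⟩, fun ⟨z, ha, hz⟩ => ⟨z, hz, ha⟩⟩

theorem measurable_ntMax (κ : ℝ) (h : Cn n → ℝ≥0∞) : Measurable (ntMax κ h) :=
  measurable_of_Ioi fun a => by
    rw [show ntMax κ h ⁻¹' Set.Ioi a = {ζ | a < ntMax κ h ζ} from rfl, setOf_lt_ntMax]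
    exact (isOpen_biUnion fun z _ => isOpen_shadow κ z).measurableSet

theorem essSup_eq_ntMax (hh : ContinuousOn h (unitBall n)) (ζ : UnitSphere n) :
    essSup h ((ballVolume n).restrict (approachRegion κ ζ)) = ntMax κ h ζ := by
  have hΓ := isOpen_approachRegion κ ζ
  apply le_antisymm
  · refine essSup_le_of_ae_le _ ?_
    filter_upwards [ae_restrict_mem hΓ.measurableSet] with z hz using le_ntMax hz
  · refine iSup₂_le fun z hz => ?_
    by_contra! hlt
    set c := essSup h ((ballVolume n).restrict (approachRegion κ ζ)) with hc
    have ho : IsOpen (approachRegion κ ζ ∩ h ⁻¹' Set.Ioi c) :=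
      (hh.mono fun w hw => hw.1).isOpen_inter_preimage hΓ isOpen_Ioi
    have h0 : (ballVolume n) (approachRegion κ ζ ∩ h ⁻¹' Set.Ioi c) = 0 := by
      have h1 : ∀ᵐ w ∂((ballVolume n).restrict (approachRegion κ ζ)), h w ≤ c := ae_le_essSup
      rw [ae_restrict_iff' hΓ.measurableSet, ae_iff] at h1
      refine measure_mono_null (fun w hw => ?_) h1
      exact fun hcon => (hcon hw.1).not_gt hw.2
    rw [ballVolume_apply_of_subset fun w hw => hw.1.1, mul_eq_zero, ENNReal.inv_eq_zero] at h0
    rcases h0 with h0 | h0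
    · exact volume_unitBall_ne_top n h0
    · exact (ho.measure_pos volume ⟨z, hz, hlt⟩).ne' h0

theorem weighted_eq_enorm {z : Cn n} (hz : z ∈ unitBall n) :
    ‖(((1 - ‖z‖ ^ 2) ^ t : ℝ) : ℂ) * f z‖ₑ = weighted t f z := by
  have hδ := one_sub_sq_pos hz
  rw [weighted, enorm_mul, ← ofReal_norm, Complex.norm_real,
    Real.norm_of_nonneg (Real.rpow_nonneg hδ.le _)]

theorem continuousOn_weighted (hf : DifferentiableOn ℂ f (unitBall n)) :
    ContinuousOn (weighted t f) (unitBall n) := by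
  have h1 : ContinuousOn (fun z : Cn n => (((1 - ‖z‖ ^ 2) ^ t : ℝ) : ℂ) * f z) (unitBall n) := by
    refine ContinuousOn.mul ?_ hf.continuousOn
    refine Complex.continuous_ofReal.comp_continuousOn ?_
    exact ContinuousOn.rpow_const (by fun_prop) fun z hz => Or.inl (one_sub_sq_pos hz).ne'
  exact h1.enorm.congr fun z hz => (weighted_eq_enorm hz).symm

theorem tentSupNorm_eq (p : ℝ) (hf : DifferentiableOn ℂ f (unitBall n)) :
    tentSupNorm κ p (fun z => (((1 - ‖z‖ ^ 2) ^ t : ℝ) : ℂ) * f z) =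
      (∫⁻ ζ, ntMax κ (weighted t f) ζ ^ p ∂(sphereMeasure n)) ^ (1 / p) := by
  unfold tentSupNorm
  congr 2
  funext ζ
  rw [← essSup_eq_ntMax (continuousOn_weighted hf)]
  congr 1
  refine essSup_congr_ae ?_
  filter_upwards [ae_restrict_mem (isOpen_approachRegion κ ζ).measurableSet] with z hz
  exact weighted_eq_enorm hz.1

end ntMax

theorem lintegral_ne_top_of_rpow {X : Type*} [MeasurableSpace X] {μ : Measure X}
    [IsFiniteMeasure μ] {p : ℝ} (hp : 1 ≤ p) {G : X → ℝ≥0∞} (hG : ∫⁻ x, G x ^ p ∂μ ≠ ⊤) :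
    ∫⁻ x, G x ∂μ ≠ ⊤ := by
  have h1 : ∀ x, G x ≤ 1 + G x ^ p := fun x => by
    rcases le_total (G x) 1 with h | h
    · exact h.trans le_self_add
    · calc G x = G x ^ (1 : ℝ) := (ENNReal.rpow_one _).symm
        _ ≤ G x ^ p := ENNReal.rpow_le_rpow_of_exponent_le h hp
        _ ≤ _ := le_add_self
  refine ((lintegral_mono h1).trans_lt ?_).ne
  rw [lintegral_add_left measurable_const, lintegral_const, one_mul]
  exact ENNReal.add_lt_top.2 ⟨measure_lt_top _ _, hG.lt_top⟩

/-- Multipliers whose coefficients are symbols act on the weighted nontangential maximal functions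
in `L^p`; they also change the aperture. -/
theorem exists_lintegral_ntMax_mult_le (n : ℕ) [NeZero n] {γ κ p : ℝ} (hγ : 1 < γ) (hκ : 0 < κ)
    (hp : 1 < p) {e : ℝ} {m : ℕ → ℝ} (hm : IsSymbol e m) {t₁ t₂ : ℝ} (ht : t₂ = t₁ + e)
    (ht0 : 0 < t₂) :
    ∃ C : ℝ≥0, ∀ f : Cn n → ℂ, DifferentiableOn ℂ f (unitBall n) →
      ∫⁻ ζ, ntMax κ (weighted t₂ (mult m f)) ζ ^ p ∂(sphereMeasure n) ≤
        C * ∫⁻ ζ, ntMax γ (weighted t₁ f) ζ ^ p ∂(sphereMeasure n) := by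
  obtain ⟨C₁, h₁⟩ := exists_mult_le_maxFn n hγ hκ hm ht ht0
  obtain ⟨C₂, h₂⟩ := lintegral_maxFn_rpow_le n hp
  have hp0 : 0 < p := by linarith
  have := sphereMeasure_isProbability n
  refine ⟨C₁ ^ p * C₂ + 1, fun f hf => ?_⟩
  set G := ntMax γ (weighted t₁ f) with hG
  have hGm : Measurable G := measurable_ntMax _ _
  by_cases hfin : ∫⁻ ζ, G ζ ^ p ∂(sphereMeasure n) = ⊤
  · rw [hfin, ENNReal.mul_top (by simp)]; exact le_top
  have h3 := h₁ f hf G hGm (lintegral_ne_top_of_rpow hp.le hfin) fun ζ w hw => le_ntMax hw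
  calc _ ≤ ∫⁻ ζ, (C₁ : ℝ≥0∞) ^ p * maxFn G ζ ^ p ∂(sphereMeasure n) := by
        refine lintegral_mono fun ζ => ?_
        rw [← ENNReal.mul_rpow_of_nonneg _ _ hp0.le]
        exact ENNReal.rpow_le_rpow (iSup₂_le fun z hz => h3 ζ z hz) hp0.le
    _ = (C₁ : ℝ≥0∞) ^ p * ∫⁻ ζ, maxFn G ζ ^ p ∂(sphereMeasure n) :=
        lintegral_const_mul _ ((measurable_maxFn hGm).pow_const p)
    _ ≤ (C₁ : ℝ≥0∞) ^ p * (C₂ * ∫⁻ ζ, G ζ ^ p ∂(sphereMeasure n)) :=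
        mul_le_mul_right (h₂ G hGm) _
    _ ≤ _ := by
        rw [← mul_assoc, ENNReal.coe_add, ENNReal.coe_mul, ENNReal.coe_rpow_of_nonneg _ hp0.le,
          ENNReal.coe_one]
        exact mul_le_mul_left le_self_add _

/-- Composing a quotient of rising factorials with its inverse. -/
theorem mult_ratio_ratio {n : ℕ} [NeZero n] {f : Cn n → ℂ} (hf : DifferentiableOn ℂ f (unitBall n))
    (m : ℕ → ℝ) {a b : ℝ} (ha : ∀ j : ℕ, a + j ≠ 0) (hb : ∀ j : ℕ, b + j ≠ 0) :
    mult (m * ratio b a) (mult (ratio a b) f) = mult m f := by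
  rw [mult_mult _ (isSymbol_ratio ha hb) hf]
  congr 1
  funext k
  rw [Pi.mul_apply, Pi.mul_apply, mul_assoc, ratio_mul_ratio ha, ratio_self hb, mul_one]

theorem exists_lintegral_approach_weight_le (n : ℕ) [NeZero n] {κ e : ℝ} (hκ : 0 < κ)
    (he : -(n : ℝ) - 1 < e) : ∃ C : ℝ≥0, ∀ ζ : UnitSphere n,
      ∫⁻ w in approachRegion κ ζ, ENNReal.ofReal ((1 - ‖w‖ ^ 2) ^ e) ∂(ballVolume n) ≤ C := by
  obtain ⟨C, hC⟩ := exists_lintegral_approach_le n hκ he (lt_add_one (n + 1 + e))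
  refine ⟨C, fun ζ => ?_⟩
  have h := hC ζ 0 (by rw [mem_unitBall_iff, norm_zero]; exact one_pos)
  have e0 : ∀ w : Cn n, kd 0 w = 1 := fun w => by simp [kd]
  simpa only [e0, Real.one_rpow, ENNReal.ofReal_one, mul_one] using h

/-- Membership of the nontangential maximal function of `g`, with a small weight, in `L^p` makes `g`
integrable against a power of the distance to the sphere. -/
theorem lintegral_weight_lt_top (n : ℕ) [NeZero n] {β p ε : ℝ} (hε : ε < β + 1)
    (hp : 1 ≤ p) {g : Cn n → ℂ} (hgm : Measurable g)
    (hN : ∫⁻ ζ, ntMax 4 (weighted ε g) ζ ^ p ∂(sphereMeasure n) ≠ ⊤) :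
    ∫⁻ z, ‖g z‖ₑ * ENNReal.ofReal ((1 - ‖z‖ ^ 2) ^ β) ∂(ballVolume n) < ⊤ := by
  have := sphereMeasure_isProbability n
  obtain ⟨C₁, h₁⟩ := exists_lintegral_mul_le_area n (le_refl (4 : ℝ)) β
  obtain ⟨C₂, h₂⟩ := exists_lintegral_approach_weight_le n (κ := 4) (e := β - n - ε)
    (by norm_num) (by linarith)
  set N := ntMax 4 (weighted ε g) with hNdef
  have hwm : Measurable (weighted ε g) := (measurable_weight ε).mul hgm.enorm
  have h3 := h₁ (fun z => ENNReal.ofReal ((1 - ‖z‖ ^ 2) ^ (-ε))) (weighted ε g) N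
    (measurable_weight _) hwm (measurable_ntMax _ _) fun ζ w hw => le_ntMax hw
  have h4 : ∀ ζ : UnitSphere n,
      area 4 (β - n) (fun z => ENNReal.ofReal ((1 - ‖z‖ ^ 2) ^ (-ε))) ζ ≤ C₂ := by
    intro ζ
    refine le_trans (le_of_eq ?_) (h₂ ζ)
    refine setLIntegral_congr_fun (isOpen_approachRegion 4 ζ).measurableSet fun w hw => ?_
    have hδ := one_sub_sq_pos hw.1
    simp only
    rw [← ENNReal.ofReal_mul (by positivity), ← Real.rpow_add hδ]
    congr 2; ring
  calc _ = ∫⁻ z, ENNReal.ofReal ((1 - ‖z‖ ^ 2) ^ (-ε)) * weighted ε g z *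
        ENNReal.ofReal ((1 - ‖z‖ ^ 2) ^ β) ∂(ballVolume n) := by
        refine lintegral_congr_ae ?_
        filter_upwards [ae_mem_unitBall n] with z hz
        have hδ := one_sub_sq_pos hz
        rw [weighted, ← mul_assoc, ← ENNReal.ofReal_mul (by positivity), ← Real.rpow_add hδ,
          neg_add_cancel, Real.rpow_zero, ENNReal.ofReal_one, one_mul]
    _ ≤ _ := h3
    _ ≤ C₁ * ∫⁻ ζ, N ζ * C₂ ∂(sphereMeasure n) := by
        gcongr with ζ; exact h4 ζ
    _ = C₁ * ((∫⁻ ζ, N ζ ∂(sphereMeasure n)) * C₂) := by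
        rw [lintegral_mul_const _ (measurable_ntMax _ _)]
    _ < ⊤ := ENNReal.mul_lt_top ENNReal.coe_lt_top (ENNReal.mul_lt_top
        (lintegral_ne_top_of_rpow hp hN).lt_top ENNReal.coe_lt_top)

/-! ### Bounded holomorphic functions -/

section bddHolo

variable {n : ℕ} {f : Cn n → ℂ}

/-- The extension by zero of the restriction of `f` to the ball. -/
def cut (f : Cn n → ℂ) : Cn n → ℂ := (unitBall n).indicator f

theorem cut_apply {z : Cn n} (hz : z ∈ unitBall n) : cut f z = f z := Set.indicator_of_mem hz f

theorem isHolo_cut (hf : DifferentiableOn ℂ f (unitBall n)) : IsHolo n (cut f) :=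
  ⟨hf.congr fun _ hz => cut_apply hz, fun _ hz => Set.indicator_of_notMem hz f⟩

theorem IsHolo.ext {g : Cn n → ℂ} (hf : IsHolo n f) (hg : IsHolo n g)
    (h : ∀ z ∈ unitBall n, f z = g z) : f = g := by
  funext z
  by_cases hz : z ∈ unitBall n
  · exact h z hz
  · rw [hf.2 z hz, hg.2 z hz]

variable (n) in
/-- The bounded holomorphic functions on the unit ball. -/
def bddHolo : Submodule ℂ (Cn n → ℂ) where
  carrier := {f | IsHolo n f ∧ ∃ M : ℝ, ∀ z, ‖f z‖ ≤ M}
  zero_mem' := ⟨⟨differentiableOn_const 0, fun _ _ => rfl⟩, 0, fun z => by simp⟩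
  add_mem' := fun {f g} ⟨hf, M, hM⟩ ⟨hg, M', hM'⟩ =>
    ⟨⟨hf.1.add hg.1, fun z hz => by simp [hf.2 z hz, hg.2 z hz]⟩, M + M',
      fun z => (norm_add_le _ _).trans (add_le_add (hM z) (hM' z))⟩
  smul_mem' := fun c f ⟨hf, M, hM⟩ =>
    ⟨⟨hf.1.const_smul c, fun z hz => by simp [hf.2 z hz]⟩, ‖c‖ * M, fun z => by
      rw [Pi.smul_apply, norm_smul]; exact mul_le_mul_of_nonneg_left (hM z) (norm_nonneg c)⟩

theorem norm_cut_le {M : ℝ} (hM : ∀ z, ‖z‖ < 1 → ‖f z‖ ≤ M) (z : Cn n) : ‖cut f z‖ ≤ M := by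
  have hM0 : 0 ≤ M := (norm_nonneg _).trans (hM 0 (by rw [norm_zero]; exact one_pos))
  by_cases hz : z ∈ unitBall n
  · rw [cut_apply hz]; exact hM z (mem_unitBall_iff.1 hz)
  · rw [cut, Set.indicator_of_notMem hz, norm_zero]; exact hM0

theorem cut_mem_bddHolo (hf : DifferentiableOn ℂ f (unitBall n)) {M : ℝ}
    (hM : ∀ z, ‖z‖ < 1 → ‖f z‖ ≤ M) : cut f ∈ bddHolo n :=
  ⟨isHolo_cut hf, M, norm_cut_le hM⟩

theorem cut_dilate_mem_bddHolo (hf : DifferentiableOn ℂ f (unitBall n)) {r : ℝ} (hr0 : 0 ≤ r)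
    (hr1 : r < 1) : cut (dilate r f) ∈ bddHolo n := by
  obtain ⟨M, -, hM⟩ := exists_norm_dilate_le hf hr0 hr1
  exact cut_mem_bddHolo (differentiableOn_dilate hf hr0 hr1.le) fun z hz => hM z hz.le

/-- The homogeneous polynomial `⟨·, u⟩ ^ k` on the unit ball. -/
def power (k : ℕ) (u : Cn n) : bddHolo n :=
  ⟨cut fun z => (inner ℂ u z : ℂ) ^ k,
    cut_mem_bddHolo (M := ‖u‖ ^ k) (((innerSL ℂ u).differentiable).pow k).differentiableOn
      fun z hz => by
        rw [norm_pow]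
        refine pow_le_pow_left₀ (norm_nonneg _) ((norm_inner_le_norm u z).trans ?_) k
        exact mul_le_of_le_one_right (norm_nonneg u) hz.le⟩

theorem power_apply {k : ℕ} {u z : Cn n} (hz : z ∈ unitBall n) :
    (power k u : Cn n → ℂ) z = (inner ℂ u z : ℂ) ^ k :=
  cut_apply (f := fun z => (inner ℂ u z : ℂ) ^ k) hz

theorem norm_power_le (k : ℕ) (u z : Cn n) : ‖(power k u : Cn n → ℂ) z‖ ≤ ‖u‖ ^ k :=
  norm_cut_le (fun z hz => by
    rw [norm_pow]
    refine pow_le_pow_left₀ (norm_nonneg _) ((norm_inner_le_norm u z).trans ?_) k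
    exact mul_le_of_le_one_right (norm_nonneg u) hz.le) z

/-- A functional on the bounded holomorphic functions that is bounded for the supremum norm commutes
with uniformly convergent series. -/
theorem hasSum_of_bounded (L : bddHolo n →ₗ[ℂ] ℂ) {K : ℝ}
    (hL : ∀ (F : bddHolo n) (M : ℝ), (∀ z, ‖(F : Cn n → ℂ) z‖ ≤ M) → ‖L F‖ ≤ K * M)
    {P : ℕ → bddHolo n} {F : bddHolo n} {u : ℕ → ℝ} (hu : Summable u)
    (hP : ∀ k z, ‖(P k : Cn n → ℂ) z‖ ≤ u k)
    (hF : ∀ z ∈ unitBall n, HasSum (fun k => (P k : Cn n → ℂ) z) ((F : Cn n → ℂ) z)) :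
    HasSum (fun k => L (P k)) (L F) := by
  have hs : Summable fun k => L (P k) := by
    refine Summable.of_norm_bounded (hu.mul_left K) fun k => hL (P k) (u k) (hP k)
  refine (hs.hasSum_iff_tendsto_nat).2 ?_
  rw [tendsto_iff_norm_sub_tendsto_zero]
  have h1 : Tendsto (fun N => K * ∑' k, u (k + N)) atTop (𝓝 (K * 0)) :=
    (tendsto_sum_nat_add u).const_mul K
  rw [mul_zero] at h1
  refine squeeze_zero (fun _ => norm_nonneg _) (fun N => ?_) h1
  have h2 : ∑ k ∈ Finset.range N, L (P k) - L F = -L (F - ∑ k ∈ Finset.range N, P k) := by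
    rw [map_sub, map_sum]; ring
  rw [h2, norm_neg]
  refine hL _ _ fun z => ?_
  rw [Submodule.coe_sub, Submodule.coe_sum, Pi.sub_apply, Finset.sum_apply]
  have hsN : Summable fun k => u (k + N) := (summable_nat_add_iff N).2 hu
  by_cases hz : z ∈ unitBall n
  · have h3 := (hF z hz)
    rw [← h3.tsum_eq, ← h3.summable.sum_add_tsum_nat_add N, add_sub_cancel_left]
    exact tsum_of_norm_bounded hsN.hasSum fun k => hP _ z
  · rw [F.2.1.2 z hz, Finset.sum_eq_zero fun k _ => (P k).2.1.2 z hz, sub_zero, norm_zero]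
    exact tsum_nonneg fun k => (norm_nonneg _).trans (hP _ z)

/-- Dilations of holomorphic functions are limits of polynomials, which are combinations of the
functions `⟨·, u⟩ ^ k`. -/
theorem eq_zero_of_power [NeZero n] (L : bddHolo n →ₗ[ℂ] ℂ) {K : ℝ}
    (hL : ∀ (F : bddHolo n) (M : ℝ), (∀ z, ‖(F : Cn n → ℂ) z‖ ≤ M) → ‖L F‖ ≤ K * M)
    (h0 : ∀ k u, L (power k u) = 0) (hf : DifferentiableOn ℂ f (unitBall n)) {r : ℝ}
    (hr0 : 0 ≤ r) (hr1 : r < 1) : L ⟨cut (dilate r f), cut_dilate_mem_bddHolo hf hr0 hr1⟩ = 0 := by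
  have hspan : ∀ k, ∀ P ∈ Submodule.span ℂ (Set.range fun (u z : Cn n) => (inner ℂ u z : ℂ) ^ k),
      ∃ h : cut P ∈ bddHolo n, L ⟨cut P, h⟩ = 0 := by
    intro k P hP
    induction hP using Submodule.span_induction with
    | mem P hP =>
      obtain ⟨u, rfl⟩ := hP
      exact ⟨(power k u).2, h0 k u⟩
    | zero =>
      have e : cut (0 : Cn n → ℂ) = 0 := Set.indicator_zero' _
      refine ⟨by rw [e]; exact zero_mem _, ?_⟩
      simp only [e]; exact map_zero L
    | add P Q _ _ hP hQ =>
      obtain ⟨h1, e1⟩ := hP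
      obtain ⟨h2, e2⟩ := hQ
      have e : cut (P + Q) = cut P + cut Q := Set.indicator_add _ _ _
      refine ⟨by rw [e]; exact add_mem h1 h2, ?_⟩
      have := map_add L ⟨_, h1⟩ ⟨_, h2⟩
      rw [e1, e2, add_zero] at this
      simp only [e]; exact this
    | smul c P _ hP =>
      obtain ⟨h1, e1⟩ := hP
      have e : cut (c • P) = c • cut P := Set.indicator_smul _ (fun _ => c) P
      refine ⟨by rw [e]; exact Submodule.smul_mem _ c h1, ?_⟩
      have := map_smul L c ⟨_, h1⟩
      rw [e1, smul_zero] at this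
      simp only [e]; exact this
  have hd := differentiableOn_dilate hf hr0 hr1.le
  choose hmem hzero using fun k => hspan k _ (homogPart_mem_span hd k)
  obtain ⟨u, hu, hbound⟩ := (isHomogSeries_homogPart hf).bound ((1 + r) / 2) (by linarith)
    (by linarith)
  have h1 : HasSum (fun k => L ⟨cut (homogPart (dilate r f) k), hmem k⟩)
      (L ⟨cut (dilate r f), cut_dilate_mem_bddHolo hf hr0 hr1⟩) := by
    refine hasSum_of_bounded L hL hu (fun k z => norm_cut_le (fun z hz => ?_) z) fun z hz => ?_
    · rw [homogPart_dilate hf, ← homogPart_smul hf]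
      refine hbound k _ ?_
      rw [norm_smul, Complex.norm_real, Real.norm_of_nonneg hr0]
      nlinarith [norm_nonneg z]
    · simp only [cut_apply hz]
      exact hasSum_homogPart hd (mem_unitBall_iff.1 hz)
  simp only [hzero] at h1
  exact h1.unique hasSum_zero

end bddHolo

/-! ### Hardy type tent spaces -/

section tentNorm

variable {n : ℕ} {γ α p q : ℝ} {f : Cn n → ℂ}

theorem tentNorm_eq_area (γ p q α : ℝ) (f : Cn n → ℂ) : tentNorm γ p q α f =
    (∫⁻ ζ, area γ α (fun z => ‖f z‖ₑ ^ q) ζ ^ (p / q) ∂(sphereMeasure n)) ^ (1 / p) := rfl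

theorem tentNorm_congr {g : Cn n → ℂ} (h : ∀ z ∈ unitBall n, f z = g z) :
    tentNorm γ p q α f = tentNorm γ p q α g := by
  rw [tentNorm_eq_area, tentNorm_eq_area,
    area_congr (v := fun z => ‖g z‖ₑ ^ q) fun z hz => by rw [h z hz]]

theorem tentNorm_smul (hp : 0 < p) (hq : 0 < q) (c : ℂ) (hf : Measurable f) :
    tentNorm γ p q α (c • f) = ‖c‖ₑ * tentNorm γ p q α f := by
  have h1 : ∀ ζ : UnitSphere n, area γ α (fun z => ‖(c • f) z‖ₑ ^ q) ζ =
      ‖c‖ₑ ^ q * area γ α (fun z => ‖f z‖ₑ ^ q) ζ := fun ζ => by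
    rw [area, area, ← lintegral_const_mul _ (measurable_mul_weight α (hf.enorm.pow_const q))]
    refine lintegral_congr fun z => ?_
    rw [Pi.smul_apply, enorm_smul, ENNReal.mul_rpow_of_nonneg _ _ hq.le, mul_assoc]
  rw [tentNorm_eq_area, tentNorm_eq_area]
  simp_rw [h1, ENNReal.mul_rpow_of_nonneg _ _ (div_nonneg hp.le hq.le)]
  rw [lintegral_const_mul _ ((measurable_area' γ α (hf.enorm.pow_const q)).pow_const _),
    ENNReal.mul_rpow_of_nonneg _ _ (by positivity), ← ENNReal.rpow_mul, ← ENNReal.rpow_mul]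
  congr 1
  rw [show q * (p / q * (1 / p)) = 1 by field_simp, ENNReal.rpow_one]

end tentNorm

theorem exists_tentNorm_le_of_bounded (n : ℕ) [NeZero n] {γ p q α : ℝ} (hγ : 0 < γ) (hp : 0 < p)
    (hq : 0 < q) (hα : -(n : ℝ) - 1 < α) : ∃ C : ℝ≥0, ∀ (f : Cn n → ℂ) (M : ℝ),
      (∀ z ∈ unitBall n, ‖f z‖ ≤ M) → tentNorm γ p q α f ≤ C * ENNReal.ofReal M := by
  obtain ⟨C, hC⟩ := exists_lintegral_approach_weight_le n hγ hα
  have := sphereMeasure_isProbability n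
  refine ⟨C ^ (1 / q), fun f M hM => ?_⟩
  have hpq : 0 ≤ p / q := by positivity
  have h1 : ∀ ζ : UnitSphere n, area γ α (fun z => ‖f z‖ₑ ^ q) ζ ≤ ENNReal.ofReal M ^ q * C := by
    intro ζ
    refine le_trans ?_ (mul_le_mul_right (hC ζ) _)
    rw [area, ← lintegral_const_mul _ (measurable_weight α)]
    refine setLIntegral_mono' (isOpen_approachRegion γ ζ).measurableSet fun z hz => ?_
    refine mul_le_mul_left (ENNReal.rpow_le_rpow ?_ hq.le) _
    rw [← ofReal_norm]
    exact ENNReal.ofReal_le_ofReal (hM z hz.1)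
  calc tentNorm γ p q α f ≤ (∫⁻ _, (ENNReal.ofReal M ^ q * C) ^ (p / q)
        ∂(sphereMeasure n)) ^ (1 / p) := by
        rw [tentNorm_eq_area]
        exact ENNReal.rpow_le_rpow (lintegral_mono fun ζ => ENNReal.rpow_le_rpow (h1 ζ) hpq)
          (by positivity)
    _ = _ := by
        rw [lintegral_const, measure_univ, mul_one, ← ENNReal.rpow_mul,
          show p / q * (1 / p) = 1 / q by field_simp,
          ENNReal.mul_rpow_of_nonneg _ _ (by positivity), ← ENNReal.rpow_mul,
          mul_one_div_cancel hq.ne', ENNReal.rpow_one,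
          ENNReal.coe_rpow_of_nonneg _ (by positivity), mul_comm]

/-- A holomorphic function in the tent space is dominated by a positive kernel operator applied to
its `q`-th power, which is controlled by the tent norm. -/
theorem exists_kernel_majorant (n : ℕ) [NeZero n] {γ p q α : ℝ} (hγ : 1 < γ) (hq0 : 0 < q)
    (hq1 : q ≤ 1) (hqp : q < p) : ∃ (b : ℝ) (C : ℝ≥0), α < b ∧ 0 ≤ n + 1 + b ∧
      (∀ f : Cn n → ℂ, DifferentiableOn ℂ f (unitBall n) → ∀ z ∈ unitBall n,
        ‖f z‖ₑ ^ q ≤ C * kerInt γ⁻¹ b (n + 1 + b) (fun w => ‖f w‖ₑ ^ q) z) ∧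
      ∀ u : Cn n → ℝ≥0∞, Measurable u →
        ∫⁻ ζ, kerInt γ⁻¹ b (b - α) u (ζ : UnitSphere n) ^ (p / q) ∂(sphereMeasure n) ≤
          C * ∫⁻ ζ, area γ α u ζ ^ (p / q) ∂(sphereMeasure n) := by
  have hγ0 : 0 < γ := by linarith
  -- the majorant needs `n + 1 ≤ N q`, and its norm bound needs `n < N q - n - 1 - α`
  obtain ⟨N, hN⟩ := exists_nat_gt (max ((n + 1) / q) ((2 * n + 1 + α) / q))
  have hN1 : n + 1 ≤ N * q := ((div_lt_iff₀ hq0).1 ((le_max_left _ _).trans_lt hN)).le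
  have hN2 : 2 * n + 1 + α < N * q := (div_lt_iff₀ hq0).1 ((le_max_right _ _).trans_lt hN)
  have hn : (0 : ℝ) ≤ n := n.cast_nonneg
  obtain ⟨C₁, h₁⟩ := exists_enorm_rpow_le_kerInt n (inv_nonneg.2 hγ0.le)
    (inv_lt_one_of_one_lt₀ hγ) hq0 hq1 hN1
  obtain ⟨C₂, h₂⟩ := exists_lintegral_kerInt_le_area n (ε := min ((γ - 1) / 2) 1)
    (lt_min (by linarith) one_pos) (min_le_right _ _) hγ0 (ρ := γ⁻¹) (α := α) (b := N * q - n - 1)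
    (r := p / q) (fun w => one_lt_of_aperture hγ) (by linarith) ((one_lt_div₀ hq0).2 hqp)
  refine ⟨N * q - n - 1, max C₁ C₂, by linarith, by linarith, fun f hf z hz => ?_, fun u hu => ?_⟩
  · rw [show n + 1 + (N * q - n - 1) = N * q by ring]
    exact (h₁ f hf z hz).trans (mul_le_mul_left (by exact_mod_cast le_max_left _ _) _)
  · exact (h₂ u hu).trans (mul_le_mul_left (by exact_mod_cast le_max_right _ _) _)

theorem kerInt_smul_le {n : ℕ} {ρ b c : ℝ} (hc : 0 ≤ c) (u : Cn n → ℝ≥0∞) {z : Cn n}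
    (hz : z ∈ unitBall n) {r : ℝ} (hr0 : 0 ≤ r) (hr1 : r ≤ 1) :
    kerInt ρ b c u ((r : ℂ) • z) ≤ ENNReal.ofReal (2 ^ c) * kerInt ρ b c u z := by
  have hz1 := (mem_unitBall_iff.1 hz).le
  rw [kerInt, kerInt, ← lintegral_const_mul' _ _ ENNReal.ofReal_ne_top]
  refine setLIntegral_mono' (isOpen_outer n ρ).measurableSet fun w hw => ?_
  have hw1 := mem_unitBall_iff.1 hw.1
  have hδ := one_sub_sq_pos hw.1
  have h1 : kd z w ≤ 2 * kd ((r : ℂ) • z) w := by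
    rw [kd_comm z, kd_comm _ w]; exact kd_le_two_kd_smul hw1.le hz1 hr0 hr1
  have h2 := rpow_neg_le_of_le_mul (kd_pos hz1 hw1) two_pos hc h1
  rw [mul_left_comm, ← ENNReal.ofReal_mul (by positivity)]
  refine mul_le_mul_right (ENNReal.ofReal_le_ofReal ?_) _
  rw [mul_left_comm]
  exact mul_le_mul_of_nonneg_left h2 (Real.rpow_nonneg hδ.le _)

theorem measurable_dilate {n : ℕ} {f : Cn n → ℂ} (hf : Measurable f) (r : ℝ) :
    Measurable (dilate r f) := hf.comp (measurable_const_smul (r : ℂ))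

/-- Dilations converge in the tent quasinorm, by dominated convergence: the kernel majorant of `f`
also dominates its dilations. -/
theorem tendsto_tentNorm_dilate_sub {n : ℕ} [NeZero n] {γ p q α : ℝ} (hγ : 1 < γ) (hq0 : 0 < q)
    (hq1 : q ≤ 1) (hqp : q < p) (hα : -(n : ℝ) - 1 < α) {f : Cn n → ℂ} (hf : IsHolo n f)
    (hfn : tentNorm γ p q α f < ⊤) :
    Tendsto (fun r : ℝ => tentNorm γ p q α (dilate r f - f)) (𝓝[<] 1) (𝓝 0) := by
  have hp : 0 < p := hq0.trans hqp
  have hγ0 : 0 < γ := by linarith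
  have hpq : 0 < p / q := by positivity
  obtain ⟨b, C, hαb, hb0, hmaj, hnorm⟩ := exists_kernel_majorant n (α := α) hγ hq0 hq1 hqp
  obtain ⟨C₂, hC₂⟩ := exists_area_kerInt_le n γ⁻¹ hγ0 hα hαb
  have hfm := hf.measurable
  set u : Cn n → ℝ≥0∞ := fun w => ‖f w‖ₑ ^ q with hu
  have hum : Measurable u := hfm.enorm.pow_const q
  set S := kerInt γ⁻¹ b (n + 1 + b) u with hS
  have hSm : Measurable S := measurable_kerInt _ _ _ hum
  set Λ : UnitSphere n → ℝ≥0∞ := fun ζ => kerInt γ⁻¹ b (b - α) u ζ with hΛ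
  have hΛm : Measurable Λ := (measurable_kerInt _ _ _ hum).comp measurable_subtype_coe
  have hΛi : ∫⁻ ζ, Λ ζ ^ (p / q) ∂(sphereMeasure n) ≠ ⊤ := by
    refine ((hnorm u hum).trans_lt (ENNReal.mul_lt_top ENNReal.coe_lt_top ?_)).ne
    exact (tentNorm_lt_top_iff hp f).1 hfn
  have hΛfin : ∀ᵐ ζ ∂(sphereMeasure n), Λ ζ ≠ ⊤ := by
    filter_upwards [ae_lt_top (hΛm.pow_const _) hΛi] with ζ hζ h
    rw [h, ENNReal.top_rpow_of_pos hpq] at hζ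
    exact lt_irrefl _ hζ
  -- `D * S` dominates `|f_r - f| ^ q` for all `r` at once
  set D : ℝ≥0∞ := 2 ^ q * (C * ENNReal.ofReal (2 ^ (n + 1 + b)) + C) with hD
  have hDtop : D ≠ ⊤ := ENNReal.mul_ne_top (two_rpow_ne_top hq0.le)
    (ENNReal.add_ne_top.2 ⟨ENNReal.mul_ne_top ENNReal.coe_ne_top ENNReal.ofReal_ne_top,
      ENNReal.coe_ne_top⟩)
  have hdom : ∀ r : ℝ, 0 ≤ r → r ≤ 1 → ∀ z ∈ unitBall n, ‖(dilate r f - f) z‖ₑ ^ q ≤ D * S z := by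
    intro r hr0 hr1 z hz
    have hrz : (r : ℂ) • z ∈ unitBall n := by
      rw [mem_unitBall_iff, norm_smul, Complex.norm_real, Real.norm_of_nonneg hr0]
      exact (mul_le_of_le_one_left (norm_nonneg z) hr1).trans_lt (mem_unitBall_iff.1 hz)
    have h1 : ‖dilate r f z‖ₑ ^ q ≤ C * (ENNReal.ofReal (2 ^ (n + 1 + b)) * S z) :=
      (hmaj f hf.1 _ hrz).trans (mul_le_mul_right (kerInt_smul_le hb0 u hz hr0 hr1) _)
    have h2 : ‖(dilate r f - f) z‖ₑ ≤ ‖dilate r f z‖ₑ + ‖f z‖ₑ := by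
      rw [Pi.sub_apply]; exact enorm_sub_le
    calc _ ≤ (‖dilate r f z‖ₑ + ‖f z‖ₑ) ^ q := ENNReal.rpow_le_rpow h2 hq0.le
      _ ≤ 2 ^ q * (‖dilate r f z‖ₑ ^ q + ‖f z‖ₑ ^ q) := rpow_add_le hq0.le _ _
      _ ≤ 2 ^ q * (C * (ENNReal.ofReal (2 ^ (n + 1 + b)) * S z) + C * S z) :=
        mul_le_mul_right (add_le_add h1 (hmaj f hf.1 z hz)) _
      _ = D * S z := by rw [hD]; ring
  have hr : ∀ᶠ r : ℝ in 𝓝[<] 1, 0 ≤ r ∧ r ≤ 1 := by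
    filter_upwards [Ioo_mem_nhdsLT (zero_lt_one' ℝ)] with r hr using ⟨hr.1.le, hr.2.le⟩
  have hI : ∀ r : ℝ, Measurable fun z => ‖(dilate r f - f) z‖ₑ ^ q := fun r =>
    ((measurable_dilate hfm r).sub hfm).enorm.pow_const q
  have hbd : ∀ ζ : UnitSphere n, ∫⁻ z in approachRegion γ ζ,
      D * S z * ENNReal.ofReal ((1 - ‖z‖ ^ 2) ^ α) ∂(ballVolume n) ≤ D * (C₂ * Λ ζ) := by
    intro ζ
    simp_rw [mul_assoc]
    rw [lintegral_const_mul _ (measurable_mul_weight α hSm)]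
    exact mul_le_mul_right (hC₂ u hum ζ) _
  have hΓ : ∀ ζ : UnitSphere n, MeasurableSet (approachRegion γ ζ) := fun ζ =>
    (isOpen_approachRegion γ ζ).measurableSet
  have hinner : ∀ ζ, Λ ζ ≠ ⊤ → Tendsto (fun r : ℝ => area γ α
      (fun z => ‖(dilate r f - f) z‖ₑ ^ q) ζ) (𝓝[<] 1) (𝓝 0) := by
    intro ζ hζ
    rw [← lintegral_zero (μ := (ballVolume n).restrict (approachRegion γ ζ))]
    refine tendsto_lintegral_filter_of_dominated_convergence
      (fun z => D * S z * ENNReal.ofReal ((1 - ‖z‖ ^ 2) ^ α))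
      (Eventually.of_forall fun r => measurable_mul_weight α (hI r)) ?_ ?_ ?_
    · filter_upwards [hr] with r hr
      filter_upwards [ae_restrict_mem (hΓ ζ)] with z hz
      exact mul_le_mul_left (hdom r hr.1 hr.2 z hz.1) _
    · exact ((hbd ζ).trans_lt (ENNReal.mul_lt_top hDtop.lt_top
        (ENNReal.mul_lt_top ENNReal.coe_lt_top hζ.lt_top))).ne
    · filter_upwards [ae_restrict_mem (hΓ ζ)] with z hz
      have hcont : ContinuousAt f z :=
        hf.1.continuousOn.continuousAt (Metric.isOpen_ball.mem_nhds hz.1)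
      have h1 : Tendsto (fun r : ℝ => (r : ℂ) • z) (𝓝[<] 1) (𝓝 z) := by
        have : Continuous fun r : ℝ => (r : ℂ) • z := by fun_prop
        have := this.tendsto 1
        rw [Complex.ofReal_one, one_smul] at this
        exact this.mono_left nhdsWithin_le_nhds
      have h2 : Tendsto (fun r : ℝ => ‖(dilate r f - f) z‖ₑ) (𝓝[<] 1) (𝓝 0) := by
        have := ((hcont.tendsto.comp h1).sub_const (f z)).enorm
        rwa [sub_self, enorm_zero] at this
      have h3 := (ENNReal.continuous_rpow_const (y := q)).tendsto 0
      rw [ENNReal.zero_rpow_of_pos hq0] at h3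
      have h4 := ENNReal.Tendsto.mul_const (b := ENNReal.ofReal ((1 - ‖z‖ ^ 2) ^ α)) (h3.comp h2)
        (Or.inr ENNReal.ofReal_ne_top)
      rwa [zero_mul] at h4
  have houter : Tendsto (fun r : ℝ =>
      ∫⁻ ζ, area γ α (fun z => ‖(dilate r f - f) z‖ₑ ^ q) ζ ^ (p / q) ∂(sphereMeasure n))
      (𝓝[<] 1) (𝓝 0) := by
    rw [← lintegral_zero (μ := sphereMeasure n)]
    refine tendsto_lintegral_filter_of_dominated_convergence
      (fun ζ => (D * C₂) ^ (p / q) * Λ ζ ^ (p / q))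
      (Eventually.of_forall fun r => (measurable_area' γ α (hI r)).pow_const _) ?_ ?_ ?_
    · filter_upwards [hr] with r hr
      refine ae_of_all _ fun ζ => ?_
      rw [← ENNReal.mul_rpow_of_nonneg _ _ hpq.le, mul_assoc]
      refine ENNReal.rpow_le_rpow (le_trans ?_ (hbd ζ)) hpq.le
      exact setLIntegral_mono' (hΓ ζ) fun z hz => mul_le_mul_left (hdom r hr.1 hr.2 z hz.1) _
    · rw [lintegral_const_mul _ (hΛm.pow_const _)]
      exact ENNReal.mul_ne_top (ENNReal.rpow_ne_top_of_nonneg hpq.le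
        (ENNReal.mul_ne_top hDtop ENNReal.coe_ne_top)) hΛi
    · filter_upwards [hΛfin] with ζ hζ
      have h3 := (ENNReal.continuous_rpow_const (y := p / q)).tendsto 0
      rw [ENNReal.zero_rpow_of_pos hpq] at h3
      exact h3.comp (hinner ζ hζ)
  have h3 := (ENNReal.continuous_rpow_const (y := 1 / p)).tendsto 0
  rw [ENNReal.zero_rpow_of_pos (by positivity)] at h3
  exact h3.comp houter

/-! ### Continuous functionals -/

section Functionals

variable {n : ℕ} {γ α p q : ℝ} {hp : 0 < p} {hq : 0 < q}

theorem HT.isHolo (f : HT n γ α hp hq) : IsHolo n f.toFun :=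
  (show ↥(htSubmodule n γ α hp hq) from f).2.1

theorem HT.qnorm_lt_top (f : HT n γ α hp hq) : f.qnorm < ⊤ :=
  (show ↥(htSubmodule n γ α hp hq) from f).2.2

theorem HT.toFun_add (f g : HT n γ α hp hq) : (f + g).toFun = f.toFun + g.toFun := rfl

theorem HT.toFun_smul (c : ℂ) (f : HT n γ α hp hq) : (c • f).toFun = c • f.toFun := rfl

theorem HT.qnorm_smul (c : ℂ) (f : HT n γ α hp hq) : (c • f).qnorm = ‖c‖ₑ * f.qnorm :=
  tentNorm_smul hp hq c f.isHolo.measurable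

/-- A bounded linear functional is continuous for the topology of the quasinorm. -/
theorem HT.continuous_of_bound (τ : HT n γ α hp hq →ₗ[ℂ] ℂ) {K : ℝ≥0∞} (hK : K ≠ ⊤)
    (h : ∀ f, ‖τ f‖ₑ ≤ K * f.qnorm) : Continuous τ := by
  refine ⟨fun U hU f hf => ?_⟩
  obtain ⟨ε, hε, hball⟩ := EMetric.isOpen_iff.1 hU (τ f) hf
  refine ⟨ε / (K + 1), ENNReal.div_pos hε.ne' (ENNReal.add_ne_top.2 ⟨hK, ENNReal.one_ne_top⟩),
    fun g hg => hball ?_⟩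
  rw [Metric.mem_eball, edist_eq_enorm_sub, ← map_sub]
  calc _ ≤ K * (g - f).qnorm := h _
    _ ≤ (K + 1) * (g - f).qnorm := mul_le_mul_left le_self_add _
    _ < ε := by
        rw [mul_comm]
        exact ENNReal.mul_lt_of_lt_div hg

theorem dualNorm_lt_top (τ : HT n γ α hp hq →L[ℂ] ℂ) : dualNorm τ < ⊤ := by
  have h0 : (0 : HT n γ α hp hq) ∈ τ ⁻¹' Metric.eball 0 1 := by simp
  have hopen : IsOpen (τ ⁻¹' Metric.eball 0 1) := Metric.isOpen_eball.preimage τ.continuous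
  obtain ⟨ε, hε, hball⟩ := hopen 0 h0
  obtain ⟨c, hc0, hcε⟩ : ∃ c : ℝ≥0, 0 < c ∧ (c : ℝ≥0∞) < ε := by
    obtain ⟨c, hc0, hcε⟩ := ENNReal.lt_iff_exists_nnreal_btwn.1 hε
    exact ⟨c, by exact_mod_cast hc0, hcε⟩
  have hce : ‖((c : ℝ) : ℂ)‖ₑ = c := by
    rw [← ofReal_norm, Complex.norm_real, Real.norm_of_nonneg c.coe_nonneg,
      ENNReal.ofReal_coe_nnreal]
  refine lt_of_le_of_lt (b := (c : ℝ≥0∞)⁻¹) (iSup₂_le fun f hf => ?_)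
    (ENNReal.inv_lt_top.2 (by exact_mod_cast hc0))
  have h1 : ((c : ℝ) : ℂ) • f ∈ τ ⁻¹' Metric.eball 0 1 := by
    refine hball _ ?_
    rw [sub_zero, HT.qnorm_smul, hce]
    exact (mul_le_of_le_one_right zero_le hf).trans_lt hcε
  rw [Set.mem_preimage, Metric.mem_eball, edist_zero_right, map_smul, enorm_smul, hce] at h1
  rw [ENNReal.le_inv_iff_mul_le, mul_comm]
  exact h1.le

theorem enorm_le_dualNorm_mul (τ : HT n γ α hp hq →L[ℂ] ℂ) (f : HT n γ α hp hq) :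
    ‖τ f‖ₑ ≤ dualNorm τ * f.qnorm := by
  have key : ∀ c : ℝ≥0, c * f.qnorm ≤ 1 → c * ‖τ f‖ₑ ≤ dualNorm τ := by
    intro c hc
    have hce : ‖((c : ℝ) : ℂ)‖ₑ = c := by
      rw [← ofReal_norm, Complex.norm_real, Real.norm_of_nonneg c.coe_nonneg,
        ENNReal.ofReal_coe_nnreal]
    have h1 : ‖τ (((c : ℝ) : ℂ) • f)‖ₑ ≤ dualNorm τ :=
      le_iSup₂ (f := fun (f : HT n γ α hp hq) (_ : f.qnorm ≤ 1) => ‖τ f‖ₑ) _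
        (by rw [HT.qnorm_smul, hce]; exact hc)
    rwa [map_smul, enorm_smul, hce] at h1
  have hf := f.qnorm_lt_top.ne
  have hD := (dualNorm_lt_top τ).ne
  by_cases h0 : f.qnorm = 0
  · rw [h0, mul_zero, nonpos_iff_eq_zero]
    by_contra hne
    have h2 : ∀ c : ℝ≥0, (c : ℝ≥0∞) ≤ dualNorm τ / ‖τ f‖ₑ := fun c => by
      rw [ENNReal.le_div_iff_mul_le (Or.inl hne) (Or.inl enorm_ne_top)]
      exact key c (by rw [h0, mul_zero]; exact zero_le)
    exact (ENNReal.div_lt_top hD hne).ne (ENNReal.eq_top_of_forall_nnreal_le h2)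
  · have h2 := key (f.qnorm⁻¹).toNNReal (by
      rw [ENNReal.coe_toNNReal (ENNReal.inv_ne_top.2 h0), ENNReal.inv_mul_cancel h0 hf])
    rw [ENNReal.coe_toNNReal (ENNReal.inv_ne_top.2 h0)] at h2
    calc ‖τ f‖ₑ = f.qnorm⁻¹ * ‖τ f‖ₑ * f.qnorm := by
          rw [mul_right_comm, ENNReal.inv_mul_cancel h0 hf, one_mul]
      _ ≤ _ := mul_le_mul_left h2 _

theorem dualNorm_le {τ : HT n γ α hp hq →L[ℂ] ℂ} {K : ℝ≥0∞} (h : ∀ f, ‖τ f‖ₑ ≤ K * f.qnorm) :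
    dualNorm τ ≤ K :=
  iSup₂_le fun f hf => (h f).trans (mul_le_of_le_one_right zero_le hf)

variable [NeZero n]

/-- The inclusion of the bounded holomorphic functions into the tent space. -/
def toHT (hγ : 1 < γ) (hα : -(n : ℝ) - 1 < α) : bddHolo n →ₗ[ℂ] HT n γ α hp hq :=
  Submodule.inclusion (p := bddHolo n) (p' := htSubmodule n γ α hp hq) fun f hf => by
    obtain ⟨M, hM⟩ := hf.2
    obtain ⟨C, hC⟩ := exists_tentNorm_le_of_bounded n (zero_lt_one.trans hγ) hp hq hα
    exact ⟨hf.1, (hC f M fun z _ => hM z).trans_lt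
      (ENNReal.mul_lt_top ENNReal.coe_lt_top ENNReal.ofReal_lt_top)⟩

variable {hγ : 1 < γ} {hα : -(n : ℝ) - 1 < α}

theorem toFun_toHT (F : bddHolo n) : (toHT (hp := hp) (hq := hq) hγ hα F).toFun = F := rfl

theorem exists_norm_toHT_le (τ : HT n γ α hp hq →L[ℂ] ℂ) : ∃ K : ℝ, 0 ≤ K ∧
    ∀ (F : bddHolo n) (M : ℝ), (∀ z, ‖(F : Cn n → ℂ) z‖ ≤ M) → ‖τ (toHT hγ hα F)‖ ≤ K * M := by
  obtain ⟨C, hC⟩ := exists_tentNorm_le_of_bounded n (zero_lt_one.trans hγ) hp hq hα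
  refine ⟨(dualNorm τ * C).toReal, ENNReal.toReal_nonneg, fun F M hM => ?_⟩
  have hM0 : 0 ≤ M := (norm_nonneg _).trans (hM 0)
  have htop : dualNorm τ * C ≠ ⊤ := ENNReal.mul_ne_top (dualNorm_lt_top τ).ne ENNReal.coe_ne_top
  have h1 : ‖τ (toHT hγ hα F)‖ₑ ≤ dualNorm τ * C * ENNReal.ofReal M := by
    rw [mul_assoc]
    exact (enorm_le_dualNorm_mul τ _).trans (mul_le_mul_right (hC _ M fun z _ => hM z) _)
  have h2 := ENNReal.toReal_mono (ENNReal.mul_ne_top htop ENNReal.ofReal_ne_top) h1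
  rwa [toReal_enorm, ENNReal.toReal_mul, ENNReal.toReal_ofReal hM0] at h2

/-- The values of a functional at the dilations of `f` converge to its value at `f`. -/
theorem tendsto_of_dilate (hγ : 1 < γ) (hα : -(n : ℝ) - 1 < α) (hq1 : q ≤ 1) (hqp : q < p)
    (τ : HT n γ α hp hq →L[ℂ] ℂ) (f : HT n γ α hp hq) {φ : ℝ → ℂ}
    (hφ : ∀ (r : ℝ) (hr0 : 0 ≤ r) (hr1 : r < 1),
      φ r = τ (toHT hγ hα ⟨_, cut_dilate_mem_bddHolo f.isHolo.1 hr0 hr1⟩)) :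
    Tendsto φ (𝓝[<] 1) (𝓝 (τ f)) := by
  rw [tendsto_iff_edist_tendsto_0]
  have h1 := ENNReal.Tendsto.const_mul (a := dualNorm τ) (tendsto_tentNorm_dilate_sub hγ hq hq1 hqp
    hα f.isHolo f.qnorm_lt_top) (Or.inr (dualNorm_lt_top τ).ne)
  rw [mul_zero] at h1
  refine tendsto_of_tendsto_of_tendsto_of_le_of_le' tendsto_const_nhds h1
    (Eventually.of_forall fun _ => zero_le) ?_
  filter_upwards [Ioo_mem_nhdsLT (zero_lt_one' ℝ)] with r hr
  rw [edist_eq_enorm_sub, hφ r hr.1.le hr.2, ← map_sub]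
  refine (enorm_le_dualNorm_mul τ _).trans_eq ?_
  congr 1
  refine tentNorm_congr fun z hz => ?_
  exact congrArg (· - f.toFun z) (cut_apply (f := dilate r f.toFun) hz)

/-- A continuous functional is determined by its values at the functions `⟨·, u⟩ ^ k`. -/
theorem ext_of_power (hγ : 1 < γ) (hα : -(n : ℝ) - 1 < α) (hq1 : q ≤ 1) (hqp : q < p)
    {τ₁ τ₂ : HT n γ α hp hq →L[ℂ] ℂ}
    (h : ∀ k u, τ₁ (toHT hγ hα (power k u)) = τ₂ (toHT hγ hα (power k u))) : τ₁ = τ₂ := by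
  obtain ⟨K₁, -, h₁⟩ := exists_norm_toHT_le (hγ := hγ) (hα := hα) τ₁
  obtain ⟨K₂, -, h₂⟩ := exists_norm_toHT_le (hγ := hγ) (hα := hα) τ₂
  refine ContinuousLinearMap.ext fun f => ?_
  refine tendsto_nhds_unique (tendsto_of_dilate hγ hα hq1 hqp τ₁ f
    (φ := fun r => if hr : 0 ≤ r ∧ r < 1 then
      τ₁ (toHT hγ hα ⟨_, cut_dilate_mem_bddHolo f.isHolo.1 hr.1 hr.2⟩) else 0)
    fun r hr0 hr1 => dif_pos ⟨hr0, hr1⟩) ?_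
  refine tendsto_of_dilate hγ hα hq1 hqp τ₂ f fun r hr0 hr1 => ?_
  rw [dif_pos ⟨hr0, hr1⟩, ← sub_eq_zero]
  exact eq_zero_of_power ((τ₁.toLinearMap - τ₂.toLinearMap) ∘ₗ toHT hγ hα) (K := K₁ + K₂)
    (fun F M hM => by
      rw [add_mul]
      exact (norm_sub_le _ _).trans (add_le_add (h₁ F M hM) (h₂ F M hM)))
    (fun k u => sub_eq_zero.2 (h k u)) f.isHolo.1 hr0 hr1

end Functionals

/-- Functions in the tent space pair with functions whose nontangential maximal function lies in the
dual Lebesgue space. -/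
theorem exists_lintegral_mul_le_tentNorm (n : ℕ) [NeZero n] {γ p q p' α β : ℝ} (hγ : 1 < γ)
    (hq0 : 0 < q) (hq1 : q < 1) (hp : 1 < p) (hp' : p' = p / (p - 1)) (hα : -(n : ℝ) - 1 < α)
    (hβ : β = n + (α + (1 / q - 1) * (n + 1 + α))) : ∃ C : ℝ≥0, ∀ f : Cn n → ℂ, IsHolo n f →
      ∀ h : Cn n → ℝ≥0∞, Measurable h →
        ∫⁻ z, ‖f z‖ₑ * h z * ENNReal.ofReal ((1 - ‖z‖ ^ 2) ^ β) ∂(ballVolume n) ≤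
          C * (∫⁻ ζ, ntMax 4 h ζ ^ p' ∂(sphereMeasure n)) ^ (1 / p') * tentNorm γ p q α f := by
  have hp0 : 0 < p := by linarith
  have hconj : p'.HolderConjugate p := by
    rw [hp']; exact (Real.HolderConjugate.conjExponent hp).symm
  obtain ⟨b, C, hαb, -, hmaj, hnorm⟩ := exists_kernel_majorant n (α := α) hγ hq0 hq1.le
    (hq1.trans hp)
  obtain ⟨C₁, h₁⟩ := exists_lintegral_mul_le_area n (le_refl (4 : ℝ)) β
  obtain ⟨C₂, h₂⟩ := exists_area_kerInt_rpow_le n γ⁻¹ (κ := 4) (by norm_num) hα hαb hq0 hq1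
  refine ⟨C₁ * (C ^ (1 / q) * C₂) * C ^ (1 / p), fun f hf h hh => ?_⟩
  have hfm := hf.measurable
  have hum : Measurable fun z => ‖f z‖ₑ ^ q := hfm.enorm.pow_const q
  set u : Cn n → ℝ≥0∞ := fun z => ‖f z‖ₑ ^ q with hu
  set Λ : UnitSphere n → ℝ≥0∞ := fun ζ => kerInt γ⁻¹ b (b - α) u ζ with hΛ
  have hΛm : Measurable Λ := (measurable_kerInt _ _ _ hum).comp measurable_subtype_coe
  have h3 : ∀ ζ, area 4 (β - n) (fun z => ‖f z‖ₑ) ζ ≤ C ^ (1 / q) * C₂ * Λ ζ ^ (1 / q) := by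
    intro ζ
    have h4 := h₂ u hum ζ
    rw [show α + (1 / q - 1) * (n + 1 + α) = β - n by rw [hβ]; ring] at h4
    have hSm : Measurable fun z => kerInt γ⁻¹ b (n + 1 + b) u z ^ (1 / q) :=
      (measurable_kerInt _ _ _ hum).pow_const _
    calc _ ≤ area 4 (β - n) (fun z => (C : ℝ≥0∞) ^ (1 / q) *
          kerInt γ⁻¹ b (n + 1 + b) u z ^ (1 / q)) ζ := by
          refine setLIntegral_mono' (isOpen_approachRegion 4 ζ).measurableSet fun z hz => ?_
          refine mul_le_mul_left ?_ _
          simp only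
          rw [← ENNReal.mul_rpow_of_nonneg _ _ (by positivity)]
          calc ‖f z‖ₑ = (‖f z‖ₑ ^ q) ^ (1 / q) := by
                rw [← ENNReal.rpow_mul, mul_one_div_cancel hq0.ne', ENNReal.rpow_one]
            _ ≤ _ := ENNReal.rpow_le_rpow (hmaj f hf.1 z hz.1) (by positivity)
      _ = (C : ℝ≥0∞) ^ (1 / q) *
          area 4 (β - n) (fun z => kerInt γ⁻¹ b (n + 1 + b) u z ^ (1 / q)) ζ := by
          rw [area, area, ← lintegral_const_mul _ (measurable_mul_weight _ hSm)]
          simp_rw [mul_assoc]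
      _ ≤ (C : ℝ≥0∞) ^ (1 / q) * (C₂ * Λ ζ ^ (1 / q)) := mul_le_mul_right h4 _
      _ = _ := by rw [mul_assoc]
  set N := ntMax 4 h with hN
  have hNm : Measurable N := measurable_ntMax _ _
  calc _ ≤ C₁ * ∫⁻ ζ, N ζ * area 4 (β - n) (fun z => ‖f z‖ₑ) ζ ∂(sphereMeasure n) :=
        h₁ _ h N hfm.enorm hh hNm fun ζ w hw => le_ntMax hw
    _ ≤ C₁ * ∫⁻ ζ, C ^ (1 / q) * C₂ * (N * fun ζ => Λ ζ ^ (1 / q)) ζ ∂(sphereMeasure n) := by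
        refine mul_le_mul_right (lintegral_mono fun ζ => ?_) _
        rw [Pi.mul_apply, mul_left_comm]
        exact mul_le_mul_right (h3 ζ) _
    _ = C₁ * (C ^ (1 / q) * C₂) * ∫⁻ ζ, (N * fun ζ => Λ ζ ^ (1 / q)) ζ ∂(sphereMeasure n) := by
        rw [lintegral_const_mul _ (hNm.mul (hΛm.pow_const _)), ← mul_assoc]
    _ ≤ C₁ * (C ^ (1 / q) * C₂) * ((∫⁻ ζ, N ζ ^ p' ∂(sphereMeasure n)) ^ (1 / p') *
          (∫⁻ ζ, (Λ ζ ^ (1 / q)) ^ p ∂(sphereMeasure n)) ^ (1 / p)) :=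
        mul_le_mul_right (ENNReal.lintegral_mul_le_Lp_mul_Lq _ hconj hNm.aemeasurable
          (hΛm.pow_const _).aemeasurable) _
    _ ≤ C₁ * (C ^ (1 / q) * C₂) * ((∫⁻ ζ, N ζ ^ p' ∂(sphereMeasure n)) ^ (1 / p') *
          (C ^ (1 / p) * tentNorm γ p q α f)) := by
        refine mul_le_mul_right (mul_le_mul_right ?_ _) _
        rw [tentNorm_eq_area, ← ENNReal.mul_rpow_of_nonneg _ _ (by positivity)]
        refine ENNReal.rpow_le_rpow (le_trans (le_of_eq ?_) (hnorm u hum)) (by positivity)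
        refine lintegral_congr fun ζ => ?_
        rw [← ENNReal.rpow_mul, one_div_mul_eq_div]
    _ = _ := by
        push_cast
        rw [ENNReal.coe_rpow_of_nonneg _ (by positivity),
          ENNReal.coe_rpow_of_nonneg _ (by positivity)]
        ring

/-! ### Weighted pairings -/

section Pairing

variable {n : ℕ} {b : ℝ} {g : Cn n → ℂ}

/-- The radial measure on the whole ball. -/
theorem shellMeasure_ball (n : ℕ) (b : ℝ) : shellMeasure n (-1) b =
    (ballVolume n).withDensity (fun w => ENNReal.ofReal ((1 - ‖w‖ ^ 2) ^ b)) := by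
  rw [shellMeasure, Measure.restrict_eq_self_of_ae_mem]
  filter_upwards [ae_mem_unitBall n] with w hw
  exact ⟨hw, lt_of_lt_of_le (by norm_num) (norm_nonneg w)⟩

theorem toReal_ofReal_weight_smul {w : Cn n} (hw : w ∈ unitBall n) (x : ℂ) :
    (ENNReal.ofReal ((1 - ‖w‖ ^ 2) ^ b)).toReal • x = x * (((1 - ‖w‖ ^ 2) ^ b : ℝ) : ℂ) := by
  rw [ENNReal.toReal_ofReal (Real.rpow_nonneg (one_sub_sq_pos hw).le _), Complex.real_smul,
    mul_comm]

theorem integral_shellMeasure_ball (F : Cn n → ℂ) : ∫ w, F w ∂(shellMeasure n (-1) b) =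
    ∫ w, F w * (((1 - ‖w‖ ^ 2) ^ b : ℝ) : ℂ) ∂(ballVolume n) := by
  rw [shellMeasure_ball, integral_withDensity_eq_integral_toReal_smul (measurable_weight b)
    (ae_of_all _ fun _ => ENNReal.ofReal_lt_top)]
  refine integral_congr_ae ?_
  filter_upwards [ae_mem_unitBall n] with w hw using toReal_ofReal_weight_smul hw _

theorem integrable_shellMeasure_ball {F : Cn n → ℂ} (hF : Integrable F (shellMeasure n (-1) b)) :
    Integrable (fun w => F w * (((1 - ‖w‖ ^ 2) ^ b : ℝ) : ℂ)) (ballVolume n) := by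
  rw [shellMeasure_ball, integrable_withDensity_iff_integrable_smul' (measurable_weight b)
    (ae_of_all _ fun _ => ENNReal.ofReal_lt_top)] at hF
  refine hF.congr ?_
  filter_upwards [ae_mem_unitBall n] with w hw using toReal_ofReal_weight_smul hw _

theorem lintegral_shellMeasure_ball {F : Cn n → ℝ≥0∞} (hF : Measurable F) :
    ∫⁻ w, F w ∂(shellMeasure n (-1) b) =
      ∫⁻ w, F w * ENNReal.ofReal ((1 - ‖w‖ ^ 2) ^ b) ∂(ballVolume n) := by
  rw [shellMeasure_ball, lintegral_withDensity_eq_lintegral_mul _ (measurable_weight b) hF]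
  exact lintegral_congr fun w => mul_comm _ _

theorem bddHolo_measurable (F : bddHolo n) : Measurable (F : Cn n → ℂ) := F.2.1.measurable

theorem integrable_mul_conj (F : bddHolo n) (hg : Integrable g (shellMeasure n (-1) b)) :
    Integrable (fun w => (F : Cn n → ℂ) w * (starRingEnd ℂ) (g w)) (shellMeasure n (-1) b) := by
  obtain ⟨M, hM⟩ := F.2.2
  have hgc : Integrable (fun w => (starRingEnd ℂ) (g w)) (shellMeasure n (-1) b) :=
    (LinearIsometryEquiv.integrable_comp_iff Complex.conjLIE).2 hg
  exact hgc.bdd_mul (c := M) (bddHolo_measurable F).aestronglyMeasurable (ae_of_all _ hM)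

/-- The functional `F ↦ ∫ F conj g` on the bounded holomorphic functions. -/
def pairL (hg : Integrable g (shellMeasure n (-1) b)) : bddHolo n →ₗ[ℂ] ℂ where
  toFun F := ∫ w, (F : Cn n → ℂ) w * (starRingEnd ℂ) (g w) ∂(shellMeasure n (-1) b)
  map_add' F F' := by
    rw [← integral_add (integrable_mul_conj F hg) (integrable_mul_conj F' hg)]
    refine integral_congr_ae (ae_of_all _ fun w => ?_)
    simp only [Submodule.coe_add, Pi.add_apply, add_mul]
  map_smul' c F := by
    rw [RingHom.id_apply, ← integral_smul]
    refine integral_congr_ae (ae_of_all _ fun w => ?_)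
    simp only [Submodule.coe_smul, Pi.smul_apply, smul_eq_mul, mul_assoc]

theorem norm_pairL_le (hg : Integrable g (shellMeasure n (-1) b)) (F : bddHolo n) (M : ℝ)
    (hM : ∀ z, ‖(F : Cn n → ℂ) z‖ ≤ M) :
    ‖pairL hg F‖ ≤ (∫ w, ‖g w‖ ∂(shellMeasure n (-1) b)) * M := by
  rw [mul_comm, ← integral_const_mul]
  refine norm_integral_le_of_norm_le (hg.norm.const_mul M) (ae_of_all _ fun w => ?_)
  rw [norm_mul, RCLike.norm_conj]
  exact mul_le_mul_of_nonneg_right (hM w) (norm_nonneg _)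

theorem integral_power_mul_conj [NeZero n] (hb : -1 < b) (hgd : DifferentiableOn ℂ g (unitBall n))
    (hg : Integrable g (shellMeasure n (-1) b)) (k : ℕ) (u : Cn n) :
    ∫ w, (power k u : Cn n → ℂ) w * (starRingEnd ℂ) (g w) ∂(shellMeasure n (-1) b) =
      moment n (-1) b k * (starRingEnd ℂ) (homogPart g k u) := by
  have h1 := integral_mul_inner_pow (by norm_num) hb hgd hg k u
  have h2 := congrArg (starRingEnd ℂ) h1
  rw [← integral_conj, map_mul, Complex.conj_ofReal] at h2
  rw [← h2]
  refine integral_congr_ae ?_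
  filter_upwards [ae_shellMeasure_mem n (-1) b] with w hw
  rw [power_apply hw.1, map_mul, map_pow, inner_conj_symm, mul_comm]

end Pairing

/-! ### Comparison of the fractional derivatives -/

theorem ntMax_congr {n : ℕ} {κ : ℝ} {h h' : Cn n → ℝ≥0∞} (hh : ∀ z ∈ unitBall n, h z = h' z) :
    ntMax κ h = ntMax κ h' :=
  funext fun _ => iSup_congr fun z => iSup_congr fun hz => hh z hz.1

theorem isSymbol_one : IsSymbol 0 1 := by
  have h : ∀ j : ℕ, (1 : ℝ) + j ≠ 0 := fun j => by positivity
  have h1 := isSymbol_ratio h h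
  rw [sub_self] at h1
  convert h1 using 1
  exact funext fun k => (ratio_self h k).symm

theorem btNorm_rpow_eq {n : ℕ} [NeZero n] {γ p s t : ℝ} (hp : 0 < p)
    (hs : ∀ j : ℕ, (n + 1 + s : ℝ) + j ≠ 0) (hst : ∀ j : ℕ, (n + 1 + s + t : ℝ) + j ≠ 0)
    {g : Cn n → ℂ} (hg : DifferentiableOn ℂ g (unitBall n)) : btNorm γ p s t g ^ p =
      ∫⁻ ζ, ntMax γ (weighted t (mult (ratio (n + 1 + s + t) (n + 1 + s)) g)) ζ ^ p
        ∂(sphereMeasure n) := by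
  rw [btNorm, fracDeriv_eq_mult,
    tentSupNorm_eq p (differentiableOn_mult (isSymbol_ratio hst hs) hg), ← ENNReal.rpow_mul,
    one_div_mul_cancel hp.ne', ENNReal.rpow_one]

/-- Every symbol of positive order, followed by the weight of the same order, is controlled by the
norm of `BT`: in particular, that space does not depend on the parameters of the fractional
derivative or on the aperture. -/
theorem exists_lintegral_ntMax_le_btNorm (n : ℕ) [NeZero n] {γ κ p s t : ℝ} (hγ : 1 < γ)
    (hκ : 0 < κ) (hp : 1 < p) (hs : ∀ j : ℕ, (n + 1 + s : ℝ) + j ≠ 0)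
    (hst : ∀ j : ℕ, (n + 1 + s + t : ℝ) + j ≠ 0) {e : ℝ} (he : 0 < e) {m : ℕ → ℝ}
    (hm : IsSymbol e m) : ∃ C : ℝ≥0, ∀ g : Cn n → ℂ, DifferentiableOn ℂ g (unitBall n) →
      ∫⁻ ζ, ntMax κ (weighted e (mult m g)) ζ ^ p ∂(sphereMeasure n) ≤
        C * btNorm γ p s t g ^ p := by
  have h1 := hm.mul (isSymbol_ratio hs hst)
  obtain ⟨C, hC⟩ := exists_lintegral_ntMax_mult_le n hγ hκ hp h1 (t₁ := t) (t₂ := e) (by ring) he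
  refine ⟨C, fun g hg => ?_⟩
  have h2 := hC _ (differentiableOn_mult (isSymbol_ratio hst hs) hg)
  rwa [mult_ratio_ratio hg m hst hs, ← btNorm_rpow_eq (zero_lt_one.trans hp) hs hst hg] at h2

theorem exists_btNorm_le_lintegral_ntMax (n : ℕ) [NeZero n] {γ κ p s t : ℝ} (hγ : 0 < γ)
    (hκ : 1 < κ) (hp : 1 < p) (hs : ∀ j : ℕ, (n + 1 + s : ℝ) + j ≠ 0)
    (hst : ∀ j : ℕ, (n + 1 + s + t : ℝ) + j ≠ 0) (ht : 0 < t) {B T : ℝ}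
    (hB : ∀ j : ℕ, B + j ≠ 0) (hBT : ∀ j : ℕ, B + T + j ≠ 0) :
    ∃ C : ℝ≥0, ∀ g : Cn n → ℂ, DifferentiableOn ℂ g (unitBall n) →
      btNorm γ p s t g ^ p ≤
        C * ∫⁻ ζ, ntMax κ (weighted T (mult (ratio (B + T) B) g)) ζ ^ p ∂(sphereMeasure n) := by
  have h1 := (isSymbol_ratio hst hs).mul (isSymbol_ratio hB hBT)
  obtain ⟨C, hC⟩ := exists_lintegral_ntMax_mult_le n hκ hγ hp h1 (t₁ := T) (t₂ := t) (by ring) ht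
  refine ⟨C, fun g hg => ?_⟩
  have h2 := hC _ (differentiableOn_mult (isSymbol_ratio hBT hB) hg)
  rwa [mult_ratio_ratio hg _ hBT hB, ← btNorm_rpow_eq (zero_lt_one.trans hp) hs hst hg] at h2

theorem integrable_of_btNorm_lt_top {n : ℕ} [NeZero n] {γ p s t β : ℝ} (hγ : 1 < γ) (hp : 1 < p)
    (hs : ∀ j : ℕ, (n + 1 + s : ℝ) + j ≠ 0) (hst : ∀ j : ℕ, (n + 1 + s + t : ℝ) + j ≠ 0)
    (hβ : -1 < β) {g : Cn n → ℂ} (hg : IsHolo n g) (hgn : btNorm γ p s t g < ⊤) :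
    Integrable g (shellMeasure n (-1) β) := by
  -- the weight `(1 - |z|²) ^ ((β + 1) / 2)` in front of `g` leaves an integrable power
  have hε : 0 < (β + 1) / 2 := by linarith
  obtain ⟨C, hC⟩ := exists_lintegral_ntMax_le_btNorm n hγ (κ := 4) (by norm_num) hp hs hst hε
    (isSymbol_one.mono hε.le)
  have h1 := hC g hg.1
  have h2 : ntMax 4 (weighted ((β + 1) / 2) (mult 1 g)) = ntMax 4 (weighted ((β + 1) / 2) g) := by
    refine ntMax_congr fun z hz => ?_
    rw [weighted, weighted, mult_one hg.1 hz]
  rw [h2] at h1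
  refine ⟨hg.measurable.aestronglyMeasurable, ?_⟩
  rw [hasFiniteIntegral_iff_enorm, lintegral_shellMeasure_ball hg.measurable.enorm]
  refine lintegral_weight_lt_top n (by linarith) hp.le hg.measurable (h1.trans_lt ?_).ne
  exact ENNReal.mul_lt_top ENNReal.coe_lt_top
    (ENNReal.rpow_lt_top_of_nonneg (by linarith) hgn.ne)

/-! ### The functional of a function -/

/-- A holomorphic function `g` with a weighted fractional derivative whose nontangential maximal
function lies in `L^{p'}` gives a bounded functional on the tent space. It is defined by integration
against that derivative, and on polynomials it agrees with the pairing with `g`. -/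
theorem exists_functional (n : ℕ) [NeZero n] {γ p q p' α β T : ℝ} (hγ : 1 < γ)
    (hq0 : 0 < q) (hq1 : q < 1) (hp : 1 < p) (hp0 : 0 < p) (hp' : p' = p / (p - 1))
    (hα : -(n : ℝ) - 1 < α) (hβ : β = n + (α + (1 / q - 1) * (n + 1 + α))) (hβ1 : -1 < β)
    (hT : 0 < T) : ∃ C : ℝ≥0, ∀ g : Cn n → ℂ, DifferentiableOn ℂ g (unitBall n) →
      ∫⁻ ζ, ntMax 4 (weighted T (mult (ratio (n + β + 1 + T) (n + β + 1)) g)) ζ ^ p'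
        ∂(sphereMeasure n) ≠ ⊤ →
      ∃ τ : HT n γ α hp0 hq0 →L[ℂ] ℂ,
        (∀ k u, τ (toHT hγ hα (power k u)) =
          moment n (-1) β k * (starRingEnd ℂ) (homogPart g k u)) ∧
        dualNorm τ ≤ C * (∫⁻ ζ, ntMax 4 (weighted T (mult (ratio (n + β + 1 + T) (n + β + 1)) g)) ζ
          ^ p' ∂(sphereMeasure n)) ^ (1 / p') := by
  obtain ⟨C, hC⟩ := exists_lintegral_mul_le_tentNorm n hγ hq0 hq1 hp hp' hα hβ
  have hn : (0 : ℝ) ≤ n := n.cast_nonneg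
  have hB : ∀ j : ℕ, n + β + 1 + (j : ℝ) ≠ 0 := fun j => by
    have : (0 : ℝ) ≤ j := j.cast_nonneg
    linarith
  have hBT : ∀ j : ℕ, n + β + 1 + T + (j : ℝ) ≠ 0 := fun j => by
    have : (0 : ℝ) ≤ j := j.cast_nonneg
    linarith
  have hp'0 : 0 < p' := by rw [hp']; exact div_pos hp0 (by linarith)
  -- with this factor, integration of weight `β + T` against the fractional derivative of `g` agrees
  -- with integration of weight `β` against `g`
  set c : ℝ := moment n (-1) β 0 / moment n (-1) (β + T) 0 with hc
  have hm1 := moment_pos n (ρ := -1) (by norm_num) hβ1 0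
  have hm2 := moment_pos n (ρ := -1) (b := β + T) (by norm_num) (by linarith) 0
  have hc0 : 0 < c := div_pos hm1 hm2
  refine ⟨c.toNNReal * C, fun g hg hfin => ?_⟩
  have hsym := isSymbol_ratio hBT hB
  have hGd := differentiableOn_mult hsym hg
  have hG := isHolo_cut hGd
  set G := cut (mult (ratio (n + β + 1 + T) (n + β + 1)) g) with hGdef
  have hGm := hG.measurable
  have hGc : Measurable fun w => (starRingEnd ℂ) (G w) :=
    Complex.continuous_conj.measurable.comp hGm
  have hnt : ntMax 4 (weighted T (mult (ratio (n + β + 1 + T) (n + β + 1)) g)) =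
      ntMax 4 (weighted T G) := by
    refine ntMax_congr fun z hz => ?_
    rw [weighted, weighted, hGdef, cut_apply hz]
  rw [hnt] at hfin ⊢
  set X := (∫⁻ ζ, ntMax 4 (weighted T G) ζ ^ p' ∂(sphereMeasure n)) ^ (1 / p') with hX
  have hXfin : X ≠ ⊤ := ENNReal.rpow_ne_top_of_nonneg (by positivity) hfin
  have hwm : Measurable (weighted T G) := (measurable_weight T).mul hGm.enorm
  have hbound : ∀ f : HT n γ α hp0 hq0,
      ∫⁻ w, ‖f.toFun w * (starRingEnd ℂ) (G w)‖ₑ ∂(shellMeasure n (-1) (β + T)) ≤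
        C * X * f.qnorm := by
    intro f
    have hfm := f.isHolo.measurable
    rw [lintegral_shellMeasure_ball (F := fun w => ‖f.toFun w * (starRingEnd ℂ) (G w)‖ₑ)
      (hfm.mul hGc).enorm]
    refine le_trans (lintegral_mono_ae ?_) (hC f.toFun f.isHolo (weighted T G) hwm)
    filter_upwards [ae_mem_unitBall n] with w hw
    have hδ := one_sub_sq_pos hw
    rw [enorm_mul, RCLike.enorm_conj, add_comm β, Real.rpow_add hδ,
      ENNReal.ofReal_mul (by positivity), weighted]
    refine le_of_eq ?_
    ring
  have hint : ∀ f : HT n γ α hp0 hq0,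
      Integrable (fun w => f.toFun w * (starRingEnd ℂ) (G w)) (shellMeasure n (-1) (β + T)) := by
    intro f
    have hfm := f.isHolo.measurable
    refine ⟨(hfm.mul hGc).aestronglyMeasurable, ?_⟩
    rw [hasFiniteIntegral_iff_enorm]
    exact (hbound f).trans_lt (ENNReal.mul_lt_top (ENNReal.mul_lt_top ENNReal.coe_lt_top
      hXfin.lt_top) f.qnorm_lt_top)
  have hGi : Integrable G (shellMeasure n (-1) (β + T)) := by
    have h1 := hint (toHT hγ hα (power 0 0))
    have h2 : Integrable (fun w => (starRingEnd ℂ) (G w)) (shellMeasure n (-1) (β + T)) := by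
      refine h1.congr ?_
      filter_upwards [ae_shellMeasure_mem n (-1) (β + T)] with w hw
      rw [toFun_toHT, power_apply hw.1, pow_zero, one_mul]
    exact (LinearIsometryEquiv.integrable_comp_iff Complex.conjLIE).1 h2
  let τ₀ : HT n γ α hp0 hq0 →ₗ[ℂ] ℂ :=
    { toFun := fun f => c * ∫ w, f.toFun w * (starRingEnd ℂ) (G w) ∂(shellMeasure n (-1) (β + T))
      map_add' := fun f f' => by
        rw [← mul_add, ← integral_add (hint f) (hint f')]
        congr 1
        refine integral_congr_ae (ae_of_all _ fun w => ?_)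
        simp only [HT.toFun_add, Pi.add_apply, add_mul]
      map_smul' := fun a f => by
        rw [RingHom.id_apply, smul_eq_mul, mul_left_comm]
        congr 1
        rw [← integral_const_mul]
        refine integral_congr_ae (ae_of_all _ fun w => ?_)
        simp only [HT.toFun_smul, Pi.smul_apply, smul_eq_mul, mul_assoc] }
  have hτ₀ : ∀ f, ‖τ₀ f‖ₑ ≤ (c.toNNReal * C : ℝ≥0) * X * f.qnorm := by
    intro f
    change ‖(c : ℂ) * _‖ₑ ≤ _
    have hce : ‖(c : ℂ)‖ₑ = c.toNNReal := by
      rw [← ofReal_norm, Complex.norm_real, Real.norm_of_nonneg hc0.le]; rfl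
    rw [enorm_mul, hce, ENNReal.coe_mul, mul_assoc, mul_assoc, ← mul_assoc (C : ℝ≥0∞)]
    exact mul_le_mul_right ((enorm_integral_le_lintegral_enorm _).trans (hbound f)) _
  refine ⟨⟨τ₀, HT.continuous_of_bound τ₀ (ENNReal.mul_ne_top ENNReal.coe_ne_top hXfin) hτ₀⟩,
    fun k u => ?_, dualNorm_le hτ₀⟩
  change (c : ℂ) * ∫ w, (power k u : Cn n → ℂ) w * _ ∂_ = _
  rw [integral_power_mul_conj (by linarith) hG.1 hGi,
    homogPart_congr hGd (fun z hz => cut_apply hz), homogPart_mult hsym hg, map_mul,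
    Complex.conj_ofReal, ← mul_assoc, ← mul_assoc, ← Complex.ofReal_mul, ← Complex.ofReal_mul]
  congr 2
  rw [moment_eq n (by norm_num) hβ1 k, moment_eq n (by norm_num) (by linarith : -1 < β + T) k,
    show n + (β + T) + 1 = n + β + 1 + T by ring,
    ← ratio_mul_ratio (a := 1) (c := n + β + 1) hBT k, hc]
  field_simp

/-! ### Kernels as test functions -/

theorem differentiableOn_kernel {n : ℕ} (c : ℝ) {w : Cn n} (hw : w ∈ unitBall n) :
    DifferentiableOn ℂ (fun z : Cn n => 1 / (1 - (inner ℂ w z : ℂ)) ^ (c : ℂ)) (unitBall n) := by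
  intro z hz
  have hx : ‖(inner ℂ w z : ℂ)‖ < 1 :=
    (norm_inner_le_of_le_one (mem_unitBall_iff.1 hw).le).trans_lt (mem_unitBall_iff.1 hz)
  have hre : 0 < (1 - (inner ℂ w z : ℂ)).re := by
    rw [Complex.sub_re, Complex.one_re]
    linarith [(Complex.re_le_norm (inner ℂ w z : ℂ))]
  have hs : 1 - (inner ℂ w z : ℂ) ∈ Complex.slitPlane := Or.inl hre
  have hd : DifferentiableAt ℂ (fun z : Cn n => 1 - (inner ℂ w z : ℂ)) z :=
    ((innerSL ℂ w).differentiable z).const_sub 1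
  have hne : (1 - (inner ℂ w z : ℂ)) ^ (c : ℂ) ≠ 0 := by
    rw [Complex.cpow_def_of_ne_zero (Complex.slitPlane_ne_zero hs)]
    exact Complex.exp_ne_zero _
  have hd2 : DifferentiableAt ℂ (fun z : Cn n => (1 - (inner ℂ w z : ℂ)) ^ (c : ℂ)) z :=
    hd.cpow_const hs
  simp only [one_div]
  exact (hd2.fun_inv hne).differentiableWithinAt

theorem norm_kernel {n : ℕ} (c : ℝ) {w z : Cn n} (hw : w ∈ unitBall n) (hz : z ∈ unitBall n) :
    ‖1 / (1 - (inner ℂ w z : ℂ)) ^ (c : ℂ)‖ = kd w z ^ (-c) :=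
  norm_one_div_one_sub_cpow c
    ((norm_inner_le_of_le_one (mem_unitBall_iff.1 hw).le).trans_lt (mem_unitBall_iff.1 hz))

/-- The function `(1 - ⟨·, w⟩) ^ (-c)` for a point `w` of the ball. -/
def kernelFn {n : ℕ} {c : ℝ} (hc : 0 ≤ c) {w : Cn n} (hw : w ∈ unitBall n) : bddHolo n :=
  ⟨_, cut_mem_bddHolo (differentiableOn_kernel c hw) (M := (1 - ‖w‖) ^ (-c)) fun z hz => by
    have hw1 := mem_unitBall_iff.1 hw
    rw [norm_kernel c hw (mem_unitBall_iff.2 hz)]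
    refine Real.rpow_le_rpow_of_nonpos (by linarith) ?_ (by linarith)
    rw [kd_comm]
    exact one_sub_norm_le_kd hz.le⟩

theorem kernelFn_apply {n : ℕ} {c : ℝ} (hc : 0 ≤ c) {w z : Cn n} (hw : w ∈ unitBall n)
    (hz : z ∈ unitBall n) :
    (kernelFn hc hw : Cn n → ℂ) z = 1 / (1 - (inner ℂ w z : ℂ)) ^ (c : ℂ) :=
  cut_apply (f := fun z => 1 / (1 - (inner ℂ w z : ℂ)) ^ (c : ℂ)) hz

/-! ### The function of a functional -/

section DualFun

variable {n : ℕ} {γ α p q β T : ℝ} {hp : 0 < p} {hq : 0 < q} {hγ : 1 < γ}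
  {hα : -(n : ℝ) - 1 < α}

theorem power_smul (k : ℕ) (c : ℂ) (u : Cn n) :
    power k (c • u) = (starRingEnd ℂ) c ^ k • power k u := by
  apply Subtype.ext
  refine (power k (c • u)).2.1.ext ((starRingEnd ℂ) c ^ k • power k u).2.1 fun z hz => ?_
  rw [Submodule.coe_smul, Pi.smul_apply, power_apply hz, power_apply hz, inner_smul_left, mul_pow,
    smul_eq_mul]

/-- Expanding `⟨·, w⟩ ^ k` in monomials exhibits an antiholomorphic polynomial in `w`. -/
theorem differentiable_conj_power (L : bddHolo n →ₗ[ℂ] ℂ) (k : ℕ) :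
    Differentiable ℂ fun w : Cn n => (starRingEnd ℂ) (L (power k w)) := by
  have hM : ∀ i : Fin k → Fin n, ∀ z : Cn n, ‖z‖ < 1 → ‖∏ j, z (i j)‖ ≤ 1 := fun i z hz => by
    rw [norm_prod]
    exact Finset.prod_le_one (fun _ _ => norm_nonneg _) fun j _ =>
      (PiLp.norm_apply_le z (i j)).trans hz.le
  have hd : ∀ i : Fin k → Fin n, Differentiable ℂ fun z : Cn n => ∏ j, z (i j) := fun i => by
    fun_prop
  set e : (Fin k → Fin n) → bddHolo n := fun i =>
    ⟨_, cut_mem_bddHolo (hd i).differentiableOn (hM i)⟩ with he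
  have h1 : ∀ w : Cn n, power k w = ∑ i : Fin k → Fin n, (starRingEnd ℂ) (∏ j, w (i j)) • e i := by
    intro w
    apply Subtype.ext
    refine (power k w).2.1.ext (∑ i : Fin k → Fin n,
      (starRingEnd ℂ) (∏ j, w (i j)) • e i).2.1 fun z hz => ?_
    rw [power_apply hz, inner_eq_sum, Fintype.sum_pow, Submodule.coe_sum, Finset.sum_apply]
    refine Finset.sum_congr rfl fun i _ => ?_
    have h2 : (e i : Cn n → ℂ) z = ∏ j, z (i j) := cut_apply (f := fun z : Cn n => ∏ j, z (i j)) hz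
    rw [Finset.prod_mul_distrib, Submodule.coe_smul, Pi.smul_apply, h2, smul_eq_mul, map_prod,
      mul_comm]
  have h3 : (fun w : Cn n => (starRingEnd ℂ) (L (power k w))) =
      fun w => ∑ i : Fin k → Fin n, (∏ j, w (i j)) * (starRingEnd ℂ) (L (e i)) := by
    funext w
    rw [h1, map_sum, map_sum]
    refine Finset.sum_congr rfl fun i _ => ?_
    rw [map_smul, smul_eq_mul, map_mul, Complex.conj_conj]
  rw [h3]
  exact Differentiable.fun_sum fun i _ => (hd i).mul_const _

variable [NeZero n]

/-- The homogeneous polynomials whose sum represents the functional `τ`. -/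
def dualPart (hγ : 1 < γ) (hα : -(n : ℝ) - 1 < α) (β : ℝ) (τ : HT n γ α hp hq →L[ℂ] ℂ) (k : ℕ)
    (w : Cn n) : ℂ :=
  ((moment n (-1) β k)⁻¹ : ℝ) * (starRingEnd ℂ) (τ (toHT hγ hα (power k w)))

theorem exists_norm_power_le (hγ : 1 < γ) (hα : -(n : ℝ) - 1 < α) (τ : HT n γ α hp hq →L[ℂ] ℂ) :
    ∃ K : ℝ, 0 ≤ K ∧ ∀ k u, ‖τ (toHT hγ hα (power k u))‖ ≤ K * ‖u‖ ^ k := by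
  obtain ⟨K, hK, h⟩ := exists_norm_toHT_le (hγ := hγ) (hα := hα) τ
  exact ⟨K, hK, fun k u => h _ _ (norm_power_le k u)⟩

theorem isHomogSeries_dualPart (hβ : -1 < β) (τ : HT n γ α hp hq →L[ℂ] ℂ) :
    IsHomogSeries (dualPart hγ hα β τ) where
  differentiable k :=
    (differentiable_conj_power (τ.toLinearMap ∘ₗ toHT hγ hα) k).const_mul _
  smul k c z := by
    rw [dualPart, dualPart, power_smul, map_smul, map_smul, smul_eq_mul, map_mul, map_pow,
      Complex.conj_conj]
    ring
  bound R hR0 hR1 := by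
    obtain ⟨K, hK, h⟩ := exists_norm_power_le hγ hα τ
    have hsum := ((isSymbol_inv_moment n (ρ := -1) (by norm_num) hβ).summable (x := (R : ℂ))
      (by rwa [Complex.norm_real, Real.norm_of_nonneg hR0.le])).norm
    refine ⟨_, hsum.mul_left K, fun k z hz => ?_⟩
    rw [dualPart, norm_mul, norm_mul, RCLike.norm_conj, norm_pow, Complex.norm_real R,
      Real.norm_of_nonneg hR0.le, mul_left_comm]
    refine mul_le_mul_of_nonneg_left ((h k z).trans ?_) (norm_nonneg _)
    exact mul_le_mul_of_nonneg_left (pow_le_pow_left₀ (norm_nonneg z) hz.le k) hK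

/-- The holomorphic function representing the functional `τ` in the pairing with weight `β`. -/
def dualFun (hγ : 1 < γ) (hα : -(n : ℝ) - 1 < α) (β : ℝ) (τ : HT n γ α hp hq →L[ℂ] ℂ) :
    Cn n → ℂ := cut fun w => ∑' k, dualPart hγ hα β τ k w

theorem isHolo_dualFun (hβ : -1 < β) (τ : HT n γ α hp hq →L[ℂ] ℂ) :
    IsHolo n (dualFun hγ hα β τ) := isHolo_cut (isHomogSeries_dualPart hβ τ).differentiableOn_tsum

theorem homogPart_dualFun (hβ : -1 < β) (τ : HT n γ α hp hq →L[ℂ] ℂ) (k : ℕ) (w : Cn n) :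
    homogPart (dualFun hγ hα β τ) k w = dualPart hγ hα β τ k w :=
  (isHomogSeries_dualPart hβ τ).homogPart_eq (fun _ hz => cut_apply hz) k w

theorem conj_homogPart_dualFun (hβ : -1 < β) (τ : HT n γ α hp hq →L[ℂ] ℂ) (k : ℕ) (w : Cn n) :
    moment n (-1) β k * (starRingEnd ℂ) (homogPart (dualFun hγ hα β τ) k w) =
      τ (toHT hγ hα (power k w)) := by
  have h := (moment_pos n (ρ := -1) (by norm_num) hβ k).ne'
  rw [homogPart_dualFun hβ, dualPart, map_mul, Complex.conj_ofReal, Complex.conj_conj, ← mul_assoc,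
    ← Complex.ofReal_mul, mul_inv_cancel₀ h, Complex.ofReal_one, one_mul]

/-- A function with the homogeneous parts prescribed by `τ` is the function of `τ`. -/
theorem dualFun_eq (hβ : -1 < β) {τ : HT n γ α hp hq →L[ℂ] ℂ} {g : Cn n → ℂ} (hg : IsHolo n g)
    (h : ∀ k u, τ (toHT hγ hα (power k u)) =
      moment n (-1) β k * (starRingEnd ℂ) (homogPart g k u)) :
    dualFun hγ hα β τ = g := by
  refine (isHolo_dualFun hβ τ).ext hg fun z hz => ?_
  rw [dualFun, cut_apply hz, ← (hasSum_homogPart hg.1 (mem_unitBall_iff.1 hz)).tsum_eq]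
  refine tsum_congr fun k => ?_
  have h0 := (moment_pos n (ρ := -1) (by norm_num) hβ k).ne'
  rw [dualPart, h, map_mul, Complex.conj_ofReal, Complex.conj_conj, ← mul_assoc,
    ← Complex.ofReal_mul, inv_mul_cancel₀ h0, Complex.ofReal_one, one_mul]

/-- The fractional derivative of the function of `τ` is given by the values of `τ` at kernels. -/
theorem mult_dualFun (hβ : -1 < β) (hT : 0 < T) (hc : 0 ≤ n + β + 1 + T)
    (τ : HT n γ α hp hq →L[ℂ] ℂ) {w : Cn n} (hw : w ∈ unitBall n) :
    mult (ratio (n + β + 1 + T) (n + β + 1)) (dualFun hγ hα β τ) w =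
      ((moment n (-1) β 0)⁻¹ : ℝ) * (starRingEnd ℂ) (τ (toHT hγ hα (kernelFn hc hw))) := by
  have hn : (0 : ℝ) ≤ n := n.cast_nonneg
  have hB : ∀ j : ℕ, n + β + 1 + (j : ℝ) ≠ 0 := fun j => by
    have : (0 : ℝ) ≤ j := j.cast_nonneg
    linarith [(Nat.one_le_cast (α := ℝ)).2 (NeZero.one_le (n := n))]
  have hBT : ∀ j : ℕ, n + β + 1 + T + (j : ℝ) ≠ 0 := fun j => by
    have : (0 : ℝ) ≤ j := j.cast_nonneg
    linarith [(Nat.one_le_cast (α := ℝ)).2 (NeZero.one_le (n := n))]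
  have h1j : ∀ j : ℕ, (1 : ℝ) + j ≠ 0 := fun j => by positivity
  have hw1 := mem_unitBall_iff.1 hw
  obtain ⟨K, hK, hbd⟩ := exists_norm_toHT_le (hγ := hγ) (hα := hα) τ
  set a := ratio (n + β + 1 + T) 1 with ha
  have hsum := ((isSymbol_ratio hBT h1j).summable (x := (‖w‖ : ℂ))
      (by rwa [Complex.norm_real, norm_norm])).norm
  have h1 : HasSum (fun k => (τ.toLinearMap ∘ₗ toHT hγ hα) ((a k : ℂ) • power k w))
      ((τ.toLinearMap ∘ₗ toHT hγ hα) (kernelFn hc hw)) := by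
    refine hasSum_of_bounded _ hbd hsum (fun k z => ?_) fun z hz => ?_
    · rw [Submodule.coe_smul, Pi.smul_apply, norm_smul, norm_mul, norm_pow, Complex.norm_real ‖w‖,
        norm_norm]
      exact mul_le_mul_of_nonneg_left (norm_power_le k w z) (norm_nonneg _)
    · rw [kernelFn_apply hc hw hz]
      simp only [Submodule.coe_smul, Pi.smul_apply, power_apply hz, smul_eq_mul]
      exact hasSum_ratio _ ((norm_inner_le_of_le_one hw1.le).trans_lt (mem_unitBall_iff.1 hz))
  have h2 := ((Complex.hasSum_conj'.2 h1).mul_left (((moment n (-1) β 0)⁻¹ : ℝ) : ℂ)).tsum_eq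
  refine Eq.trans (tsum_congr fun k => ?_) h2
  rw [homogPart_dualFun hβ, dualPart, map_smul, smul_eq_mul, map_mul, Complex.conj_ofReal,
    ← mul_assoc, ← mul_assoc, ← Complex.ofReal_mul, ← Complex.ofReal_mul]
  congr 2
  have hm0 := (moment_pos n (ρ := -1) (by norm_num) hβ 0).ne'
  have hr : ratio 1 (n + β + 1) k ≠ 0 := ratio_ne_zero h1j hB k
  rw [moment_eq n (by norm_num) hβ k, ha, ← ratio_mul_ratio (c := n + β + 1) h1j k]
  field_simp

end DualFun

/-! ### Disjoint families of shadows -/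

theorem shadow_subset_korBall_of_eq {n : ℕ} {κ : ℝ} {w : Cn n} {η : UnitSphere n}
    (hη : w = ((‖w‖ : ℝ) : ℂ) • (η : Cn n)) (hw : w ∈ unitBall n) :
    shadow κ w ⊆ korBall η (κ * (1 - ‖w‖ ^ 2)) := by
  intro ζ hζ
  have h1 := (mem_approachRegion_iff.1 hζ).2
  have h2 := kd_le_two_kd_smul (norm_sphere_le ζ) (norm_sphere_le η) (norm_nonneg w)
    (mem_unitBall_iff.1 hw).le
  rw [← hη] at h2
  change kd (η : Cn n) ζ < _
  rw [kd_comm]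
  linarith

theorem exists_sphereMeasure_shadow_le (n : ℕ) [NeZero n] {κ : ℝ} (hκ : 0 < κ) :
    ∃ C : ℝ≥0, ∀ w ∈ unitBall n,
      sphereMeasure n (shadow κ w) ≤ C * ENNReal.ofReal ((1 - ‖w‖ ^ 2) ^ n) := by
  obtain ⟨C, hC0, hC⟩ := sphereMeasure_korBall_le n
  refine ⟨(C * κ ^ n).toNNReal, fun w hw => ?_⟩
  obtain ⟨η, hη⟩ := exists_eq_smul_sphere w
  have hδ := one_sub_sq_pos hw
  refine (measure_mono (shadow_subset_korBall_of_eq hη hw)).trans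
    ((hC η _ (by positivity)).trans_eq ?_)
  rw [mul_pow, ← mul_assoc, ENNReal.ofReal_mul (by positivity)]
  rfl

/-- Vitali covering: shadows of points of a compact part of the ball contain finitely many disjoint
ones which carry a fixed proportion of the measure of the union. -/
theorem exists_disjoint_shadows (n : ℕ) [NeZero n] : ∃ C : ℝ≥0, ∀ ρ : ℝ, ρ < 1 →
    ∀ S : Set (Cn n), (∀ w ∈ S, ‖w‖ ≤ ρ) → ∃ u : Finset (Cn n), ↑u ⊆ S ∧
      (u : Set (Cn n)).PairwiseDisjoint (shadow 4) ∧
      sphereMeasure n (⋃ a ∈ S, shadow 4 a) ≤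
        C * ∑ b ∈ u, ENNReal.ofReal ((1 - ‖b‖ ^ 2) ^ n) := by
  obtain ⟨C, hC0, hC⟩ := sphereMeasure_korBall_le n
  obtain ⟨c, hc0, hc⟩ := exists_le_sphereMeasure_shadow n one_pos le_rfl
  have := sphereMeasure_isProbability n
  refine ⟨(C * 168 ^ n).toNNReal, fun ρ hρ S hS => ?_⟩
  have hball : ∀ w ∈ S, w ∈ unitBall n := fun w hw => mem_unitBall_iff.2 ((hS w hw).trans_lt hρ)
  have hlow : ∀ w ∈ S, ENNReal.ofReal (c * (1 - ‖w‖ ^ 2) ^ n) ≤ sphereMeasure n (shadow 4 w) :=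
    fun w hw => hc 4 w (hball w hw) (by linarith [norm_nonneg w])
  have hne : ∀ w ∈ S, (shadow 4 w).Nonempty := fun w hw => by
    have h1 := hlow w hw
    by_contra hemp
    rw [Set.not_nonempty_iff_eq_empty.1 hemp, measure_empty, nonpos_iff_eq_zero,
      ENNReal.ofReal_eq_zero] at h1
    have := one_sub_sq_pos (hball w hw)
    exact absurd h1 (not_le.2 (by positivity))
  obtain ⟨v, hvS, hdisj, hcov⟩ := Vitali.exists_disjoint_subfamily_covering_enlargement
    (fun w : Cn n => shadow 4 w) S (fun w => 1 - ‖w‖ ^ 2) 2 one_lt_two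
    (fun w hw => (one_sub_sq_pos (hball w hw)).le) 1 (fun w _ => one_sub_sq_le_one w) hne
  -- disjoint shadows of points of a compact part of the ball have measures bounded below
  have hfin : v.Finite := by
    rcases v.eq_empty_or_nonempty with rfl | ⟨w₀, hw₀⟩
    · exact Set.finite_empty
    have hρ0 : 0 ≤ ρ := (norm_nonneg w₀).trans (hS w₀ (hvS hw₀))
    have hρ2 : 0 < 1 - ρ ^ 2 := by nlinarith
    have h1 := Measure.finite_const_le_meas_of_disjoint_iUnion (sphereMeasure n)
      (ε := ENNReal.ofReal (c * (1 - ρ ^ 2) ^ n)) (ENNReal.ofReal_pos.2 (by positivity))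
      (As := fun w : v => shadow 4 (w : Cn n)) (fun w => (isOpen_shadow 4 _).measurableSet)
      (fun a b hab => hdisj a.2 b.2 fun h => hab (Subtype.ext h)) (measure_ne_top _ _)
    have h2 : {w : v | ENNReal.ofReal (c * (1 - ρ ^ 2) ^ n) ≤
        sphereMeasure n (shadow 4 (w : Cn n))} = Set.univ := by
      refine Set.eq_univ_of_forall fun w => ?_
      refine le_trans (ENNReal.ofReal_le_ofReal ?_) (hlow w (hvS w.2))
      have := hS w (hvS w.2)
      gcongr
    rw [h2] at h1
    exact Set.finite_coe_iff.1 (Set.finite_univ_iff.1 h1)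
  refine ⟨hfin.toFinset, by rwa [hfin.coe_toFinset], by rwa [hfin.coe_toFinset], ?_⟩
  choose η hη using fun w : Cn n => exists_eq_smul_sphere w
  have hsub : (⋃ a ∈ S, shadow 4 a) ⊆
      ⋃ b ∈ hfin.toFinset, korBall (η b) (168 * (1 - ‖b‖ ^ 2)) := by
    refine Set.iUnion₂_subset fun a ha => ?_
    obtain ⟨b, hb, hab, hle⟩ := hcov a ha
    have ha1 := shadow_subset_korBall_of_eq (κ := 4) (hη a) (hball a ha)
    have hb1 := shadow_subset_korBall_of_eq (κ := 4) (hη b) (hball b (hvS hb))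
    have h1 := korBall_subset_of_inter (hab.mono (Set.inter_subset_inter ha1 hb1))
    have hδ := one_sub_sq_pos (hball b (hvS hb))
    -- `1 - |a|² ≤ 2 (1 - |b|²)` by the choice of `b`, and non-isotropic balls are enlarged by the
    -- factor `21` to contain the smaller balls which they meet
    have h2 : 21 * max (4 * (1 - ‖a‖ ^ 2)) (4 * (1 - ‖b‖ ^ 2)) ≤ 168 * (1 - ‖b‖ ^ 2) := by
      have : max (4 * (1 - ‖a‖ ^ 2)) (4 * (1 - ‖b‖ ^ 2)) ≤ 8 * (1 - ‖b‖ ^ 2) :=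
        max_le (by linarith) (by linarith)
      linarith
    exact fun ζ hζ => Set.mem_iUnion₂.2
      ⟨b, hfin.mem_toFinset.2 hb, lt_of_lt_of_le (h1 (ha1 hζ)) h2⟩
  calc _ ≤ ∑ b ∈ hfin.toFinset, sphereMeasure n (korBall (η b) (168 * (1 - ‖b‖ ^ 2))) :=
        (measure_mono hsub).trans (measure_biUnion_finset_le _ _)
    _ ≤ ∑ b ∈ hfin.toFinset, (C * 168 ^ n).toNNReal * ENNReal.ofReal ((1 - ‖b‖ ^ 2) ^ n) := by
        refine Finset.sum_le_sum fun b hb => ?_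
        have hδ := one_sub_sq_pos (hball b (hvS (hfin.mem_toFinset.1 hb)))
        refine (hC (η b) _ (by positivity)).trans_eq ?_
        rw [mul_pow, ← mul_assoc, ENNReal.ofReal_mul (by positivity)]
        rfl
    _ = _ := (Finset.mul_sum _ _ _).symm

/-! ### Test functions -/

/-- At each point of a family of sets which are disjoint on each dyadic level, the sum of the dyadic
weights is dominated by its largest term. -/
theorem exists_dyadic_sum_rpow_le {s r : ℝ} (hs : 0 < s) (hr : 0 < r) : ∃ C : ℝ≥0,
    ∀ {X Y : Type*} (I : Finset (Σ _ : ℤ, Y)) (U : Y → Set X),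
      (∀ x ∈ I, ∀ y ∈ I, x.1 = y.1 → x ≠ y → Disjoint (U x.2) (U y.2)) → ∀ ζ : X,
        (∑ x ∈ I, (U x.2).indicator (fun _ => ((2 : ℝ≥0∞) ^ x.1) ^ s) ζ) ^ r ≤
          C * ∑ x ∈ I, (U x.2).indicator (fun _ => ((2 : ℝ≥0∞) ^ x.1) ^ (s * r)) ζ := by
  classical
  obtain ⟨C, hC⟩ := exists_tsum_dyadic_le hs
  refine ⟨(C * 2 ^ s) ^ r, fun {X Y} I U hI ζ => ?_⟩
  set J := I.filter fun x => ζ ∈ U x.2 with hJ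
  have hsum : ∀ φ : ℤ → ℝ≥0∞, ∑ x ∈ I, (U x.2).indicator (fun _ => φ x.1) ζ = ∑ x ∈ J, φ x.1 := by
    intro φ
    rw [hJ, Finset.sum_filter]
    exact Finset.sum_congr rfl fun x _ => Set.indicator_apply _ _ _
  rw [hsum (fun j => ((2 : ℝ≥0∞) ^ j) ^ s), hsum (fun j => ((2 : ℝ≥0∞) ^ j) ^ (s * r))]
  rcases J.eq_empty_or_nonempty with hemp | hne
  · rw [hemp, Finset.sum_empty, ENNReal.zero_rpow_of_pos hr]; exact zero_le
  obtain ⟨x₀, hx₀, hmax⟩ := J.exists_max_image (fun x => x.1) hne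
  have hinj : Set.InjOn (fun x : Σ _ : ℤ, Y => x.1) J := by
    intro x hx y hy hxy
    have hx' := Finset.mem_filter.1 hx
    have hy' := Finset.mem_filter.1 hy
    by_contra hne
    exact (hI x hx'.1 y hy'.1 hxy hne).le_bot ⟨hx'.2, hy'.2⟩
  have h2 : (2 : ℝ≥0∞) ≠ 0 := two_ne_zero
  have h2t : (2 : ℝ≥0∞) ≠ ⊤ := ENNReal.ofNat_ne_top
  have h1 : ∑ x ∈ J, ((2 : ℝ≥0∞) ^ x.1) ^ s ≤ C * ((2 : ℝ≥0∞) ^ (x₀.1 + 1)) ^ s := by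
    refine le_trans ?_ (hC _)
    rw [← Finset.sum_image (f := fun j : ℤ => ((2 : ℝ≥0∞) ^ j) ^ s)
      (g := fun x : Σ _ : ℤ, Y => x.1) hinj]
    refine le_trans (Finset.sum_le_sum fun j hj => ?_)
      (ENNReal.sum_le_tsum (J.image fun x : Σ _ : ℤ, Y => x.1))
    obtain ⟨x, hx, rfl⟩ := Finset.mem_image.1 hj
    rw [if_pos]
    rw [two_zpow_eq_ofReal, two_zpow_eq_ofReal, ENNReal.ofReal_lt_ofReal_iff (by positivity)]
    exact zpow_lt_zpow_right₀ one_lt_two (Int.lt_add_one_of_le (hmax x hx))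
  calc _ ≤ (C * ((2 : ℝ≥0∞) ^ (x₀.1 + 1)) ^ s) ^ r := ENNReal.rpow_le_rpow h1 hr.le
    _ = (C * 2 ^ s : ℝ≥0∞) ^ r * ((2 : ℝ≥0∞) ^ x₀.1) ^ (s * r) := by
        rw [ENNReal.zpow_add h2 h2t, zpow_one, mul_comm ((2 : ℝ≥0∞) ^ x₀.1),
          ENNReal.mul_rpow_of_nonneg _ _ hs.le, ← mul_assoc, ENNReal.mul_rpow_of_nonneg _ _ hr.le,
          ← ENNReal.rpow_mul ((2 : ℝ≥0∞) ^ x₀.1)]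
    _ ≤ (C * 2 ^ s : ℝ≥0∞) ^ r * ∑ x ∈ J, ((2 : ℝ≥0∞) ^ x.1) ^ (s * r) :=
        mul_le_mul_right (Finset.single_le_sum (f := fun x : Σ _ : ℤ, Y =>
          ((2 : ℝ≥0∞) ^ x.1) ^ (s * r)) (fun _ _ => zero_le) hx₀) _
    _ = _ := by
        rw [ENNReal.coe_rpow_of_nonneg _ hr.le, ENNReal.coe_mul, ENNReal.coe_rpow_of_nonneg _ hs.le]
        rfl

/-- Sums of kernels at points with disjoint shadows on each dyadic level. The kernels contribute
independently of each other because `q < 1`, and the duality argument for positive operators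
replaces them by the indicator functions of the shadows. -/
theorem exists_tentNorm_sum_kernel_le (n : ℕ) [NeZero n] {γ p q p' α c d : ℝ} (hγ : 0 < γ)
    (hq0 : 0 < q) (hq1 : q < 1) (hp : 1 < p) (hp' : p' = p / (p - 1)) (hα : -(n : ℝ) - 1 < α)
    (hd : n < d) (hc : c * q = d + (n + 1 + α)) : ∃ C : ℝ≥0, ∀ I : Finset (Σ _ : ℤ, Cn n),
      (∀ x ∈ I, x.2 ∈ unitBall n) →
      (∀ x ∈ I, ∀ y ∈ I, x.1 = y.1 → x ≠ y → Disjoint (shadow 4 x.2) (shadow 4 y.2)) →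
      ∀ F : Cn n → ℂ, (∀ z ∈ unitBall n, ‖F z‖ₑ ≤
        ∑ x ∈ I, ((2 : ℝ≥0∞) ^ x.1) ^ (p' - 1) *
          ENNReal.ofReal ((1 - ‖x.2‖ ^ 2) ^ (d / q) * kd x.2 z ^ (-c))) →
        tentNorm γ p q α F ≤ C * (∑ x ∈ I, ((2 : ℝ≥0∞) ^ x.1) ^ p' *
          ENNReal.ofReal ((1 - ‖x.2‖ ^ 2) ^ n)) ^ (1 / p) := by
  have hp0 : 0 < p := by linarith
  have hp1 : 0 < p - 1 := by linarith
  have hp'1 : 0 < p' - 1 := by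
    rw [hp', sub_pos, one_lt_div hp1]; linarith
  have hr1 : 1 < p / q := (one_lt_div₀ hq0).2 (by linarith)
  have hr0 : 0 < p / q := by linarith
  have hsr : (p' - 1) * q * (p / q) = p' := by
    rw [hp']; field_simp; ring
  obtain ⟨C₁, h₁⟩ := exists_lintegral_approach_le n hγ hα (c := c * q)
    (by linarith [(Nat.cast_nonneg n : (0 : ℝ) ≤ n)])
  obtain ⟨C₂, h₂⟩ := exists_lintegral_kd_le_maxFn n (κ := 4) (by norm_num) hd
  obtain ⟨C₃, h₃⟩ := exists_le_lintegral_shadow n one_pos le_rfl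
  obtain ⟨C₄, h₄⟩ := exists_lintegral_rpow_le_of_duality n hr1 (C₃ * C₂)
  obtain ⟨C₅, h₅⟩ := exists_dyadic_sum_rpow_le (mul_pos hp'1 hq0) hr0
  obtain ⟨C₆, h₆⟩ := exists_sphereMeasure_shadow_le n (κ := 4) (by norm_num)
  refine ⟨(C₁ ^ (p / q) * (C₄ * (C₅ * C₆))) ^ (1 / p), fun I hI hdis F hF => ?_⟩
  have hshm : ∀ w : Cn n, MeasurableSet (shadow 4 w) := fun w => (isOpen_shadow 4 w).measurableSet
  -- the weight of a kernel after taking `q`-th powers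
  set a : ℤ → ℝ≥0∞ := fun j => ((2 : ℝ≥0∞) ^ j) ^ ((p' - 1) * q) with ha
  set A : UnitSphere n → ℝ≥0∞ := fun ζ => ∑ x ∈ I, a x.1 *
    ENNReal.ofReal ((1 - ‖x.2‖ ^ 2) ^ d * kd x.2 ζ ^ (-d)) with hA
  set A' : UnitSphere n → ℝ≥0∞ := fun ζ => ∑ x ∈ I, (shadow 4 x.2).indicator (fun _ => a x.1) ζ
    with hA'
  have hkm : ∀ w : Cn n, Measurable fun ζ : UnitSphere n =>
      ENNReal.ofReal ((1 - ‖w‖ ^ 2) ^ d * kd w ζ ^ (-d)) := fun w =>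
    (((measurable_kd measurable_const
      measurable_subtype_coe).pow_const _).const_mul _).ennreal_ofReal
  have hAm : Measurable A := Finset.measurable_fun_sum _ fun x _ => (hkm x.2).const_mul _
  have hA'm : Measurable A' := Finset.measurable_fun_sum _ fun x _ =>
    measurable_const.indicator (hshm x.2)
  have harea : ∀ ζ, area γ α (fun z => ‖F z‖ₑ ^ q) ζ ≤ C₁ * A ζ := by
    intro ζ
    have hΓ := (isOpen_approachRegion γ ζ).measurableSet
    calc _ ≤ ∫⁻ z in approachRegion γ ζ, ∑ x ∈ I, a x.1 * (ENNReal.ofReal ((1 - ‖x.2‖ ^ 2) ^ d) *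
          ENNReal.ofReal ((1 - ‖z‖ ^ 2) ^ α * kd x.2 z ^ (-(c * q)))) ∂(ballVolume n) := by
          refine setLIntegral_mono' hΓ fun z hz => ?_
          have hδz := one_sub_sq_pos hz.1
          -- `x ↦ x ^ q` is subadditive
          have h7 : ‖F z‖ₑ ^ q ≤ ∑ x ∈ I, (((2 : ℝ≥0∞) ^ x.1) ^ (p' - 1) *
              ENNReal.ofReal ((1 - ‖x.2‖ ^ 2) ^ (d / q) * kd x.2 z ^ (-c))) ^ q :=
            (ENNReal.rpow_le_rpow (hF z hz.1) hq0.le).trans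
              (Finset.le_sum_of_subadditive (fun x : ℝ≥0∞ => x ^ q)
                (ENNReal.zero_rpow_of_pos hq0).le
                (fun x y => ENNReal.rpow_add_le_add_rpow x y hq0.le hq1.le) _ _)
          refine (mul_le_mul_left h7 _).trans_eq ?_
          rw [Finset.sum_mul]
          refine Finset.sum_congr rfl fun x hx => ?_
          have hδ := one_sub_sq_pos (hI x hx)
          have hk := kd_nonneg x.2 z
          rw [ENNReal.mul_rpow_of_nonneg _ _ hq0.le, ← ENNReal.rpow_mul, mul_assoc,
            ENNReal.ofReal_rpow_of_nonneg (by positivity) hq0.le,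
            ← ENNReal.ofReal_mul (by positivity), ← ENNReal.ofReal_mul (by positivity),
            Real.mul_rpow (by positivity) (by positivity), ← Real.rpow_mul hδ.le,
            ← Real.rpow_mul hk, div_mul_cancel₀ _ hq0.ne', neg_mul]
          congr 2; ring
      _ = ∑ x ∈ I, a x.1 * (ENNReal.ofReal ((1 - ‖x.2‖ ^ 2) ^ d) *
          ∫⁻ z in approachRegion γ ζ, ENNReal.ofReal ((1 - ‖z‖ ^ 2) ^ α * kd x.2 z ^ (-(c * q)))
            ∂(ballVolume n)) := by
          rw [lintegral_finsetSum _ fun x _ =>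
            ((measurable_kernel_right α (c * q) x.2).const_mul _).const_mul _]
          refine Finset.sum_congr rfl fun x _ => ?_
          rw [lintegral_const_mul _ ((measurable_kernel_right α (c * q) x.2).const_mul _),
            lintegral_const_mul _ (measurable_kernel_right α (c * q) x.2)]
      _ ≤ ∑ x ∈ I, a x.1 * (ENNReal.ofReal ((1 - ‖x.2‖ ^ 2) ^ d) *
          (C₁ * ENNReal.ofReal (kd x.2 ζ ^ (-d)))) := by
          refine Finset.sum_le_sum fun x hx => mul_le_mul_right (mul_le_mul_right ?_ _) _
          have h7 := h₁ ζ x.2 (hI x hx)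
          rwa [show n + 1 + α - c * q = -d by rw [hc]; ring] at h7
      _ = C₁ * A ζ := by
          rw [hA, Finset.mul_sum]
          refine Finset.sum_congr rfl fun x hx => ?_
          have hδ := one_sub_sq_pos (hI x hx)
          rw [ENNReal.ofReal_mul (by positivity)]
          ring
  -- the average of `ψ` against a kernel is bounded by the average of its maximal function over the
  -- shadow
  have hduality : ∀ ψ : UnitSphere n → ℝ≥0∞, Measurable ψ → ∫⁻ ζ, ψ ζ * A ζ ∂(sphereMeasure n) ≤
      (C₃ * C₂ : ℝ≥0) * ∫⁻ ζ, maxFn ψ ζ * A' ζ ∂(sphereMeasure n) := by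
    intro ψ hψ
    have hMm := measurable_maxFn hψ
    have hkm' : ∀ w : Cn n, Measurable fun ζ : UnitSphere n =>
        ψ ζ * ENNReal.ofReal (kd w ζ ^ (-d)) := fun w => hψ.mul
      ((measurable_kd measurable_const measurable_subtype_coe).pow_const _).ennreal_ofReal
    have e1 : ∫⁻ ζ, ψ ζ * A ζ ∂(sphereMeasure n) = ∑ x ∈ I, a x.1 *
        (ENNReal.ofReal ((1 - ‖x.2‖ ^ 2) ^ d) *
          ∫⁻ ζ, ψ ζ * ENNReal.ofReal (kd x.2 ζ ^ (-d)) ∂(sphereMeasure n)) := by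
      have hm : ∀ x : Σ _ : ℤ, Cn n, Measurable fun ζ : UnitSphere n => ψ ζ * (a x.1 *
          ENNReal.ofReal ((1 - ‖x.2‖ ^ 2) ^ d * kd x.2 ζ ^ (-d))) := fun x =>
        hψ.mul ((hkm x.2).const_mul _)
      simp only [hA, Finset.mul_sum]
      rw [lintegral_finsetSum _ fun x _ => hm x]
      refine Finset.sum_congr rfl fun x hx => ?_
      have hδ := one_sub_sq_pos (hI x hx)
      rw [← lintegral_const_mul _ (hkm' x.2), ← lintegral_const_mul _ ((hkm' x.2).const_mul _)]
      refine lintegral_congr fun ζ => ?_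
      rw [ENNReal.ofReal_mul (by positivity)]
      ring
    have e2 : ∫⁻ ζ, maxFn ψ ζ * A' ζ ∂(sphereMeasure n) =
        ∑ x ∈ I, a x.1 * ∫⁻ ζ in shadow 4 x.2, maxFn ψ ζ ∂(sphereMeasure n) := by
      have hm : ∀ x : Σ _ : ℤ, Cn n, Measurable fun ζ =>
          maxFn ψ ζ * (shadow 4 x.2).indicator (fun _ => a x.1) ζ := fun x =>
        hMm.mul (measurable_const.indicator (hshm x.2))
      simp only [hA', Finset.mul_sum]
      rw [lintegral_finsetSum _ fun x _ => hm x]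
      refine Finset.sum_congr rfl fun x _ => ?_
      rw [← lintegral_const_mul _ hMm, ← lintegral_indicator (hshm x.2)]
      refine lintegral_congr fun ζ => ?_
      by_cases hζ : ζ ∈ shadow 4 x.2
      · rw [Set.indicator_of_mem hζ, Set.indicator_of_mem hζ, mul_comm]
      · rw [Set.indicator_of_notMem hζ, Set.indicator_of_notMem hζ, mul_zero]
    rw [e1, e2, Finset.mul_sum]
    refine Finset.sum_le_sum fun x hx => ?_
    have hδ := one_sub_sq_pos (hI x hx)
    have h7 := h₃ 4 x.2 (hI x hx) (by linarith [norm_nonneg x.2]) _ _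
      (fun ζ hζ => h₂ ψ hψ ζ x.2 hζ)
    rw [lintegral_const_mul _ hMm] at h7
    have e3 : ENNReal.ofReal ((1 - ‖x.2‖ ^ 2) ^ d) *
        (ENNReal.ofReal ((1 - ‖x.2‖ ^ 2) ^ (-(n : ℝ))) *
          ENNReal.ofReal ((1 - ‖x.2‖ ^ 2) ^ (n - d))) = 1 := by
      rw [← ENNReal.ofReal_mul (by positivity), ← ENNReal.ofReal_mul (by positivity),
        ← Real.rpow_add hδ, ← Real.rpow_add hδ, show d + (-(n : ℝ) + (n - d)) = 0 by ring,
        Real.rpow_zero, ENNReal.ofReal_one]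
    calc _ ≤ a x.1 * (ENNReal.ofReal ((1 - ‖x.2‖ ^ 2) ^ d) * (C₃ *
          ENNReal.ofReal ((1 - ‖x.2‖ ^ 2) ^ (-(n : ℝ))) *
          (C₂ * ENNReal.ofReal ((1 - ‖x.2‖ ^ 2) ^ (n - d)) *
            ∫⁻ ζ in shadow 4 x.2, maxFn ψ ζ ∂(sphereMeasure n)))) :=
          mul_le_mul_right (mul_le_mul_right h7 _) _
      _ = ENNReal.ofReal ((1 - ‖x.2‖ ^ 2) ^ d) * (ENNReal.ofReal ((1 - ‖x.2‖ ^ 2) ^ (-(n : ℝ))) *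
          ENNReal.ofReal ((1 - ‖x.2‖ ^ 2) ^ (n - d))) * (C₃ * C₂ * (a x.1 *
            ∫⁻ ζ in shadow 4 x.2, maxFn ψ ζ ∂(sphereMeasure n))) := by ring
      _ = _ := by rw [e3, one_mul, ENNReal.coe_mul]
  have hsum : ∫⁻ ζ, A' ζ ^ (p / q) ∂(sphereMeasure n) ≤ C₅ * (C₆ * ∑ x ∈ I,
      ((2 : ℝ≥0∞) ^ x.1) ^ p' * ENNReal.ofReal ((1 - ‖x.2‖ ^ 2) ^ n)) := by
    calc _ ≤ ∫⁻ ζ, C₅ * ∑ x ∈ I, (shadow 4 x.2).indicator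
          (fun _ => ((2 : ℝ≥0∞) ^ x.1) ^ p') ζ ∂(sphereMeasure n) := by
          refine lintegral_mono fun ζ => ?_
          have h7 := h₅ I (fun w : Cn n => shadow 4 w) hdis ζ
          rwa [hsr] at h7
      _ = C₅ * ∑ x ∈ I, ((2 : ℝ≥0∞) ^ x.1) ^ p' * sphereMeasure n (shadow 4 x.2) := by
          rw [lintegral_const_mul _ (Finset.measurable_fun_sum _ fun x _ =>
              measurable_const.indicator (hshm x.2)),
            lintegral_finsetSum _ fun x _ => measurable_const.indicator (hshm x.2)]
          congr 1
          exact Finset.sum_congr rfl fun x _ => lintegral_indicator_const (hshm x.2) _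
      _ ≤ C₅ * ∑ x ∈ I, ((2 : ℝ≥0∞) ^ x.1) ^ p' *
            (C₆ * ENNReal.ofReal ((1 - ‖x.2‖ ^ 2) ^ n)) :=
          mul_le_mul_right (Finset.sum_le_sum fun x hx => mul_le_mul_right (h₆ _ (hI x hx)) _) _
      _ = _ := by
          congr 1
          rw [Finset.mul_sum]
          exact Finset.sum_congr rfl fun x _ => by ring
  rw [tentNorm_eq_area, ENNReal.coe_rpow_of_nonneg _ (by positivity),
    ← ENNReal.mul_rpow_of_nonneg _ _ (by positivity)]
  refine ENNReal.rpow_le_rpow ?_ (by positivity)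
  calc _ ≤ ∫⁻ ζ, (C₁ : ℝ≥0∞) ^ (p / q) * A ζ ^ (p / q) ∂(sphereMeasure n) := by
        refine lintegral_mono fun ζ => ?_
        rw [← ENNReal.mul_rpow_of_nonneg _ _ hr0.le]
        exact ENNReal.rpow_le_rpow (harea ζ) hr0.le
    _ = (C₁ : ℝ≥0∞) ^ (p / q) * ∫⁻ ζ, A ζ ^ (p / q) ∂(sphereMeasure n) :=
        lintegral_const_mul _ (hAm.pow_const _)
    _ ≤ (C₁ : ℝ≥0∞) ^ (p / q) * (C₄ * (C₅ * (C₆ * ∑ x ∈ I,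
      ((2 : ℝ≥0∞) ^ x.1) ^ p' * ENNReal.ofReal ((1 - ‖x.2‖ ^ 2) ^ n)))) :=
        mul_le_mul_right ((h₄ A A' hAm hA'm hduality).trans (mul_le_mul_right hsum _)) _
    _ = _ := by
        push_cast
        rw [ENNReal.coe_rpow_of_nonneg _ hr0.le]
        ring

/-! ### The range of the dual space -/

/-- A finite quantity which is bounded by a multiple of its power `1 / p` can be absorbed. -/
theorem le_rpow_of_le_mul_rpow {p p' : ℝ} (hp' : 0 < p') (hpp : 1 / p' = 1 - 1 / p)
    {X K : ℝ≥0∞} (hX : X ≠ ⊤) (h : X ≤ K * X ^ (1 / p)) : X ≤ K ^ p' := by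
  by_cases hX0 : X = 0
  · rw [hX0]; exact zero_le
  have h3 : X ^ (1 / p') ≤ K := by
    rw [hpp, ENNReal.rpow_sub _ _ hX0 hX, ENNReal.rpow_one]
    exact ENNReal.div_le_of_le_mul h
  calc X = (X ^ (1 / p')) ^ p' := by
        rw [← ENNReal.rpow_mul, one_div_mul_cancel hp'.ne', ENNReal.rpow_one]
    _ ≤ K ^ p' := ENNReal.rpow_le_rpow h3 hp'.le

theorem two_zpow_ne_top (j : ℤ) : (2 : ℝ≥0∞) ^ j ≠ ⊤ := by
  rw [two_zpow_eq_ofReal]; exact ENNReal.ofReal_ne_top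

theorem two_zpow_ne_zero (j : ℤ) : (2 : ℝ≥0∞) ^ j ≠ 0 := by
  rw [two_zpow_eq_ofReal]; exact (ENNReal.ofReal_pos.2 (by positivity)).ne'

theorem two_zpow_rpow_eq (j : ℤ) (p : ℝ) :
    ((2 : ℝ≥0∞) ^ j) ^ p = ((2 : ℝ≥0∞) ^ j) ^ (p - 1) * (2 : ℝ≥0∞) ^ j := by
  conv_rhs => rw [← ENNReal.rpow_one ((2 : ℝ≥0∞) ^ j), ← ENNReal.rpow_mul, one_mul]
  rw [← ENNReal.rpow_add _ _ (two_zpow_ne_zero j) (two_zpow_ne_top j), sub_add_cancel]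

theorem sum_two_zpow_rpow_mul_ne_top {n : ℕ} {p : ℝ} (hp : 0 ≤ p) (I : Finset (Σ _ : ℤ, Cn n)) :
    ∑ x ∈ I, ((2 : ℝ≥0∞) ^ x.1) ^ p * ENNReal.ofReal ((1 - ‖x.2‖ ^ 2) ^ n) ≠ ⊤ :=
  (ENNReal.sum_lt_top.2 fun x _ => ENNReal.mul_lt_top
    (ENNReal.rpow_lt_top_of_nonneg hp (two_zpow_ne_top x.1)) ENNReal.ofReal_lt_top).ne

set_option maxHeartbeats 400000 in
/-- Testing a functional on a sum of kernels with disjoint shadows on each dyadic level: the sum `X`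
on the left-hand side satisfies `X ≤ C ‖τ‖ X ^ (1 / p)`. -/
theorem exists_sum_le_dualNorm (n : ℕ) [NeZero n] {γ p q p' α β T : ℝ} (hγ : 1 < γ) (hq0 : 0 < q)
    (hq1 : q < 1) (hp : 1 < p) (hp0 : 0 < p) (hp' : p' = p / (p - 1)) (hα : -(n : ℝ) - 1 < α)
    (hβ : β = n + (α + (1 / q - 1) * (n + 1 + α))) (hβ1 : -1 < β) (hT : T = n / q) :
    ∃ C : ℝ≥0, ∀ (τ : HT n γ α hp0 hq0 →L[ℂ] ℂ) (I : Finset (Σ _ : ℤ, Cn n)),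
      (∀ x ∈ I, x.2 ∈ unitBall n) →
      (∀ x ∈ I, ∀ y ∈ I, x.1 = y.1 → x ≠ y → Disjoint (shadow 4 x.2) (shadow 4 y.2)) →
      (∀ x ∈ I, (2 : ℝ≥0∞) ^ x.1 ≤ weighted T
        (mult (ratio (n + β + 1 + T) (n + β + 1)) (dualFun hγ hα β τ)) x.2) →
      ∑ x ∈ I, ((2 : ℝ≥0∞) ^ x.1) ^ p' * ENNReal.ofReal ((1 - ‖x.2‖ ^ 2) ^ n) ≤
        C * dualNorm τ ^ p' := by
  classical
  have hn : (1 : ℝ) ≤ n := (Nat.one_le_cast (α := ℝ)).2 (NeZero.one_le (n := n))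
  have hp1 : 0 < p - 1 := by linarith
  have hp'0 : 0 < p' := by rw [hp']; positivity
  have hp'1 : 0 < p' - 1 := by rw [hp', sub_pos, one_lt_div hp1]; linarith
  have hpp : 1 / p' = 1 - 1 / p := by rw [hp']; field_simp
  have hT0 : 0 < T := by rw [hT]; positivity
  set c : ℝ := n + β + 1 + T with hc
  set d : ℝ := n * q + n with hd
  have hc0 : 0 ≤ c := by rw [hc]; linarith
  have hdq : d / q = n + T := by rw [hd, hT]; field_simp
  have hcq : c * q = d + (n + 1 + α) := by rw [hc, hd, hβ, hT]; field_simp; ring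
  obtain ⟨C, hC⟩ := exists_tentNorm_sum_kernel_le n (γ := γ) (by linarith) hq0 hq1 hp hp' hα
    (d := d) (c := c) (by rw [hd]; nlinarith) hcq
  have hm0 := moment_pos n (ρ := -1) (by norm_num) hβ1 0
  set l : ℝ := (moment n (-1) β 0)⁻¹ with hl
  have hl0 : 0 < l := inv_pos.2 hm0
  refine ⟨(l.toNNReal * C) ^ p', fun τ I hI hdis hlow => ?_⟩
  set X := ∑ x ∈ I, ((2 : ℝ≥0∞) ^ x.1) ^ p' * ENNReal.ofReal ((1 - ‖x.2‖ ^ 2) ^ n) with hX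
  set K : Cn n → bddHolo n := fun w => if h : w ∈ unitBall n then kernelFn hc0 h else 0 with hK
  have hKeq : ∀ w (h : w ∈ unitBall n), K w = kernelFn hc0 h := fun w h => dif_pos h
  set v : Cn n → ℂ := fun w => τ (toHT hγ hα (K w)) with hv
  -- the unimodular factor aligns the contributions of the kernels
  set a : (Σ _ : ℤ, Cn n) → ℂ := fun x =>
    ((((2 : ℝ) ^ x.1) ^ (p' - 1) * (1 - ‖x.2‖ ^ 2) ^ (n + T) : ℝ) : ℂ) *
      ((starRingEnd ℂ) (v x.2) / ‖v x.2‖) with ha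
  set F : bddHolo n := ∑ x ∈ I, a x • K x.2 with hF
  have hpos : ∀ x ∈ I, 0 ≤ ((2 : ℝ) ^ x.1) ^ (p' - 1) * (1 - ‖x.2‖ ^ 2) ^ (n + T) := fun x hx => by
    have := one_sub_sq_pos (hI x hx); positivity
  have h2 : ∀ j : ℤ, ((2 : ℝ≥0∞) ^ j) ^ (p' - 1) = ENNReal.ofReal (((2 : ℝ) ^ j) ^ (p' - 1)) := by
    intro j
    rw [two_zpow_eq_ofReal, ENNReal.ofReal_rpow_of_pos (by positivity)]
  have hFn : tentNorm γ p q α (F : Cn n → ℂ) ≤ C * X ^ (1 / p) := by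
    refine hC I hI hdis F fun z hz => ?_
    rw [hF, Submodule.coe_sum, Finset.sum_apply]
    refine (enorm_sum_le _ _).trans (Finset.sum_le_sum fun x hx => ?_)
    have hδ := one_sub_sq_pos (hI x hx)
    have hk := kd_nonneg x.2 z
    rw [Submodule.coe_smul, Pi.smul_apply, hKeq _ (hI x hx), kernelFn_apply hc0 (hI x hx) hz,
      enorm_smul, h2, ← ENNReal.ofReal_mul (by positivity), ← ofReal_norm, ← ofReal_norm,
      norm_kernel c (hI x hx) hz, ← ENNReal.ofReal_mul (norm_nonneg _), hdq, ← mul_assoc]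
    refine ENNReal.ofReal_le_ofReal (mul_le_mul_of_nonneg_right ?_ (by positivity))
    rw [ha, norm_mul, Complex.norm_real, Real.norm_of_nonneg (hpos x hx), norm_div,
      RCLike.norm_conj, Complex.norm_real, norm_norm]
    exact mul_le_of_le_one_right (hpos x hx) (div_self_le_one _)
  have hτF : τ (toHT hγ hα F) = ((∑ x ∈ I,
      ((2 : ℝ) ^ x.1) ^ (p' - 1) * (1 - ‖x.2‖ ^ 2) ^ (n + T) * ‖v x.2‖ : ℝ) : ℂ) := by
    rw [hF, map_sum, map_sum, Complex.ofReal_sum]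
    refine Finset.sum_congr rfl fun x _ => ?_
    rw [map_smul, map_smul, smul_eq_mul, ha, Complex.ofReal_mul, mul_assoc]
    congr 1
    change _ * v x.2 = _
    rw [div_mul_eq_mul_div, mul_comm, Complex.mul_conj, Complex.normSq_eq_norm_sq,
      Complex.ofReal_pow, pow_two, mul_self_div_self]
  have hXle : X ≤ l.toNNReal * ‖τ (toHT hγ hα F)‖ₑ := by
    have e1 : ‖τ (toHT hγ hα F)‖ₑ = ∑ x ∈ I, ENNReal.ofReal
        (((2 : ℝ) ^ x.1) ^ (p' - 1) * (1 - ‖x.2‖ ^ 2) ^ (n + T) * ‖v x.2‖) := by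
      have hterm : ∀ x ∈ I, 0 ≤ ((2 : ℝ) ^ x.1) ^ (p' - 1) * (1 - ‖x.2‖ ^ 2) ^ (n + T) * ‖v x.2‖ :=
        fun x hx => mul_nonneg (hpos x hx) (norm_nonneg _)
      rw [hτF, ← ofReal_norm, Complex.norm_real, Real.norm_of_nonneg (Finset.sum_nonneg hterm),
        ENNReal.ofReal_sum_of_nonneg hterm]
    rw [e1, Finset.mul_sum]
    refine Finset.sum_le_sum fun x hx => ?_
    have hδ := one_sub_sq_pos (hI x hx)
    have e2 : weighted T (mult (ratio c (n + β + 1)) (dualFun hγ hα β τ)) x.2 =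
        ENNReal.ofReal ((1 - ‖x.2‖ ^ 2) ^ T) * (l.toNNReal * ‖v x.2‖ₑ) := by
      rw [weighted, mult_dualFun hβ1 hT0 hc0 τ (hI x hx), enorm_mul, RCLike.enorm_conj, hv]
      simp only
      rw [hKeq _ (hI x hx), ← ofReal_norm (((moment n (-1) β 0)⁻¹ : ℝ) : ℂ), Complex.norm_real,
        Real.norm_of_nonneg hl0.le]
      rfl
    calc _ ≤ ((2 : ℝ≥0∞) ^ x.1) ^ (p' - 1) * (ENNReal.ofReal ((1 - ‖x.2‖ ^ 2) ^ T) *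
          (l.toNNReal * ‖v x.2‖ₑ)) * ENNReal.ofReal ((1 - ‖x.2‖ ^ 2) ^ n) := by
          rw [two_zpow_rpow_eq, ← e2]
          exact mul_le_mul_left (mul_le_mul_right (hlow x hx) _) _
      _ = _ := by
          rw [h2, ENNReal.ofReal_mul (hpos x hx), ENNReal.ofReal_mul (by positivity),
            Real.rpow_add hδ, ENNReal.ofReal_mul (by positivity), Real.rpow_natCast, ofReal_norm]
          ring
  have hXfin : X ≠ ⊤ := sum_two_zpow_rpow_mul_ne_top hp'0.le I
  have hmain : X ≤ l.toNNReal * C * dualNorm τ * X ^ (1 / p) := by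
    have hFq : (toHT hγ hα F : HT n γ α hp0 hq0).qnorm ≤ C * X ^ (1 / p) := by
      rw [HT.qnorm, toFun_toHT]; exact hFn
    have hτ := (enorm_le_dualNorm_mul τ (toHT hγ hα F)).trans (mul_le_mul_right hFq _)
    refine (hXle.trans (mul_le_mul_right hτ _)).trans_eq ?_
    rw [mul_assoc, mul_assoc, mul_left_comm (C : ℝ≥0∞)]
  refine (le_rpow_of_le_mul_rpow hp'0 hpp hXfin hmain).trans_eq ?_
  rw [ENNReal.mul_rpow_of_nonneg _ _ hp'0.le, ENNReal.coe_rpow_of_nonneg _ hp'0.le,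
    ENNReal.coe_mul]

/-- The function of a functional has a weighted fractional derivative whose nontangential maximal
function is controlled in `L^{p'}` by the norm of the functional. -/
theorem exists_lintegral_ntMax_le_dualNorm (n : ℕ) [NeZero n] {γ p q p' α β T : ℝ} (hγ : 1 < γ)
    (hq0 : 0 < q) (hq1 : q < 1) (hp : 1 < p) (hp0 : 0 < p) (hp' : p' = p / (p - 1))
    (hα : -(n : ℝ) - 1 < α) (hβ : β = n + (α + (1 / q - 1) * (n + 1 + α))) (hβ1 : -1 < β)
    (hT : T = n / q) : ∃ C : ℝ≥0, ∀ τ : HT n γ α hp0 hq0 →L[ℂ] ℂ,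
      ∫⁻ ζ, ntMax 4 (weighted T (mult (ratio (n + β + 1 + T) (n + β + 1)) (dualFun hγ hα β τ))) ζ
        ^ p' ∂(sphereMeasure n) ≤ C * dualNorm τ ^ p' := by
  have hp'0 : 0 < p' := by rw [hp']; exact div_pos hp0 (by linarith)
  obtain ⟨C, hC⟩ := exists_sum_le_dualNorm n hγ hq0 hq1 hp hp0 hp' hα hβ hβ1 hT
  obtain ⟨C₁, hC₁⟩ := exists_disjoint_shadows n
  refine ⟨2 ^ p' * (C₁ * C), fun τ => ?_⟩
  set h := weighted T (mult (ratio (n + β + 1 + T) (n + β + 1)) (dualFun hγ hα β τ)) with hh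
  -- the restrictions of `h` to an exhaustion of the ball by compact balls
  set R : ℕ → ℝ := fun m => 1 - 1 / ((m : ℝ) + 1) with hR
  have hRm : Monotone R := fun m m' hm => by
    have : (m : ℝ) ≤ m' := by exact_mod_cast hm
    simp only [hR]; gcongr
  have hR1 : ∀ m, R m < 1 := fun m => by
    have : (0 : ℝ) < 1 / ((m : ℝ) + 1) := by positivity
    simp only [hR]; linarith
  set H : ℕ → Cn n → ℝ≥0∞ := fun m => {w | ‖w‖ ≤ R m}.indicator h with hH
  have hHm : Monotone H := fun m m' hm =>
    Set.indicator_le_indicator_of_subset (fun w hw => le_trans hw (hRm hm)) fun _ => zero_le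
  have hsup : ∀ ζ, ntMax 4 h ζ = ⨆ m, ntMax 4 (H m) ζ := by
    intro ζ
    refine le_antisymm (iSup₂_le fun z hz => ?_) (iSup_le fun m => iSup₂_mono fun z _ =>
      Set.indicator_le_self _ _ _)
    obtain ⟨m, hm⟩ := exists_nat_one_div_lt (sub_pos.2 (mem_unitBall_iff.1 hz.1))
    have hzm : z ∈ {w : Cn n | ‖w‖ ≤ R m} := by
      change ‖z‖ ≤ 1 - 1 / ((m : ℝ) + 1); linarith
    calc h z = H m z := (Set.indicator_of_mem hzm h).symm
      _ ≤ ntMax 4 (H m) ζ := le_ntMax hz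
      _ ≤ _ := le_iSup (fun m => ntMax 4 (H m) ζ) m
  have hlevel : ∀ m, ∫⁻ ζ, ntMax 4 (H m) ζ ^ p' ∂(sphereMeasure n) ≤
      2 ^ p' * (C₁ * (C * dualNorm τ ^ p')) := by
    intro m
    set N := ntMax 4 (H m) with hN
    have hNm : Measurable N := measurable_ntMax _ _
    set S : ℤ → Set (Cn n) := fun j => {w | (2 : ℝ≥0∞) ^ j < H m w} with hS
    have hSR : ∀ j, ∀ w ∈ S j, ‖w‖ ≤ R m := fun j w hw => by
      by_contra hcon
      have h0 : H m w = 0 := Set.indicator_of_notMem (s := {w : Cn n | ‖w‖ ≤ R m}) hcon h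
      have hw' : (2 : ℝ≥0∞) ^ j < H m w := hw
      rw [h0] at hw'
      exact not_lt_zero hw'
    choose u huS hudisj hucov using fun j => hC₁ (R m) (hR1 m) (S j) (hSR j)
    have hterm : ∀ j : ℤ, Measurable fun ζ =>
        if (2 : ℝ≥0∞) ^ j < N ζ then ((2 : ℝ≥0∞) ^ j) ^ p' else 0 := fun j =>
      Measurable.ite (measurableSet_lt measurable_const hNm) measurable_const measurable_const
    calc _ ≤ ∫⁻ ζ, 2 ^ p' * ∑' j : ℤ, (if (2 : ℝ≥0∞) ^ j < N ζ then ((2 : ℝ≥0∞) ^ j) ^ p' else 0)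
          ∂(sphereMeasure n) := lintegral_mono fun ζ => rpow_le_tsum_dyadic hp'0 _
      _ = 2 ^ p' * ∑' j : ℤ, ((2 : ℝ≥0∞) ^ j) ^ p' *
          sphereMeasure n {ζ | (2 : ℝ≥0∞) ^ j < N ζ} := by
          rw [lintegral_const_mul _ (Measurable.tsum hterm), lintegral_tsum fun j =>
            (hterm j).aemeasurable]
          congr 1
          refine tsum_congr fun j => ?_
          rw [← lintegral_indicator_const (measurableSet_lt measurable_const hNm)]
          refine lintegral_congr fun ζ => ?_
          by_cases hζ : (2 : ℝ≥0∞) ^ j < N ζ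
          · rw [if_pos hζ, Set.indicator_of_mem (s := {ζ | (2 : ℝ≥0∞) ^ j < N ζ}) hζ]
          · rw [if_neg hζ, Set.indicator_of_notMem (s := {ζ | (2 : ℝ≥0∞) ^ j < N ζ}) hζ]
      _ ≤ 2 ^ p' * (C₁ * (C * dualNorm τ ^ p')) := by
          refine mul_le_mul_right ?_ _
          rw [ENNReal.tsum_eq_iSup_sum]
          refine iSup_le fun J => ?_
          calc _ ≤ ∑ j ∈ J, ((2 : ℝ≥0∞) ^ j) ^ p' *
                (C₁ * ∑ b ∈ u j, ENNReal.ofReal ((1 - ‖b‖ ^ 2) ^ n)) := by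
                refine Finset.sum_le_sum fun j _ => mul_le_mul_right ?_ _
                rw [setOf_lt_ntMax]
                exact hucov j
            _ = C₁ * ∑ x ∈ J.sigma u, ((2 : ℝ≥0∞) ^ x.1) ^ p' *
                ENNReal.ofReal ((1 - ‖x.2‖ ^ 2) ^ n) := by
                rw [Finset.sum_sigma, Finset.mul_sum]
                refine Finset.sum_congr rfl fun j _ => ?_
                rw [mul_left_comm, Finset.mul_sum]
            _ ≤ C₁ * (C * dualNorm τ ^ p') := by
                refine mul_le_mul_right (hC τ _ (fun x hx => ?_) (fun x hx y hy hxy hne => ?_)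
                  fun x hx => ?_) _
                · have := hSR _ _ (huS _ (Finset.mem_sigma.1 hx).2)
                  exact mem_unitBall_iff.2 (this.trans_lt (hR1 m))
                · obtain ⟨j, a⟩ := x
                  obtain ⟨j', b⟩ := y
                  obtain rfl : j = j' := hxy
                  exact hudisj j (Finset.mem_sigma.1 hx).2 (Finset.mem_sigma.1 hy).2
                    fun hab => hne (congrArg (Sigma.mk j) hab)
                · have h1 : (2 : ℝ≥0∞) ^ x.1 < H m x.2 := huS _ (Finset.mem_sigma.1 hx).2
                  exact h1.le.trans (Set.indicator_le_self _ _ _)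
  calc _ = ∫⁻ ζ, ⨆ m, ntMax 4 (H m) ζ ^ p' ∂(sphereMeasure n) := by
        refine lintegral_congr fun ζ => ?_
        rw [hsup, (ENNReal.monotone_rpow_of_nonneg hp'0.le).map_iSup_of_continuousAt
          ENNReal.continuous_rpow_const.continuousAt (ENNReal.zero_rpow_of_pos hp'0)]
    _ = ⨆ m, ∫⁻ ζ, ntMax 4 (H m) ζ ^ p' ∂(sphereMeasure n) := by
        refine lintegral_iSup (fun m => (measurable_ntMax _ _).pow_const _) fun m m' hm ζ => ?_
        exact ENNReal.rpow_le_rpow (iSup₂_mono fun z _ => hHm hm z) hp'0.le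
    _ ≤ 2 ^ p' * (C₁ * (C * dualNorm τ ^ p')) := iSup_le hlevel
    _ = _ := by
        push_cast
        rw [ENNReal.coe_rpow_of_nonneg _ hp'0.le, mul_assoc, mul_assoc]
        rfl

/-! ### The identification of the dual space -/

theorem le_coe_rpow_mul {p : ℝ} (hp : 0 < p) {a b : ℝ≥0∞} {C : ℝ≥0} (h : a ^ p ≤ C * b ^ p) :
    a ≤ (C ^ (1 / p) : ℝ≥0) * b := by
  rw [← ENNReal.rpow_le_rpow_iff hp, ENNReal.mul_rpow_of_nonneg _ _ hp.le,
    ← ENNReal.coe_rpow_of_nonneg _ hp.le, ← NNReal.rpow_mul, one_div_mul_cancel hp.ne',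
    NNReal.rpow_one]
  exact h

section dual

variable {n : ℕ} [NeZero n] {γ α p q β : ℝ} {hp : 0 < p} {hq : 0 < q} {hγ : 1 < γ}
  {hα : -(n : ℝ) - 1 < α}

/-- The conjugate-linear map which sends a functional to the function representing it. -/
def dualMap (hγ : 1 < γ) (hα : -(n : ℝ) - 1 < α) (hβ : -1 < β) :
    (HT n γ α hp hq →L[ℂ] ℂ) →ₛₗ[starRingEnd ℂ] (Cn n → ℂ) where
  toFun τ := dualFun hγ hα β τ
  map_add' τ₁ τ₂ := by
    funext z
    by_cases hz : z ∈ unitBall n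
    · rw [Pi.add_apply, dualFun, dualFun, dualFun, cut_apply hz, cut_apply hz, cut_apply hz,
        ← ((isHomogSeries_dualPart hβ τ₁).summable (mem_unitBall_iff.1 hz)).tsum_add
          ((isHomogSeries_dualPart hβ τ₂).summable (mem_unitBall_iff.1 hz))]
      refine tsum_congr fun k => ?_
      rw [dualPart, dualPart, dualPart, add_apply, map_add, mul_add]
    · rw [Pi.add_apply, (isHolo_dualFun hβ _).2 z hz, (isHolo_dualFun hβ _).2 z hz,
        (isHolo_dualFun hβ _).2 z hz, add_zero]
  map_smul' c τ := by
    funext z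
    by_cases hz : z ∈ unitBall n
    · rw [Pi.smul_apply, dualFun, dualFun, cut_apply hz, cut_apply hz, smul_eq_mul, ← tsum_mul_left]
      refine tsum_congr fun k => ?_
      rw [dualPart, dualPart, smul_apply, smul_eq_mul, map_mul, mul_left_comm]
    · rw [Pi.smul_apply, (isHolo_dualFun hβ _).2 z hz, (isHolo_dualFun hβ _).2 z hz, smul_zero]

theorem dualMap_apply (hβ : -1 < β) (τ : HT n γ α hp hq →L[ℂ] ℂ) :
    dualMap hγ hα hβ τ = dualFun hγ hα β τ := rfl

theorem dualMap_injective (hβ : -1 < β) (hq1 : q ≤ 1) (hqp : q < p) :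
    Function.Injective (dualMap (hp := hp) (hq := hq) hγ hα hβ) := fun τ₁ τ₂ h => by
  rw [dualMap_apply, dualMap_apply] at h
  exact ext_of_power hγ hα hq1 hqp fun k u => by
    rw [← conj_homogPart_dualFun hβ, ← conj_homogPart_dualFun hβ, h]

theorem pairing_dilate_dualFun (hβ : -1 < β) (τ : HT n γ α hp hq →L[ℂ] ℂ)
    (hg : Integrable (dualFun hγ hα β τ) (shellMeasure n (-1) β)) {f : Cn n → ℂ}
    (hf : DifferentiableOn ℂ f (unitBall n)) {r : ℝ} (hr0 : 0 ≤ r) (hr1 : r < 1) :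
    pairing β (dilate r f) (dualFun hγ hα β τ) =
      τ (toHT hγ hα ⟨_, cut_dilate_mem_bddHolo hf hr0 hr1⟩) := by
  obtain ⟨K, -, hK⟩ := exists_norm_toHT_le (hγ := hγ) (hα := hα) τ
  have h0 := eq_zero_of_power (pairL hg - τ.toLinearMap ∘ₗ toHT hγ hα)
    (K := (∫ w, ‖dualFun hγ hα β τ w‖ ∂(shellMeasure n (-1) β)) + K)
    (fun F M hM => by
      rw [add_mul]
      exact (norm_sub_le _ _).trans (add_le_add (norm_pairL_le hg F M hM) (hK F M hM)))
    (fun k u => by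
      rw [LinearMap.sub_apply, sub_eq_zero]
      exact (integral_power_mul_conj hβ (isHolo_dualFun hβ τ).1 hg k u).trans
        (conj_homogPart_dualFun hβ τ k u)) hf hr0 hr1
  rw [LinearMap.sub_apply, sub_eq_zero] at h0
  refine Eq.trans ?_ h0
  change _ = ∫ w, cut (dilate r f) w * (starRingEnd ℂ) (dualFun hγ hα β τ w)
    ∂(shellMeasure n (-1) β)
  rw [integral_shellMeasure_ball, pairing]
  refine integral_congr_ae ?_
  filter_upwards [ae_mem_unitBall n] with w hw
  rw [cut_apply hw]

end dual

theorem integrable_dilate_mul_conj {n : ℕ} {β r : ℝ} {f g : Cn n → ℂ}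
    (hf : DifferentiableOn ℂ f (unitBall n)) (hr0 : 0 ≤ r) (hr1 : r < 1)
    (hg : Integrable g (shellMeasure n (-1) β)) :
    Integrable (fun z => dilate r f z * (starRingEnd ℂ) (g z) * (((1 - ‖z‖ ^ 2) ^ β : ℝ) : ℂ))
      (ballVolume n) := by
  refine (integrable_shellMeasure_ball (integrable_mul_conj
    ⟨_, cut_dilate_mem_bddHolo hf hr0 hr1⟩ hg)).congr ?_
  filter_upwards [ae_mem_unitBall n] with w hw
  rw [cut_apply hw]

end TentDuality

end

theorem mainTheorem2 (n : ℕ) (hn : 1 ≤ n) (γ : ℝ) (hγ : 1 < γ)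
    (p q : ℝ) (hq0 : 0 < q) (hq1 : q < 1) (hp1 : 1 < p)
    (α : ℝ) (hα : -(n : ℝ) - 1 < α)
    (α' : ℝ) (hα' : α' = α + (1 / q - 1) * (n + 1 + α))
    (p' : ℝ) (hp' : p' = p / (p - 1))
    (s t : ℝ) (ht : 0 < t)
    (hs : ∀ m : ℕ, (n : ℝ) + s ≠ -((m : ℝ) + 1))
    (hst : ∀ m : ℕ, (n : ℝ) + s + t ≠ -((m : ℝ) + 1)) :
    (∀ f : TentDuality.HT n γ α (zero_lt_one.trans hp1) hq0, ∀ g ∈ TentDuality.BT n γ p' s t,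
      ∀ r ∈ Set.Ioo (0 : ℝ) 1,
        Integrable (fun z => TentDuality.dilate r f.toFun z * (starRingEnd ℂ) (g z) *
          (((1 - ‖z‖ ^ 2) ^ ((n : ℝ) + α') : ℝ) : ℂ)) (TentDuality.ballVolume n)) ∧
    ∃ Φ : (TentDuality.HT n γ α (zero_lt_one.trans hp1) hq0 →L[ℂ] ℂ)
        →ₛₗ[starRingEnd ℂ] (TentDuality.Cn n → ℂ),
      Function.Injective Φ ∧
      Set.range Φ = TentDuality.BT n γ p' s t ∧
      (∀ (τ : TentDuality.HT n γ α (zero_lt_one.trans hp1) hq0 →L[ℂ] ℂ)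
        (f : TentDuality.HT n γ α (zero_lt_one.trans hp1) hq0),
        Tendsto (fun r : ℝ =>
            TentDuality.pairing ((n : ℝ) + α') (TentDuality.dilate r f.toFun) (Φ τ))
          (𝓝[<] 1) (𝓝 (τ f))) ∧
      ∃ C : ℝ≥0, ∀ τ : TentDuality.HT n γ α (zero_lt_one.trans hp1) hq0 →L[ℂ] ℂ,
        TentDuality.dualNorm τ ≤ C * TentDuality.btNorm γ p' s t (Φ τ) ∧
        TentDuality.btNorm γ p' s t (Φ τ) ≤ C * TentDuality.dualNorm τ := by
  open TentDuality in
  have : NeZero n := ⟨by omega⟩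
  have hn1 : (1 : ℝ) ≤ n := by exact_mod_cast hn
  have hp0 : 0 < p := zero_lt_one.trans hp1
  have hp1' : 0 < p - 1 := by linarith
  have hp'1 : 1 < p' := by rw [hp', one_lt_div hp1']; linarith
  have hp'0 : 0 < p' := zero_lt_one.trans hp'1
  have hs' : ∀ j : ℕ, (n + 1 + s : ℝ) + j ≠ 0 := fun j h => hs j (by linarith)
  have hst' : ∀ j : ℕ, (n + 1 + s + t : ℝ) + j ≠ 0 := fun j h => hst j (by linarith)
  obtain ⟨β, hβα⟩ : ∃ β : ℝ, β = n + α' := ⟨_, rfl⟩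
  have hβ : β = n + (α + (1 / q - 1) * (n + 1 + α)) := by rw [hβα, hα']
  have hβ1 : -1 < β := by
    have h : β = (n + 1 + α) / q - 1 := by rw [hβ]; ring
    have : 0 < (n + 1 + α) / q := div_pos (by linarith) hq0
    linarith
  rw [← hβα]
  obtain ⟨T, hT⟩ : ∃ T : ℝ, T = n / q := ⟨_, rfl⟩
  have hT0 : 0 < T := by rw [hT]; positivity
  have hB : ∀ j : ℕ, (n + β + 1 : ℝ) + j ≠ 0 := fun j => by
    have : (0 : ℝ) ≤ j := j.cast_nonneg
    exact ne_of_gt (by linarith)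
  have hBT : ∀ j : ℕ, (n + β + 1 + T : ℝ) + j ≠ 0 := fun j => by
    have : (0 : ℝ) ≤ j := j.cast_nonneg
    exact ne_of_gt (by linarith)
  have hsym : IsSymbol T (ratio (n + β + 1 + T) (n + β + 1)) := by
    have h := isSymbol_ratio hBT hB
    rwa [add_sub_cancel_left] at h
  obtain ⟨C₁, hC₁⟩ := exists_btNorm_le_lintegral_ntMax n (γ := γ) (κ := 4) (p := p') (by linarith)
    (by norm_num) hp'1 hs' hst' ht hB hBT
  obtain ⟨C₂, hC₂⟩ := exists_lintegral_ntMax_le_dualNorm n hγ hq0 hq1 hp1 hp0 hp' hα hβ hβ1 hT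
  obtain ⟨C₃, hC₃⟩ := exists_lintegral_ntMax_le_btNorm n hγ (κ := 4) (by norm_num) hp'1 hs' hst' hT0
    hsym
  obtain ⟨C₄, hC₄⟩ := exists_functional n hγ hq0 hq1 hp1 hp0 hp' hα hβ hβ1 hT0
  have hle : ∀ τ : HT n γ α hp0 hq0 →L[ℂ] ℂ, btNorm γ p' s t (dualFun hγ hα β τ) ≤
      ((C₁ * C₂) ^ (1 / p') : ℝ≥0) * dualNorm τ := fun τ => by
    refine le_coe_rpow_mul hp'0 ((hC₁ _ (isHolo_dualFun hβ1 τ).1).trans ?_)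
    rw [ENNReal.coe_mul, mul_assoc]
    exact mul_le_mul_right (hC₂ τ) _
  have hmem : ∀ τ : HT n γ α hp0 hq0 →L[ℂ] ℂ, btNorm γ p' s t (dualFun hγ hα β τ) < ⊤ := fun τ =>
    (hle τ).trans_lt (ENNReal.mul_lt_top ENNReal.coe_lt_top (dualNorm_lt_top τ))
  -- every function in `BT` represents a functional whose norm it controls
  have hfun : ∀ g, IsHolo n g → btNorm γ p' s t g < ⊤ → ∃ τ : HT n γ α hp0 hq0 →L[ℂ] ℂ,
      dualFun hγ hα β τ = g ∧ dualNorm τ ≤ (C₄ * C₃ ^ (1 / p') : ℝ≥0) * btNorm γ p' s t g := by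
    intro g hg hgn
    have h1 := hC₃ g hg.1
    have h2 : (C₃ : ℝ≥0∞) * btNorm γ p' s t g ^ p' < ⊤ := ENNReal.mul_lt_top ENNReal.coe_lt_top
      (ENNReal.rpow_lt_top_of_nonneg hp'0.le hgn.ne)
    obtain ⟨τ, hτ, hτn⟩ := hC₄ g hg.1 (h1.trans_lt h2).ne
    refine ⟨τ, dualFun_eq hβ1 hg hτ, hτn.trans ?_⟩
    rw [ENNReal.coe_mul, mul_assoc]
    refine mul_le_mul_right (le_coe_rpow_mul hp'0 ?_) _
    rwa [← ENNReal.rpow_mul, one_div_mul_cancel hp'0.ne', ENNReal.rpow_one]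
  refine ⟨fun f g hg r hr => integrable_dilate_mul_conj f.isHolo.1 hr.1.le hr.2
    (integrable_of_btNorm_lt_top hγ hp'1 hs' hst' hβ1 hg.1 hg.2), dualMap hγ hα hβ1,
    dualMap_injective hβ1 hq1.le (hq1.trans hp1), ?_, fun τ f => ?_,
    max (C₄ * C₃ ^ (1 / p')) ((C₁ * C₂) ^ (1 / p')), fun τ => ⟨?_, ?_⟩⟩
  · refine Set.Subset.antisymm ?_ fun g hg => ?_
    · rintro _ ⟨τ, rfl⟩
      exact ⟨isHolo_dualFun hβ1 τ, hmem τ⟩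
    · obtain ⟨τ, hτ, -⟩ := hfun g hg.1 hg.2
      exact ⟨τ, hτ⟩
  · exact tendsto_of_dilate hγ hα hq1.le (hq1.trans hp1) τ f fun r hr0 hr1 =>
      pairing_dilate_dualFun hβ1 τ (integrable_of_btNorm_lt_top hγ hp'1 hs' hst' hβ1
        (isHolo_dualFun hβ1 τ) (hmem τ)) f.isHolo.1 hr0 hr1
  · obtain ⟨τ', hτ', hn'⟩ := hfun _ (isHolo_dualFun hβ1 τ) (hmem τ)
    obtain rfl : τ' = τ := dualMap_injective hβ1 hq1.le (hq1.trans hp1) hτ'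
    exact hn'.trans (mul_le_mul_left (ENNReal.coe_le_coe.2 (le_max_left _ _)) _)
  · exact (hle τ).trans (mul_le_mul_left (ENNReal.coe_le_coe.2 (le_max_right _ _)) _)
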